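/- Let $\epsilon\in\mathbb R$, $\epsilon\neq 0$, let $\mathbb T^2=\mathbb R^2/2\pi\mathbb Z^2$, let $B:\mathbb T^2\to\mathbb R$ be smooth, and let $\mathbb J=\begin{pmatrix}0&-1\\1&0\end{pmatrix}$. Let $\mathfrak s^*$ be the space of triples $(n,\boldsymbol P,\varrho)$ where $n:\mathbb T^2\to\mathbb R$ is smooth and nowhere zero, $\boldsymbol P:\mathbb T^2\to\mathbb R^2$ is smooth, and $\varrho:\mathbb T^2\times\mathbb R^2\to\mathbb R$, $(\boldsymbol q,\boldsymbol\xi)\mapsto\varrho(\boldsymbol q,\boldsymbol\xi)$, is smooth and decays, with all its derivatives, faster than any power of $|\boldsymbol\xi|$. Tangent vectors are triples $(\delta n,\delta\boldsymbol P,\delta\varrho)$ of the same kind (with $\delta n$ unrestricted), and covectors are triples $(\alpha_n,\boldsymbol\alpha_P,\alpha_\varrho)$ with $\alpha_n,\boldsymbol\alpha_P$ smooth on $\mathbb T^2$ and $\alpha_\varrho$ smooth on $\mathbb T^2\times\mathbb R^2$ with polynomially bounded derivatives; they are paired by $\int\alpha_n\,\delta n\,d\boldsymbol q+\int\boldsymbol\alpha_P\cdot\delta\boldsymbol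 P\,d\boldsymbol q+\int\alpha_\varrho\,\delta\varrho\,d\boldsymbol\xi\,d\boldsymbol q$. Write $\langle Q\rangle=\int Q\,\varrho\,d\boldsymbol\xi$, $\Omega=-\partial_{\boldsymbol q}\cdot(\mathbb J\boldsymbol P/n)$, $[\boldsymbol X,\boldsymbol Y]=\boldsymbol X\cdot\partial_{\boldsymbol q}\boldsymbol Y-\boldsymbol Y\cdot\partial_{\boldsymbol q}\boldsymbol X$, and let the divergence of a tensor be contracted with the first index. Equip $\mathfrak s^*$ with the Poisson bracket $\{\cdot,\cdot\}_E$ whose Poisson tensor $\pi_E$, evaluated on the functional derivatives of $F$ and $G$ with $\boldsymbol X=\frac{\delta F}{\delta\boldsymbol P}$, $\boldsymbol Y=\frac{\delta G}{\delta\boldsymbol P}$, $f=\frac1n\frac{\delta F}{\delta\varrho}$, $g=\frac1n\frac{\delta G}{\delta\varrho}$, is $$\begin{aligned}\{F,G\}_E=&-\epsilon\int\Big(\boldsymbol X\cdot\big[\partial_{\boldsymbol q}\tfrac{\delta G}{\delta n}-\partial_{\boldsymbol q}\langle g\rangle+\langle\partial_{\boldsymbol q}g\rangle\big]-\boldsymbol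 Y\cdot\big[\partial_{\boldsymbol q}\tfrac{\delta F}{\delta n}-\partial_{\boldsymbol q}\langle f\rangle+\langle\partial_{\boldsymbol q}f\rangle\big]\Big)n\,d\boldsymbol q-\epsilon\int[\boldsymbol X,\boldsymbol Y]\cdot\boldsymbol P\,d\boldsymbol q+\int B\,\boldsymbol X\cdot\mathbb J\boldsymbol Y\,n\,d\boldsymbol q\\&+\epsilon\int(\partial_{\boldsymbol q}f\cdot\partial_{\boldsymbol\xi}g-\partial_{\boldsymbol q}g\cdot\partial_{\boldsymbol\xi}f)\,n\varrho\,d\boldsymbol\xi\,d\boldsymbol q+\int(B-\epsilon\Omega)\,\partial_{\boldsymbol\xi}f\cdot\mathbb J\partial_{\boldsymbol\xi}g\,n\varrho\,d\boldsymbol\xi\,d\boldsymbol q\\&-\epsilon\int\big(\langle\partial_{\boldsymbol q}f\rangle\cdot\langle\partial_{\boldsymbol\xi}g\rangle-\langle\partial_{\boldsymbol q}g\rangle\cdot\langle\partial_{\boldsymbol\xi}f\rangle\big)n\,d\boldsymbol q-\int(B-\epsilon\Omega)\,\langle\partial_{\boldsymbol\xi}f\rangle\cdot\mathbb J\langle\partial_{\boldsymbol\xi}g\rangle\,n\,d\boldsymbol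 q\\&-\epsilon\int\Big(\big[\boldsymbol X-\langle\partial_{\boldsymbol\xi}f\rangle\big]\cdot\partial_{\boldsymbol q}\cdot\big[n\langle(\partial_{\boldsymbol\xi}g)\boldsymbol\xi\rangle\big]-\big[\boldsymbol Y-\langle\partial_{\boldsymbol\xi}g\rangle\big]\cdot\partial_{\boldsymbol q}\cdot\big[n\langle(\partial_{\boldsymbol\xi}f)\boldsymbol\xi\rangle\big]\Big)d\boldsymbol q.\end{aligned}$$ A functional on a subset $N\subset\mathfrak s^*$ is called smooth if it, together with some covector-valued map representing its differential, is smooth along all smooth finite-dimensional families in $N$ and satisfies the chain rule along smooth curves in $N$; $T_\sigma N$ denotes the set of velocities at $\sigma$ of smooth curves in $N$ and $T_\sigma N^\circ$ its annihilator. Let $\Sigma=\{(n,\boldsymbol P,\varrho)\in\mathfrak s^*\mid\partial_{\boldsymbol q}n=0,\ \partial_{\boldsymbol q}\cdot\boldsymbol P=0\}$. Then $\Sigma$ is a Poisson–Dirac submanifold of $(\mathfrak s^*,\{\cdot,\cdot\}_E)$, with $T_\sigma\Sigma=\{(\delta n,\delta\boldsymbol P,\delta\varrho)\mid\partial_{\boldsymbol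 q}\delta n=0,\ \partial_{\boldsymbol q}\cdot\delta\boldsymbol P=0\}$. That is: the bundle map $\widehat\pi_E$, given by $\langle\beta,\widehat\pi_E(\alpha)\rangle=\pi_E(\beta,\alpha)$ for all covectors $\beta$, is well defined on $\mathfrak s^*$; $T_\sigma\Sigma\cap\widehat\pi_E(T_\sigma\Sigma^\circ)=\{0\}$ for every $\sigma\in\Sigma$; every covector at $\sigma\in\Sigma$ can be modified, without changing its restriction to $T_\sigma\Sigma$, to one that vanishes on $\widehat\pi_E(T_\sigma\Sigma^\circ)$; and the induced bracket $\{F,G\}_\Sigma(\sigma)=\pi_E(\widetilde{dF_\sigma},\widetilde{dG_\sigma})$, where $\widetilde{dF_\sigma},\widetilde{dG_\sigma}$ are any covectors that extend $dF_\sigma,dG_\sigma$ and vanish on $\widehat\pi_E(T_\sigma\Sigma^\circ)$, is well defined and is a smooth functional on $\Sigma$ whenever $F$ and $G$ are. Every smooth functional $F$ on $\Sigma$ has a unique functional derivative $(\frac{\delta F}{\delta n_0},\frac{\delta F}{\delta\boldsymbol\pi},\frac{\delta F}{\delta\varrho})$ with $\frac{\delta F}{\delta n_0}$ spatially constant and $\frac{\delta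 F}{\delta\boldsymbol\pi}$ divergence-free. The bracket $\{\cdot,\cdot\}_\Sigma$ is a Poisson bracket on the smooth functionals on $\Sigma$ (bilinear, skew-symmetric, a derivation in each argument, satisfying the Jacobi identity), and at $\sigma=(n_0,\boldsymbol\pi,\varrho)\in\Sigma$, with $\Omega=-\partial_{\boldsymbol q}\cdot(\mathbb J\boldsymbol\pi/n_0)$, it is given explicitly, without the inverse Laplacian, by $$\begin{aligned}\{F,G\}_\Sigma=&\int(B-\epsilon\Omega)\,\tfrac{\delta F}{\delta\boldsymbol\pi}\cdot\mathbb J\tfrac{\delta G}{\delta\boldsymbol\pi}\,n_0\,d\boldsymbol q-\epsilon\int\Big(\tfrac{\delta F}{\delta\boldsymbol\pi}\cdot\big\langle\partial_{\boldsymbol q}\tfrac{\delta G}{\delta\varrho}\big\rangle-\tfrac{\delta G}{\delta\boldsymbol\pi}\cdot\big\langle\partial_{\boldsymbol q}\tfrac{\delta F}{\delta\varrho}\big\rangle\Big)d\boldsymbol q\\&-\epsilon\int\Big(\big[\tfrac{\delta F}{\delta\boldsymbol\pi}-\langle\partial_{\boldsymbol\xi}f\rangle\big]\cdot\partial_{\boldsymbol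 q}\cdot\big\langle(\partial_{\boldsymbol\xi}\tfrac{\delta G}{\delta\varrho})\boldsymbol\xi\big\rangle-\big[\tfrac{\delta G}{\delta\boldsymbol\pi}-\langle\partial_{\boldsymbol\xi}g\rangle\big]\cdot\partial_{\boldsymbol q}\cdot\big\langle(\partial_{\boldsymbol\xi}\tfrac{\delta F}{\delta\varrho})\boldsymbol\xi\big\rangle\Big)d\boldsymbol q\\&+\epsilon\int(\partial_{\boldsymbol q}f\cdot\partial_{\boldsymbol\xi}g-\partial_{\boldsymbol q}g\cdot\partial_{\boldsymbol\xi}f)\,n_0\varrho\,d\boldsymbol\xi\,d\boldsymbol q+\int(B-\epsilon\Omega)\,\partial_{\boldsymbol\xi}f\cdot\mathbb J\partial_{\boldsymbol\xi}g\,n_0\varrho\,d\boldsymbol\xi\,d\boldsymbol q\\&-\epsilon\int\big(\langle\partial_{\boldsymbol q}f\rangle\cdot\langle\partial_{\boldsymbol\xi}g\rangle-\langle\partial_{\boldsymbol q}g\rangle\cdot\langle\partial_{\boldsymbol\xi}f\rangle\big)n_0\,d\boldsymbol q-\int(B-\epsilon\Omega)\,\langle\partial_{\boldsymbol\xi}f\rangle\cdot\mathbb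 J\langle\partial_{\boldsymbol\xi}g\rangle\,n_0\,d\boldsymbol q,\end{aligned}$$ where $f=\frac1{n_0}\frac{\delta F}{\delta\varrho}$ and $g=\frac1{n_0}\frac{\delta G}{\delta\varrho}$. -/

import Mathlib

open MeasureTheory Set
open scoped ContDiff

namespace QNVP

noncomputable section

/-! ### Vector calculus on the plane and on the torus of period `2π`

Functions on the torus are functions on the plane that are `2π`-periodic in both coordinates. -/

/-- Points, velocities and vectors in the plane. -/
abbrev Vec : Type := Fin 2 → ℝ

/-- The gradient of a scalar function. -/
def grad (f : Vec → ℝ) (q : Vec) : Vec := fun i => fderiv ℝ f q (Pi.single i 1)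

/-- The divergence of a vector field. -/
def divg (X : Vec → Vec) (q : Vec) : ℝ := ∑ i, fderiv ℝ (fun p => X p i) q (Pi.single i 1)

/-- The divergence of a tensor field, contracted with the first index: `(∂ · T)_j = ∑ i, ∂_i T_ij`. -/
def divT (T : Vec → Fin 2 → Fin 2 → ℝ) (q : Vec) : Vec :=
  fun j => ∑ i, fderiv ℝ (fun p => T p i j) q (Pi.single i 1)

/-- The counterclockwise rotation by `π/2`, with matrix `(0, -1; 1, 0)`. -/
def rot (v : Vec) : Vec := ![-v 1, v 0]

/-- The gradient in the space variable of a function on phase space. -/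
def gradQ (χ : Vec → Vec → ℝ) (q ξ : Vec) : Vec := grad (fun p => χ p ξ) q

/-- The gradient in the velocity variable of a function on phase space. -/
def gradV (χ : Vec → Vec → ℝ) (q ξ : Vec) : Vec := grad (χ q) ξ

/-- The tensor product `(u w)_ij = u_i w_j`. -/
def tens (u w : Vec) : Fin 2 → Fin 2 → ℝ := fun i j => u i * w j

/-- The integral over the torus, i.e. over one period cell. -/
def torusInt (f : Vec → ℝ) : ℝ := ∫ q in Icc (0 : Vec) (fun _ => 2 * Real.pi), f q

/-- The integral over phase space (torus times velocity plane). -/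
def phaseInt (f : Vec → Vec → ℝ) : ℝ := torusInt fun q => ∫ ξ, f q ξ

/-- The velocity average `⟨Q⟩ = ∫ Q ϱ dξ` of a scalar, vector or tensor valued quantity. -/
def avg {F : Type*} [NormedAddCommGroup F] [NormedSpace ℝ F]
    (ϱ : Vec → Vec → ℝ) (Q : Vec → Vec → F) (q : Vec) : F := ∫ ξ, ϱ q ξ • Q q ξ

/-- The vorticity `Ω = - ∂ · (J P / n)`. -/
def vorticity (n : Vec → ℝ) (P : Vec → Vec) (q : Vec) : ℝ :=
  -divg (fun p => rot ((n p)⁻¹ • P p)) q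

/-! ### Function spaces -/

/-- Doubly periodic functions of the space variable. -/
def Periodic2 {F : Type*} (f : Vec → F) : Prop :=
  ∀ (i : Fin 2) (q : Vec), f (q + Pi.single i (2 * Real.pi)) = f q

/-- Smooth functions on the torus with values in `F`. -/
def torusField (F : Type*) [NormedAddCommGroup F] [NormedSpace ℝ F] : Submodule ℝ (Vec → F) where
  carrier := {f | ContDiff ℝ ∞ f ∧ Periodic2 f}
  add_mem' := by
    rintro f g ⟨hf, hf'⟩ ⟨hg, hg'⟩
    exact ⟨hf.add hg, fun i q => by simp [hf' i q, hg' i q]⟩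
  zero_mem' := ⟨contDiff_const, fun _ _ => rfl⟩
  smul_mem' := by
    rintro c f ⟨hf, hf'⟩
    exact ⟨contDiff_const.smul hf, fun i q => by simp [hf' i q]⟩

/-- Smooth scalar functions on the torus. -/
abbrev ScalarField : Type := torusField ℝ

/-- Smooth vector fields on the torus. -/
abbrev VectorField : Type := torusField Vec

/-- Phase space densities: smooth functions on torus times velocity plane which, with all their
derivatives, decay faster than any power of the velocity. -/
def density : Submodule ℝ (Vec → Vec → ℝ) where
  carrier := {f | ContDiff ℝ ∞ (fun p : Vec × Vec => f p.1 p.2) ∧ Periodic2 f ∧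
    ∀ k m : ℕ, ∃ C : ℝ, ∀ q ξ : Vec,
      (1 + ‖ξ‖) ^ k * ‖iteratedFDeriv ℝ m (fun p : Vec × Vec => f p.1 p.2) (q, ξ)‖ ≤ C}
  add_mem' := by
    rintro f g ⟨hf, hf', hfb⟩ ⟨hg, hg', hgb⟩
    refine ⟨hf.add hg, fun i q => by simp [hf' i q, hg' i q], fun k m => ?_⟩
    obtain ⟨C, hC⟩ := hfb k m
    obtain ⟨D, hD⟩ := hgb k m
    refine ⟨C + D, fun q ξ => ?_⟩
    have h : iteratedFDeriv ℝ m (fun p : Vec × Vec => (f + g) p.1 p.2) (q, ξ) =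
        iteratedFDeriv ℝ m (fun p : Vec × Vec => f p.1 p.2) (q, ξ) +
        iteratedFDeriv ℝ m (fun p : Vec × Vec => g p.1 p.2) (q, ξ) :=
      iteratedFDeriv_add_apply (hf.contDiffAt.of_le (by exact_mod_cast le_top))
        (hg.contDiffAt.of_le (by exact_mod_cast le_top))
    rw [h]
    calc _ ≤ (1 + ‖ξ‖) ^ k * (‖iteratedFDeriv ℝ m (fun p : Vec × Vec => f p.1 p.2) (q, ξ)‖ +
          ‖iteratedFDeriv ℝ m (fun p : Vec × Vec => g p.1 p.2) (q, ξ)‖) := by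
          gcongr; exact norm_add_le _ _
      _ ≤ C + D := by rw [mul_add]; exact add_le_add (hC q ξ) (hD q ξ)
  zero_mem' := ⟨contDiff_const, fun _ _ => rfl, fun k m => ⟨0, fun q ξ => by
    have h : iteratedFDeriv ℝ m (fun p : Vec × Vec => (0 : Vec → Vec → ℝ) p.1 p.2) (q, ξ) = 0 := by
      exact congrFun iteratedFDeriv_fun_zero (q, ξ)
    rw [h]; simp⟩⟩
  smul_mem' := by
    rintro c f ⟨hf, hf', hfb⟩
    refine ⟨contDiff_const.smul (f := fun _ : Vec × Vec => c) hf, fun i q => by simp [hf' i q], fun k m => ?_⟩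
    obtain ⟨C, hC⟩ := hfb k m
    refine ⟨‖c‖ * C, fun q ξ => ?_⟩
    have h : iteratedFDeriv ℝ m (fun p : Vec × Vec => (c • f) p.1 p.2) (q, ξ) =
        c • iteratedFDeriv ℝ m (fun p : Vec × Vec => f p.1 p.2) (q, ξ) :=
      iteratedFDeriv_const_smul_apply (f := fun p : Vec × Vec => f p.1 p.2) (a := c) (hf.contDiffAt.of_le (by exact_mod_cast le_top))
    rw [h, norm_smul, mul_left_comm]
    exact mul_le_mul_of_nonneg_left (hC q ξ) (norm_nonneg _)

/-- Phase space observables, dual to the densities: smooth functions on torus times velocity plane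
each of whose derivatives is bounded by a power of the velocity. -/
def observable : Submodule ℝ (Vec → Vec → ℝ) where
  carrier := {f | ContDiff ℝ ∞ (fun p : Vec × Vec => f p.1 p.2) ∧ Periodic2 f ∧
    ∀ m : ℕ, ∃ (k : ℕ) (C : ℝ), ∀ q ξ : Vec,
      ‖iteratedFDeriv ℝ m (fun p : Vec × Vec => f p.1 p.2) (q, ξ)‖ ≤ C * (1 + ‖ξ‖) ^ k}
  add_mem' := by
    rintro f g ⟨hf, hf', hfb⟩ ⟨hg, hg', hgb⟩
    refine ⟨hf.add hg, fun i q => by simp [hf' i q, hg' i q], fun m => ?_⟩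
    obtain ⟨k, C, hC⟩ := hfb m
    obtain ⟨l, D, hD⟩ := hgb m
    refine ⟨k + l, |C| + |D|, fun q ξ => ?_⟩
    have h : iteratedFDeriv ℝ m (fun p : Vec × Vec => (f + g) p.1 p.2) (q, ξ) =
        iteratedFDeriv ℝ m (fun p : Vec × Vec => f p.1 p.2) (q, ξ) +
        iteratedFDeriv ℝ m (fun p : Vec × Vec => g p.1 p.2) (q, ξ) :=
      iteratedFDeriv_add_apply (hf.contDiffAt.of_le (by exact_mod_cast le_top))
        (hg.contDiffAt.of_le (by exact_mod_cast le_top))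
    have h1 : (1 : ℝ) ≤ 1 + ‖ξ‖ := by linarith [norm_nonneg ξ]
    rw [h, add_mul]
    refine (norm_add_le _ _).trans (add_le_add ((hC q ξ).trans ?_) ((hD q ξ).trans ?_))
    · exact mul_le_mul (le_abs_self C) (pow_le_pow_right₀ h1 (by omega)) (by positivity)
        (abs_nonneg C)
    · exact mul_le_mul (le_abs_self D) (pow_le_pow_right₀ h1 (by omega)) (by positivity)
        (abs_nonneg D)
  zero_mem' := ⟨contDiff_const, fun _ _ => rfl, fun m => ⟨0, 0, fun q ξ => by
    have h : iteratedFDeriv ℝ m (fun p : Vec × Vec => (0 : Vec → Vec → ℝ) p.1 p.2) (q, ξ) = 0 := by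
      exact congrFun iteratedFDeriv_fun_zero (q, ξ)
    rw [h]; simp⟩⟩
  smul_mem' := by
    rintro c f ⟨hf, hf', hfb⟩
    refine ⟨contDiff_const.smul (f := fun _ : Vec × Vec => c) hf, fun i q => by simp [hf' i q], fun m => ?_⟩
    obtain ⟨k, C, hC⟩ := hfb m
    refine ⟨k, ‖c‖ * C, fun q ξ => ?_⟩
    have h : iteratedFDeriv ℝ m (fun p : Vec × Vec => (c • f) p.1 p.2) (q, ξ) =
        c • iteratedFDeriv ℝ m (fun p : Vec × Vec => f p.1 p.2) (q, ξ) :=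
      iteratedFDeriv_const_smul_apply (f := fun p : Vec × Vec => f p.1 p.2) (a := c) (hf.contDiffAt.of_le (by exact_mod_cast le_top))
    rw [h, norm_smul, mul_assoc]
    exact mul_le_mul_of_nonneg_left (hC q ξ) (norm_nonneg _)

/-- Triples `(n, P, ϱ)`; also the tangent vectors `(δn, δP, δϱ)`. -/
abbrev State : Type := ScalarField × VectorField × density

/-- Cotangent vectors `(δn*, δP*, δϱ*)`, i.e. triples of functional derivatives. -/
abbrev Covector : Type := ScalarField × VectorField × observable

/-- The density `n` of a triple. -/
def State.n (z : State) : Vec → ℝ := z.1.1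

/-- The momentum density `P` of a triple. -/
def State.P (z : State) : Vec → Vec := z.2.1.1

/-- The phase space density `ϱ` of a triple. -/
def State.rho (z : State) : Vec → Vec → ℝ := z.2.2.1

/-- The component of a covector dual to the density. -/
def Covector.n (α : Covector) : Vec → ℝ := α.1.1

/-- The component of a covector dual to the momentum density. -/
def Covector.P (α : Covector) : Vec → Vec := α.2.1.1

/-- The component of a covector dual to the phase space density. -/
def Covector.rho (α : Covector) : Vec → Vec → ℝ := α.2.2.1

/-- The duality pairing between covectors and tangent vectors. -/
def pairing (α : Covector) (v : State) : ℝ :=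
  torusInt (fun q => α.n q * v.n q) + torusInt (fun q => α.P q ⬝ᵥ v.P q)
    + phaseInt (fun q ξ => α.rho q ξ * v.rho q ξ)

/-- The phase space: triples whose density vanishes nowhere (the bracket involves `1/n`).
It is an open subset of the linear space of all triples. -/
def phaseSpace : Set State := {z | ∀ q, z.n q ≠ 0}

/-- The submanifold of triples with spatially constant density and divergence-free momentum. -/
def Sig : Set State :=
  {z | z ∈ phaseSpace ∧ (∀ q, grad z.n q = 0) ∧ (∀ q, divg z.P q = 0)}

/-! ### Smooth families, curves and functionals -/

section Families

variable {E : Type*} [NormedAddCommGroup E] [NormedSpace ℝ E]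

/-- Smooth families of functions on the torus, with parameter in the open set `U`. -/
def SmoothFieldFamily {F : Type*} [NormedAddCommGroup F] [NormedSpace ℝ F]
    (U : Set E) (f : E → Vec → F) : Prop :=
  ContDiffOn ℝ ∞ (fun p : E × Vec => f p.1 p.2) (U ×ˢ univ)

/-- Smooth families of phase space densities: jointly smooth, with decay of all derivatives that is
locally uniform in the parameter. -/
def SmoothDensityFamily (U : Set E) (f : E → Vec → Vec → ℝ) : Prop :=
  ContDiffOn ℝ ∞ (fun p : E × Vec × Vec => f p.1 p.2.1 p.2.2) (U ×ˢ univ) ∧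
  ∀ K ⊆ U, IsCompact K → ∀ k m : ℕ, ∃ C : ℝ, ∀ s ∈ K, ∀ q ξ : Vec,
    (1 + ‖ξ‖) ^ k *
      ‖iteratedFDeriv ℝ m (fun p : E × Vec × Vec => f p.1 p.2.1 p.2.2) (s, q, ξ)‖ ≤ C

/-- Smooth families of observables: jointly smooth, with polynomial bounds on all derivatives that
are locally uniform in the parameter. -/
def SmoothObservableFamily (U : Set E) (f : E → Vec → Vec → ℝ) : Prop :=
  ContDiffOn ℝ ∞ (fun p : E × Vec × Vec => f p.1 p.2.1 p.2.2) (U ×ˢ univ) ∧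
  ∀ K ⊆ U, IsCompact K → ∀ m : ℕ, ∃ (k : ℕ) (C : ℝ), ∀ s ∈ K, ∀ q ξ : Vec,
    ‖iteratedFDeriv ℝ m (fun p : E × Vec × Vec => f p.1 p.2.1 p.2.2) (s, q, ξ)‖
      ≤ C * (1 + ‖ξ‖) ^ k

/-- Smooth families of triples. -/
def SmoothStateFamily (U : Set E) (σ : E → State) : Prop :=
  SmoothFieldFamily U (fun s => (σ s).n) ∧ SmoothFieldFamily U (fun s => (σ s).P) ∧
    SmoothDensityFamily U (fun s => (σ s).rho)

/-- Smooth families of covectors. -/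
def SmoothCovectorFamily (U : Set E) (α : E → Covector) : Prop :=
  SmoothFieldFamily U (fun s => (α s).n) ∧ SmoothFieldFamily U (fun s => (α s).P) ∧
    SmoothObservableFamily U (fun s => (α s).rho)

end Families

/-- `v` is the velocity of the curve `c` at time `t`. -/
def IsVelocity (c : ℝ → State) (t : ℝ) (v : State) : Prop :=
  (∀ q, HasDerivAt (fun s => (c s).n q) (v.n q) t) ∧
  (∀ q, HasDerivAt (fun s => (c s).P q) (v.P q) t) ∧
  (∀ q ξ, HasDerivAt (fun s => (c s).rho q ξ) (v.rho q ξ) t)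

/-- The tangent space at `σ` of a subset of the space of triples: the velocities at `σ` of the
smooth curves in that subset. -/
def tangentSpace (N : Set State) (σ : State) : Set State :=
  {v | ∃ (U : Set ℝ) (c : ℝ → State), IsOpen U ∧ (0 : ℝ) ∈ U ∧ SmoothStateFamily U c ∧
    (∀ t ∈ U, c t ∈ N) ∧ c 0 = σ ∧ IsVelocity c 0 v}

/-- The annihilator of the tangent space. -/
def annihilator (N : Set State) (σ : State) : Set Covector :=
  {α | ∀ v ∈ tangentSpace N σ, pairing α v = 0}

/-- `F` is a smooth functional on `N`, and the covectors `dF σ` represent its differential: both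
are smooth along smooth finite-dimensional families in `N`, and the chain rule
`d/dt F(c(t)) = ⟨dF(c(t)), c'(t)⟩` holds along smooth curves in `N`. -/
def IsDifferential (N : Set State) (F : N → ℝ) (dF : N → Covector) : Prop :=
  (∀ (k : ℕ) (U : Set (Fin k → ℝ)) (σ : (Fin k → ℝ) → N), IsOpen U →
    SmoothStateFamily U (fun s => (σ s : State)) →
      ContDiffOn ℝ ∞ (fun s => F (σ s)) U ∧ SmoothCovectorFamily U (fun s => dF (σ s))) ∧
  (∀ (U : Set ℝ) (c : ℝ → N), IsOpen U → SmoothStateFamily U (fun t => (c t : State)) →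
    ∀ t ∈ U, ∀ v : State, IsVelocity (fun s => (c s : State)) t v →
      HasDerivAt (fun s => F (c s)) (pairing (dF (c t)) v) t)

/-- The smooth functionals on `N`. -/
def smoothFunctionals (N : Set State) : Set (N → ℝ) := {F | ∃ dF, IsDifferential N F dF}

/-! ### Poisson brackets and Poisson–Dirac submanifolds -/

/-- `br` is a Poisson bracket on the algebra `A` of functions on `X`. -/
structure IsPoissonBracket {X : Type*} (A : Set (X → ℝ))
    (br : (X → ℝ) → (X → ℝ) → X → ℝ) : Prop where
  const_mem : ∀ c : ℝ, (fun _ => c) ∈ A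
  add_mem : ∀ F ∈ A, ∀ G ∈ A, F + G ∈ A
  mul_mem : ∀ F ∈ A, ∀ G ∈ A, F * G ∈ A
  bracket_mem : ∀ F ∈ A, ∀ G ∈ A, br F G ∈ A
  add_left : ∀ F ∈ A, ∀ G ∈ A, ∀ H ∈ A, br (F + G) H = br F H + br G H
  smul_left : ∀ c : ℝ, ∀ F ∈ A, ∀ G ∈ A, br (c • F) G = c • br F G
  skew : ∀ F ∈ A, ∀ G ∈ A, br F G = -br G F
  leibniz : ∀ F ∈ A, ∀ G ∈ A, ∀ H ∈ A, br (F * G) H = F * br G H + br F H * G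
  jacobi : ∀ F ∈ A, ∀ G ∈ A, ∀ H ∈ A, br (br F G) H + br (br G H) F + br (br H F) G = 0

/-- `v` is the image of the covector `α` at `z` under the bundle map of the Poisson tensor `Λ`:
`⟨β, v⟩ = Λ(β, α)` for every covector `β`. -/
def IsSharp (Λ : State → Covector → Covector → ℝ) (z : State) (α : Covector) (v : State) : Prop :=
  ∀ β : Covector, pairing β v = Λ z β α

/-- `α` is a covector at `σ` that agrees with `a` on the tangent space of `N` and vanishes on the
image under the bundle map of the annihilator of that tangent space. -/
def IsTransverseExtension (Λ : State → Covector → Covector → ℝ) (N : Set State) (σ : State)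
    (a α : Covector) : Prop :=
  (∀ v ∈ tangentSpace N σ, pairing α v = pairing a v) ∧
  (∀ γ ∈ annihilator N σ, ∀ w, IsSharp Λ σ γ w → pairing α w = 0)

/-- `br` is the bracket induced on `N` by the Poisson tensor `Λ`: the value at `σ` of the bracket of
two smooth functionals is the value of `Λ` on any transverse extensions of their differentials. -/
def IsInducedBracket (Λ : State → Covector → Covector → ℝ) (N : Set State)
    (br : (N → ℝ) → (N → ℝ) → N → ℝ) : Prop :=
  ∀ (F G : N → ℝ) (dF dG : N → Covector), IsDifferential N F dF → IsDifferential N G dG →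
    ∀ (σ : N) (α β : Covector), IsTransverseExtension Λ N σ (dF σ) α →
      IsTransverseExtension Λ N σ (dG σ) β → br F G σ = Λ σ α β

/-- `N` is a Poisson–Dirac submanifold of `M` equipped with the Poisson tensor `Λ`. -/
structure IsPoissonDirac (Λ : State → Covector → Covector → ℝ) (M N : Set State) : Prop where
  subset : N ⊆ M
  /-- The Poisson tensor has a bundle map from covectors to tangent vectors. -/
  sharp : ∀ z ∈ M, ∀ α : Covector, ∃! v : State, IsSharp Λ z α v
  /-- The tangent space meets the image of its annihilator under the bundle map in zero only. -/
  dirac : ∀ σ ∈ N, tangentSpace N σ ∩ {v | ∃ α ∈ annihilator N σ, IsSharp Λ σ α v} = {0}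
  /-- Every covector of `N` has a transverse extension. -/
  extension : ∀ σ ∈ N, ∀ a : Covector, ∃ α : Covector, IsTransverseExtension Λ N σ a α
  /-- The induced bracket is well defined and varies smoothly. -/
  smooth : ∃ br : (N → ℝ) → (N → ℝ) → N → ℝ, IsInducedBracket Λ N br ∧
    ∀ F ∈ smoothFunctionals N, ∀ G ∈ smoothFunctionals N, br F G ∈ smoothFunctionals N

/-! ### The two brackets -/

/-- The Poisson bracket of the magnetized Vlasov–Poisson system in the variables `(n, P, ϱ)`, at the
point `z`, as a function of the functional derivatives
`α = (δF/δn, δF/δP, δF/δϱ)` and `β = (δG/δn, δG/δP, δG/δϱ)`. -/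
def bracketE (ε : ℝ) (B : ScalarField) (z : State) (α β : Covector) : ℝ :=
  let n := z.n
  let ϱ := z.rho
  let b : Vec → ℝ := B.1
  let Ω := vorticity z.n z.P
  let X := α.P
  let Y := β.P
  -- the functions `(1/n) δF/δϱ` and `(1/n) δG/δϱ`
  let f : Vec → Vec → ℝ := fun q ξ => (n q)⁻¹ * α.rho q ξ
  let g : Vec → Vec → ℝ := fun q ξ => (n q)⁻¹ * β.rho q ξ;
  - ε * torusInt (fun q =>
      (X q ⬝ᵥ (grad β.n q - grad (avg ϱ g) q + avg ϱ (gradQ g) q)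
        - Y q ⬝ᵥ (grad α.n q - grad (avg ϱ f) q + avg ϱ (gradQ f) q)) * n q)
  - ε * torusInt (fun q => _root_.VectorField.lieBracket ℝ X Y q ⬝ᵥ z.P q)
  + torusInt (fun q => b q * (X q ⬝ᵥ rot (Y q)) * n q)
  + ε * phaseInt (fun q ξ =>
      (gradQ f q ξ ⬝ᵥ gradV g q ξ - gradQ g q ξ ⬝ᵥ gradV f q ξ) * n q * ϱ q ξ)
  + phaseInt (fun q ξ =>
      (b q - ε * Ω q) * (gradV f q ξ ⬝ᵥ rot (gradV g q ξ)) * n q * ϱ q ξ)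
  - ε * torusInt (fun q =>
      (avg ϱ (gradQ f) q ⬝ᵥ avg ϱ (gradV g) q - avg ϱ (gradQ g) q ⬝ᵥ avg ϱ (gradV f) q) * n q)
  - torusInt (fun q =>
      (b q - ε * Ω q) * (avg ϱ (gradV f) q ⬝ᵥ rot (avg ϱ (gradV g) q)) * n q)
  - ε * torusInt (fun q =>
      (X q - avg ϱ (gradV f) q) ⬝ᵥ
          divT (fun p => n p • avg ϱ (fun p' ξ => tens (gradV g p' ξ) ξ) p) q
        - (Y q - avg ϱ (gradV g) q) ⬝ᵥ
          divT (fun p => n p • avg ϱ (fun p' ξ => tens (gradV f p' ξ) ξ) p) q)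

/-- The bracket of the magnetized quasineutral Vlasov–Poisson system at the point
`σ = (n₀, π, ϱ)`, as a function of the functional derivatives
`a = (δF/δn₀, δF/δπ, δF/δϱ)` and `c = (δG/δn₀, δG/δπ, δG/δϱ)`. -/
def bracketSig (ε : ℝ) (B : ScalarField) (σ : State) (a c : Covector) : ℝ :=
  let n := σ.n
  let ϱ := σ.rho
  let b : Vec → ℝ := B.1
  let Ω := vorticity σ.n σ.P
  let X := a.P
  let Y := c.P
  -- the functions `(1/n₀) δF/δϱ` and `(1/n₀) δG/δϱ`
  let f : Vec → Vec → ℝ := fun q ξ => (n q)⁻¹ * a.rho q ξ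
  let g : Vec → Vec → ℝ := fun q ξ => (n q)⁻¹ * c.rho q ξ;
  torusInt (fun q => (b q - ε * Ω q) * (X q ⬝ᵥ rot (Y q)) * n q)
  - ε * torusInt (fun q =>
      X q ⬝ᵥ avg ϱ (gradQ c.rho) q - Y q ⬝ᵥ avg ϱ (gradQ a.rho) q)
  - ε * torusInt (fun q =>
      (X q - avg ϱ (gradV f) q) ⬝ᵥ
          divT (avg ϱ (fun p ξ => tens (gradV c.rho p ξ) ξ)) q
        - (Y q - avg ϱ (gradV g) q) ⬝ᵥ
          divT (avg ϱ (fun p ξ => tens (gradV a.rho p ξ) ξ)) q)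
  + ε * phaseInt (fun q ξ =>
      (gradQ f q ξ ⬝ᵥ gradV g q ξ - gradQ g q ξ ⬝ᵥ gradV f q ξ) * n q * ϱ q ξ)
  + phaseInt (fun q ξ =>
      (b q - ε * Ω q) * (gradV f q ξ ⬝ᵥ rot (gradV g q ξ)) * n q * ϱ q ξ)
  - ε * torusInt (fun q =>
      (avg ϱ (gradQ f) q ⬝ᵥ avg ϱ (gradV g) q - avg ϱ (gradQ g) q ⬝ᵥ avg ϱ (gradV f) q) * n q)
  - torusInt (fun q =>
      (b q - ε * Ω q) * (avg ϱ (gradV f) q ⬝ᵥ rot (avg ϱ (gradV g) q)) * n q)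

/-- `dF` is the functional derivative `(δF/δn₀, δF/δπ, δF/δϱ)` of a smooth functional `F` on the
submanifold: it represents the differential, `δF/δn₀` is spatially constant and `δF/δπ` is
divergence-free. -/
def IsFunctionalDerivative (F : Sig → ℝ) (dF : Sig → Covector) : Prop :=
  IsDifferential Sig F dF ∧
    ∀ σ, (∀ q, grad (dF σ).n q = 0) ∧ (∀ q, divg (dF σ).P q = 0)

end

end QNVP

/-! The proof turns the brackets into commutative algebra. Smooth families of observables with
parameters in `E` form a commutative ring `Obs E` with commuting derivations `dq`, `dv`, `dt`.
Rapidly decaying families form a module `Den E`, `fib` is the velocity integral and `tor` the torus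
integral. Both brackets become `tor` of a ring element (`bracketE_at`, `bracketSig_at`), so most
identities are ring identities modulo integration by parts: `tor` kills `dq i`, and `fib` kills `dvD
i`. The parameter handles smoothness along families, since all constructions are carried out for
whole families.

The essential analytic input is the Poisson equation with smooth dependence on parameters
(`exists_lap_eq`). The biharmonic Fourier series with coefficients |k|⁻⁴ converges absolutely in
dimension two; convolving its sum with Δf inverts the Laplacian. This gives the Leray projection
(`exists_leray`) and a normalized representative of each covector on the tangent spaces of Σ
(`exists_normalized`), hence the unique functional derivatives.

On Σ the annihilator consists of the covectors (η, ∇φ, 0) with η of mean zero. The density component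
of the image of such a covector is -εnΔφ. If the image is tangent to Σ, this is constant with mean
zero, so ∇φ = 0; the image is then (0, -εn∇η, 0), and divergence-freeness forces it to vanish
(`poissonDirac_dirac`). Conversely, a Poisson equation for the density component turns a normalized
covector into a transverse extension (`poissonDirac_extension`). Every transverse extension has
divergence-free momentum component, and for such covectors the density components drop out of the
bracket (`tor_brE`). Thus the induced bracket is the explicit one, with no inverse Laplacian.

The Jacobi identity is proved directly on Σ. With relative velocities x = X - ⟨∂f/∂ξ⟩, y = Y -
⟨∂g/∂ξ⟩, with b = B - εΩ and h = nϱ, the bracket is the torus integral of n b x·Jy + ⟨{f + x·ξ, g +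
y·ξ} - {x·ξ, y·ξ}⟩_h, where {·,·} is the magnetic bracket `PB` on phase space (`tor_brS`). The
derivative of the bracket of two functionals has a part with their Hessians and a part `varS` at
fixed covectors. In the cyclic sum the Hessian parts cancel by symmetry of second derivatives. Along
a Hamiltonian vector, `varS` is found by pairing the vector with suitable test covectors
(`tor_varS_ham`). Its cyclic sum vanishes (`tor_cyclic_sum`) by the Jacobi identities for `PB` and
for vector fields, the closedness of area forms on the torus, and the formula for the exterior
derivative of a covector field. That `varS` is represented by covectors (`exists_variation`) and
that Hessians can be transposed (`exists_hessian`) makes the bracket of smooth functionals smooth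
again. -/

namespace QNVP

noncomputable section

set_option linter.unusedSectionVars false

/-! ### The ring of smooth families of observables -/

section Rings

variable (E : Type) [NormedAddCommGroup E] [NormedSpace ℝ E]

/-- Points of phase space together with a parameter. -/
abbrev Dom : Type := E × Vec × Vec

variable {E}

/-- All derivatives up to order `m` are bounded by a common power of the velocity. -/
theorem exists_bound_upto {f : Dom E → ℝ} {K : Set E}
    (h : ∀ m : ℕ, ∃ (k : ℕ) (C : ℝ), ∀ s ∈ K, ∀ q ξ : Vec,
      ‖iteratedFDeriv ℝ m f (s, q, ξ)‖ ≤ C * (1 + ‖ξ‖) ^ k) (m : ℕ) :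
    ∃ (k : ℕ) (C : ℝ), 0 ≤ C ∧ ∀ i ≤ m, ∀ s ∈ K, ∀ q ξ : Vec,
      ‖iteratedFDeriv ℝ i f (s, q, ξ)‖ ≤ C * (1 + ‖ξ‖) ^ k := by
  choose k C hC using h
  refine ⟨∑ i ∈ Finset.range (m + 1), k i, ∑ i ∈ Finset.range (m + 1), |C i|,
    Finset.sum_nonneg fun _ _ => abs_nonneg _, fun i hi s hs q ξ => (hC i s hs q ξ).trans ?_⟩
  have hi' : i ∈ Finset.range (m + 1) := by simp; omega
  have h1 : (1 : ℝ) ≤ 1 + ‖ξ‖ := by linarith [norm_nonneg ξ]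
  refine mul_le_mul ?_ (pow_le_pow_right₀ h1 ?_) (by positivity)
    (Finset.sum_nonneg fun _ _ => abs_nonneg _)
  · exact (le_abs_self _).trans
      (Finset.single_le_sum (f := fun i => |C i|) (fun _ _ => abs_nonneg _) hi')
  · exact Finset.single_le_sum (f := k) (fun _ _ => Nat.zero_le _) hi'

/-- All derivatives up to order `m` have a common decay bound. -/
theorem exists_decay_upto {f : Dom E → ℝ} {K : Set E}
    (h : ∀ k m : ℕ, ∃ C : ℝ, ∀ s ∈ K, ∀ q ξ : Vec,
      (1 + ‖ξ‖) ^ k * ‖iteratedFDeriv ℝ m f (s, q, ξ)‖ ≤ C) (k m : ℕ) :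
    ∃ C : ℝ, 0 ≤ C ∧ ∀ i ≤ m, ∀ s ∈ K, ∀ q ξ : Vec,
      (1 + ‖ξ‖) ^ k * ‖iteratedFDeriv ℝ i f (s, q, ξ)‖ ≤ C := by
  choose C hC using h k
  refine ⟨∑ i ∈ Finset.range (m + 1), |C i|,
    Finset.sum_nonneg fun _ _ => abs_nonneg _, fun i hi s hs q ξ => (hC i s hs q ξ).trans ?_⟩
  have hi' : i ∈ Finset.range (m + 1) := by simp; omega
  exact (le_abs_self _).trans
      (Finset.single_le_sum (f := fun i => |C i|) (fun _ _ => abs_nonneg _) hi')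

theorem contDiff_cast {F G : Type*} [NormedAddCommGroup F] [NormedSpace ℝ F]
    [NormedAddCommGroup G] [NormedSpace ℝ G] {f : F → G}
    (hf : ContDiff ℝ ∞ f) (m : ℕ) : ContDiff ℝ m f := hf.of_le (by exact_mod_cast le_top)

theorem iteratedFDeriv_add_eq {f g : Dom E → ℝ} (hf : ContDiff ℝ ∞ f) (hg : ContDiff ℝ ∞ g)
    (m : ℕ) (p : Dom E) :
    iteratedFDeriv ℝ m (f + g) p = iteratedFDeriv ℝ m f p + iteratedFDeriv ℝ m g p :=
  iteratedFDeriv_add_apply (contDiff_cast hf m).contDiffAt (contDiff_cast hg m).contDiffAt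

variable (E) in
/-- Smooth families of observables with parameter in `E`, as a subalgebra. -/
def obsAlgebra : Subalgebra ℝ (Dom E → ℝ) where
  carrier := {f | ContDiff ℝ ∞ f ∧
    (∀ (i : Fin 2) s q ξ, f (s, q + Pi.single i (2 * Real.pi), ξ) = f (s, q, ξ)) ∧
    ∀ K : Set E, IsCompact K → ∀ m : ℕ, ∃ (k : ℕ) (C : ℝ), ∀ s ∈ K, ∀ q ξ : Vec,
      ‖iteratedFDeriv ℝ m f (s, q, ξ)‖ ≤ C * (1 + ‖ξ‖) ^ k}
  add_mem' := by
    rintro f g ⟨hf, hf', hfb⟩ ⟨hg, hg', hgb⟩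
    refine ⟨hf.add hg, fun i s q ξ => by simp [hf' i s q, hg' i s q], fun K hK m => ?_⟩
    obtain ⟨k, C, hC0, hC⟩ := exists_bound_upto (hfb K hK) m
    obtain ⟨l, D, hD0, hD⟩ := exists_bound_upto (hgb K hK) m
    refine ⟨k + l, C + D, fun s hs q ξ => ?_⟩
    have h1 : (1 : ℝ) ≤ 1 + ‖ξ‖ := by linarith [norm_nonneg ξ]
    rw [iteratedFDeriv_add_eq hf hg, add_mul]
    refine (norm_add_le _ _).trans (add_le_add ((hC m le_rfl s hs q ξ).trans ?_)
      ((hD m le_rfl s hs q ξ).trans ?_))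
    · exact mul_le_mul_of_nonneg_left (pow_le_pow_right₀ h1 (by omega)) hC0
    · exact mul_le_mul_of_nonneg_left (pow_le_pow_right₀ h1 (by omega)) hD0
  mul_mem' := by
    rintro f g ⟨hf, hf', hfb⟩ ⟨hg, hg', hgb⟩
    refine ⟨hf.mul hg, fun i s q ξ => by simp [hf' i s q, hg' i s q], fun K hK m => ?_⟩
    obtain ⟨k, C, hC0, hC⟩ := exists_bound_upto (hfb K hK) m
    obtain ⟨l, D, hD0, hD⟩ := exists_bound_upto (hgb K hK) m
    refine ⟨k + l, ∑ i ∈ Finset.range (m + 1), (m.choose i : ℝ) * C * D, fun s hs q ξ => ?_⟩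
    refine (norm_iteratedFDeriv_mul_le hf hg _ (by exact_mod_cast le_top)).trans ?_
    rw [Finset.sum_mul]
    refine Finset.sum_le_sum fun i hi => ?_
    have hi' : i ≤ m := by simp at hi; omega
    calc _ ≤ (m.choose i : ℝ) * (C * (1 + ‖ξ‖) ^ k) * (D * (1 + ‖ξ‖) ^ l) := by
          gcongr
          · exact hC i hi' s hs q ξ
          · exact hD _ (by omega) s hs q ξ
      _ = _ := by rw [pow_add]; ring
  algebraMap_mem' := by
    intro r
    refine ⟨contDiff_const, fun _ _ _ _ => rfl, fun K hK m => ?_⟩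
    refine ⟨0, |r|, fun s hs q ξ => ?_⟩
    have e : (algebraMap ℝ (Dom E → ℝ)) r = fun _ => r := rfl
    rw [e]
    rcases Nat.eq_zero_or_pos m with rfl | hm
    · simp
    · simp [iteratedFDeriv_const_of_ne hm.ne']

variable (E) in
/-- The type of smooth families of observables with parameter in `E`. -/
def Obs : Type := obsAlgebra E

instance : CommRing (Obs E) := inferInstanceAs (CommRing (obsAlgebra E))
instance : Algebra ℝ (Obs E) := inferInstanceAs (Algebra ℝ (obsAlgebra E))

/-- The underlying function of an observable. -/
def Obs.fn (f : Obs E) : Dom E → ℝ := Subtype.val f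

theorem Obs.fn_add (f g : Obs E) : (f + g).fn = f.fn + g.fn := rfl
theorem Obs.fn_mul (f g : Obs E) : (f * g).fn = f.fn * g.fn := rfl
theorem Obs.fn_neg (f : Obs E) : (-f).fn = -f.fn := rfl
theorem Obs.fn_sub (f g : Obs E) : (f - g).fn = f.fn - g.fn := rfl
theorem Obs.fn_smul (c : ℝ) (f : Obs E) : (c • f).fn = c • f.fn := rfl
theorem Obs.fn_zero : (0 : Obs E).fn = 0 := rfl
theorem Obs.fn_one : (1 : Obs E).fn = 1 := rfl

theorem Obs.contDiff (f : Obs E) : ContDiff ℝ ∞ f.fn := f.2.1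

theorem Obs.differentiable (f : Obs E) : Differentiable ℝ f.fn :=
  f.2.1.differentiable (by simp)

theorem Obs.periodic (f : Obs E) (i : Fin 2) (s : E) (q ξ : Vec) :
    f.fn (s, q + Pi.single i (2 * Real.pi), ξ) = f.fn (s, q, ξ) := f.2.2.1 i s q ξ

theorem Obs.bound (f : Obs E) {K : Set E} (hK : IsCompact K) (m : ℕ) : ∃ (k : ℕ) (C : ℝ),
    ∀ s ∈ K, ∀ q ξ : Vec, ‖iteratedFDeriv ℝ m f.fn (s, q, ξ)‖ ≤ C * (1 + ‖ξ‖) ^ k :=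
  f.2.2.2 K hK m

theorem Obs.ext_fn {f g : Obs E} (h : ∀ p, f.fn p = g.fn p) : f = g := Subtype.ext (funext h)

theorem Obs.ext {f g : Obs E} (h : ∀ s q ξ, f.fn (s, q, ξ) = g.fn (s, q, ξ)) : f = g :=
  Subtype.ext (funext fun p => h p.1 p.2.1 p.2.2)

/-! ### Directional derivatives as derivations of the ring of observables. -/

theorem norm_iteratedFDeriv_pd_le {f : Dom E → ℝ} (hf : ContDiff ℝ ∞ f) (v : Dom E) (m : ℕ)
    (p : Dom E) : ‖iteratedFDeriv ℝ m (fun p => fderiv ℝ f p v) p‖ ≤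
      ‖v‖ * ‖iteratedFDeriv ℝ (m + 1) f p‖ := by
  rw [← norm_iteratedFDeriv_fderiv]
  exact norm_iteratedFDeriv_clm_apply_const (N := m)
    (hf.fderiv_right (m := m) (by exact_mod_cast le_top)).contDiffAt le_rfl

theorem contDiff_pd {f : Dom E → ℝ} (hf : ContDiff ℝ ∞ f) (v : Dom E) :
    ContDiff ℝ ∞ (fun p => fderiv ℝ f p v) :=
  (hf.fderiv_right (m := ∞) (by simp)).clm_apply contDiff_const

theorem fderiv_periodic {f : Dom E → ℝ}
    (h : ∀ (i : Fin 2) s q ξ, f (s, q + Pi.single i (2 * Real.pi), ξ) = f (s, q, ξ))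
    (i : Fin 2) (s : E) (q ξ : Vec) :
    fderiv ℝ f (s, q + Pi.single i (2 * Real.pi), ξ) = fderiv ℝ f (s, q, ξ) := by
  have e : f = fun p => f (p + ((0 : E), Pi.single i (2 * Real.pi), (0 : Vec))) := by
    ext ⟨s, q, ξ⟩; simp [h]
  conv_rhs => rw [e]
  rw [fderiv_comp_add_right]; simp

/-- The directional derivative. -/
def pd (v : Dom E) : Derivation ℝ (Obs E) (Obs E) :=
  Derivation.mk'
    { toFun := fun f => ⟨fun p => fderiv ℝ f.fn p v, contDiff_pd f.contDiff v,
        fun i s q ξ => by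
          change fderiv ℝ f.fn _ v = fderiv ℝ f.fn _ v; rw [fderiv_periodic f.periodic], fun K hK m => by
          obtain ⟨k, C, hC⟩ := f.2.2.2 K hK (m + 1)
          refine ⟨k, ‖v‖ * C, fun s hs q ξ => (norm_iteratedFDeriv_pd_le f.contDiff v m _).trans ?_⟩
          rw [mul_assoc]
          exact mul_le_mul_of_nonneg_left (hC s hs q ξ) (norm_nonneg _)⟩
      map_add' := fun f g => Obs.ext_fn fun p => by
        change fderiv ℝ (f.fn + g.fn) p v = _
        rw [fderiv_add (f.differentiable p) (g.differentiable p)]; rfl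
      map_smul' := fun c f => Obs.ext_fn fun p => by
        change fderiv ℝ (c • f.fn) p v = _
        rw [fderiv_const_smul (f.differentiable p)]; rfl }
    fun f g => Obs.ext_fn fun p => by
      change fderiv ℝ (f.fn * g.fn) p v = f.fn p * fderiv ℝ g.fn p v + g.fn p * fderiv ℝ f.fn p v
      rw [fderiv_mul (f.differentiable p) (g.differentiable p)]; simp

theorem pd_apply (v : Dom E) (f : Obs E) (p : Dom E) : (pd v f).fn p = fderiv ℝ f.fn p v := rfl

/-- Symmetry of the second derivative. Every commutation rule among `dq`, `dv` and `dt` is an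
instance. -/
theorem pd_comm (v w : Dom E) (f : Obs E) : pd v (pd w f) = pd w (pd v f) := by
  refine Obs.ext_fn fun p => ?_
  have h2 : ∀ v w, (pd v (pd w f)).fn p = fderiv ℝ (fderiv ℝ f.fn) p v w := by
    intro v w
    change fderiv ℝ (fun p => fderiv ℝ f.fn p w) p v = _
    rw [fderiv_clm_apply
      ((f.contDiff.fderiv_right (m := ∞) (by simp)).differentiable (by simp) p)
      (differentiableAt_const w)]
    simp
  rw [h2, h2]
  exact ((contDiff_cast f.contDiff 2).contDiffAt.isSymmSndFDerivAt
    (by rw [minSmoothness_of_isRCLikeNormedField]; exact le_rfl)) v w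

/-- The derivative with respect to a space coordinate. -/
def dq (i : Fin 2) : Derivation ℝ (Obs E) (Obs E) := pd (0, Pi.single i 1, 0)

/-- The derivative with respect to a velocity coordinate. -/
def dv (i : Fin 2) : Derivation ℝ (Obs E) (Obs E) := pd (0, 0, Pi.single i 1)

/-- The derivative with respect to the parameter. -/
def dt (e : E) : Derivation ℝ (Obs E) (Obs E) := pd (e, 0, 0)

theorem dq_comm (i j : Fin 2) (f : Obs E) : dq i (dq j f) = dq j (dq i f) := pd_comm _ _ f
theorem dv_comm (i j : Fin 2) (f : Obs E) : dv i (dv j f) = dv j (dv i f) := pd_comm _ _ f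
theorem dv_dq (i j : Fin 2) (f : Obs E) : dv i (dq j f) = dq j (dv i f) := pd_comm _ _ f
theorem dt_dq (e : E) (j : Fin 2) (f : Obs E) : dt e (dq j f) = dq j (dt e f) := pd_comm _ _ f
theorem dt_dv (e : E) (j : Fin 2) (f : Obs E) : dt e (dv j f) = dv j (dt e f) := pd_comm _ _ f

/-! ### Densities as an ideal of the ring of observables. -/

variable (E) in
/-- Smooth families of phase space densities with parameter in `E`, as an ideal. -/
def denIdeal : Ideal (Obs E) where
  carrier := {f | ∀ K : Set E, IsCompact K → ∀ k m : ℕ, ∃ C : ℝ, ∀ s ∈ K, ∀ q ξ : Vec,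
      (1 + ‖ξ‖) ^ k * ‖iteratedFDeriv ℝ m f.fn (s, q, ξ)‖ ≤ C}
  add_mem' := by
    intro f g hfb hgb K hK k m
    obtain ⟨C, hC⟩ := hfb K hK k m
    obtain ⟨D, hD⟩ := hgb K hK k m
    refine ⟨C + D, fun s hs q ξ => ?_⟩
    change _ * ‖iteratedFDeriv ℝ m (f.fn + g.fn) _‖ ≤ _
    rw [iteratedFDeriv_add_eq f.contDiff g.contDiff]
    calc _ ≤ (1 + ‖ξ‖) ^ k * (‖iteratedFDeriv ℝ m f.fn (s, q, ξ)‖ +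
          ‖iteratedFDeriv ℝ m g.fn (s, q, ξ)‖) := by
          gcongr; exact norm_add_le _ _
      _ ≤ C + D := by rw [mul_add]; exact add_le_add (hC s hs q ξ) (hD s hs q ξ)
  zero_mem' := by
    intro K hK k m
    refine ⟨0, fun s hs q ξ => ?_⟩
    have : iteratedFDeriv ℝ m (0 : Obs E).fn (s, q, ξ) = 0 :=
      congrFun (iteratedFDeriv_fun_zero) _
    rw [this]; simp
  smul_mem' := by
    intro g f hf K hK k m
    obtain ⟨l, D, hD0, hD⟩ := exists_bound_upto (g.2.2.2 K hK) m
    obtain ⟨C, hC0, hC⟩ := exists_decay_upto (hf K hK) (k + l) m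
    refine ⟨∑ i ∈ Finset.range (m + 1), (m.choose i : ℝ) * D * C, fun s hs q ξ => ?_⟩
    refine (mul_le_mul_of_nonneg_left (norm_iteratedFDeriv_mul_le g.contDiff f.contDiff _
      (n := m) (by exact_mod_cast le_top)) (by positivity)).trans ?_
    rw [Finset.mul_sum]
    refine Finset.sum_le_sum fun i hi => ?_
    have hi' : i ≤ m := by simp at hi; omega
    calc _ ≤ (1 + ‖ξ‖) ^ k * ((m.choose i : ℝ) * (D * (1 + ‖ξ‖) ^ l) *
          ‖iteratedFDeriv ℝ (m - i) f.fn (s, q, ξ)‖) := by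
          gcongr
          exact hD i hi' s hs q ξ
      _ = (m.choose i : ℝ) * D *
          ((1 + ‖ξ‖) ^ (k + l) * ‖iteratedFDeriv ℝ (m - i) f.fn (s, q, ξ)‖) := by
          rw [pow_add]; ring
      _ ≤ _ := by gcongr; exact hC _ (by omega) s hs q ξ

theorem mem_denIdeal {f : Obs E} : f ∈ denIdeal E ↔ ∀ K : Set E, IsCompact K → ∀ k m : ℕ,
    ∃ C : ℝ, ∀ s ∈ K, ∀ q ξ : Vec, (1 + ‖ξ‖) ^ k * ‖iteratedFDeriv ℝ m f.fn (s, q, ξ)‖ ≤ C :=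
  Iff.rfl

variable (E) in
/-- The type of smooth families of phase space densities with parameter in `E`. -/
def Den : Type := denIdeal E

instance : AddCommGroup (Den E) := inferInstanceAs (AddCommGroup (denIdeal E))
instance : Module (Obs E) (Den E) := inferInstanceAs (Module (Obs E) (denIdeal E))
instance : Module ℝ (Den E) := inferInstanceAs (Module ℝ (denIdeal E))
instance : IsScalarTower ℝ (Obs E) (Den E) :=
  inferInstanceAs (IsScalarTower ℝ (Obs E) (denIdeal E))

/-- The observable underlying a density. -/
def Den.obs (d : Den E) : Obs E := Subtype.val d

theorem Den.ext_obs {d d' : Den E} (h : d.obs = d'.obs) : d = d' := Subtype.ext h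

theorem Den.bound (d : Den E) {K : Set E} (hK : IsCompact K) (k m : ℕ) : ∃ C : ℝ,
    ∀ s ∈ K, ∀ q ξ : Vec, (1 + ‖ξ‖) ^ k * ‖iteratedFDeriv ℝ m d.obs.fn (s, q, ξ)‖ ≤ C :=
  d.2 K hK k m

theorem Den.obs_add (d d' : Den E) : (d + d').obs = d.obs + d'.obs := rfl
theorem Den.obs_smul (F : Obs E) (d : Den E) : (F • d).obs = F * d.obs := rfl

theorem pd_mem_Den (v : Dom E) {f : Obs E} (hf : f ∈ denIdeal E) : pd v f ∈ denIdeal E := by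
  intro K hK k m
  obtain ⟨C, hC⟩ := hf K hK k (m + 1)
  refine ⟨‖v‖ * C, fun s hs q ξ => ?_⟩
  calc _ ≤ (1 + ‖ξ‖) ^ k * (‖v‖ * ‖iteratedFDeriv ℝ (m + 1) f.fn (s, q, ξ)‖) := by
        gcongr; exact norm_iteratedFDeriv_pd_le f.contDiff v m _
    _ = ‖v‖ * ((1 + ‖ξ‖) ^ k * ‖iteratedFDeriv ℝ (m + 1) f.fn (s, q, ξ)‖) := by ring
    _ ≤ _ := by gcongr; exact hC s hs q ξ

/-- The directional derivative of a density. -/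
def pdD (v : Dom E) : Den E →ₗ[ℝ] Den E where
  toFun f := ⟨pd v f.obs, pd_mem_Den v f.2⟩
  map_add' f g := Subtype.ext (map_add (pd v) f.obs g.obs)
  map_smul' c f := Subtype.ext ((pd v).map_smul c f.obs)

theorem pdD_smul (v : Dom E) (F : Obs E) (d : Den E) :
    pdD v (F • d) = pd v F • d + F • pdD v d := by
  refine Den.ext_obs ?_
  change pd v (F * d.obs) = pd v F * d.obs + F * pd v d.obs
  rw [Derivation.leibniz]; simp only [smul_eq_mul]; ring

/-- The derivative of a density with respect to a space coordinate. -/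
def dqD (i : Fin 2) : Den E →ₗ[ℝ] Den E := pdD (0, Pi.single i 1, 0)
/-- The derivative of a density with respect to a velocity coordinate. -/
def dvD (i : Fin 2) : Den E →ₗ[ℝ] Den E := pdD (0, 0, Pi.single i 1)
/-- The derivative of a density with respect to the parameter. -/
def dtD (e : E) : Den E →ₗ[ℝ] Den E := pdD (e, 0, 0)

theorem dqD_smul (i : Fin 2) (F : Obs E) (d : Den E) :
    dqD i (F • d) = dq i F • d + F • dqD i d := pdD_smul _ F d
theorem dvD_smul (i : Fin 2) (F : Obs E) (d : Den E) :
    dvD i (F • d) = dv i F • d + F • dvD i d := pdD_smul _ F d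
theorem dtD_smul (e : E) (F : Obs E) (d : Den E) :
    dtD e (F • d) = dt e F • d + F • dtD e d := pdD_smul _ F d

/-! ### Functions of position alone, and the velocity coordinates. -/

variable (E) in
/-- Families of functions of the space variable. -/
def Fld : Subalgebra ℝ (Obs E) where
  carrier := {f | ∀ s q ξ, f.fn (s, q, ξ) = f.fn (s, q, 0)}
  add_mem' := fun {f g} hf hg s q ξ => by
    change f.fn _ + g.fn _ = f.fn _ + g.fn _; rw [hf s q ξ, hg s q ξ]
  mul_mem' := fun {f g} hf hg s q ξ => by
    change f.fn _ * g.fn _ = f.fn _ * g.fn _; rw [hf s q ξ, hg s q ξ]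
  algebraMap_mem' := fun r s q ξ => rfl

/-- Such a function factors through the projection to zero velocity, whose derivative kills the
velocity directions. -/
theorem dv_Fld {u : Obs E} (hu : u ∈ Fld E) (i : Fin 2) : dv i u = 0 := by
  refine Obs.ext fun s q ξ => ?_
  change fderiv ℝ u.fn (s, q, ξ) (0, 0, Pi.single i 1) = 0
  have e : u.fn = (u.fn ∘ fun p : Dom E => (p.1, p.2.1, (0 : Vec))) :=
    funext fun p => hu p.1 p.2.1 p.2.2
  have hd : HasFDerivAt (fun p : Dom E => (p.1, p.2.1, (0 : Vec)))
      ((ContinuousLinearMap.fst ℝ E (Vec × Vec)).prod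
        (((ContinuousLinearMap.fst ℝ Vec Vec).comp (ContinuousLinearMap.snd ℝ E (Vec × Vec))).prod 0))
      (s, q, ξ) := by
    refine HasFDerivAt.prodMk hasFDerivAt_fst (HasFDerivAt.prodMk ?_ (hasFDerivAt_const _ _))
    exact HasFDerivAt.comp _ hasFDerivAt_fst hasFDerivAt_snd
  rw [e, fderiv_comp _ (u.differentiable _) hd.differentiableAt, hd.fderiv]
  have : ((0 : E), (0 : Vec), (0 : Vec)) = 0 := rfl
  simp [this]

/-- Functions of position are those invariant under velocity translations, and translations commute
with differentiation. -/
theorem pd_mem_Fld (e : E) (w : Vec) {u : Obs E} (hu : u ∈ Fld E) : pd (e, w, 0) u ∈ Fld E := by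
  intro s q ξ
  change fderiv ℝ u.fn _ _ = fderiv ℝ u.fn _ _
  have e' : u.fn = fun p => u.fn (p + ((0 : E), (0 : Vec), ξ)) := by
    ext ⟨s, q, η⟩
    simp only [Prod.mk_add_mk, add_zero]
    rw [hu s q η, hu s q (η + ξ)]
  conv_rhs => rw [e', fderiv_comp_add_right]
  simp

theorem dq_mem_Fld (i : Fin 2) {u : Obs E} (hu : u ∈ Fld E) : dq i u ∈ Fld E :=
  pd_mem_Fld _ _ hu
theorem dt_mem_Fld (e : E) {u : Obs E} (hu : u ∈ Fld E) : dt e u ∈ Fld E :=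
  pd_mem_Fld _ _ hu

theorem iteratedFDeriv_clm_norm_le {F G : Type*} [NormedAddCommGroup F] [NormedSpace ℝ F]
    [NormedAddCommGroup G] [NormedSpace ℝ G] (T : F →L[ℝ] G) (n : ℕ) (hn : n ≠ 0) (x : F) :
    ‖iteratedFDeriv ℝ n T x‖ ≤ ‖T‖ := by
  obtain ⟨k, rfl⟩ := Nat.exists_eq_succ_of_ne_zero hn
  rw [← norm_iteratedFDeriv_fderiv]
  have : fderiv ℝ (T : F → G) = fun _ => T := funext fun x => T.fderiv
  rw [this]
  rcases Nat.eq_zero_or_pos k with rfl | hk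
  · simp
  · rw [iteratedFDeriv_const_of_ne hk.ne']; simp

/-- The velocity coordinates. -/
def xi (i : Fin 2) : Obs E :=
  ⟨fun p => p.2.2 i, by fun_prop, fun _ _ _ _ => rfl, fun K _ m => by
    set T : Dom E →L[ℝ] ℝ := (ContinuousLinearMap.proj (R := ℝ) (φ := fun _ : Fin 2 => ℝ) i).comp
      ((ContinuousLinearMap.snd ℝ Vec Vec).comp (ContinuousLinearMap.snd ℝ E (Vec × Vec))) with hT
    have e : (fun p : Dom E => p.2.2 i) = T := rfl
    refine ⟨1, 1 + ‖T‖, fun s _ q ξ => ?_⟩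
    rw [e]
    have h0 : 0 ≤ ‖T‖ * ‖ξ‖ := by positivity
    rcases Nat.eq_zero_or_pos m with rfl | hm
    · rw [norm_iteratedFDeriv_zero]
      have : ‖T (s, q, ξ)‖ ≤ ‖ξ‖ := norm_le_pi_norm ξ i
      nlinarith [norm_nonneg T]
    · have := iteratedFDeriv_clm_norm_le T m hm.ne' (s, q, ξ)
      nlinarith [norm_nonneg T, norm_nonneg ξ]⟩

theorem pd_xi (v : Dom E) (i : Fin 2) : pd v (xi i) = algebraMap ℝ (Obs E) (v.2.2 i) := by
  refine Obs.ext_fn fun p => ?_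
  set T : Dom E →L[ℝ] ℝ := (ContinuousLinearMap.proj (R := ℝ) (φ := fun _ : Fin 2 => ℝ) i).comp
      ((ContinuousLinearMap.snd ℝ Vec Vec).comp (ContinuousLinearMap.snd ℝ E (Vec × Vec))) with hT
  change fderiv ℝ T p v = v.2.2 i
  rw [T.fderiv]; rfl

@[simp] theorem dq_xi (i j : Fin 2) : dq i (xi j : Obs E) = 0 := by
  rw [dq, pd_xi]; simp
@[simp] theorem dt_xi (e : E) (j : Fin 2) : dt e (xi j : Obs E) = 0 := by
  rw [dt, pd_xi]; simp
@[simp] theorem dv_xi_self (i : Fin 2) : dv i (xi i : Obs E) = 1 := by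
  rw [dv, pd_xi]; simp
theorem dv_xi_ne {i j : Fin 2} (h : j ≠ i) : dv i (xi j : Obs E) = 0 := by
  rw [dv, pd_xi]; simp [h]

end Rings

/-! ### Integrals depending on a parameter -/

section Parametric

variable {M : Type} [NormedAddCommGroup M] [NormedSpace ℝ M] [FiniteDimensional ℝ M]

/-- All derivatives are dominated by integrable functions, locally uniformly in the parameter. -/
def Dominated {G : Type} [NormedAddCommGroup G] [NormedSpace ℝ G] (μ : Measure Vec)
    (F : M × Vec → G) : Prop :=
  ∀ K : Set M, IsCompact K → ∀ m : ℕ, ∃ g : Vec → ℝ, Integrable g μ ∧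
    ∀ᵐ y ∂μ, ∀ x ∈ K, ‖iteratedFDeriv ℝ m F (x, y)‖ ≤ g y

variable {G : Type} [NormedAddCommGroup G] [NormedSpace ℝ G] {μ : Measure Vec} {F : M × Vec → G}

theorem Dominated.integrable (hF : ContDiff ℝ ∞ F) (h : Dominated μ F) (x : M) :
    Integrable (fun y => F (x, y)) μ := by
  obtain ⟨g, hg, hb⟩ := h {x} isCompact_singleton 0
  refine hg.mono' (by have := hF.continuous; fun_prop) ?_
  filter_upwards [hb] with y hy
  simpa using hy x rfl

/-- The partial derivative with respect to the parameter. -/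
def partialFst (F : M × Vec → G) (p : M × Vec) : M →L[ℝ] G :=
  (fderiv ℝ F p).comp (ContinuousLinearMap.inl ℝ M Vec)

theorem contDiff_partialFst (hF : ContDiff ℝ ∞ F) : ContDiff ℝ ∞ (partialFst F) :=
  (hF.fderiv_right (m := ∞) (by simp)).clm_comp contDiff_const

theorem Dominated.partialFst (hF : ContDiff ℝ ∞ F) (h : Dominated μ F) :
    Dominated μ (partialFst F) := by
  intro K hK m
  obtain ⟨g, hg, hb⟩ := h K hK (m + 1)
  set T : ((M × Vec) →L[ℝ] G) →L[ℝ] (M →L[ℝ] G) :=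
    (ContinuousLinearMap.compL ℝ M (M × Vec) G).flip (ContinuousLinearMap.inl ℝ M Vec) with hT
  refine ⟨fun y => ‖T‖ * g y, hg.const_mul _, ?_⟩
  filter_upwards [hb] with y hy x hx
  have e : QNVP.partialFst F = T ∘ fderiv ℝ F := rfl
  rw [e]
  refine (T.norm_iteratedFDeriv_comp_left (n := m)
    (hF.fderiv_right (m := m) (by exact_mod_cast le_top)).contDiffAt (by exact_mod_cast le_rfl)).trans ?_
  rw [norm_iteratedFDeriv_fderiv]
  exact mul_le_mul_of_nonneg_left (hy x hx) (norm_nonneg _)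

theorem hasFDerivAt_integral_param (hF : ContDiff ℝ ∞ F) (h : Dominated μ F) (x : M) :
    HasFDerivAt (fun x => ∫ y, F (x, y) ∂μ) (∫ y, partialFst F (x, y) ∂μ) x := by
  obtain ⟨g, hg, hb⟩ := h.partialFst hF (Metric.closedBall x 1) (isCompact_closedBall x 1) 0
  have hc := hF.continuous
  have hc' := (contDiff_partialFst hF).continuous
  refine hasFDerivAt_integral_of_dominated_of_fderiv_le (bound := g)
    (F := fun x y => F (x, y)) (F' := fun x y => partialFst F (x, y))
    (Metric.closedBall_mem_nhds x one_pos) (Filter.Eventually.of_forall fun x => ?_)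
    (h.integrable hF x) ?_ ?_ hg (Filter.Eventually.of_forall fun y x _ => ?_)
  · exact (hc.comp (by fun_prop : Continuous fun y : Vec => (x, y))).aestronglyMeasurable
  · exact (hc'.comp (by fun_prop : Continuous fun y : Vec => (x, y))).aestronglyMeasurable
  · filter_upwards [hb] with y hy z hz
    simpa using hy z hz
  · exact ((hF.differentiable (by simp)) (x, y)).hasFDerivAt.comp x (hasFDerivAt_prodMk_left x y)

/-- The codomain is quantified inside the induction, because the derivative of the integral is the
integral of a function with values in `M →L[ℝ] G`. -/
theorem contDiff_integral_param_nat (n : ℕ) : ∀ {G : Type} [NormedAddCommGroup G]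
    [NormedSpace ℝ G] {F : M × Vec → G}, ContDiff ℝ ∞ F → Dominated μ F →
    ContDiff ℝ n (fun x => ∫ y, F (x, y) ∂μ) := by
  induction n with
  | zero =>
    intro G _ _ F hF h
    refine contDiff_zero.2 (continuous_iff_continuousAt.2 fun x =>
      (hasFDerivAt_integral_param hF h x).continuousAt)
  | succ n ih =>
    intro G _ _ F hF h
    push_cast
    refine contDiff_succ_iff_fderiv.2 ⟨fun x =>
      (hasFDerivAt_integral_param hF h x).differentiableAt, by simp, ?_⟩
    have : (fderiv ℝ fun x => ∫ y, F (x, y) ∂μ) = fun x => ∫ y, partialFst F (x, y) ∂μ :=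
      funext fun x => (hasFDerivAt_integral_param hF h x).fderiv
    rw [this]
    exact ih (contDiff_partialFst hF) (h.partialFst hF)

theorem contDiff_integral_param (hF : ContDiff ℝ ∞ F) (h : Dominated μ F) :
    ContDiff ℝ ∞ (fun x => ∫ y, F (x, y) ∂μ) :=
  contDiff_infty.2 fun n => contDiff_integral_param_nat n hF h

theorem fderiv_integral_param [CompleteSpace G] (hF : ContDiff ℝ ∞ F) (h : Dominated μ F) (x v : M) :
    fderiv ℝ (fun x => ∫ y, F (x, y) ∂μ) x v = ∫ y, fderiv ℝ F (x, y) (v, 0) ∂μ := by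
  rw [(hasFDerivAt_integral_param hF h x).fderiv,
    ContinuousLinearMap.integral_apply ((h.partialFst hF).integrable (contDiff_partialFst hF) x)]
  rfl

end Parametric

/-! ### Periodic functions -/

/-- The period cell. -/
def cell : Set Vec := Icc (0 : Vec) (fun _ => 2 * Real.pi)

theorem isCompact_cell : IsCompact cell := isCompact_Icc

theorem Periodic2.add_zsmul {F : Type*} {f : Vec → F} (h : Periodic2 f) (k l : ℤ) (q : Vec) :
    f (q + (k • Pi.single 0 (2 * Real.pi) + l • Pi.single 1 (2 * Real.pi))) = f q := by
  have h0 : Function.Periodic f (Pi.single 0 (2 * Real.pi)) := h 0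
  have h1 : Function.Periodic f (Pi.single 1 (2 * Real.pi)) := h 1
  rw [← add_assoc, h1.zsmul l, h0.zsmul k]

theorem exists_cell (q : Vec) : ∃ q' ∈ cell, ∃ k l : ℤ,
    q = q' + (k • Pi.single 0 (2 * Real.pi) + l • Pi.single 1 (2 * Real.pi)) := by
  have hp : 0 < 2 * Real.pi := by positivity
  have h := fun i => toIcoMod_mem_Ico hp 0 (q i)
  refine ⟨fun i => toIcoMod hp 0 (q i), ⟨fun i => (h i).1, fun i => ?_⟩,
    toIcoDiv hp 0 (q 0), toIcoDiv hp 0 (q 1), ?_⟩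
  · have := (h i).2.le; simpa using this
  · funext i
    fin_cases i
    · have := toIcoMod_add_toIcoDiv_zsmul hp 0 (q 0)
      simp at this ⊢
    · have := toIcoMod_add_toIcoDiv_zsmul hp 0 (q 1)
      simp at this ⊢

theorem Periodic2.exists_cell_eq {F : Type*} {f : Vec → F} (h : Periodic2 f) (q : Vec) :
    ∃ q' ∈ cell, f q = f q' := by
  obtain ⟨q', hq', k, l, e⟩ := exists_cell q
  exact ⟨q', hq', by rw [e, h.add_zsmul]⟩

section Rings

variable {E : Type} [NormedAddCommGroup E] [NormedSpace ℝ E]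

/-- The projection of phase space onto space. -/
def projQ : Dom E →L[ℝ] E × Vec :=
  (ContinuousLinearMap.fst ℝ E (Vec × Vec)).prod
    ((ContinuousLinearMap.fst ℝ Vec Vec).comp (ContinuousLinearMap.snd ℝ E (Vec × Vec)))

theorem iteratedFDeriv_comp_clm_norm_le {F G H : Type*} [NormedAddCommGroup F] [NormedSpace ℝ F]
    [NormedAddCommGroup G] [NormedSpace ℝ G] [NormedAddCommGroup H] [NormedSpace ℝ H]
    {f : G → H} (hf : ContDiff ℝ ∞ f) (T : F →L[ℝ] G) (m : ℕ) (x : F) :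
    ‖iteratedFDeriv ℝ m (f ∘ T) x‖ ≤ ‖T‖ ^ m * ‖iteratedFDeriv ℝ m f (T x)‖ := by
  rw [T.iteratedFDeriv_comp_right (contDiff_cast hf m) x le_rfl]
  refine (ContinuousMultilinearMap.norm_compContinuousLinearMap_le _ _).trans ?_
  simp [mul_comm]

/-- A smooth family of functions on the torus, as a family of observables. -/
def mkFld (g : E × Vec → ℝ) (hg : ContDiff ℝ ∞ g) (hp : ∀ s, Periodic2 fun q => g (s, q)) :
    Obs E :=
  ⟨fun p => g (p.1, p.2.1), hg.comp (by fun_prop), fun i s q ξ => hp s i q, fun K hK m => by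
    have hc : Continuous fun p : E × Vec => ‖iteratedFDeriv ℝ m g p‖ :=
      (hg.continuous_iteratedFDeriv (by exact_mod_cast le_top)).norm
    obtain ⟨C, hC⟩ := (hK.prod isCompact_cell).bddAbove_image hc.continuousOn
    refine ⟨0, ‖(projQ : Dom E →L[ℝ] E × Vec)‖ ^ m * C, fun s hs q ξ => ?_⟩
    refine (iteratedFDeriv_comp_clm_norm_le hg projQ m (s, q, ξ)).trans ?_
    rw [pow_zero, mul_one]
    refine mul_le_mul_of_nonneg_left ?_ (by positivity)
    -- Compactness bounds the derivatives only over the period cell; their periodicity extends the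
    -- bound to the whole plane.
    have hper : Periodic2 fun q => ‖iteratedFDeriv ℝ m g (s, q)‖ := by
      intro i q
      have e : g = fun p => g (p + ((0 : E), Pi.single i (2 * Real.pi))) := by
        ext ⟨s, q⟩; simpa using (hp s i q).symm
      conv_rhs => rw [e]
      simp only [iteratedFDeriv_comp_add_right]
      simp
    obtain ⟨q', hq', e⟩ := hper.exists_cell_eq q
    change ‖iteratedFDeriv ℝ m g (s, q)‖ ≤ C
    rw [e]
    exact hC ⟨(s, q'), ⟨hs, hq'⟩, rfl⟩⟩

theorem mkFld_mem (g : E × Vec → ℝ) (hg : ContDiff ℝ ∞ g)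
    (hp : ∀ s, Periodic2 fun q => g (s, q)) : mkFld g hg hp ∈ Fld E := fun _ _ _ => rfl

/-! ### The velocity integral -/

/-- The exponent 3 exceeds the dimension 2 of the velocity plane; this is the decay rate used to
dominate densities. -/
theorem integrable_decay : Integrable (fun ξ : Vec => ((1 + ‖ξ‖) ^ 3)⁻¹) := by
  have h := integrable_one_add_norm (E := Vec) (μ := volume) (r := 3) (by simp; norm_num)
  refine h.congr (Filter.Eventually.of_forall fun ξ => ?_)
  have : (0 : ℝ) ≤ 1 + ‖ξ‖ := by positivity
  simp only [Real.rpow_neg this]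
  norm_cast

/-- The regrouping of the velocity variable. -/
def regroup : (E × Vec) × Vec →L[ℝ] Dom E :=
  (ContinuousLinearEquiv.prodAssoc ℝ E Vec Vec : (E × Vec) × Vec →L[ℝ] Dom E)

theorem Den.dominated (d : Den E) : Dominated volume (d.obs.fn ∘ (regroup : (E × Vec) × Vec →L[ℝ] Dom E)) := by
  intro K hK m
  obtain ⟨C, hC⟩ := d.2 (Prod.fst '' K) (hK.image continuous_fst) 3 m
  refine ⟨fun ξ => ‖(regroup : (E × Vec) × Vec →L[ℝ] Dom E)‖ ^ m * (C * ((1 + ‖ξ‖) ^ 3)⁻¹),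
    (integrable_decay.const_mul _).const_mul _, Filter.Eventually.of_forall fun ξ p hp => ?_⟩
  refine (iteratedFDeriv_comp_clm_norm_le d.obs.contDiff regroup m (p, ξ)).trans ?_
  refine mul_le_mul_of_nonneg_left ?_ (by positivity)
  have := hC p.1 ⟨p, hp, rfl⟩ p.2 ξ
  rw [← div_eq_mul_inv, le_div_iff₀ (by positivity), mul_comm]
  exact this

theorem Den.contDiff_regroup (d : Den E) :
    ContDiff ℝ ∞ (d.obs.fn ∘ (regroup : (E × Vec) × Vec →L[ℝ] Dom E)) :=
  d.obs.contDiff.comp (regroup (E := E)).contDiff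

variable [FiniteDimensional ℝ E]

theorem Den.integrable (d : Den E) (s : E) (q : Vec) : Integrable fun ξ => d.obs.fn (s, q, ξ) :=
  d.dominated.integrable d.contDiff_regroup (s, q)

/-- The velocity integral. -/
def fib : Den E →ₗ[ℝ] Obs E where
  toFun d := mkFld (fun p => ∫ ξ, d.obs.fn (p.1, p.2, ξ))
    (contDiff_integral_param d.contDiff_regroup d.dominated)
    (fun s i q => by simp only [d.obs.periodic])
  map_add' d d' := Obs.ext fun s q ξ => integral_add (d.integrable s q) (d'.integrable s q)
  map_smul' c d := Obs.ext fun s q ξ => integral_const_mul c _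

theorem fib_apply (d : Den E) (s : E) (q ξ : Vec) :
    (fib d).fn (s, q, ξ) = ∫ η, d.obs.fn (s, q, η) := rfl

theorem fib_mem (d : Den E) : fib d ∈ Fld E := fun _ _ _ => rfl

theorem fib_smul {u : Obs E} (hu : u ∈ Fld E) (d : Den E) : fib (u • d) = u * fib d := by
  refine Obs.ext fun s q ξ => ?_
  change ∫ η, u.fn (s, q, η) * d.obs.fn (s, q, η) = u.fn (s, q, ξ) * ∫ η, d.obs.fn (s, q, η)
  rw [← integral_const_mul]
  congr 1; funext η
  have h1 := hu s q η; have h2 := hu s q ξ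
  change u.fn _ = u.fn _ at h1; change u.fn _ = u.fn _ at h2
  rw [h1, h2]

/-- Differentiation under the integral sign, in the directions that do not move the integration
variable. -/
theorem fib_pd (e : E) (w : Vec) (d : Den E) : fib (pdD (e, w, 0) d) = pd (e, w, 0) (fib d) := by
  refine Obs.ext fun s q ξ => ?_
  rw [pd_apply, fib_apply]
  have h1 := fderiv_integral_param d.contDiff_regroup d.dominated (s, q) (e, w)
  have e1 : (fib d).fn = (fun p : E × Vec => ∫ y, (d.obs.fn ∘ regroup) (p, y)) ∘ projQ := rfl
  have hdiff : DifferentiableAt ℝ (fun p : E × Vec => ∫ y, (d.obs.fn ∘ regroup) (p, y))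
      (projQ (s, q, ξ)) :=
    (contDiff_integral_param d.contDiff_regroup d.dominated).differentiable (by simp) _
  have e2 := fderiv_comp (s, q, ξ) hdiff (projQ (E := E)).differentiableAt
  rw [e1, e2, (projQ (E := E)).fderiv]
  change _ = fderiv ℝ (fun p : E × Vec => ∫ y, (d.obs.fn ∘ regroup) (p, y)) (s, q) (e, w)
  rw [h1]
  congr 1; funext η
  have e3 := fderiv_comp ((s, q), η) (d.obs.differentiable (regroup ((s, q), η)))
    (regroup (E := E)).differentiableAt
  rw [e3, (regroup (E := E)).fderiv]
  rfl

theorem fib_dqD (i : Fin 2) (d : Den E) : fib (dqD i d) = dq i (fib d) := fib_pd _ _ d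
theorem fib_dtD (e : E) (d : Den E) : fib (dtD e d) = dt e (fib d) := fib_pd _ _ d

/-- Integration by parts against the constant function 1: the velocity decay leaves no boundary
term. -/
theorem fib_dvD (i : Fin 2) (d : Den E) : fib (dvD i d) = 0 := by
  refine Obs.ext fun s q ξ => ?_
  rw [fib_apply]
  have hd : Differentiable ℝ fun η => d.obs.fn (s, q, η) :=
    d.obs.differentiable.comp (by fun_prop)
  have e : ∀ η, (dvD i d).obs.fn (s, q, η) = fderiv ℝ (fun η => d.obs.fn (s, q, η)) η (Pi.single i 1) := by
    intro η
    have h1 : HasFDerivAt (fun η : Vec => ((s, q, η) : Dom E))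
      ((0 : Vec →L[ℝ] E).prod ((0 : Vec →L[ℝ] Vec).prod (ContinuousLinearMap.id ℝ Vec))) η :=
      (hasFDerivAt_const _ _).prodMk ((hasFDerivAt_const _ _).prodMk (hasFDerivAt_id _))
    have h2 := ((d.obs.differentiable (s, q, η)).hasFDerivAt.comp η h1).fderiv
    change _ = fderiv ℝ (d.obs.fn ∘ fun η => (s, q, η)) η _
    rw [h2]; rfl
  have hi := (dvD i d).integrable s q
  have := integral_mul_fderiv_eq_neg_fderiv_mul_of_integrable (μ := (volume : Measure Vec))
    (f := fun η => d.obs.fn (s, q, η)) (g := fun _ => (1 : ℝ)) (v := Pi.single i 1)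
    (by simpa [← e] using hi) (by simp) (by simpa using d.integrable s q)
    (fun x _ => hd x) (fun x _ => differentiableAt_const _)
  simp only [fderiv_fun_const, Pi.zero_apply, zero_apply, mul_zero, mul_one,
    integral_zero, ← e] at this
  rw [Obs.fn_zero]; simp only [Pi.zero_apply]; linarith

/-! ### The torus integral -/

theorem dominated_cell {f : E × Vec → ℝ} (hf : ContDiff ℝ ∞ f) :
    Dominated (volume.restrict cell) f := by
  intro K hK m
  have hc : Continuous fun p : E × Vec => ‖iteratedFDeriv ℝ m f p‖ :=
    (hf.continuous_iteratedFDeriv (by exact_mod_cast le_top)).norm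
  obtain ⟨C, hC⟩ := (hK.prod isCompact_cell).bddAbove_image hc.continuousOn
  have hfin : volume cell ≠ ⊤ := isCompact_cell.measure_lt_top.ne
  refine ⟨fun _ => C, integrableOn_const hfin, ?_⟩
  refine (ae_restrict_iff' measurableSet_Icc).2 (Filter.Eventually.of_forall fun q hq s hs => ?_)
  exact hC ⟨(s, q), ⟨hs, hq⟩, rfl⟩

/-- The restriction of an observable to zero velocity. -/
theorem Obs.contDiff_zero_velocity (f : Obs E) :
    ContDiff ℝ ∞ (fun p : E × Vec => f.fn (p.1, p.2, 0)) := f.contDiff.comp (by fun_prop)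

/-- The torus integral, at zero velocity. -/
def tor : Obs E →ₗ[ℝ] (E → ℝ) where
  toFun f := fun s => torusInt fun q => f.fn (s, q, 0)
  map_add' f g := funext fun s => by
    exact integral_add ((dominated_cell f.contDiff_zero_velocity).integrable f.contDiff_zero_velocity s)
      ((dominated_cell g.contDiff_zero_velocity).integrable g.contDiff_zero_velocity s)
  map_smul' c f := funext fun s => integral_const_mul c _

theorem tor_apply (f : Obs E) (s : E) : tor f s = torusInt fun q => f.fn (s, q, 0) := rfl

theorem contDiff_tor (f : Obs E) : ContDiff ℝ ∞ (tor f) :=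
  contDiff_integral_param f.contDiff_zero_velocity (dominated_cell f.contDiff_zero_velocity)

theorem fderiv_tor (f : Obs E) (s e : E) : fderiv ℝ (tor f) s e = tor (dt e f) s := by
  have h := fderiv_integral_param f.contDiff_zero_velocity
    (dominated_cell f.contDiff_zero_velocity) s e
  refine h.trans ?_
  refine integral_congr_ae (Filter.Eventually.of_forall fun q => ?_)
  have h1 : HasFDerivAt (fun p : E × Vec => ((p.1, p.2, 0) : Dom E))
      ((ContinuousLinearMap.fst ℝ E Vec).prod ((ContinuousLinearMap.snd ℝ E Vec).prod 0)) (s, q) :=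
    hasFDerivAt_fst.prodMk (hasFDerivAt_snd.prodMk (hasFDerivAt_const _ _))
  have h2 := ((f.differentiable (s, q, 0)).hasFDerivAt.comp (s, q) h1).fderiv
  change fderiv ℝ (f.fn ∘ fun p : E × Vec => (p.1, p.2, 0)) (s, q) (e, 0) = _
  rw [h2]; rfl

/-- The divergence theorem on the period cell for the vector field `g` times the `i`-th basis
vector; by periodicity the fluxes through opposite faces cancel. -/
theorem torusInt_fderiv {g : Vec → ℝ} (hg : ContDiff ℝ ∞ g) (hp : Periodic2 g) (i : Fin 2) :
    torusInt (fun q => fderiv ℝ g q (Pi.single i 1)) = 0 := by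
  have hd := hg.differentiable (by simp)
  set T : ℝ →L[ℝ] Vec := ContinuousLinearMap.single ℝ (fun _ : Fin 2 => ℝ) i with hT
  have hsum : ∀ q, (∑ j, (T.comp (fderiv ℝ g q)) (Pi.single j 1) j) = fderiv ℝ g q (Pi.single i 1) := by
    intro q
    rw [Finset.sum_eq_single i] <;> simp +contextual [hT]
  have hcont : Continuous fun q => fderiv ℝ g q (Pi.single i 1) :=
    ((hg.fderiv_right (m := ∞) (by simp)).clm_apply contDiff_const).continuous
  have h := integral_divergence_of_hasFDerivAt_off_countable (n := 1) (0 : Vec)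
    (fun _ => 2 * Real.pi) (fun _ => by simp; positivity) (fun q => T (g q))
    (fun q => T.comp (fderiv ℝ g q)) ∅ countable_empty
    (T.continuous.comp hg.continuous).continuousOn
    (fun x _ => T.hasFDerivAt.comp x (hd x).hasFDerivAt)
    (by simp only [hsum]; exact hcont.continuousOn.integrableOn_compact isCompact_Icc)
  simp only [hsum] at h
  refine h.trans (Finset.sum_eq_zero fun j _ => ?_)
  rw [sub_eq_zero]
  congr 1; funext x
  have : (j.insertNth (2 * Real.pi) x : Vec) =
      (j.insertNth ((0 : Vec) j) x : Vec) + Pi.single j (2 * Real.pi) := by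
    funext k
    rcases eq_or_ne k j with rfl | hk
    · simp
    · obtain ⟨l, rfl⟩ := Fin.exists_succAbove_eq hk
      simp
  rw [this]
  change T (g _) j = T (g _) j
  rw [hp j]

theorem fn_zero_velocity_dq (f : Obs E) (i : Fin 2) (s : E) (q ξ : Vec) :
    (dq i f).fn (s, q, ξ) = fderiv ℝ (fun q => f.fn (s, q, ξ)) q (Pi.single i 1) := by
  have h1 : HasFDerivAt (fun q : Vec => ((s, q, ξ) : Dom E))
      ((0 : Vec →L[ℝ] E).prod ((ContinuousLinearMap.id ℝ Vec).prod (0 : Vec →L[ℝ] Vec))) q :=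
    (hasFDerivAt_const _ _).prodMk ((hasFDerivAt_id _).prodMk (hasFDerivAt_const _ _))
  have h2 := ((f.differentiable (s, q, ξ)).hasFDerivAt.comp q h1).fderiv
  change _ = fderiv ℝ (f.fn ∘ fun q => (s, q, ξ)) q _
  rw [h2]; rfl

theorem fn_dv (f : Obs E) (i : Fin 2) (s : E) (q ξ : Vec) :
    (dv i f).fn (s, q, ξ) = fderiv ℝ (fun ξ => f.fn (s, q, ξ)) ξ (Pi.single i 1) := by
  have h1 : HasFDerivAt (fun η : Vec => ((s, q, η) : Dom E))
      ((0 : Vec →L[ℝ] E).prod ((0 : Vec →L[ℝ] Vec).prod (ContinuousLinearMap.id ℝ Vec))) ξ :=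
    (hasFDerivAt_const _ _).prodMk ((hasFDerivAt_const _ _).prodMk (hasFDerivAt_id _))
  have h2 := ((f.differentiable (s, q, ξ)).hasFDerivAt.comp ξ h1).fderiv
  change _ = fderiv ℝ (f.fn ∘ fun η => (s, q, η)) ξ _
  rw [h2]; rfl

theorem fn_dt (f : Obs E) (e s : E) (q ξ : Vec) :
    (dt e f).fn (s, q, ξ) = fderiv ℝ (fun s => f.fn (s, q, ξ)) s e := by
  have h1 : HasFDerivAt (fun s : E => ((s, q, ξ) : Dom E))
      ((ContinuousLinearMap.id ℝ E).prod (0 : E →L[ℝ] Vec × Vec)) s :=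
    (hasFDerivAt_id _).prodMk (hasFDerivAt_const _ _)
  have h2 := ((f.differentiable (s, q, ξ)).hasFDerivAt.comp s h1).fderiv
  change _ = fderiv ℝ (f.fn ∘ fun s => (s, q, ξ)) s _
  rw [h2]; rfl

theorem tor_dq (i : Fin 2) (f : Obs E) : tor (dq i f) = 0 := by
  funext s
  rw [tor_apply]
  simp only [fn_zero_velocity_dq]
  exact torusInt_fderiv (g := fun q => f.fn (s, q, 0)) (f.contDiff.comp (by fun_prop))
    (fun i q => f.periodic i s q 0) i

theorem tor_mul_dq (i : Fin 2) (f g : Obs E) : tor (f * dq i g) = -tor (dq i f * g) := by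
  have h := tor_dq i (f * g)
  rw [Derivation.leibniz, map_add, smul_eq_mul, smul_eq_mul, mul_comm g] at h
  exact eq_neg_of_add_eq_zero_left h

/-- A nonnegative function with zero integral vanishes almost everywhere on the cell, by continuity
everywhere on it, and by periodicity on the plane. All later arguments of the form "the integral of
a square is zero" rest on this. -/
theorem tor_eq_zero_of_nonneg {u : Obs E} (hu : u ∈ Fld E) {s : E}
    (h0 : ∀ q, 0 ≤ u.fn (s, q, 0)) (h : tor u s = 0) (q ξ : Vec) : u.fn (s, q, ξ) = 0 := by
  have hc : Continuous fun q => u.fn (s, q, 0) := u.contDiff.continuous.comp (by fun_prop)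
  have hz : ∀ q ∈ cell, u.fn (s, q, 0) = 0 := by
    have h1 : ∫ q in cell, u.fn (s, q, 0) = 0 := h
    rw [setIntegral_eq_zero_iff_of_nonneg_ae (Filter.Eventually.of_forall h0)
      (hc.continuousOn.integrableOn_compact isCompact_cell)] at h1
    intro q hq
    -- Passing from almost everywhere to everywhere on a closed set needs the set to lie in the
    -- closure of its interior.
    have hcl : cell ⊆ closure (interior cell) := by
      have hcv : Convex ℝ cell := convex_Icc _ _
      refine hcv.closure_interior_eq_closure_of_nonempty_interior ?_ ▸ subset_closure
      refine ⟨fun _ => Real.pi, ?_⟩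
      rw [cell, ← pi_univ_Icc, interior_pi_set finite_univ]
      intro i _
      simp only [interior_Icc]
      constructor <;> simp [Real.pi_pos]
    exact Measure.eqOn_of_ae_eq h1 hc.continuousOn continuousOn_const hcl hq
  obtain ⟨q', hq', e⟩ := Periodic2.exists_cell_eq (f := fun q => u.fn (s, q, ξ))
    (fun i q => u.periodic i s q ξ) q
  have h1 := hu s q' ξ
  change u.fn _ = u.fn _ at h1
  rw [e, h1, hz q' hq']

theorem tor_self_eq_zero {u : Obs E} (hu : u ∈ Fld E) {s : E} (h : tor (u * u) s = 0) (q ξ : Vec) :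
    u.fn (s, q, ξ) = 0 :=
  mul_self_eq_zero.1 (tor_eq_zero_of_nonneg (mul_mem hu hu) (fun _ => mul_self_nonneg _) h q ξ)

end Rings

/-! ### Families of states and covectors as elements of the rings -/

section Lift

variable {E : Type} [NormedAddCommGroup E] [NormedSpace ℝ E]
variable {E' : Type} [NormedAddCommGroup E'] [NormedSpace ℝ E']

variable (E) in
/-- Smooth families of triples with parameter in `E`. -/
structure StF where
  n : Obs E
  P : Fin 2 → Obs E
  r : Den E
  hn : n ∈ Fld E
  hP : ∀ i, P i ∈ Fld E

variable (E) in
/-- Smooth families of covectors with parameter in `E`. -/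
structure CvF where
  n : Obs E
  P : Fin 2 → Obs E
  r : Obs E
  hn : n ∈ Fld E
  hP : ∀ i, P i ∈ Fld E

theorem Obs.slice_mem (f : Obs E) (s : E) : (fun q ξ => f.fn (s, q, ξ)) ∈ observable := by
  refine ⟨f.contDiff.comp (by fun_prop : ContDiff ℝ ∞ fun p : Vec × Vec => (s, p.1, p.2)),
    fun i q => funext fun ξ => f.periodic i s q ξ, fun m => ?_⟩
  obtain ⟨k, C, hC⟩ := f.bound (isCompact_singleton (x := s)) m
  set T := ContinuousLinearMap.inr ℝ E (Vec × Vec)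
  refine ⟨k, ‖T‖ ^ m * C, fun q ξ => ?_⟩
  have e : (fun p : Vec × Vec => f.fn (s, p.1, p.2)) =
      (fun p => f.fn (p + ((s, 0, 0) : Dom E))) ∘ T := by
    ext p; simp [T, Prod.mk_zero_zero]
  rw [e]
  refine (iteratedFDeriv_comp_clm_norm_le
    (f.contDiff.comp (by fun_prop : ContDiff ℝ ∞ fun p : Dom E => p + ((s, 0, 0) : Dom E))) T m (q, ξ)).trans ?_
  rw [mul_assoc]
  refine mul_le_mul_of_nonneg_left ?_ (by positivity)
  have := iteratedFDeriv_comp_add_right (𝕜 := ℝ) (f := f.fn) m ((s, 0, 0) : Dom E) (T (q, ξ))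
  change ‖iteratedFDeriv ℝ m (fun p => f.fn (p + ((s, 0, 0) : Dom E))) _‖ ≤ _
  rw [this]
  simpa [T] using hC s rfl q ξ

theorem Den.slice_mem (d : Den E) (s : E) : (fun q ξ => d.obs.fn (s, q, ξ)) ∈ density := by
  refine ⟨d.obs.contDiff.comp (by fun_prop : ContDiff ℝ ∞ fun p : Vec × Vec => (s, p.1, p.2)),
    fun i q => funext fun ξ => d.obs.periodic i s q ξ, fun k m => ?_⟩
  obtain ⟨C, hC⟩ := d.bound (isCompact_singleton (x := s)) k m
  set T := ContinuousLinearMap.inr ℝ E (Vec × Vec)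
  refine ⟨‖T‖ ^ m * C, fun q ξ => ?_⟩
  have e : (fun p : Vec × Vec => d.obs.fn (s, p.1, p.2)) =
      (fun p => d.obs.fn (p + ((s, 0, 0) : Dom E))) ∘ T := by
    ext p; simp [T, Prod.mk_zero_zero]
  rw [e]
  have h1 := iteratedFDeriv_comp_clm_norm_le
    (d.obs.contDiff.comp (by fun_prop : ContDiff ℝ ∞ fun p : Dom E => p + ((s, 0, 0) : Dom E)))
    T m (q, ξ)
  have h2 := iteratedFDeriv_comp_add_right (𝕜 := ℝ) (f := d.obs.fn) m ((s, 0, 0) : Dom E) (T (q, ξ))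
  change _ ≤ ‖T‖ ^ m * ‖iteratedFDeriv ℝ m (fun p => d.obs.fn (p + ((s, 0, 0) : Dom E))) _‖ at h1
  rw [h2] at h1
  refine (mul_le_mul_of_nonneg_left h1 (by positivity)).trans ?_
  rw [mul_left_comm]
  refine mul_le_mul_of_nonneg_left ?_ (by positivity)
  have h3 := hC s rfl q ξ
  simpa [T] using h3

theorem Obs.fld_slice_mem (f : Obs E) (s : E) : (fun q => f.fn (s, q, 0)) ∈ torusField ℝ :=
  ⟨f.contDiff.comp (by fun_prop), fun i q => f.periodic i s q 0⟩

theorem Obs.vec_slice_mem (P : Fin 2 → Obs E) (s : E) :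
    (fun q i => (P i).fn (s, q, 0)) ∈ torusField Vec :=
  ⟨contDiff_pi.2 fun i => (P i).contDiff.comp (by fun_prop),
    fun i q => funext fun j => (P j).periodic i s q 0⟩

/-- The member of a family of triples at a parameter. -/
def StF.at (S : StF E) (s : E) : State :=
  (⟨_, S.n.fld_slice_mem s⟩, ⟨_, Obs.vec_slice_mem S.P s⟩, ⟨_, S.r.slice_mem s⟩)

/-- The member of a family of covectors at a parameter. -/
def CvF.at (A : CvF E) (s : E) : Covector :=
  (⟨_, A.n.fld_slice_mem s⟩, ⟨_, Obs.vec_slice_mem A.P s⟩, ⟨_, A.r.slice_mem s⟩)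

theorem StF.at_n (S : StF E) (s : E) (q : Vec) : (S.at s).n q = S.n.fn (s, q, 0) := rfl
theorem StF.at_P (S : StF E) (s : E) (q : Vec) (i : Fin 2) :
    (S.at s).P q i = (S.P i).fn (s, q, 0) := rfl
theorem CvF.at_P (A : CvF E) (s : E) (q : Vec) (i : Fin 2) :
    (A.at s).P q i = (A.P i).fn (s, q, 0) := rfl

theorem State.ext {z w : State} (hn : ∀ q, z.n q = w.n q) (hP : ∀ q i, z.P q i = w.P q i)
    (hr : ∀ q ξ, z.rho q ξ = w.rho q ξ) : z = w :=
  Prod.ext (Subtype.ext (funext hn)) (Prod.ext (Subtype.ext (funext fun q => funext (hP q)))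
    (Subtype.ext (funext fun q => funext (hr q))))

theorem Covector.ext {z w : Covector} (hn : ∀ q, z.n q = w.n q) (hP : ∀ q i, z.P q i = w.P q i)
    (hr : ∀ q ξ, z.rho q ξ = w.rho q ξ) : z = w :=
  Prod.ext (Subtype.ext (funext hn)) (Prod.ext (Subtype.ext (funext fun q => funext (hP q)))
    (Subtype.ext (funext fun q => funext (hr q))))

theorem StF.smooth (S : StF E) : SmoothStateFamily univ S.at := by
  refine ⟨?_, ?_, ?_, fun K _ hK => S.r.2 K hK⟩
  · exact (S.n.contDiff.comp
      (by fun_prop : ContDiff ℝ ∞ fun p : E × Vec => ((p.1, p.2, 0) : Dom E))).contDiffOn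
  · exact (contDiff_pi.2 fun i => (S.P i).contDiff.comp
      (by fun_prop : ContDiff ℝ ∞ fun p : E × Vec => ((p.1, p.2, 0) : Dom E))).contDiffOn
  · exact S.r.obs.contDiff.contDiffOn

theorem CvF.smooth (S : CvF E) : SmoothCovectorFamily univ S.at := by
  refine ⟨?_, ?_, ?_, fun K _ hK => S.r.2.2.2 K hK⟩
  · exact (S.n.contDiff.comp
      (by fun_prop : ContDiff ℝ ∞ fun p : E × Vec => ((p.1, p.2, 0) : Dom E))).contDiffOn
  · exact (contDiff_pi.2 fun i => (S.P i).contDiff.comp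
      (by fun_prop : ContDiff ℝ ∞ fun p : E × Vec => ((p.1, p.2, 0) : Dom E))).contDiffOn
  · exact S.r.contDiff.contDiffOn

/-! ### Change of parameters -/

/-- A Faà di Bruno estimate. The substitution moves only the parameter, so the derivatives of the
inner map are bounded uniformly in position and velocity; `D` does not depend on `C`, and both
polynomial growth and decay bounds carry over. -/
theorem exists_reparam_bound {φ : E' → E} (hφ : ContDiff ℝ ∞ φ) {U : Set E} (hU : IsOpen U)
    (hm : ∀ s, φ s ∈ U) {F : Dom E → ℝ} (hF : ContDiffOn ℝ ∞ F (U ×ˢ univ)) {K : Set E'}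
    (hK : IsCompact K) (m : ℕ) :
    ∃ D : ℝ, 0 ≤ D ∧ ∀ s ∈ K, ∀ (q ξ : Vec) (C : ℝ),
      (∀ i ≤ m, ‖iteratedFDeriv ℝ i F (φ s, q, ξ)‖ ≤ C) →
      ‖iteratedFDeriv ℝ m (fun p : Dom E' => F (φ p.1, p.2)) (s, q, ξ)‖ ≤ D * C := by
  set Φ : Dom E' → Dom E := fun p => (φ p.1, p.2) with hΦdef
  have hΦ : ContDiff ℝ ∞ Φ := (hφ.comp contDiff_fst).prodMk contDiff_snd
  set H : E' → (Dom E' →L[ℝ] Dom E) := fun s =>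
    (ContinuousLinearMap.inl ℝ E (Vec × Vec)).comp
      ((fderiv ℝ φ s).comp (ContinuousLinearMap.fst ℝ E' (Vec × Vec))) +
    (ContinuousLinearMap.inr ℝ E (Vec × Vec)).comp (ContinuousLinearMap.snd ℝ E' (Vec × Vec)) with hH
  have hHs : ContDiff ℝ ∞ H := by
    have h1 : ContDiff ℝ ∞ (fderiv ℝ φ) := hφ.fderiv_right (m := ∞) (by simp)
    have h2 : ContDiff ℝ ∞ fun s => (fderiv ℝ φ s).comp (ContinuousLinearMap.fst ℝ E' (Vec × Vec)) :=
      h1.clm_comp contDiff_const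
    exact (contDiff_const.clm_comp h2).add contDiff_const
  have hfd : fderiv ℝ Φ = H ∘ (ContinuousLinearMap.fst ℝ E' (Vec × Vec)) := by
    funext p
    have h1 : HasFDerivAt Φ _ p :=
      (((hφ.differentiable (by simp)) p.1).hasFDerivAt.comp p hasFDerivAt_fst).prodMk hasFDerivAt_snd
    rw [h1.fderiv]
    ext v <;> simp [hH]
  have hb : ∀ j : ℕ, ∃ B : ℝ, ∀ s ∈ K, ‖iteratedFDeriv ℝ j H s‖ ≤ B := by
    intro j
    obtain ⟨B, hB⟩ := hK.bddAbove_image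
      (f := fun s => ‖iteratedFDeriv ℝ j H s‖)
      (hHs.continuous_iteratedFDeriv (m := j) (by exact_mod_cast le_top)).norm.continuousOn
    exact ⟨B, fun s hs => hB ⟨s, hs, rfl⟩⟩
  choose B hB using hb
  set T := ContinuousLinearMap.fst ℝ E' (Vec × Vec)
  -- The summand 1 gives `D ≥ 1`, so that one bound `D` on every inner derivative also serves as the
  -- bound `D ^ i` in the composition estimate.
  set D : ℝ := 1 + ∑ j ∈ Finset.range m, ‖T‖ ^ j * |B j| with hD
  have hsum : 0 ≤ ∑ j ∈ Finset.range m, ‖T‖ ^ j * |B j| :=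
    Finset.sum_nonneg fun _ _ => by positivity
  have hD1 : 1 ≤ D := by linarith
  refine ⟨m.factorial * D ^ m, by positivity, fun s hs q ξ C hC => ?_⟩
  have hUo : IsOpen (U ×ˢ (univ : Set (Vec × Vec))) := hU.prod isOpen_univ
  have h := norm_iteratedFDerivWithin_comp_le (n := m) (N := ∞) hF (hΦ.contDiffOn (s := univ))
    (by exact_mod_cast le_top) hUo.uniqueDiffOn uniqueDiffOn_univ (fun p _ => ⟨hm p.1, mem_univ _⟩)
    (mem_univ (s, q, ξ)) (C := C) (D := D) ?_ ?_
  · rw [iteratedFDerivWithin_univ] at h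
    refine h.trans (le_of_eq ?_)
    ring
  · intro i hi
    rw [iteratedFDerivWithin_of_isOpen i hUo ⟨hm s, mem_univ _⟩]
    exact hC i hi
  · intro i hi hi'
    obtain ⟨j, rfl⟩ := Nat.exists_eq_succ_of_ne_zero (by omega : i ≠ 0)
    rw [iteratedFDerivWithin_univ, ← norm_iteratedFDeriv_fderiv, hfd]
    refine (iteratedFDeriv_comp_clm_norm_le hHs T j (s, q, ξ)).trans ?_
    calc _ ≤ ‖T‖ ^ j * |B j| := by
          gcongr; exact (hB j s hs).trans (le_abs_self _)
      _ ≤ D := by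
          rw [hD]
          have := Finset.single_le_sum (f := fun j => ‖T‖ ^ j * |B j|)
            (fun _ _ => by positivity) (Finset.mem_range.2 (by omega : j < m))
          linarith
      _ ≤ D ^ (j + 1) := le_self_pow₀ hD1 (by omega)

theorem reparam_contDiff {φ : E' → E} (hφ : ContDiff ℝ ∞ φ) {U : Set E}
    (hm : ∀ s, φ s ∈ U) {F : Dom E → ℝ} (hF : ContDiffOn ℝ ∞ F (U ×ˢ univ)) :
    ContDiff ℝ ∞ (fun p : Dom E' => F (φ p.1, p.2)) := by
  have hΦ : ContDiff ℝ ∞ (fun p : Dom E' => ((φ p.1, p.2) : Dom E)) :=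
    (hφ.comp contDiff_fst).prodMk contDiff_snd
  rw [← contDiffOn_univ]
  exact hF.comp hΦ.contDiffOn fun p _ => ⟨hm p.1, mem_univ _⟩

theorem reparam_observable {φ : E' → E} (hφ : ContDiff ℝ ∞ φ) {U : Set E} (hU : IsOpen U)
    (hm : ∀ s, φ s ∈ U) {f : E → Vec → Vec → ℝ} (hf : SmoothObservableFamily U f)
    (K : Set E') (hK : IsCompact K) (m : ℕ) : ∃ (k : ℕ) (C : ℝ), ∀ s ∈ K, ∀ q ξ : Vec,
      ‖iteratedFDeriv ℝ m (fun p : Dom E' => f (φ p.1) p.2.1 p.2.2) (s, q, ξ)‖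
        ≤ C * (1 + ‖ξ‖) ^ k := by
  obtain ⟨D, hD0, hD⟩ := exists_reparam_bound hφ hU hm hf.1 hK m
  obtain ⟨k, C, hC0, hC⟩ := exists_bound_upto
    (hf.2 (φ '' K) (by rintro _ ⟨s, _, rfl⟩; exact hm s) (hK.image hφ.continuous)) m
  refine ⟨k, D * C, fun s hs q ξ => (hD s hs q ξ _ fun i hi => hC i hi _ ⟨s, hs, rfl⟩ q ξ).trans ?_⟩
  rw [mul_assoc]

theorem reparam_density {φ : E' → E} (hφ : ContDiff ℝ ∞ φ) {U : Set E} (hU : IsOpen U)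
    (hm : ∀ s, φ s ∈ U) {f : E → Vec → Vec → ℝ} (hf : SmoothDensityFamily U f)
    (K : Set E') (hK : IsCompact K) (k m : ℕ) : ∃ C : ℝ, ∀ s ∈ K, ∀ q ξ : Vec,
      (1 + ‖ξ‖) ^ k * ‖iteratedFDeriv ℝ m (fun p : Dom E' => f (φ p.1) p.2.1 p.2.2) (s, q, ξ)‖
        ≤ C := by
  obtain ⟨D, hD0, hD⟩ := exists_reparam_bound hφ hU hm hf.1 hK m
  obtain ⟨C, hC0, hC⟩ := exists_decay_upto
    (hf.2 (φ '' K) (by rintro _ ⟨s, _, rfl⟩; exact hm s) (hK.image hφ.continuous)) k m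
  refine ⟨D * C, fun s hs q ξ => ?_⟩
  have hp : 0 < (1 + ‖ξ‖) ^ k := by positivity
  have := hD s hs q ξ (((1 + ‖ξ‖) ^ k)⁻¹ * C) fun i hi => by
    rw [inv_mul_eq_div, le_div_iff₀ hp, mul_comm]
    exact hC i hi _ ⟨s, hs, rfl⟩ q ξ
  calc _ ≤ (1 + ‖ξ‖) ^ k * (D * (((1 + ‖ξ‖) ^ k)⁻¹ * C)) := by gcongr
    _ = D * C := by field_simp

theorem SmoothDensityFamily.observable {U : Set E} {f : E → Vec → Vec → ℝ}
    (hf : SmoothDensityFamily U f) : SmoothObservableFamily U f := by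
  refine ⟨hf.1, fun K hKU hK m => ?_⟩
  obtain ⟨C, hC⟩ := hf.2 K hKU hK 0 m
  exact ⟨0, C, fun s hs q ξ => by simpa using hC s hs q ξ⟩

/-- A smooth family of observables lifts along a change of parameters. -/
def liftObs {φ : E' → E} (hφ : ContDiff ℝ ∞ φ) {U : Set E} (hU : IsOpen U)
    (hm : ∀ s, φ s ∈ U) {f : E → Vec → Vec → ℝ} (hf : SmoothObservableFamily U f)
    (hp : ∀ s, Periodic2 (f s)) : Obs E' :=
  ⟨fun p => f (φ p.1) p.2.1 p.2.2, reparam_contDiff hφ hm hf.1,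
    fun i s q ξ => congrFun (hp (φ s) i q) ξ, reparam_observable hφ hU hm hf⟩

/-- A smooth family of densities lifts along a change of parameters. -/
def liftDen {φ : E' → E} (hφ : ContDiff ℝ ∞ φ) {U : Set E} (hU : IsOpen U)
    (hm : ∀ s, φ s ∈ U) {f : E → Vec → Vec → ℝ} (hf : SmoothDensityFamily U f)
    (hp : ∀ s, Periodic2 (f s)) : Den E' :=
  ⟨liftObs hφ hU hm hf.observable hp, mem_denIdeal.2 fun K hK k m => by
    exact reparam_density hφ hU hm hf K hK k m⟩

/-- A smooth family of functions on the torus lifts along a change of parameters. -/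
def liftFld {φ : E' → E} (hφ : ContDiff ℝ ∞ φ) {U : Set E}
    (hm : ∀ s, φ s ∈ U) {f : E → Vec → ℝ} (hf : SmoothFieldFamily U f)
    (hp : ∀ s, Periodic2 (f s)) : Obs E' :=
  mkFld (fun p => f (φ p.1) p.2) (by
    have hΦ : ContDiff ℝ ∞ (fun p : E' × Vec => ((φ p.1, p.2) : E × Vec)) :=
      (hφ.comp contDiff_fst).prodMk contDiff_snd
    rw [← contDiffOn_univ]
    exact hf.comp hΦ.contDiffOn fun p _ => ⟨hm p.1, mem_univ _⟩) (fun s => hp (φ s))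

theorem SmoothFieldFamily.component {U : Set E} {f : E → Vec → Vec} (hf : SmoothFieldFamily U f)
    (i : Fin 2) : SmoothFieldFamily U (fun s q => f s q i) := contDiffOn_pi.1 hf i

theorem Periodic2.component {f : Vec → Vec} (hf : Periodic2 f) (i : Fin 2) :
    Periodic2 (fun q => f q i) := fun j q => congrFun (hf j q) i

/-- A smooth family of triples lifts along a change of parameters. -/
def liftState {φ : E' → E} (hφ : ContDiff ℝ ∞ φ) {U : Set E} (hU : IsOpen U)
    (hm : ∀ s, φ s ∈ U) {σ : E → State} (h : SmoothStateFamily U σ) : StF E' where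
  n := liftFld hφ hm h.1 fun s => (σ s).1.2.2
  P i := liftFld hφ hm (h.2.1.component i) fun s => Periodic2.component (σ s).2.1.2.2 i
  r := liftDen hφ hU hm h.2.2 fun s => (σ s).2.2.2.2.1
  hn := mkFld_mem _ _ _
  hP _ := mkFld_mem _ _ _

/-- A smooth family of covectors lifts along a change of parameters. -/
def liftCovector {φ : E' → E} (hφ : ContDiff ℝ ∞ φ) {U : Set E} (hU : IsOpen U)
    (hm : ∀ s, φ s ∈ U) {σ : E → Covector} (h : SmoothCovectorFamily U σ) : CvF E' where
  n := liftFld hφ hm h.1 fun s => (σ s).1.2.2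
  P i := liftFld hφ hm (h.2.1.component i) fun s => Periodic2.component (σ s).2.1.2.2 i
  r := liftObs hφ hU hm h.2.2 fun s => (σ s).2.2.2.2.1
  hn := mkFld_mem _ _ _
  hP _ := mkFld_mem _ _ _

theorem liftCovector_at {φ : E' → E} (hφ : ContDiff ℝ ∞ φ) {U : Set E} (hU : IsOpen U)
    (hm : ∀ s, φ s ∈ U) {σ : E → Covector} (h : SmoothCovectorFamily U σ) (s : E') :
    (liftCovector hφ hU hm h).at s = σ (φ s) := rfl

/-- Change of parameters in a family of triples. -/
def StF.comp (S : StF E) (φ : E' → E) (hφ : ContDiff ℝ ∞ φ) : StF E' :=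
  liftState hφ isOpen_univ (fun _ => mem_univ _) S.smooth

/-- Change of parameters in a family of covectors. -/
def CvF.comp (A : CvF E) (φ : E' → E) (hφ : ContDiff ℝ ∞ φ) : CvF E' :=
  liftCovector hφ isOpen_univ (fun _ => mem_univ _) A.smooth

theorem StF.comp_at (S : StF E) (φ : E' → E) (hφ : ContDiff ℝ ∞ φ) (s : E') :
    (S.comp φ hφ).at s = S.at (φ s) := rfl

theorem CvF.comp_at (A : CvF E) (φ : E' → E) (hφ : ContDiff ℝ ∞ φ) (s : E') :
    (A.comp φ hφ).at s = A.at (φ s) := rfl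

theorem const_smoothObservable {f : Vec → Vec → ℝ} (hf : f ∈ observable) :
    SmoothObservableFamily (univ : Set E) (fun _ => f) := by
  set T := ContinuousLinearMap.snd ℝ E (Vec × Vec)
  refine ⟨(hf.1.comp T.contDiff).contDiffOn, fun K _ hK m => ?_⟩
  obtain ⟨k, C, hC⟩ := hf.2.2 m
  refine ⟨k, ‖T‖ ^ m * C, fun s _ q ξ => ?_⟩
  refine (iteratedFDeriv_comp_clm_norm_le hf.1 T m (s, q, ξ)).trans ?_
  rw [mul_assoc]
  exact mul_le_mul_of_nonneg_left (hC q ξ) (by positivity)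

theorem const_smoothDensity {f : Vec → Vec → ℝ} (hf : f ∈ density) :
    SmoothDensityFamily (univ : Set E) (fun _ => f) := by
  set T := ContinuousLinearMap.snd ℝ E (Vec × Vec)
  refine ⟨(hf.1.comp T.contDiff).contDiffOn, fun K _ hK k m => ?_⟩
  obtain ⟨C, hC⟩ := hf.2.2 k m
  refine ⟨‖T‖ ^ m * C, fun s _ q ξ => ?_⟩
  calc _ ≤ (1 + ‖ξ‖) ^ k *
        (‖T‖ ^ m * ‖iteratedFDeriv ℝ m (fun p : Vec × Vec => f p.1 p.2) (q, ξ)‖) := by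
        gcongr; exact iteratedFDeriv_comp_clm_norm_le hf.1 T m (s, q, ξ)
    _ = ‖T‖ ^ m * ((1 + ‖ξ‖) ^ k *
        ‖iteratedFDeriv ℝ m (fun p : Vec × Vec => f p.1 p.2) (q, ξ)‖) := by ring
    _ ≤ _ := by gcongr; exact hC q ξ

theorem const_smoothField {F : Type*} [NormedAddCommGroup F] [NormedSpace ℝ F] {f : Vec → F}
    (hf : ContDiff ℝ ∞ f) : SmoothFieldFamily (univ : Set E) (fun _ => f) :=
  (hf.comp contDiff_snd).contDiffOn

variable (E) in
/-- The constant family of triples. -/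
def constState (z : State) : StF E :=
  liftState (φ := id) contDiff_id isOpen_univ (fun _ => mem_univ _)
    (σ := fun _ : E => z) ⟨const_smoothField z.1.2.1, const_smoothField z.2.1.2.1,
      const_smoothDensity z.2.2.2⟩

variable (E) in
/-- The constant family of covectors. -/
def constCovector (z : Covector) : CvF E :=
  liftCovector (φ := id) contDiff_id isOpen_univ (fun _ => mem_univ _)
    (σ := fun _ : E => z) ⟨const_smoothField z.1.2.1, const_smoothField z.2.1.2.1,
      const_smoothObservable z.2.2.2⟩

theorem constState_at (z : State) (s : E) : (constState E z).at s = z := rfl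
theorem constCovector_at (z : Covector) (s : E) : (constCovector E z).at s = z := rfl

/-! ### Localization -/

/-- The identity is multiplied, relative to `s₀`, by a bump function supported in a ball inside `U`.
Composing with `φ` replaces a family over an open set by one over the whole space with the same germ
at `s₀`. -/
theorem exists_cutoff [FiniteDimensional ℝ E] {U : Set E} (hU : IsOpen U) {s₀ : E} (hs : s₀ ∈ U) :
    ∃ φ : E → E, ContDiff ℝ ∞ φ ∧ (∀ s, φ s ∈ U) ∧ ∀ᶠ s in nhds s₀, φ s = s := by
  obtain ⟨r, hr, hb⟩ := Metric.isOpen_iff.1 hU s₀ hs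
  let χ : ContDiffBump s₀ := ⟨r / 2, r, by positivity, by linarith⟩
  refine ⟨fun s => s₀ + χ s • (s - s₀), ?_, fun s => hb ?_, ?_⟩
  · exact contDiff_const.add (χ.contDiff.smul (contDiff_id.sub contDiff_const))
  · rw [Metric.mem_ball, dist_eq_norm, add_sub_cancel_left, norm_smul]
    by_cases h : dist s s₀ < r
    · calc _ ≤ 1 * ‖s - s₀‖ := by
            gcongr
            rw [Real.norm_eq_abs, abs_of_nonneg χ.nonneg]; exact χ.le_one
        _ < r := by rw [one_mul, ← dist_eq_norm]; exact h
    · rw [χ.zero_of_le_dist (not_lt.1 h)]; simpa using hr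
  · filter_upwards [χ.eventuallyEq_one] with s hs
    rw [hs]; simp

/-- The growth exponent may vary with the local representative; compactness of `K` reduces the bound
to finitely many of them, and exponents are added on unions. -/
theorem smoothObservable_of_local {U : Set E} {f : E → Vec → Vec → ℝ}
    (h : ∀ s₀ ∈ U, ∃ a : Obs E, ∀ᶠ s in nhds s₀, ∀ q ξ, f s q ξ = a.fn (s, q, ξ)) :
    SmoothObservableFamily U f := by
  have key : ∀ s₀ ∈ U, ∃ a : Obs E, ∃ V : Set E, IsOpen V ∧ s₀ ∈ V ∧
      ∀ s ∈ V, ∀ q ξ, (fun p : Dom E => f p.1 p.2.1 p.2.2) =ᶠ[nhds (s, q, ξ)] a.fn := by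
    intro s₀ hs₀
    obtain ⟨a, ha⟩ := h s₀ hs₀
    obtain ⟨V, hV, hVo, hsV⟩ := eventually_nhds_iff.1 ha
    refine ⟨a, V, hVo, hsV, fun s hs q ξ => ?_⟩
    filter_upwards [(hVo.preimage (continuous_fst (X := E) (Y := Vec × Vec))).mem_nhds hs] with p hp
    exact hV p.1 hp p.2.1 p.2.2
  refine ⟨?_, fun K hKU hK m => ?_⟩
  · rintro ⟨s, q, ξ⟩ ⟨hs, -⟩
    obtain ⟨a, V, _, hsV, hV⟩ := key s hs
    exact (a.contDiff.contDiffAt.congr_of_eventuallyEq (hV s hsV q ξ)).contDiffWithinAt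
  · refine hK.induction_on (p := fun K => ∃ (k : ℕ) (C : ℝ), ∀ s ∈ K, ∀ q ξ : Vec,
      ‖iteratedFDeriv ℝ m (fun p : Dom E => f p.1 p.2.1 p.2.2) (s, q, ξ)‖
        ≤ C * (1 + ‖ξ‖) ^ k) ⟨0, 0, by simp⟩ ?_ ?_ ?_
    · rintro s t hst ⟨k, C, hC⟩
      exact ⟨k, C, fun x hx => hC x (hst hx)⟩
    · rintro s t ⟨k, C, hC⟩ ⟨l, D, hD⟩
      refine ⟨k + l, |C| + |D|, fun x hx q ξ => ?_⟩
      have h1 : (1 : ℝ) ≤ 1 + ‖ξ‖ := by linarith [norm_nonneg ξ]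
      rcases hx with hx | hx
      · refine (hC x hx q ξ).trans (mul_le_mul ?_ (pow_le_pow_right₀ h1 (by omega)) (by positivity)
          (by positivity))
        linarith [le_abs_self C, abs_nonneg D]
      · refine (hD x hx q ξ).trans (mul_le_mul ?_ (pow_le_pow_right₀ h1 (by omega)) (by positivity)
          (by positivity))
        linarith [le_abs_self D, abs_nonneg C]
    · intro s₀ hs₀
      obtain ⟨a, V, hVo, hsV, hV⟩ := key s₀ (hKU hs₀)
      obtain ⟨k, C, hC⟩ := a.2.2.2 K hK m
      refine ⟨V ∩ K, Filter.inter_mem (mem_nhdsWithin_of_mem_nhds (hVo.mem_nhds hsV)) self_mem_nhdsWithin,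
        k, C, fun s hs q ξ => ?_⟩
      rw [((hV s hs.1 q ξ).iteratedFDeriv ℝ m).eq_of_nhds]
      exact hC s hs.2 q ξ

theorem smoothCovector_of_local {U : Set E} {α : E → Covector}
    (h : ∀ s₀ ∈ U, ∃ A : CvF E, ∀ᶠ s in nhds s₀, α s = A.at s) : SmoothCovectorFamily U α := by
  refine ⟨?_, ?_, smoothObservable_of_local fun s₀ hs₀ => ?_⟩
  · rintro ⟨s, q⟩ ⟨hs, -⟩
    obtain ⟨A, hA⟩ := h s hs
    refine ((A.smooth.1.contDiffAt (by simp)).congr_of_eventuallyEq ?_).contDiffWithinAt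
    filter_upwards [continuous_fst.continuousAt.eventually hA] with p hp
    exact congrArg (fun α : Covector => α.n p.2) hp
  · rintro ⟨s, q⟩ ⟨hs, -⟩
    obtain ⟨A, hA⟩ := h s hs
    refine ((A.smooth.2.1.contDiffAt (by simp)).congr_of_eventuallyEq ?_).contDiffWithinAt
    filter_upwards [continuous_fst.continuousAt.eventually hA] with p hp
    exact congrArg (fun α : Covector => α.P p.2) hp
  · obtain ⟨A, hA⟩ := h s₀ hs₀
    refine ⟨A.r, ?_⟩
    filter_upwards [hA] with s hs q ξ
    exact congrArg (fun α : Covector => α.rho q ξ) hs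

/-! ### Differentials in terms of lifted families -/

/-- The derivative of a family of triples with respect to the parameter. -/
def StF.deriv (S : StF E) (e : E) : StF E :=
  ⟨dt e S.n, fun i => dt e (S.P i), dtD e S.r, dt_mem_Fld e S.hn, fun i => dt_mem_Fld e (S.hP i)⟩

/-- The derivative of a family of covectors with respect to the parameter. -/
def CvF.deriv (A : CvF E) (e : E) : CvF E :=
  ⟨dt e A.n, fun i => dt e (A.P i), dt e A.r, dt_mem_Fld e A.hn, fun i => dt_mem_Fld e (A.hP i)⟩

theorem Obs.hasDerivAt (f : Obs ℝ) (t : ℝ) (q ξ : Vec) :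
    HasDerivAt (fun s => f.fn (s, q, ξ)) ((dt 1 f).fn (t, q, ξ)) t := by
  rw [fn_dt, fderiv_apply_one_eq_deriv]
  exact ((f.differentiable.comp (by fun_prop : Differentiable ℝ fun s : ℝ => ((s, q, ξ) : Dom ℝ)))
    t).hasDerivAt

theorem StF.isVelocity (S : StF ℝ) (t : ℝ) : IsVelocity S.at t ((S.deriv 1).at t) :=
  ⟨fun q => S.n.hasDerivAt t q 0, fun q => hasDerivAt_pi.2 fun i => (S.P i).hasDerivAt t q 0,
    fun q ξ => S.r.obs.hasDerivAt t q ξ⟩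

theorem IsVelocity.unique {c : ℝ → State} {t : ℝ} {v w : State} (hv : IsVelocity c t v)
    (hw : IsVelocity c t w) : v = w :=
  State.ext (fun q => (hv.1 q).unique (hw.1 q))
    (fun q i => congrFun ((hv.2.1 q).unique (hw.2.1 q)) i)
    (fun q ξ => (hv.2.2 q ξ).unique (hw.2.2 q ξ))

theorem IsVelocity.congr {c d : ℝ → State} {t : ℝ} {v : State} (hv : IsVelocity c t v)
    (h : ∀ᶠ s in nhds t, d s = c s) : IsVelocity d t v :=
  ⟨fun q => (hv.1 q).congr_of_eventuallyEq (h.mono fun s hs => by simp only [hs]),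
    fun q => (hv.2.1 q).congr_of_eventuallyEq (h.mono fun s hs => by simp only [hs]),
    fun q ξ => (hv.2.2 q ξ).congr_of_eventuallyEq (h.mono fun s hs => by simp only [hs])⟩

/-- It is enough to check that a covector field is a differential on families with the whole space as
parameter domain. -/
theorem isDifferential_of_lift {N : Set State} {F : N → ℝ} {dF : N → Covector}
    (h1 : ∀ (k : ℕ) (S : StF (Fin k → ℝ)) (σ : (Fin k → ℝ) → N), (∀ s, S.at s = σ s) →
      ContDiff ℝ ∞ (fun s => F (σ s)) ∧ ∃ A : CvF (Fin k → ℝ), ∀ s, dF (σ s) = A.at s)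
    (h2 : ∀ (S : StF ℝ) (c : ℝ → N), (∀ t, S.at t = c t) → ∀ t,
      HasDerivAt (fun s => F (c s)) (pairing (dF (c t)) ((S.deriv 1).at t)) t) :
    IsDifferential N F dF := by
  refine ⟨fun k U σ hU hσ => ⟨?_, ?_⟩, fun U c hU hc t ht v hv => ?_⟩
  · intro s hs
    obtain ⟨φ, hφ, hφU, hev⟩ := exists_cutoff hU hs
    have h := (h1 k (liftState hφ hU hφU hσ) (fun s => σ (φ s)) fun s => rfl).1
    refine (h.contDiffAt.congr_of_eventuallyEq ?_).contDiffWithinAt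
    filter_upwards [hev] with s hs
    rw [hs]
  · refine smoothCovector_of_local fun s hs => ?_
    obtain ⟨φ, hφ, hφU, hev⟩ := exists_cutoff hU hs
    obtain ⟨A, hA⟩ := (h1 k (liftState hφ hU hφU hσ) (fun s => σ (φ s)) fun s => rfl).2
    refine ⟨A, ?_⟩
    filter_upwards [hev] with s hs
    rw [← hA, hs]
  · obtain ⟨φ, hφ, hφU, hev⟩ := exists_cutoff hU ht
    set S := liftState hφ hU hφU hc
    have h := h2 S (fun s => c (φ s)) (fun s => rfl) t
    have ht' : φ t = t := hev.self_of_nhds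
    have hv' : (S.deriv 1).at t = v := by
      refine (S.isVelocity t).unique (hv.congr ?_)
      filter_upwards [hev] with s hs
      change (c (φ s) : State) = c s
      rw [hs]
    rw [hv', ht'] at h
    refine h.congr_of_eventuallyEq ?_
    filter_upwards [hev] with s hs
    rw [hs]

/-- The definition tests only parameter spaces `Fin k → ℝ`; a linear isomorphism carries the
conclusion to any finite-dimensional `E`. -/
theorem IsDifferential.lift [FiniteDimensional ℝ E] {N : Set State} {F : N → ℝ}
    {dF : N → Covector} (h : IsDifferential N F dF) (S : StF E) (σ : E → N)
    (hσ : ∀ s, S.at s = σ s) :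
    ContDiff ℝ ∞ (fun s => F (σ s)) ∧ ∃ A : CvF E, ∀ s, dF (σ s) = A.at s := by
  let ψ : E ≃L[ℝ] (Fin (Module.finrank ℝ E) → ℝ) := ContinuousLinearEquiv.ofFinrankEq (by simp)
  have h' := h.1 _ univ (fun s => σ (ψ.symm s)) isOpen_univ (by
    have := (S.comp ψ.symm ψ.symm.contDiff).smooth
    convert this using 2 with s
    rw [StF.comp_at, hσ])
  refine ⟨?_, (liftCovector (φ := ψ) ψ.contDiff isOpen_univ (fun _ => mem_univ _) h'.2), fun s => ?_⟩
  · have := (contDiffOn_univ.1 h'.1).comp ψ.contDiff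
    convert this using 2 with s
    simp
  · rw [liftCovector_at]; simp

theorem IsDifferential.hasDerivAt {N : Set State} {F : N → ℝ}
    {dF : N → Covector} (h : IsDifferential N F dF) (S : StF ℝ) (c : ℝ → N)
    (hc : ∀ s, S.at s = c s) (t : ℝ) :
    HasDerivAt (fun s => F (c s)) (pairing (dF (c t)) ((S.deriv 1).at t)) t := by
  have e : (fun t => (c t : State)) = S.at := funext fun s => (hc s).symm
  exact h.2 univ c isOpen_univ (by rw [e]; exact S.smooth) t (mem_univ _) _
    (by rw [e]; exact S.isVelocity t)

/-! ### Nondegeneracy and the pairing -/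

/-- The duality pairing in families. -/
def pair [FiniteDimensional ℝ E] (A : CvF E) (S : StF E) : E → ℝ :=
  tor (A.n * S.n + (A.P 0 * S.P 0 + A.P 1 * S.P 1) + fib (A.r • S.r))

theorem pairing_at [FiniteDimensional ℝ E] (A : CvF E) (S : StF E) (s : E) :
    pairing (A.at s) (S.at s) = pair A S s := by
  rw [pair, map_add, map_add]
  simp only [Pi.add_apply]
  refine congrArg₂ (· + ·) (congrArg₂ (· + ·) rfl ?_) rfl
  rw [tor_apply]
  congr 1; funext q
  simp [dotProduct, Fin.sum_univ_two, StF.at_P, CvF.at_P, Obs.fn_add, Obs.fn_mul]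

end Lift

/-! ### Fourier inversion at the origin -/

/-- The Fourier series of a continuous function with summable coefficients, evaluated at 0. The
usual coefficients carry the conjugate exponential, hence the reindexing by negation. -/
theorem hasSum_fourier_one {g : ℝ → ℂ} (hg : Continuous g) (hp : Function.Periodic g (2 * Real.pi))
    (hs : Summable fun k : ℤ => ∫ x in (0 : ℝ)..2 * Real.pi, Complex.exp (k * x * Complex.I) * g x) :
    HasSum (fun k : ℤ => ∫ x in (0 : ℝ)..2 * Real.pi, Complex.exp (k * x * Complex.I) * g x)
      (2 * Real.pi * g 0) := by
  have : Fact (0 < 2 * Real.pi) := ⟨by positivity⟩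
  let f : C(AddCircle (2 * Real.pi), ℂ) := ⟨hp.lift, continuous_coinduced_dom.mpr hg⟩
  have hf : ∀ x : ℝ, f (x : AddCircle (2 * Real.pi)) = g x := fun x => hp.lift_coe x
  have hpi : (Real.pi : ℂ) ≠ 0 := by exact_mod_cast Real.pi_ne_zero
  have hc : ∀ n : ℤ, fourierCoeff f n = (2 * Real.pi : ℂ)⁻¹ *
      ∫ x in (0 : ℝ)..2 * Real.pi, Complex.exp ((-n : ℤ) * x * Complex.I) * g x := by
    intro n
    rw [fourierCoeff_eq_intervalIntegral f n 0, zero_add, Complex.real_smul]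
    congr 1
    · push_cast; simp
    · congr 1; funext x
      rw [hf, fourier_coe_apply, smul_eq_mul]
      congr 2
      push_cast
      field_simp
  have hsum : Summable (fourierCoeff f) := by
    have := ((Equiv.neg ℤ).summable_iff.2 hs).mul_left (2 * Real.pi : ℂ)⁻¹
    refine this.congr fun n => ?_
    rw [hc]; rfl
  have h := has_pointwise_sum_fourier_series_of_summable hsum ((0 : ℝ) : AddCircle (2 * Real.pi))
  have h0 : ∀ n : ℤ, fourier n ((0 : ℝ) : AddCircle (2 * Real.pi)) = 1 := by
    intro n; rw [fourier_coe_apply]; simp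
  simp only [h0, smul_eq_mul, mul_one, hf, hc] at h
  have h2 := (Equiv.neg ℤ).hasSum_iff.2 (h.mul_left (2 * Real.pi : ℂ))
  have e : ∀ k : ℤ, (∫ x in (0 : ℝ)..2 * Real.pi, Complex.exp (k * x * Complex.I) * g x) =
      ((fun i : ℤ => 2 * (Real.pi : ℂ) * ((2 * (Real.pi : ℂ))⁻¹ * ∫ x in (0 : ℝ)..2 * Real.pi,
        Complex.exp ((-i : ℤ) * x * Complex.I) * g x)) ∘ Equiv.neg ℤ) k := by
    intro k
    simp only [Function.comp, Equiv.neg_apply, neg_neg]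
    rw [← mul_assoc, mul_inv_cancel₀ (by simpa using hpi), one_mul]
  rw [funext e]; exact h2

theorem cell_integral_eq {H : Vec → ℂ} (hH : Continuous H) :
    ∫ q in cell, H q = ∫ x in (0 : ℝ)..2 * Real.pi, ∫ z in (0 : ℝ)..2 * Real.pi, H ![x, z] := by
  have hp : (0 : ℝ) ≤ 2 * Real.pi := by positivity
  have hpre : cell = (MeasurableEquiv.finTwoArrow : Vec ≃ᵐ ℝ × ℝ) ⁻¹'
      (Icc 0 (2 * Real.pi) ×ˢ Icc 0 (2 * Real.pi)) := by
    ext q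
    simp [cell, Pi.le_def, Fin.forall_fin_two, mem_Icc]
  have hm := volume_preserving_finTwoArrow ℝ
  have h1 := hm.setIntegral_preimage_emb MeasurableEquiv.finTwoArrow.measurableEmbedding
    (fun p : ℝ × ℝ => H ![p.1, p.2]) (Icc 0 (2 * Real.pi) ×ˢ Icc 0 (2 * Real.pi))
  rw [← hpre] at h1
  have e : ∀ q : Vec, (fun p : ℝ × ℝ => H ![p.1, p.2]) (MeasurableEquiv.finTwoArrow q) = H q := by
    intro q
    change H ![q 0, q 1] = H q
    congr 1; ext i; fin_cases i <;> rfl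
  simp only [e] at h1
  have hc : Continuous fun p : ℝ × ℝ => H ![p.1, p.2] := hH.comp (by fun_prop)
  rw [h1, Measure.volume_eq_prod, setIntegral_prod _
    (hc.continuousOn.integrableOn_compact (isCompact_Icc.prod isCompact_Icc))]
  rw [intervalIntegral.integral_of_le hp, integral_Icc_eq_integral_Ioc]
  congr 1; funext x
  rw [intervalIntegral.integral_of_le hp, integral_Icc_eq_integral_Ioc]

/-- One-dimensional inversion in the first coordinate for each frequency of the second, then
inversion in the second. Summability of the double family permits summing along fibres. -/
theorem hasSum_fourier_two {F : Vec → ℂ} (hF : Continuous F) (hp : Periodic2 F)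
    (hs : Summable fun k : ℤ × ℤ =>
      ∫ q in cell, Complex.exp ((k.2 * q 0 + k.1 * q 1) * Complex.I) * F q) :
    HasSum (fun k : ℤ × ℤ => ∫ q in cell, Complex.exp ((k.2 * q 0 + k.1 * q 1) * Complex.I) * F q)
      ((2 * Real.pi) ^ 2 * F 0) := by
  have hx : ∀ z x, F ![x + 2 * Real.pi, z] = F ![x, z] := by
    intro z x
    rw [← hp 0 ![x, z]]
    congr 1; ext i; fin_cases i <;> simp
  have hz : ∀ z x, F ![x, z + 2 * Real.pi] = F ![x, z] := by
    intro z x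
    rw [← hp 1 ![x, z]]
    congr 1; ext i; fin_cases i <;> simp
  obtain ⟨g, hg⟩ : ∃ g : ℤ → ℝ → ℂ, ∀ k x, g k x =
    ∫ z in (0 : ℝ)..2 * Real.pi, Complex.exp (k * z * Complex.I) * F ![x, z] := ⟨_, fun _ _ => rfl⟩
  have hsw : ∀ k : ℤ × ℤ, ∫ q in cell, Complex.exp ((k.2 * q 0 + k.1 * q 1) * Complex.I) * F q =
      ∫ x in (0 : ℝ)..2 * Real.pi, Complex.exp (k.2 * x * Complex.I) * g k.1 x := by
    intro k
    have hc : Continuous fun q : Vec => Complex.exp ((k.2 * q 0 + k.1 * q 1) * Complex.I) * F q := by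
      fun_prop
    rw [cell_integral_eq hc]
    congr 1; funext x
    rw [hg, ← intervalIntegral.integral_const_mul]
    congr 1; funext z
    rw [← mul_assoc, ← Complex.exp_add]
    congr 2
    simp only [Matrix.cons_val_zero, Matrix.cons_val_one]; ring
  have hgc : ∀ k, Continuous (g k) := fun k => by
    rw [show g k = _ from funext (hg k)]
    exact intervalIntegral.continuous_parametric_intervalIntegral_of_continuous' (by fun_prop) _ _
  have hgp : ∀ k, Function.Periodic (g k) (2 * Real.pi) := fun k x => by simp only [hg, hx]
  rw [funext hsw] at hs ⊢
  have h1 : ∀ k : ℤ, HasSum (fun l : ℤ => ∫ x in (0 : ℝ)..2 * Real.pi,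
      Complex.exp (l * x * Complex.I) * g k x) (2 * (Real.pi : ℂ) * g k 0) := by
    intro k
    have hk : Summable fun l : ℤ => ∫ x in (0 : ℝ)..2 * Real.pi,
        Complex.exp (l * x * Complex.I) * g k x :=
      hs.comp_injective (i := fun l : ℤ => (k, l)) (Prod.mk_right_injective k)
    exact hasSum_fourier_one (hgc k) (hgp k) hk
  have h2 := hs.hasSum.prod_fiberwise h1
  have hpi : (2 * Real.pi : ℂ) ≠ 0 := by
    have : (Real.pi : ℂ) ≠ 0 := by exact_mod_cast Real.pi_ne_zero
    simpa using this
  have h2s := (summable_mul_left_iff hpi).1 h2.summable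
  rw [funext fun k => hg k 0] at h2s
  have h3 := hasSum_fourier_one (g := fun z => F ![0, z]) (by fun_prop) (fun z => hz z 0) h2s
  simp only [← hg] at h3
  have h4 := h2.unique (h3.mul_left (2 * Real.pi : ℂ))
  have h5 := hs.hasSum
  rw [h4] at h5
  have e0 : (![0, 0] : Vec) = 0 := by ext i; fin_cases i <;> rfl
  rw [e0] at h5
  have e1 : (2 * Real.pi : ℂ) ^ 2 * F 0 = 2 * Real.pi * (2 * Real.pi * F 0) := by ring
  rw [e1]
  exact h5

/-! ### The Poisson equation on the torus -/

/-- The Fourier coefficients of the biharmonic kernel. -/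
def wt (k : ℤ × ℤ) : ℝ := (((k.2 : ℝ) ^ 2 + (k.1 : ℝ) ^ 2) ^ 2)⁻¹

theorem wt_nonneg (k : ℤ × ℤ) : 0 ≤ wt k := by unfold wt; positivity

/-- The lattice has rank 2 and the decay is of order 4, so the series converges absolutely. The
coefficients |k|⁻² of the Green kernel of Δ itself would not be summable. -/
theorem summable_wt : Summable wt := by
  have h := EisensteinSeries.summable_one_div_norm_rpow (k := 4) (by norm_num)
  rw [← (finTwoArrowEquiv ℤ).symm.summable_iff] at h
  refine h.of_nonneg_of_le wt_nonneg fun k => ?_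
  simp only [Function.comp]
  set x := (finTwoArrowEquiv ℤ).symm k with hx
  have h0 : x 0 = k.1 := rfl
  have h1 : x 1 = k.2 := rfl
  have hle : ‖x‖ ^ 2 ≤ (k.2 : ℝ) ^ 2 + (k.1 : ℝ) ^ 2 := by
    have h2 : ‖x‖ ≤ √((k.2 : ℝ) ^ 2 + (k.1 : ℝ) ^ 2) := by
      refine (pi_norm_le_iff_of_nonneg (Real.sqrt_nonneg _)).2 fun i => Real.le_sqrt_of_sq_le ?_
      fin_cases i
      · simp only [Fin.zero_eta, h0, Int.norm_eq_abs, sq_abs]; nlinarith [sq_nonneg (k.2 : ℝ)]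
      · simp only [Fin.mk_one, h1, Int.norm_eq_abs, sq_abs]; nlinarith [sq_nonneg (k.1 : ℝ)]
    calc _ ≤ √((k.2 : ℝ) ^ 2 + (k.1 : ℝ) ^ 2) ^ 2 := by gcongr
      _ = _ := Real.sq_sqrt (by positivity)
  -- At the origin `wt` is `0⁻¹ = 0`: the constant Fourier mode is left out of the kernel.
  rcases eq_or_ne x 0 with hx0 | hx0
  · have e1 : k.1 = 0 := by rw [← h0, hx0]; rfl
    have e2 : k.2 = 0 := by rw [← h1, hx0]; rfl
    simp [wt, e1, e2, hx0]
  · have hpos : 0 < ‖x‖ := norm_pos_iff.2 hx0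
    rw [wt, Real.rpow_neg hpos.le]
    refine inv_anti₀ (by positivity) ?_
    have : ‖x‖ ^ (4 : ℝ) = (‖x‖ ^ 2) ^ 2 := by
      rw [← pow_mul]; norm_cast
    rw [this]
    exact pow_le_pow_left₀ (by positivity) hle 2

/-- The phase of a plane wave. -/
def phase (k : ℤ × ℤ) : Vec →L[ℝ] ℝ :=
  (k.2 : ℝ) • ContinuousLinearMap.proj (R := ℝ) (φ := fun _ : Fin 2 => ℝ) 0 +
    (k.1 : ℝ) • ContinuousLinearMap.proj (R := ℝ) (φ := fun _ : Fin 2 => ℝ) 1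

theorem phase_apply (k : ℤ × ℤ) (q : Vec) : phase k q = k.2 * q 0 + k.1 * q 1 := rfl

theorem phase_period (k : ℤ × ℤ) (i : Fin 2) : ∃ n : ℤ,
    phase k (Pi.single i (2 * Real.pi)) = n * (2 * Real.pi) := by
  fin_cases i
  · exact ⟨k.2, by simp [phase_apply]⟩
  · exact ⟨k.1, by simp [phase_apply]⟩

/-! ### Plane waves as eigenfunctions of the Laplace operator. -/

section

variable {E : Type} [NormedAddCommGroup E] [NormedSpace ℝ E] [FiniteDimensional ℝ E]

/-- The cosine wave. -/
def cosWave (k : ℤ × ℤ) : Obs E :=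
  mkFld (fun p => Real.cos (phase k p.2)) (by fun_prop) fun s i q => by
    obtain ⟨n, hn⟩ := phase_period k i
    simp only [map_add, hn, Real.cos_add_int_mul_two_pi]

/-- The sine wave. -/
def sinWave (k : ℤ × ℤ) : Obs E :=
  mkFld (fun p => Real.sin (phase k p.2)) (by fun_prop) fun s i q => by
    obtain ⟨n, hn⟩ := phase_period k i
    simp only [map_add, hn, Real.sin_add_int_mul_two_pi]

theorem dq_cosWave (k : ℤ × ℤ) (i : Fin 2) :
    dq i (cosWave k : Obs E) = -(phase k (Pi.single i 1)) • sinWave k := by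
  refine Obs.ext_fn fun ⟨s, q, ξ⟩ => ?_
  rw [fn_zero_velocity_dq]
  have h := ((phase k).hasFDerivAt (x := q)).cos.fderiv
  change fderiv ℝ (fun q => Real.cos (phase k q)) q _ = -(phase k (Pi.single i 1)) * Real.sin (phase k q)
  rw [h]; simp [mul_comm]

theorem dq_sinWave (k : ℤ × ℤ) (i : Fin 2) :
    dq i (sinWave k : Obs E) = (phase k (Pi.single i 1)) • cosWave k := by
  refine Obs.ext_fn fun ⟨s, q, ξ⟩ => ?_
  rw [fn_zero_velocity_dq]
  have h := ((phase k).hasFDerivAt (x := q)).sin.fderiv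
  change fderiv ℝ (fun q => Real.sin (phase k q)) q _ = (phase k (Pi.single i 1)) * Real.cos (phase k q)
  rw [h]; simp [mul_comm]

/-- The Laplace operator in the space variable. -/
def lap (f : Obs E) : Obs E := dq 0 (dq 0 f) + dq 1 (dq 1 f)

theorem lap_smul (c : ℝ) (f : Obs E) : lap (c • f) = c • lap f := by
  simp [lap, Derivation.map_smul]

theorem lap_cosWave (k : ℤ × ℤ) :
    lap (cosWave k : Obs E) = -((k.2 : ℝ) ^ 2 + (k.1 : ℝ) ^ 2) • cosWave k := by
  simp only [lap, dq_cosWave, Derivation.map_smul, dq_sinWave, smul_smul, ← add_smul]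
  congr 1; simp [phase_apply]; ring

theorem lap_sinWave (k : ℤ × ℤ) :
    lap (sinWave k : Obs E) = -((k.2 : ℝ) ^ 2 + (k.1 : ℝ) ^ 2) • sinWave k := by
  simp only [lap, dq_cosWave, Derivation.map_smul, dq_sinWave, smul_smul, ← add_smul]
  congr 1; simp [phase_apply]; ring

theorem tor_mul_lap (f g : Obs E) : tor (f * lap g) = tor (lap f * g) := by
  simp only [lap, mul_add, add_mul, map_add, tor_mul_dq, neg_neg]

theorem tor_wave_lap_lap {u : Obs E} {c : ℝ} (hu : lap u = -c • u) (F : Obs E) :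
    tor (u * lap (lap F)) = c ^ 2 • tor (u * F) := by
  rw [tor_mul_lap, tor_mul_lap, hu, lap_smul, hu, smul_smul, smul_mul_assoc, map_smul]
  congr 1; ring

theorem Obs.continuous_slice (F : Obs E) (s : E) : Continuous fun q => F.fn (s, q, 0) :=
  F.contDiff.continuous.comp (by fun_prop)

theorem abs_tor_wave_le {u : Obs E} (hb : ∀ p, |u.fn p| ≤ 1) (F : Obs E) (s : E) :
    |tor (u * F) s| ≤ ∫ q in cell, |F.fn (s, q, 0)| := by
  refine (abs_integral_le_integral_abs).trans ?_
  refine setIntegral_mono ?_ ?_ fun q => ?_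
  · exact ((u * F).continuous_slice s).abs.continuousOn.integrableOn_compact isCompact_cell
  · exact (F.continuous_slice s).abs.continuousOn.integrableOn_compact isCompact_cell
  · change |u.fn _ * F.fn _| ≤ _
    rw [abs_mul]
    exact mul_le_of_le_one_left (abs_nonneg _) (hb _)

/-- Moving Δ² onto `F` shows that a nonzero coefficient is `wt k` times a coefficient of Δ²F, and
the latter are bounded. The zero frequency is bounded separately. -/
theorem summable_tor_wave {u : ℤ × ℤ → Obs E} (hb : ∀ k p, |(u k).fn p| ≤ 1)
    (hu : ∀ k, lap (u k) = -((k.2 : ℝ) ^ 2 + (k.1 : ℝ) ^ 2) • u k) (F : Obs E) (s : E) :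
    Summable fun k => tor (u k * F) s := by
  have h1 : Summable fun k => wt k * ∫ q in cell, |(lap (lap F)).fn (s, q, 0)| :=
    summable_wt.mul_right _
  have h2 : Summable fun k : ℤ × ℤ => if k = 0 then ∫ q in cell, |F.fn (s, q, 0)| else 0 :=
    summable_of_ne_finset_zero (s := {0}) fun k hk => by simp at hk; simp [hk]
  refine Summable.of_norm_bounded (h1.add h2) fun k => ?_
  rw [Real.norm_eq_abs]
  split_ifs with hk
  · exact (abs_tor_wave_le (hb k) F s).trans
      (le_add_of_nonneg_left (mul_nonneg (wt_nonneg k) (integral_nonneg fun _ => abs_nonneg _)))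
  · have hc : 0 < (k.2 : ℝ) ^ 2 + (k.1 : ℝ) ^ 2 := by
      by_contra h
      have e1 : (k.2 : ℝ) = 0 := by nlinarith [sq_nonneg (k.2 : ℝ), sq_nonneg (k.1 : ℝ)]
      have e2 : (k.1 : ℝ) = 0 := by nlinarith [sq_nonneg (k.2 : ℝ), sq_nonneg (k.1 : ℝ)]
      exact hk (Prod.ext (by exact_mod_cast e2) (by exact_mod_cast e1))
    have h3 := congrFun (tor_wave_lap_lap (hu k) F) s
    have h4 := abs_tor_wave_le (hb k) (lap (lap F)) s
    rw [h3, Pi.smul_apply, smul_eq_mul, abs_mul, abs_of_nonneg (sq_nonneg _)] at h4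
    rw [add_zero, wt, ← div_eq_inv_mul, le_div_iff₀ (by positivity), mul_comm]
    exact h4

/-- The real part of Fourier inversion at the origin; the sine coefficients form the imaginary part.
-/
theorem hasSum_tor_cosWave (F : Obs E) (s : E) :
    HasSum (fun k => tor (cosWave k * F) s) ((2 * Real.pi) ^ 2 * F.fn (s, 0, 0)) := by
  have hcs := summable_tor_wave (u := cosWave) (fun k p => Real.abs_cos_le_one _) lap_cosWave F s
  have hss := summable_tor_wave (u := sinWave) (fun k p => Real.abs_sin_le_one _) lap_sinWave F s
  have hcont : Continuous fun q => (F.fn (s, q, 0) : ℂ) :=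
    Complex.continuous_ofReal.comp (F.continuous_slice s)
  have key : ∀ k : ℤ × ℤ, ∫ q in cell, Complex.exp ((k.2 * q 0 + k.1 * q 1) * Complex.I) *
      (F.fn (s, q, 0) : ℂ) = (tor (cosWave k * F) s : ℂ) + (tor (sinWave k * F) s : ℂ) * Complex.I := by
    intro k
    have hc : IntegrableOn (fun q => ((cosWave k * F).fn (s, q, 0) : ℂ)) cell :=
      (Complex.continuous_ofReal.comp ((cosWave k * F).continuous_slice s)).continuousOn.integrableOn_compact
        isCompact_cell
    have hd : IntegrableOn (fun q => ((sinWave k * F).fn (s, q, 0) : ℂ) * Complex.I) cell :=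
      ((Complex.continuous_ofReal.comp ((sinWave k * F).continuous_slice s)).mul
        continuous_const).continuousOn.integrableOn_compact isCompact_cell
    rw [tor_apply, tor_apply, torusInt, torusInt, ← integral_complex_ofReal,
      ← integral_complex_ofReal, ← integral_mul_const]
    refine Eq.trans ?_ (integral_add hc hd)
    congr 1; funext q
    have : ((k.2 : ℂ) * q 0 + k.1 * q 1) = ((phase k q : ℝ) : ℂ) := by rw [phase_apply]; push_cast; rfl
    rw [this, Complex.exp_mul_I]
    change _ = ((Real.cos (phase k q) * F.fn (s, q, 0) : ℝ) : ℂ) +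
      ((Real.sin (phase k q) * F.fn (s, q, 0) : ℝ) : ℂ) * Complex.I
    push_cast; ring
  have hsum := (hcs.mapL Complex.ofRealCLM).add ((hss.mapL Complex.ofRealCLM).mul_right Complex.I)
  have h := hasSum_fourier_two hcont (fun i q => by simp only [F.periodic]) (by
    rw [funext key]; exact hsum)
  rw [funext key] at h
  have h2 := Complex.hasSum_re h
  have e : ((2 * Real.pi : ℂ) ^ 2 * F.fn (s, 0, 0)) = (((2 * Real.pi) ^ 2 * F.fn (s, 0, 0) : ℝ) : ℂ) := by
    push_cast; rfl
  rw [e] at h2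
  simp only [Complex.add_re, Complex.ofReal_re, Complex.mul_re, Complex.I_re, Complex.I_im,
    Complex.ofReal_im, mul_zero, zero_mul, sub_zero, add_zero] at h2
  exact h2

/-- The biharmonic kernel, up to the normalization, made nonnegative by a constant. -/
def kernel (q : Vec) : ℝ := (∑' k, wt k * Real.cos (phase k q)) + ∑' k, wt k

theorem norm_wt_mul_cos_le (k : ℤ × ℤ) (x : ℝ) : ‖wt k * Real.cos x‖ ≤ wt k := by
  rw [norm_mul, Real.norm_eq_abs, Real.norm_eq_abs, abs_of_nonneg (wt_nonneg k)]
  exact mul_le_of_le_one_right (wt_nonneg k) (Real.abs_cos_le_one _)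

theorem continuous_kernel : Continuous kernel :=
  (continuous_tsum (fun k => by fun_prop) summable_wt fun k q => norm_wt_mul_cos_le k _).add
    continuous_const

/-- The added constant dominates the cosine series. Nonnegativity lets the kernel be the density of
a measure, to which differentiation under the integral applies. -/
theorem kernel_nonneg (q : Vec) : 0 ≤ kernel q := by
  have hs : Summable fun k => wt k * Real.cos (phase k q) :=
    Summable.of_norm_bounded summable_wt fun k => norm_wt_mul_cos_le k _
  rw [kernel, ← hs.tsum_add summable_wt]
  refine tsum_nonneg fun k => ?_
  have := neg_abs_le (wt k * Real.cos (phase k q))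
  have h2 := norm_wt_mul_cos_le k (phase k q)
  rw [Real.norm_eq_abs] at h2
  linarith

/-- Integrated termwise, `wt k` cancels the factor |k|⁴ that Δ² produces on the `k`-th wave, for
every `k` except 0. The sum is Fourier inversion at the origin with the zero mode removed. -/
theorem integral_kernel_lap_lap (F : Obs E) (s : E) :
    ∫ q in cell, kernel q * (lap (lap F)).fn (s, q, 0) =
      (2 * Real.pi) ^ 2 * F.fn (s, 0, 0) - tor F s := by
  set H := lap (lap F) with hH
  have hHc := H.continuous_slice s
  have hint : IntegrableOn (fun q => H.fn (s, q, 0)) cell :=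
    hHc.continuousOn.integrableOn_compact isCompact_cell
  have hterm : ∀ k, ∫ q in cell, wt k * Real.cos (phase k q) * H.fn (s, q, 0) =
      tor (cosWave k * F) s - if k = 0 then tor F s else 0 := by
    intro k
    have h1 : ∫ q in cell, wt k * Real.cos (phase k q) * H.fn (s, q, 0) =
        wt k * tor (cosWave k * H) s := by
      rw [tor_apply, torusInt, ← integral_const_mul]
      congr 1; funext q
      rw [mul_assoc]; rfl
    rw [h1, hH, congrFun (tor_wave_lap_lap (lap_cosWave k) F) s, Pi.smul_apply, smul_eq_mul]
    split_ifs with hk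
    · have : (cosWave k : Obs E) = 1 := Obs.ext_fn fun p => by
        change Real.cos (phase k p.2.1) = 1
        rw [phase_apply, hk]; simp
      rw [this, one_mul, hk]; simp
    · have hc : (k.2 : ℝ) ^ 2 + (k.1 : ℝ) ^ 2 ≠ 0 := by
        intro h
        have e1 : (k.2 : ℝ) = 0 := by nlinarith [sq_nonneg (k.2 : ℝ), sq_nonneg (k.1 : ℝ)]
        have e2 : (k.1 : ℝ) = 0 := by nlinarith [sq_nonneg (k.2 : ℝ), sq_nonneg (k.1 : ℝ)]
        exact hk (Prod.ext (by exact_mod_cast e2) (by exact_mod_cast e1))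
      rw [wt, sub_zero, ← mul_assoc, inv_mul_cancel₀ (pow_ne_zero _ hc), one_mul]
  have hswap := hasSum_integral_of_summable_integral_norm (μ := volume.restrict cell)
    (F := fun (k : ℤ × ℤ) q => wt k * Real.cos (phase k q) * H.fn (s, q, 0)) (fun k =>
      (Continuous.continuousOn (by fun_prop)).integrableOn_compact isCompact_cell) ?_
  · simp only [hterm] at hswap
    have hone : HasSum (fun k : ℤ × ℤ => if k = 0 then tor F s else 0) (tor F s) :=
      hasSum_ite_eq 0 _
    have h2 := hswap.unique ((hasSum_tor_cosWave F s).sub hone)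
    rw [← h2]
    -- The constant that made the kernel nonnegative is harmless: it is paired with a sum of
    -- derivatives.
    have hz : ∫ q in cell, (∑' k, wt k) * H.fn (s, q, 0) = 0 := by
      rw [integral_const_mul]
      have : tor H s = 0 := by rw [hH, lap, map_add, tor_dq, tor_dq]; simp
      rw [tor_apply, torusInt] at this
      rw [cell, this, mul_zero]
    have hs : ∀ q, ∑' k, wt k * Real.cos (phase k q) * H.fn (s, q, 0) =
        (∑' k, wt k * Real.cos (phase k q)) * H.fn (s, q, 0) := fun q => tsum_mul_right
    simp only [kernel, add_mul, hs]
    rw [integral_add, hz, add_zero]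
    · have hc : Continuous fun q : Vec => ∑' k, wt k * Real.cos (phase k q) :=
        continuous_tsum (fun k => by fun_prop) summable_wt fun k q => norm_wt_mul_cos_le k _
      exact (hc.mul hHc).continuousOn.integrableOn_compact isCompact_cell
    · exact hint.const_mul _
  · refine Summable.of_nonneg_of_le (fun k => integral_nonneg fun q => norm_nonneg _) (fun k => ?_)
      (summable_wt.mul_right (∫ q in cell, ‖H.fn (s, q, 0)‖))
    rw [← integral_const_mul]
    refine setIntegral_mono ?_ (hint.norm.const_mul _) fun q => ?_
    · exact (Continuous.continuousOn (by fun_prop)).integrableOn_compact isCompact_cell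
    · change ‖wt k * Real.cos (phase k q) * H.fn (s, q, 0)‖ ≤ _
      rw [norm_mul]
      gcongr; exact norm_wt_mul_cos_le k _

/-! ### Convolution -/

section Conv

variable {μ : Measure Vec} [IsFiniteMeasure μ]

theorem dominated_conv (hμ : μ ≪ volume.restrict cell) (f : Obs E) :
    Dominated μ (fun p : (E × Vec) × Vec => f.fn (p.1.1, p.1.2 - p.2, 0)) := by
  intro K hK m
  have hf : ContDiff ℝ ∞ (fun p : (E × Vec) × Vec => f.fn (p.1.1, p.1.2 - p.2, 0)) :=
    f.contDiff.comp (by fun_prop)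
  have hc := (hf.continuous_iteratedFDeriv (m := m) (by exact_mod_cast le_top)).norm
  obtain ⟨C, hC⟩ := (hK.prod isCompact_cell).bddAbove_image hc.continuousOn
  refine ⟨fun _ => C, integrable_const C, hμ.ae_le ?_⟩
  refine (ae_restrict_iff' measurableSet_Icc).2 (Filter.Eventually.of_forall fun q hq s hs => ?_)
  exact hC ⟨(s, q), ⟨hs, hq⟩, rfl⟩

theorem contDiff_conv (f : Obs E) :
    ContDiff ℝ ∞ (fun p : (E × Vec) × Vec => f.fn (p.1.1, p.1.2 - p.2, 0)) :=
  f.contDiff.comp (by fun_prop)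

/-- Convolution with a measure on the torus. -/
def conv (hμ : μ ≪ volume.restrict cell) (f : Obs E) : Obs E :=
  mkFld (fun p => ∫ y, f.fn (p.1, p.2 - y, 0) ∂μ)
    (contDiff_integral_param (contDiff_conv f) (dominated_conv hμ f))
    (fun s i q => by simp only [add_sub_right_comm, f.periodic])

theorem conv_apply (hμ : μ ≪ volume.restrict cell) (f : Obs E) (s : E) (q ξ : Vec) :
    (conv hμ f).fn (s, q, ξ) = ∫ y, f.fn (s, q - y, 0) ∂μ := rfl

theorem conv_add (hμ : μ ≪ volume.restrict cell) (f g : Obs E) :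
    conv hμ (f + g) = conv hμ f + conv hμ g :=
  Obs.ext fun s q ξ => by
    exact integral_add ((dominated_conv hμ f).integrable (contDiff_conv f) (s, q))
      ((dominated_conv hμ g).integrable (contDiff_conv g) (s, q))

/-- The derivative falls on the smooth factor, so no regularity of the kernel measure beyond
finiteness and absolute continuity is needed. -/
theorem dq_conv (hμ : μ ≪ volume.restrict cell) (i : Fin 2) (f : Obs E) :
    dq i (conv hμ f) = conv hμ (dq i f) := by
  refine Obs.ext_fn fun ⟨s, q, ξ⟩ => ?_
  rw [fn_zero_velocity_dq, conv_apply]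
  have h1 := fderiv_integral_param (contDiff_conv f) (dominated_conv hμ f) (s, q) (0, Pi.single i 1)
  have hd : DifferentiableAt ℝ (fun p : E × Vec => ∫ y, f.fn (p.1, p.2 - y, 0) ∂μ) (s, q) :=
    (contDiff_integral_param (contDiff_conv f) (dominated_conv hμ f)).differentiable (by simp) _
  have h2 := (hd.hasFDerivAt.comp q (hasFDerivAt_prodMk_right s q)).fderiv
  change fderiv ℝ ((fun p : E × Vec => ∫ y, f.fn (p.1, p.2 - y, 0) ∂μ) ∘ fun q => (s, q)) q _ = _
  rw [h2]
  change fderiv ℝ (fun p : E × Vec => ∫ y, f.fn (p.1, p.2 - y, 0) ∂μ) (s, q) (0, Pi.single i 1) = _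
  rw [h1]
  congr 1; funext y
  set T : (E × Vec) × Vec →L[ℝ] Dom E :=
    ((ContinuousLinearMap.fst ℝ E Vec).comp (ContinuousLinearMap.fst ℝ (E × Vec) Vec)).prod
      (((ContinuousLinearMap.snd ℝ E Vec).comp (ContinuousLinearMap.fst ℝ (E × Vec) Vec) -
        ContinuousLinearMap.snd ℝ (E × Vec) Vec).prod 0) with hT
  have h4 := ((f.differentiable (s, q - y, 0)).hasFDerivAt.comp ((s, q), y) T.hasFDerivAt).fderiv
  change fderiv ℝ (f.fn ∘ T) ((s, q), y) _ = _
  rw [h4]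
  simp [dq, pd_apply, hT]

theorem lap_conv (hμ : μ ≪ volume.restrict cell) (f : Obs E) :
    lap (conv hμ f) = conv hμ (lap f) := by
  simp only [lap, dq_conv, conv_add]

end Conv

/-- Reflection of the space variable. -/
def reflQ (q : Vec) (f : Obs E) : Obs E :=
  mkFld (fun p => f.fn (p.1, q - p.2, 0)) (f.contDiff.comp (by fun_prop)) fun s i y => by
    have := f.periodic i s (q - (y + Pi.single i (2 * Real.pi))) 0
    change f.fn _ = f.fn _
    rw [← this]; simp only; congr 3; abel

theorem reflQ_apply (q : Vec) (f : Obs E) (s : E) (y ξ : Vec) :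
    (reflQ q f).fn (s, y, ξ) = f.fn (s, q - y, 0) := rfl

theorem dq_reflQ (q : Vec) (i : Fin 2) (f : Obs E) : dq i (reflQ q f) = -reflQ q (dq i f) := by
  refine Obs.ext_fn fun ⟨s, y, ξ⟩ => ?_
  rw [fn_zero_velocity_dq, Obs.fn_neg, Pi.neg_apply, reflQ_apply, fn_zero_velocity_dq]
  change fderiv ℝ (fun y => f.fn (s, q - y, 0)) y _ = _
  have hd : Differentiable ℝ fun y => f.fn (s, y, 0) := f.differentiable.comp (by fun_prop)
  have h1 : HasFDerivAt (fun y : Vec => q - y) (0 - ContinuousLinearMap.id ℝ Vec) y :=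
    (hasFDerivAt_const q y).fun_sub (hasFDerivAt_id y)
  have h2 := ((hd (q - y)).hasFDerivAt.comp y h1).fderiv
  change fderiv ℝ ((fun y => f.fn (s, y, 0)) ∘ fun y => q - y) y _ = _
  rw [h2]; simp

theorem lap_reflQ (q : Vec) (f : Obs E) : lap (reflQ q f) = reflQ q (lap f) := by
  simp only [lap, dq_reflQ, map_neg, neg_neg]
  exact Obs.ext_fn fun p => rfl

theorem fn_eq_of_dq_eq_zero {u : Obs E} (hu : u ∈ Fld E) (h : ∀ i, dq i u = 0) (s : E) (q ξ : Vec) :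
    u.fn (s, q, ξ) = u.fn (s, 0, 0) := by
  have h1 := hu s q ξ
  change u.fn _ = u.fn _ at h1
  rw [h1]
  have hd : Differentiable ℝ fun q => u.fn (s, q, 0) := u.differentiable.comp (by fun_prop)
  refine is_const_of_fderiv_eq_zero hd (fun q => ?_) q 0
  ext v
  have hv : v = ∑ i, v i • (Pi.single i 1 : Vec) := by
    funext j; fin_cases j <;> simp [Fin.sum_univ_two]
  rw [hv, map_sum]
  simp only [map_smul, ← fn_zero_velocity_dq, h]
  simp [Obs.fn_zero]

theorem tor_const {u : Obs E} (hu : u ∈ Fld E) (h : ∀ i, dq i u = 0) (f : Obs E) (s : E) :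
    tor (u * f) s = u.fn (s, 0, 0) * tor f s := by
  rw [tor_apply, tor_apply, torusInt, torusInt, ← integral_const_mul]
  congr 1; funext q
  rw [Obs.fn_mul, Pi.mul_apply, fn_eq_of_dq_eq_zero hu h]

theorem tor_one_ne_zero (s : E) : tor (1 : Obs E) s ≠ 0 := by
  intro h
  have := tor_self_eq_zero (u := (1 : Obs E)) (one_mem _) (by rwa [mul_one]) 0 0
  simp [Obs.fn_one] at this

/-- The Poisson equation on the torus is solvable for mean-zero right-hand sides, smoothly in
parameters. -/
theorem exists_lap_eq {f : Obs E} (hf : f ∈ Fld E) (h0 : tor f = 0) :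
    ∃ φ ∈ Fld E, lap φ = f := by
  set μ : Measure Vec := (volume.restrict cell).withDensity fun q => ENNReal.ofReal (kernel q) with hμdef
  have hfin : IsFiniteMeasure μ := isFiniteMeasure_withDensity_ofReal
    (continuous_kernel.continuousOn.integrableOn_compact isCompact_cell).2
  have hμ : μ ≪ volume.restrict cell := withDensity_absolutelyContinuous _ _
  have hfin' : IsFiniteMeasure (volume.restrict cell) := ⟨by
    rw [Measure.restrict_apply_univ]; exact isCompact_cell.measure_lt_top⟩
  have hν : volume.restrict cell ≪ volume.restrict cell := Measure.AbsolutelyContinuous.rfl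
  have hpi : (2 * Real.pi) ^ 2 ≠ 0 := by positivity
  -- Then Δφ is (2π)⁻² times the convolution of the kernel with Δ²f. The kernel identity, which is
  -- centred at the origin, applies to `f` reflected at `q` and returns `f` minus the mean `c`.
  set φ : Obs E := ((2 * Real.pi) ^ 2)⁻¹ • conv hμ (lap f) with hφ
  have hφF : φ ∈ Fld E := (Fld E).smul_mem (mkFld_mem _ _ _) _
  set c : Obs E := ((2 * Real.pi) ^ 2)⁻¹ • conv hν f with hc
  have hcF : c ∈ Fld E := (Fld E).smul_mem (mkFld_mem _ _ _) _
  have key : lap φ = f - c := by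
    refine Obs.ext_fn fun ⟨s, q, ξ⟩ => ?_
    rw [hφ, lap_smul, lap_conv, Obs.fn_smul, Pi.smul_apply, conv_apply]
    have h1 : ∫ y, (lap (lap f)).fn (s, q - y, 0) ∂μ =
        ∫ y in cell, kernel y * (lap (lap (reflQ q f))).fn (s, y, 0) := by
      rw [hμdef, integral_withDensity_eq_integral_toReal_smul
        (continuous_kernel.measurable.ennreal_ofReal)
        (Filter.Eventually.of_forall fun _ => ENNReal.ofReal_lt_top)]
      congr 1; funext y
      rw [ENNReal.toReal_ofReal (kernel_nonneg y), smul_eq_mul, lap_reflQ, lap_reflQ, reflQ_apply]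
    rw [h1, integral_kernel_lap_lap, Obs.fn_sub, Pi.sub_apply, hc, Obs.fn_smul, Pi.smul_apply,
      conv_apply, reflQ_apply, sub_zero, smul_eq_mul, smul_eq_mul, mul_sub, ← mul_assoc,
      inv_mul_cancel₀ hpi, one_mul]
    have h2 := hf s q ξ
    change f.fn _ = f.fn _ at h2
    rw [h2]; rfl
  have hdc : ∀ i, dq i c = 0 := by
    intro i
    refine Obs.ext_fn fun ⟨s, q, ξ⟩ => ?_
    rw [hc, Derivation.map_smul, dq_conv, Obs.fn_smul, Pi.smul_apply, conv_apply]
    have h3 : ∫ y in cell, (dq i f).fn (s, q - y, 0) = -tor (dq i (reflQ q f)) s := by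
      rw [dq_reflQ, map_neg, Pi.neg_apply, neg_neg]; rfl
    rw [h3, tor_dq]; simp [Obs.fn_zero]
  -- `c` is constant in space, and its integral vanishes because those of `f` and of a Laplacian do.
  have hc0 : c = 0 := by
    refine Obs.ext_fn fun ⟨s, q, ξ⟩ => ?_
    rw [fn_eq_of_dq_eq_zero hcF hdc]
    have h4 : tor c s = 0 := by
      have : c = f - lap φ := by rw [key]; abel
      rw [this, map_sub, h0, lap, map_add, tor_dq, tor_dq]; simp
    have h5 := tor_const hcF hdc 1 s
    rw [mul_one, h4] at h5
    exact (mul_eq_zero.1 h5.symm).resolve_right (tor_one_ne_zero s)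
  exact ⟨φ, hφF, by rw [key, hc0, sub_zero]⟩

end

set_option linter.unusedSimpArgs false

/-! ### The brackets in terms of the rings -/

section Translation

variable {E : Type} [NormedAddCommGroup E] [NormedSpace ℝ E] [FiniteDimensional ℝ E]

/-- Scalar product of vectors of observables. -/
def dotO (u w : Fin 2 → Obs E) : Obs E := u 0 * w 0 + u 1 * w 1

/-- Scalar product of a vector with a rotated vector. -/
def crossO (u w : Fin 2 → Obs E) : Obs E := u 1 * w 0 - u 0 * w 1

/-- The velocity average. -/
def av (r : Den E) (F : Obs E) : Obs E := fib (F • r)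

/-- The vorticity. -/
def vortO (m : Obs E) (P : Fin 2 → Obs E) : Obs E := dq 0 (m * P 1) - dq 1 (m * P 0)

/-- The integrand of the bracket on the space of all triples. -/
def brE (ε : ℝ) (B n m : Obs E) (P : Fin 2 → Obs E) (r : Den E)
    (Cn : Obs E) (X : Fin 2 → Obs E) (f : Obs E) (An : Obs E) (Y : Fin 2 → Obs E) (g : Obs E) :
    Obs E :=
  -(ε • ((dotO X (fun i => dq i An - dq i (av r g) + av r (dq i g)) -
      dotO Y (fun i => dq i Cn - dq i (av r f) + av r (dq i f))) * n))
  - ε • dotO (fun j => dotO X (fun i => dq i (Y j)) - dotO Y (fun i => dq i (X j))) P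
  + B * crossO X Y * n
  + ε • fib (((dotO (fun i => dq i f) (fun i => dv i g) -
      dotO (fun i => dq i g) (fun i => dv i f)) * n) • r)
  + fib (((B - ε • vortO m P) * crossO (fun i => dv i f) (fun i => dv i g) * n) • r)
  - ε • ((dotO (fun i => av r (dq i f)) (fun i => av r (dv i g)) -
      dotO (fun i => av r (dq i g)) (fun i => av r (dv i f))) * n)
  - (B - ε • vortO m P) * crossO (fun i => av r (dv i f)) (fun i => av r (dv i g)) * n
  - ε • (dotO (fun i => X i - av r (dv i f))
        (fun j => dq 0 (n * av r (dv 0 g * xi j)) + dq 1 (n * av r (dv 1 g * xi j))) -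
      dotO (fun i => Y i - av r (dv i g))
        (fun j => dq 0 (n * av r (dv 0 f * xi j)) + dq 1 (n * av r (dv 1 f * xi j))))

/-- The integrand of the bracket on the submanifold. -/
def brS (ε : ℝ) (B n m : Obs E) (P : Fin 2 → Obs E) (r : Den E)
    (X : Fin 2 → Obs E) (γ f : Obs E) (Y : Fin 2 → Obs E) (α g : Obs E) :
    Obs E :=
  (B - ε • vortO m P) * crossO X Y * n
  - ε • (dotO X (fun i => av r (dq i α)) - dotO Y (fun i => av r (dq i γ)))
  - ε • (dotO (fun i => X i - av r (dv i f))
        (fun j => dq 0 (av r (dv 0 α * xi j)) + dq 1 (av r (dv 1 α * xi j))) -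
      dotO (fun i => Y i - av r (dv i g))
        (fun j => dq 0 (av r (dv 0 γ * xi j)) + dq 1 (av r (dv 1 γ * xi j))))
  + ε • fib (((dotO (fun i => dq i f) (fun i => dv i g) -
      dotO (fun i => dq i g) (fun i => dv i f)) * n) • r)
  + fib (((B - ε • vortO m P) * crossO (fun i => dv i f) (fun i => dv i g) * n) • r)
  - ε • ((dotO (fun i => av r (dq i f)) (fun i => av r (dv i g)) -
      dotO (fun i => av r (dq i g)) (fun i => av r (dv i f))) * n)
  - (B - ε • vortO m P) * crossO (fun i => av r (dv i f)) (fun i => av r (dv i g)) * n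

/-- The slice of an observable at a parameter. -/
def sl (F : Obs E) (s : E) : Vec → Vec → ℝ := fun q ξ => F.fn (s, q, ξ)

theorem gradQ_sl (F : Obs E) (s : E) (q ξ : Vec) :
    gradQ (sl F s) q ξ = fun i => (dq i F).fn (s, q, ξ) :=
  funext fun i => (fn_zero_velocity_dq F i s q ξ).symm

theorem gradV_sl (F : Obs E) (s : E) (q ξ : Vec) :
    gradV (sl F s) q ξ = fun i => (dv i F).fn (s, q, ξ) :=
  funext fun i => (fn_dv F i s q ξ).symm

theorem integrable_slice (F : Obs E) (r : Den E) (s : E) (q : Vec) :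
    Integrable fun ξ => r.obs.fn (s, q, ξ) * F.fn (s, q, ξ) := by
  refine ((F • r).integrable s q).congr (Filter.Eventually.of_forall fun ξ => ?_)
  change F.fn _ * r.obs.fn _ = _
  rw [mul_comm]

theorem integral_slice (F : Obs E) (r : Den E) (s : E) (q ξ : Vec) :
    ∫ ξ, r.obs.fn (s, q, ξ) * F.fn (s, q, ξ) = (av r F).fn (s, q, ξ) := by
  rw [av, fib_apply]
  congr 1; funext ξ
  change _ = F.fn _ * r.obs.fn _
  rw [mul_comm]

theorem avg_sl (F : Obs E) (r : Den E) (s : E) (q ξ : Vec) :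
    avg (sl r.obs s) (sl F s) q = (av r F).fn (s, q, ξ) := integral_slice F r s q ξ

theorem avg_vec (V : Fin 2 → Obs E) (r : Den E) (s : E) (q ξ' : Vec) :
    avg (sl r.obs s) (fun q ξ => ((fun i => (V i).fn (s, q, ξ)) : Vec)) q =
      fun i => (av r (V i)).fn (s, q, ξ') := by
  funext i
  exact (eval_integral (fun i => integrable_slice (V i) r s q) i).trans (integral_slice (V i) r s q ξ')

theorem avg_ten (V : Fin 2 → Fin 2 → Obs E) (r : Den E) (s : E) (q ξ' : Vec) :
    avg (sl r.obs s) (fun q ξ => ((fun i j => (V i j).fn (s, q, ξ)) : Fin 2 → Fin 2 → ℝ)) q =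
      fun i j => (av r (V i j)).fn (s, q, ξ') := by
  funext i j
  have h := eval_integral (μ := volume) (f := fun ξ (i : Fin 2) (j : Fin 2) =>
    r.obs.fn (s, q, ξ) * (V i j).fn (s, q, ξ)) (i := i)
    fun i => Integrable.of_eval fun j => integrable_slice (V i j) r s q
  exact (congrFun h j).trans ((eval_integral (fun j => integrable_slice (V i j) r s q) j).trans
    (integral_slice (V i j) r s q ξ'))

theorem grad_slice (u : Obs E) (s : E) (q : Vec) :
    grad (fun q => u.fn (s, q, 0)) q = fun i => (dq i u).fn (s, q, 0) :=
  funext fun i => (fn_zero_velocity_dq u i s q 0).symm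

theorem divg_slice (X : Fin 2 → Obs E) (s : E) (q : Vec) :
    divg (fun q i => (X i).fn (s, q, 0)) q = (dq 0 (X 0) + dq 1 (X 1)).fn (s, q, 0) := by
  rw [divg, Fin.sum_univ_two, Obs.fn_add, Pi.add_apply, fn_zero_velocity_dq, fn_zero_velocity_dq]

theorem divT_slice (T : Fin 2 → Fin 2 → Obs E) (s : E) (q : Vec) :
    divT (fun q i j => (T i j).fn (s, q, 0)) q =
      fun j => (dq 0 (T 0 j) + dq 1 (T 1 j)).fn (s, q, 0) := by
  funext j
  rw [divT, Fin.sum_univ_two, Obs.fn_add, Pi.add_apply, fn_zero_velocity_dq, fn_zero_velocity_dq]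

theorem fderiv_slice_apply (X : Fin 2 → Obs E) (s : E) (q w : Vec) (j : Fin 2) :
    fderiv ℝ (fun q => ((fun i => (X i).fn (s, q, 0)) : Vec)) q w j =
      w 0 * (dq 0 (X j)).fn (s, q, 0) + w 1 * (dq 1 (X j)).fn (s, q, 0) := by
  have hd : ∀ i, DifferentiableAt ℝ (fun q => (X i).fn (s, q, 0)) q := fun i =>
    (X i).differentiable.comp (by fun_prop : Differentiable ℝ fun q : Vec => ((s, q, 0) : Dom E)) q
  rw [fderiv_pi hd]
  have hw : w = w 0 • (Pi.single 0 1 : Vec) + w 1 • (Pi.single 1 1 : Vec) := by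
    funext j; fin_cases j <;> simp
  simp only [ContinuousLinearMap.coe_pi', fn_zero_velocity_dq]
  conv_lhs => rw [hw]
  rw [map_add, map_smul, map_smul]; rfl

theorem lieBracket_slice (X Y : Fin 2 → Obs E) (s : E) (q : Vec) (j : Fin 2) :
    _root_.VectorField.lieBracket ℝ (fun q => ((fun i => (X i).fn (s, q, 0)) : Vec))
      (fun q => ((fun i => (Y i).fn (s, q, 0)) : Vec)) q j =
    (dotO X (fun i => dq i (Y j)) - dotO Y (fun i => dq i (X j))).fn (s, q, 0) := by
  rw [_root_.VectorField.lieBracket, Pi.sub_apply, fderiv_slice_apply, fderiv_slice_apply]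
  rfl

theorem vorticity_slice (n m : Obs E) (hnm : n * m = 1) (P : Fin 2 → Obs E) (s : E) (q : Vec) :
    vorticity (fun q => n.fn (s, q, 0)) (fun q i => (P i).fn (s, q, 0)) q =
      (vortO m P).fn (s, q, 0) := by
  have hm : ∀ q, (n.fn (s, q, 0))⁻¹ = m.fn (s, q, 0) := fun q => by
    have := congrFun (congrArg Obs.fn hnm) (s, q, 0)
    exact inv_eq_of_mul_eq_one_right this
  have e : (fun p => rot ((n.fn (s, p, 0))⁻¹ • fun i => (P i).fn (s, p, 0))) =
      fun q i => ((![-(m * P 1), m * P 0] : Fin 2 → Obs E) i).fn (s, q, 0) := by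
    funext p i
    rw [hm]
    fin_cases i <;> simp [rot, Obs.fn_neg, Obs.fn_mul]
  rw [vorticity, e, divg_slice]
  simp only [Matrix.cons_val_zero, Matrix.cons_val_one, map_neg, vortO, Obs.fn_add, Obs.fn_neg,
    Obs.fn_sub, Pi.add_apply, Pi.neg_apply, Pi.sub_apply]
  ring

variable (E) in
/-- A function on the torus as a constant family. -/
def constFld (B : ScalarField) : Obs E :=
  mkFld (fun p => B.1 p.2) (B.2.1.comp contDiff_snd) fun _ => B.2.2

theorem constFld_mem (B : ScalarField) : constFld E B ∈ Fld E := mkFld_mem _ _ _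

theorem inv_mul_slice (n m : Obs E) (hnm : n * m = 1) (hm : m ∈ Fld E) (γ : Obs E)
    (s : E) : (fun q ξ => (n.fn (s, q, 0))⁻¹ * γ.fn (s, q, ξ)) = sl (m * γ) s := by
  funext q ξ
  have h1 : n.fn (s, q, 0) * m.fn (s, q, 0) = 1 := congrFun (congrArg Obs.fn hnm) (s, q, 0)
  have h2 := hm s q ξ
  change m.fn _ = m.fn _ at h2
  rw [sl, Obs.fn_mul, Pi.mul_apply, h2, inv_eq_of_mul_eq_one_right h1]

/-- Splitting the integral of `brE` into integrals of its summands makes it possible to match the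
bracket term by term. -/
theorem tor_combination_eight (ε : ℝ) (T₁ T₂ T₃ T₄ T₅ T₆ T₇ T₈ : Obs E) (s : E) :
    tor (-(ε • T₁) - ε • T₂ + T₃ + ε • T₄ + T₅ - ε • T₆ - T₇ - ε • T₈) s =
      -ε * tor T₁ s - ε * tor T₂ s + tor T₃ s + ε * tor T₄ s + tor T₅ s - ε * tor T₆ s
        - tor T₇ s - ε * tor T₈ s := by
  simp only [map_add, map_sub, map_neg, map_smul, Pi.add_apply, Pi.sub_apply, Pi.neg_apply,
    Pi.smul_apply, smul_eq_mul, neg_mul]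

theorem tor_combination_seven (ε : ℝ) (T₁ T₂ T₃ T₄ T₅ T₆ T₇ : Obs E) (s : E) :
    tor (T₁ - ε • T₂ - ε • T₃ + ε • T₄ + T₅ - ε • T₆ - T₇) s =
      tor T₁ s - ε * tor T₂ s - ε * tor T₃ s + ε * tor T₄ s + tor T₅ s - ε * tor T₆ s
        - tor T₇ s := by
  simp only [map_add, map_sub, map_smul, Pi.add_apply, Pi.sub_apply,
    Pi.smul_apply, smul_eq_mul]

/-- The passage from integrals to algebra. The ring inverse `m` of the density replaces the
pointwise `1/n`, and `m * C.r` is the function called f in the bracket. -/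
theorem bracketE_at (ε : ℝ) (B : ScalarField) (S : StF E) (C A : CvF E) {m : Obs E}
    (hm : m ∈ Fld E) (hnm : S.n * m = 1) (s : E) :
    bracketE ε B (S.at s) (C.at s) (A.at s) =
      tor (brE ε (constFld E B) S.n m S.P S.r C.n C.P (m * C.r) A.n A.P (m * A.r)) s := by
  have hn0 : ∀ (p q ξ), S.n.fn (p, q, ξ) = S.n.fn (p, q, 0) := S.hn
  have hb0 : ∀ (p q ξ), (constFld E B).fn (p, q, ξ) = B.1 q := fun _ _ _ => rfl
  have hom : ∀ (q ξ), (vortO m S.P).fn (s, q, ξ) = vorticity (S.at s).n (S.at s).P q := by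
    intro q ξ
    have h1 : vortO m S.P ∈ Fld E := (Fld E).sub_mem (dq_mem_Fld _ ((Fld E).mul_mem hm (S.hP 1)))
      (dq_mem_Fld _ ((Fld E).mul_mem hm (S.hP 0)))
    have h2 := h1 s q ξ
    change Obs.fn _ _ = Obs.fn _ _ at h2
    rw [h2]
    exact (vorticity_slice S.n m hnm S.P s q).symm
  have hf := inv_mul_slice S.n m hnm hm C.r s
  have hg := inv_mul_slice S.n m hnm hm A.r s
  have e1 : (fun q ξ => ((S.at s).n q)⁻¹ * (C.at s).rho q ξ) = sl (m * C.r) s := hf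
  have e2 : (fun q ξ => ((S.at s).n q)⁻¹ * (A.at s).rho q ξ) = sl (m * A.r) s := hg
  have e3 : (S.at s).rho = sl S.r.obs s := rfl
  have e4 : (C.at s).n = fun q => C.n.fn (s, q, 0) := rfl
  have e5 : (A.at s).n = fun q => A.n.fn (s, q, 0) := rfl
  have e6 : (C.at s).P = fun q i => (C.P i).fn (s, q, 0) := rfl
  have e7 : (A.at s).P = fun q i => (A.P i).fn (s, q, 0) := rfl
  have e8 : (S.at s).P = fun q i => (S.P i).fn (s, q, 0) := rfl
  have e9 : (S.at s).n = fun q => S.n.fn (s, q, 0) := rfl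
  have gq : ∀ F : Obs E, gradQ (sl F s) = fun q ξ i => (dq i F).fn (s, q, ξ) := fun F =>
    funext fun q => funext fun ξ => gradQ_sl F s q ξ
  have gv : ∀ F : Obs E, gradV (sl F s) = fun q ξ i => (dv i F).fn (s, q, ξ) := fun F =>
    funext fun q => funext fun ξ => gradV_sl F s q ξ
  have as : ∀ F : Obs E, avg (sl S.r.obs s) (sl F s) = fun q => (av S.r F).fn (s, q, 0) := fun F =>
    funext fun q => avg_sl F S.r s q 0
  have avv : ∀ V : Fin 2 → Obs E, avg (sl S.r.obs s) (fun q ξ => ((fun i => (V i).fn (s, q, ξ)) : Vec)) =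
      fun q i => (av S.r (V i)).fn (s, q, 0) := fun V => funext fun q => avg_vec V S.r s q 0
  have at' : ∀ F : Obs E, (fun p => S.n.fn (s, p, 0) • avg (sl S.r.obs s)
      (fun p' ξ => tens (gradV (sl F s) p' ξ) ξ) p) =
      fun q i j => (S.n * av S.r (dv i F * xi j)).fn (s, q, 0) := fun F => by
    funext q i j
    have h1 : (fun p' ξ => tens (gradV (sl F s) p' ξ) ξ) =
        fun q ξ i j => (dv i F * xi j).fn (s, q, ξ) := by
      funext q ξ i j
      rw [gradV_sl]; rfl
    rw [h1, avg_ten _ _ _ _ 0]; rfl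
  unfold bracketE
  simp only [e1, e2]
  simp only [← hom _ 0]
  rw [e3, e4, e5, e6, e7, e8, e9]
  simp only [at']
  simp only [gq, gv, as, avv, divT_slice, grad_slice]
  rw [brE, tor_combination_eight]
  refine congrArg₂ (· - ·) (congrArg₂ (· - ·) (congrArg₂ (· - ·) (congrArg₂ (· + ·)
    (congrArg₂ (· + ·) (congrArg₂ (· + ·) (congrArg₂ (· - ·) (congrArg _ ?_)
    (congrArg _ ?_)) ?_) (congrArg _ ?_)) ?_) (congrArg _ ?_)) ?_) (congrArg _ ?_)
  · rw [tor_apply]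
    congr 1; funext q
    simp only [dotProduct, Fin.sum_univ_two, dotO, crossO, rot, Obs.fn_add, Obs.fn_smul, Obs.fn_mul, Obs.fn_sub, Den.obs_smul,
      Pi.add_apply, Pi.sub_apply, Pi.mul_apply, Pi.smul_apply, Matrix.cons_val_zero, Matrix.cons_val_one, smul_eq_mul, hb0, hom]
  · rw [tor_apply]
    congr 1; funext q
    simp only [dotProduct, Fin.sum_univ_two, lieBracket_slice]
    rfl
  · rw [tor_apply]
    congr 1; funext q
    simp only [dotProduct, Fin.sum_univ_two, dotO, crossO, rot, Obs.fn_add, Obs.fn_smul, Obs.fn_mul, Obs.fn_sub, Den.obs_smul,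
      Pi.add_apply, Pi.sub_apply, Pi.mul_apply, Pi.smul_apply, Matrix.cons_val_zero, Matrix.cons_val_one, smul_eq_mul, hb0, hom]
    ring
  · rw [phaseInt, tor_apply]
    congr 1; funext q
    rw [fib_apply]
    congr 1; funext ξ
    simp only [dotProduct, Fin.sum_univ_two, dotO, crossO, rot, Obs.fn_add, Obs.fn_smul, Obs.fn_mul, Obs.fn_sub, Den.obs_smul,
      Pi.add_apply, Pi.sub_apply, Pi.mul_apply, Pi.smul_apply, Matrix.cons_val_zero, Matrix.cons_val_one, smul_eq_mul, hb0, hom, hn0 s q ξ, sl]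
  · rw [phaseInt, tor_apply]
    congr 1; funext q
    rw [fib_apply]
    congr 1; funext ξ
    simp only [dotProduct, Fin.sum_univ_two, dotO, crossO, rot, Obs.fn_add, Obs.fn_smul, Obs.fn_mul, Obs.fn_sub, Den.obs_smul,
      Pi.add_apply, Pi.sub_apply, Pi.mul_apply, Pi.smul_apply, Matrix.cons_val_zero, Matrix.cons_val_one, smul_eq_mul, hb0, hom, hn0 s q ξ, sl]
    ring
  · rw [tor_apply]
    congr 1; funext q
    simp only [dotProduct, Fin.sum_univ_two, dotO, crossO, rot, Obs.fn_add, Obs.fn_smul, Obs.fn_mul, Obs.fn_sub, Den.obs_smul,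
      Pi.add_apply, Pi.sub_apply, Pi.mul_apply, Pi.smul_apply, Matrix.cons_val_zero, Matrix.cons_val_one, smul_eq_mul, hb0, hom]
  · rw [tor_apply]
    congr 1; funext q
    simp only [dotProduct, Fin.sum_univ_two, dotO, crossO, rot, Obs.fn_add, Obs.fn_smul, Obs.fn_mul, Obs.fn_sub, Den.obs_smul,
      Pi.add_apply, Pi.sub_apply, Pi.mul_apply, Pi.smul_apply, Matrix.cons_val_zero, Matrix.cons_val_one, smul_eq_mul, hb0, hom]
    ring
  · rw [tor_apply]
    congr 1; funext q
    simp only [dotProduct, Fin.sum_univ_two, dotO, crossO, rot, Obs.fn_add, Obs.fn_smul, Obs.fn_mul, Obs.fn_sub, Den.obs_smul,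
      Pi.add_apply, Pi.sub_apply, Pi.mul_apply, Pi.smul_apply, Matrix.cons_val_zero, Matrix.cons_val_one, smul_eq_mul, hb0, hom]

theorem bracketSig_at (ε : ℝ) (B : ScalarField) (S : StF E) (C A : CvF E) {m : Obs E}
    (hm : m ∈ Fld E) (hnm : S.n * m = 1) (s : E) :
    bracketSig ε B (S.at s) (C.at s) (A.at s) =
      tor (brS ε (constFld E B) S.n m S.P S.r C.P C.r (m * C.r) A.P A.r (m * A.r)) s := by
  have hn0 : ∀ (p q ξ), S.n.fn (p, q, ξ) = S.n.fn (p, q, 0) := S.hn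
  have hb0 : ∀ (p q ξ), (constFld E B).fn (p, q, ξ) = B.1 q := fun _ _ _ => rfl
  have hom : ∀ (q ξ), (vortO m S.P).fn (s, q, ξ) = vorticity (S.at s).n (S.at s).P q := by
    intro q ξ
    have h1 : vortO m S.P ∈ Fld E := (Fld E).sub_mem (dq_mem_Fld _ ((Fld E).mul_mem hm (S.hP 1)))
      (dq_mem_Fld _ ((Fld E).mul_mem hm (S.hP 0)))
    have h2 := h1 s q ξ
    change Obs.fn _ _ = Obs.fn _ _ at h2
    rw [h2]
    exact (vorticity_slice S.n m hnm S.P s q).symm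
  have e1 : (fun q ξ => ((S.at s).n q)⁻¹ * (C.at s).rho q ξ) = sl (m * C.r) s :=
    inv_mul_slice S.n m hnm hm C.r s
  have e2 : (fun q ξ => ((S.at s).n q)⁻¹ * (A.at s).rho q ξ) = sl (m * A.r) s :=
    inv_mul_slice S.n m hnm hm A.r s
  have e3 : (S.at s).rho = sl S.r.obs s := rfl
  have e4 : (C.at s).rho = sl C.r s := rfl
  have e5 : (A.at s).rho = sl A.r s := rfl
  have e6 : (C.at s).P = fun q i => (C.P i).fn (s, q, 0) := rfl
  have e7 : (A.at s).P = fun q i => (A.P i).fn (s, q, 0) := rfl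
  have e9 : (S.at s).n = fun q => S.n.fn (s, q, 0) := rfl
  have gq : ∀ F : Obs E, gradQ (sl F s) = fun q ξ i => (dq i F).fn (s, q, ξ) := fun F =>
    funext fun q => funext fun ξ => gradQ_sl F s q ξ
  have gv : ∀ F : Obs E, gradV (sl F s) = fun q ξ i => (dv i F).fn (s, q, ξ) := fun F =>
    funext fun q => funext fun ξ => gradV_sl F s q ξ
  have avv : ∀ V : Fin 2 → Obs E, avg (sl S.r.obs s) (fun q ξ => ((fun i => (V i).fn (s, q, ξ)) : Vec)) =
      fun q i => (av S.r (V i)).fn (s, q, 0) := fun V => funext fun q => avg_vec V S.r s q 0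
  have at' : ∀ F : Obs E, avg (sl S.r.obs s)
      (fun p' ξ => tens (gradV (sl F s) p' ξ) ξ) =
      fun q i j => (av S.r (dv i F * xi j)).fn (s, q, 0) := fun F => by
    funext q i j
    have h1 : (fun p' ξ => tens (gradV (sl F s) p' ξ) ξ) =
        fun q ξ i j => (dv i F * xi j).fn (s, q, ξ) := by
      funext q ξ i j
      rw [gradV_sl]; rfl
    rw [h1, avg_ten _ _ _ _ 0]
  unfold bracketSig
  simp only [e1, e2]
  simp only [← hom _ 0]
  rw [e3, e4, e5, e6, e7, e9]
  simp only [at']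
  simp only [gq, gv, avv, divT_slice]
  rw [brS, tor_combination_seven]
  refine congrArg₂ (· - ·) (congrArg₂ (· - ·) (congrArg₂ (· + ·) (congrArg₂ (· + ·)
    (congrArg₂ (· - ·) (congrArg₂ (· - ·) ?_ (congrArg _ ?_)) (congrArg _ ?_)) (congrArg _ ?_))
    ?_) (congrArg _ ?_)) ?_
  · rw [tor_apply]
    congr 1; funext q
    simp only [dotProduct, Fin.sum_univ_two, dotO, crossO, rot, Obs.fn_add, Obs.fn_smul, Obs.fn_mul, Obs.fn_sub, Den.obs_smul,
      Pi.add_apply, Pi.sub_apply, Pi.mul_apply, Pi.smul_apply, Matrix.cons_val_zero, Matrix.cons_val_one, smul_eq_mul, hb0, hom]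
    ring
  · rw [tor_apply]
    congr 1; funext q
    simp only [dotProduct, Fin.sum_univ_two, dotO, crossO, rot, Obs.fn_add, Obs.fn_smul, Obs.fn_mul, Obs.fn_sub, Den.obs_smul,
      Pi.add_apply, Pi.sub_apply, Pi.mul_apply, Pi.smul_apply, Matrix.cons_val_zero, Matrix.cons_val_one, smul_eq_mul, hb0, hom]
  · rw [tor_apply]
    congr 1; funext q
    simp only [dotProduct, Fin.sum_univ_two, dotO, crossO, rot, Obs.fn_add, Obs.fn_smul, Obs.fn_mul, Obs.fn_sub, Den.obs_smul,
      Pi.add_apply, Pi.sub_apply, Pi.mul_apply, Pi.smul_apply, Matrix.cons_val_zero, Matrix.cons_val_one, smul_eq_mul, hb0, hom]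
  · rw [phaseInt, tor_apply]
    congr 1; funext q
    rw [fib_apply]
    congr 1; funext ξ
    simp only [dotProduct, Fin.sum_univ_two, dotO, crossO, rot, Obs.fn_add, Obs.fn_smul, Obs.fn_mul, Obs.fn_sub, Den.obs_smul,
      Pi.add_apply, Pi.sub_apply, Pi.mul_apply, Pi.smul_apply, Matrix.cons_val_zero, Matrix.cons_val_one, smul_eq_mul, hb0, hom, hn0 s q ξ, sl]
  · rw [phaseInt, tor_apply]
    congr 1; funext q
    rw [fib_apply]
    congr 1; funext ξ
    simp only [dotProduct, Fin.sum_univ_two, dotO, crossO, rot, Obs.fn_add, Obs.fn_smul, Obs.fn_mul, Obs.fn_sub, Den.obs_smul,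
      Pi.add_apply, Pi.sub_apply, Pi.mul_apply, Pi.smul_apply, Matrix.cons_val_zero, Matrix.cons_val_one, smul_eq_mul, hb0, hom, hn0 s q ξ, sl]
    ring
  · rw [tor_apply]
    congr 1; funext q
    simp only [dotProduct, Fin.sum_univ_two, dotO, crossO, rot, Obs.fn_add, Obs.fn_smul, Obs.fn_mul, Obs.fn_sub, Den.obs_smul,
      Pi.add_apply, Pi.sub_apply, Pi.mul_apply, Pi.smul_apply, Matrix.cons_val_zero, Matrix.cons_val_one, smul_eq_mul, hb0, hom]
  · rw [tor_apply]
    congr 1; funext q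
    simp only [dotProduct, Fin.sum_univ_two, dotO, crossO, rot, Obs.fn_add, Obs.fn_smul, Obs.fn_mul, Obs.fn_sub, Den.obs_smul,
      Pi.add_apply, Pi.sub_apply, Pi.mul_apply, Pi.smul_apply, Matrix.cons_val_zero, Matrix.cons_val_one, smul_eq_mul, hb0, hom]
    ring

end Translation

/-! ### Change of parameters -/

section Reparam

variable {E : Type} [NormedAddCommGroup E] [NormedSpace ℝ E] [FiniteDimensional ℝ E]
variable {E' : Type} [NormedAddCommGroup E'] [NormedSpace ℝ E'] [FiniteDimensional ℝ E']

/-- Change of parameters for families of observables. -/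
def compObs (φ : E' → E) (hφ : ContDiff ℝ ∞ φ) : Obs E →ₐ[ℝ] Obs E' where
  toFun f := liftObs hφ isOpen_univ (fun _ => mem_univ _)
    (CvF.mk 0 0 f (zero_mem _) fun _ => zero_mem _).smooth.2.2
    (fun s i q => funext fun ξ => f.periodic i s q ξ)
  map_one' := Obs.ext_fn fun _ => rfl
  map_mul' _ _ := Obs.ext_fn fun _ => rfl
  map_zero' := Obs.ext_fn fun _ => rfl
  map_add' _ _ := Obs.ext_fn fun _ => rfl
  commutes' _ := Obs.ext_fn fun _ => rfl

variable (φ : E' → E) (hφ : ContDiff ℝ ∞ φ)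

theorem compObs_fn (f : Obs E) (s : E') (q ξ : Vec) :
    (compObs φ hφ f).fn (s, q, ξ) = f.fn (φ s, q, ξ) := rfl

theorem dq_compObs (i : Fin 2) (f : Obs E) : dq i (compObs φ hφ f) = compObs φ hφ (dq i f) :=
  Obs.ext fun s q ξ => by
    rw [compObs_fn, fn_zero_velocity_dq, fn_zero_velocity_dq]; rfl

theorem dv_compObs (i : Fin 2) (f : Obs E) : dv i (compObs φ hφ f) = compObs φ hφ (dv i f) :=
  Obs.ext fun s q ξ => by
    rw [compObs_fn, fn_dv, fn_dv]; rfl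

theorem compObs_xi (i : Fin 2) : compObs φ hφ (xi i) = xi i := Obs.ext fun _ _ _ => rfl

/-- Change of parameters for families of densities. -/
def compDen (d : Den E) : Den E' :=
  liftDen hφ isOpen_univ (fun _ => mem_univ _)
    (StF.mk 0 0 d (zero_mem _) fun _ => zero_mem _).smooth.2.2
    (fun s i q => funext fun ξ => d.obs.periodic i s q ξ)

theorem compDen_obs (d : Den E) : (compDen φ hφ d).obs = compObs φ hφ d.obs := rfl

theorem compDen_smul (F : Obs E) (d : Den E) :
    compDen φ hφ (F • d) = compObs φ hφ F • compDen φ hφ d :=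
  Den.ext_obs (by rw [Den.obs_smul, compDen_obs, compDen_obs, Den.obs_smul, map_mul])

theorem compDen_add (d d' : Den E) :
    compDen φ hφ (d + d') = compDen φ hφ d + compDen φ hφ d' :=
  Den.ext_obs (by rw [Den.obs_add, compDen_obs, compDen_obs, compDen_obs, Den.obs_add, map_add])

theorem compObs_constFld (B : ScalarField) :
    compObs φ hφ (constFld E B) = constFld E' B :=
  Obs.ext fun _ _ _ => rfl

theorem fib_compDen (d : Den E) : fib (compDen φ hφ d) = compObs φ hφ (fib d) :=
  Obs.ext fun s q ξ => by rw [compObs_fn, fib_apply, fib_apply]; rfl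

theorem tor_compObs (f : Obs E) (s : E') : tor (compObs φ hφ f) s = tor f (φ s) := rfl

theorem StF.comp_n (S : StF E) : (S.comp φ hφ).n = compObs φ hφ S.n :=
  Obs.ext fun s q ξ => (S.hn (φ s) q ξ).symm

theorem StF.comp_P (S : StF E) (i : Fin 2) : (S.comp φ hφ).P i = compObs φ hφ (S.P i) :=
  Obs.ext fun s q ξ => (S.hP i (φ s) q ξ).symm

theorem StF.comp_r (S : StF E) : (S.comp φ hφ).r = compDen φ hφ S.r := rfl

theorem CvF.comp_n (S : CvF E) : (S.comp φ hφ).n = compObs φ hφ S.n :=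
  Obs.ext fun s q ξ => (S.hn (φ s) q ξ).symm

theorem CvF.comp_P (S : CvF E) (i : Fin 2) : (S.comp φ hφ).P i = compObs φ hφ (S.P i) :=
  Obs.ext fun s q ξ => (S.hP i (φ s) q ξ).symm

theorem CvF.comp_r (S : CvF E) : (S.comp φ hφ).r = compObs φ hφ S.r := rfl

end Reparam

/-! ### Extensionality -/

section Extensionality

variable {E : Type} [NormedAddCommGroup E] [NormedSpace ℝ E] [FiniteDimensional ℝ E]

theorem StF.ext_at {S T : StF E} (h : ∀ s, S.at s = T.at s) : S = T := by
  obtain ⟨n, P, r, hn, hP⟩ := S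
  obtain ⟨n', P', r', hn', hP'⟩ := T
  have h1 : n = n' := Obs.ext fun s q ξ => by
    have := congrArg (fun z => State.n z q) (h s)
    exact (hn s q ξ).trans (this.trans (hn' s q ξ).symm)
  have h2 : P = P' := funext fun i => Obs.ext fun s q ξ => by
    have := congrArg (fun z => State.P z q i) (h s)
    exact (hP i s q ξ).trans (this.trans (hP' i s q ξ).symm)
  have h3 : r = r' := Den.ext_obs (Obs.ext fun s q ξ => congrArg (fun z => State.rho z q ξ) (h s))
  subst h1 h2 h3; rfl

theorem CvF.ext_at {S T : CvF E} (h : ∀ s, S.at s = T.at s) : S = T := by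
  obtain ⟨n, P, r, hn, hP⟩ := S
  obtain ⟨n', P', r', hn', hP'⟩ := T
  have h1 : n = n' := Obs.ext fun s q ξ => by
    have := congrArg (fun z => Covector.n z q) (h s)
    exact (hn s q ξ).trans (this.trans (hn' s q ξ).symm)
  have h2 : P = P' := funext fun i => Obs.ext fun s q ξ => by
    have := congrArg (fun z => Covector.P z q i) (h s)
    exact (hP i s q ξ).trans (this.trans (hP' i s q ξ).symm)
  have h3 : r = r' := Obs.ext fun s q ξ => congrArg (fun z => Covector.rho z q ξ) (h s)
  subst h1 h2 h3; rfl

theorem Obs.fld_eq_zero {u : Obs E} (hu : u ∈ Fld E) (h : ∀ s q, u.fn (s, q, 0) = 0) : u = 0 :=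
  Obs.ext fun s q ξ => (hu s q ξ).trans (h s q)

theorem dq_eq_zero_iff_grad {u : Obs E} (hu : u ∈ Fld E) :
    (∀ i, dq i u = 0) ↔ ∀ s q, grad (fun q => u.fn (s, q, 0)) q = 0 := by
  constructor
  · intro h s q
    rw [grad_slice]
    funext i
    rw [h i]; rfl
  · intro h i
    refine Obs.fld_eq_zero (dq_mem_Fld i hu) fun s q => ?_
    have := congrFun (h s q) i
    rwa [grad_slice] at this

/-- The divergence of a family of vector fields. -/
def divO (X : Fin 2 → Obs E) : Obs E := dq 0 (X 0) + dq 1 (X 1)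

theorem divO_mem {X : Fin 2 → Obs E} (hX : ∀ i, X i ∈ Fld E) : divO X ∈ Fld E :=
  add_mem (dq_mem_Fld _ (hX _)) (dq_mem_Fld _ (hX _))

theorem divO_eq_zero_iff {X : Fin 2 → Obs E} (hX : ∀ i, X i ∈ Fld E) :
    divO X = 0 ↔ ∀ s q, divg (fun q i => (X i).fn (s, q, 0)) q = 0 := by
  constructor
  · intro h s q
    rw [divg_slice]
    exact congrFun (congrArg Obs.fn h) (s, q, 0)
  · intro h
    refine Obs.fld_eq_zero (divO_mem hX) fun s q => ?_
    have := h s q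
    rwa [divg_slice] at this

end Extensionality

section Calculus

variable {E : Type} [NormedAddCommGroup E] [NormedSpace ℝ E] [FiniteDimensional ℝ E]

/-! ### Inverses, means, and the Leray projection -/

theorem exists_inverse {n : Obs E} (hn : n ∈ Fld E) (h : ∀ s q, n.fn (s, q, 0) ≠ 0) :
    ∃ m ∈ Fld E, n * m = 1 := by
  refine ⟨mkFld (fun p => (n.fn (p.1, p.2, 0))⁻¹) ?_ ?_, mkFld_mem _ _ _, ?_⟩
  · exact ContDiff.inv (n.contDiff.comp (by fun_prop)) fun p => h p.1 p.2
  · intro s i q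
    simp only [n.periodic]
  · refine Obs.ext fun s q ξ => ?_
    have h1 : n.fn (s, q, ξ) = n.fn (s, q, 0) := hn s q ξ
    change n.fn (s, q, ξ) * (n.fn (s, q, 0))⁻¹ = 1
    rw [h1, mul_inv_cancel₀ (h s q)]

/-- Functions of the parameters alone. -/
def parFld (f : E → ℝ) (hf : ContDiff ℝ ∞ f) : Obs E :=
  mkFld (fun p => f p.1) (hf.comp contDiff_fst) fun _ _ _ => rfl

theorem parFld_mem (f : E → ℝ) (hf : ContDiff ℝ ∞ f) : parFld f hf ∈ Fld E := mkFld_mem _ _ _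

theorem dq_parFld (f : E → ℝ) (hf : ContDiff ℝ ∞ f) (i : Fin 2) : dq i (parFld f hf) = 0 :=
  Obs.ext fun s q ξ => by
    rw [fn_zero_velocity_dq]
    change fderiv ℝ (fun _ => f s) q _ = 0
    simp

/-- The quotient of the integral of `f` by that of 1, as a function of the parameter alone. -/
theorem exists_mean (f : Obs E) : ∃ c ∈ Fld E, (∀ i, dq i c = 0) ∧ tor c = tor f := by
  have h1 : ContDiff ℝ ∞ fun s => tor f s / tor (1 : Obs E) s :=
    (contDiff_tor f).div (contDiff_tor 1) tor_one_ne_zero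
  refine ⟨parFld _ h1, parFld_mem _ _, dq_parFld _ _, ?_⟩
  funext s
  rw [← mul_one (parFld _ h1), tor_const (parFld_mem _ _) (dq_parFld _ _)]
  exact div_mul_cancel₀ _ (tor_one_ne_zero s)

theorem tor_divO (X : Fin 2 → Obs E) : tor (divO X) = 0 := by
  rw [divO, map_add, tor_dq, tor_dq, add_zero]

/-- The Helmholtz decomposition, with potential from the Poisson equation Δψ = div Y; a divergence
has mean zero, so this equation is solvable. -/
theorem exists_leray {Y : Fin 2 → Obs E} (hY : ∀ i, Y i ∈ Fld E) :
    ∃ X : Fin 2 → Obs E, ∃ ψ ∈ Fld E, (∀ i, X i ∈ Fld E) ∧ divO X = 0 ∧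
      ∀ i, Y i = X i + dq i ψ := by
  obtain ⟨ψ, hψ, h⟩ := exists_lap_eq (divO_mem hY) (tor_divO Y)
  refine ⟨fun i => Y i - dq i ψ, ψ, hψ, fun i => sub_mem (hY i) (dq_mem_Fld i hψ), ?_, fun i => by ring⟩
  rw [divO, map_sub, map_sub]
  rw [divO, lap] at h
  linear_combination -h

/-- Integration by parts against a gradient. -/
theorem tor_dotO_dq (X : Fin 2 → Obs E) (ψ : Obs E) :
    tor (dotO X fun i => dq i ψ) = -tor (divO X * ψ) := by
  rw [dotO, map_add, tor_mul_dq, tor_mul_dq, divO, add_mul, map_add]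
  abel

theorem tor_dotO_dq_eq_zero {X : Fin 2 → Obs E} (hX : divO X = 0) (ψ : Obs E) :
    tor (dotO X fun i => dq i ψ) = 0 := by
  rw [tor_dotO_dq, hX, zero_mul, map_zero, neg_zero]

/-! ### Representable forms -/

/-- A real valued family of linear forms on covectors that is given by a family of tangent
vectors. -/
def Representable (T : CvF E → Obs E) : Prop := ∃ V : StF E, ∀ C, tor (T C) = pair C V

theorem Representable.congr {T T' : CvF E → Obs E} (h : Representable T)
    (e : ∀ C, tor (T' C) = tor (T C)) : Representable T' := by
  obtain ⟨V, hV⟩ := h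
  exact ⟨V, fun C => (e C).trans (hV C)⟩

theorem Representable.add {T T' : CvF E → Obs E} (h : Representable T) (h' : Representable T') :
    Representable fun C => T C + T' C := by
  obtain ⟨V, hV⟩ := h
  obtain ⟨V', hV'⟩ := h'
  refine ⟨⟨V.n + V'.n, fun i => V.P i + V'.P i, V.r + V'.r, add_mem V.hn V'.hn,
    fun i => add_mem (V.hP i) (V'.hP i)⟩, fun C => ?_⟩
  rw [map_add, hV, hV']
  simp only [pair, smul_add, mul_add, map_add]
  abel

theorem Representable.smul {T : CvF E → Obs E} (c : ℝ) (h : Representable T) :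
    Representable fun C => c • T C := by
  obtain ⟨V, hV⟩ := h
  refine ⟨⟨c • V.n, fun i => c • V.P i, c • V.r, (Fld E).smul_mem V.hn c,
    fun i => (Fld E).smul_mem (V.hP i) c⟩, fun C => ?_⟩
  have e : C.r • c • V.r = c • C.r • V.r := smul_algebra_smul_comm _ _ _
  rw [map_smul, hV]
  simp only [pair, e, mul_smul_comm, map_add, map_smul, smul_add]

theorem Representable.neg {T : CvF E → Obs E} (h : Representable T) :
    Representable fun C => -T C := by
  simpa using h.smul (-1)

/-- A linear map from covectors to functions on the torus whose product with any function on the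
torus is representable. -/
structure IsFieldForm (T : CvF E → Obs E) : Prop where
  mem : ∀ C, T C ∈ Fld E
  rep : ∀ u ∈ Fld E, Representable fun C => T C * u

namespace IsFieldForm

variable {T T' : CvF E → Obs E}

theorem representable (h : IsFieldForm T) : Representable T := by
  simpa using h.rep 1 (one_mem _)

theorem add (h : IsFieldForm T) (h' : IsFieldForm T') : IsFieldForm fun C => T C + T' C :=
  ⟨fun C => add_mem (h.mem C) (h'.mem C), fun u hu => by
    simpa [add_mul] using (h.rep u hu).add (h'.rep u hu)⟩

theorem smul (c : ℝ) (h : IsFieldForm T) : IsFieldForm fun C => c • T C :=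
  ⟨fun C => (Fld E).smul_mem (h.mem C) c, fun u hu => by
    simpa using (h.rep u hu).smul c⟩

theorem neg (h : IsFieldForm T) : IsFieldForm fun C => -T C := by
  simpa using h.smul (-1)

theorem sub (h : IsFieldForm T) (h' : IsFieldForm T') : IsFieldForm fun C => T C - T' C := by
  simpa [sub_eq_add_neg] using h.add h'.neg

theorem mul_right (h : IsFieldForm T) {w : Obs E} (hw : w ∈ Fld E) :
    IsFieldForm fun C => T C * w :=
  ⟨fun C => mul_mem (h.mem C) hw, fun u hu => by
    simpa [mul_assoc] using h.rep (w * u) (mul_mem hw hu)⟩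

theorem mul_left (h : IsFieldForm T) {w : Obs E} (hw : w ∈ Fld E) :
    IsFieldForm fun C => w * T C := by
  simpa [mul_comm] using h.mul_right hw

/-- Integration by parts moves the derivative to the test function. The stability of field forms
under `dq` is the reason why representability is demanded against every `u` rather than for `T`
alone. -/
theorem dq (h : IsFieldForm T) (i : Fin 2) : IsFieldForm fun C => QNVP.dq i (T C) :=
  ⟨fun C => dq_mem_Fld i (h.mem C), fun u hu =>
    (h.rep _ (dq_mem_Fld i hu)).neg.congr fun C => by
      rw [mul_comm, tor_mul_dq, map_neg, mul_comm]⟩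

theorem fst : IsFieldForm fun C : CvF E => C.n :=
  ⟨fun C => C.hn, fun u hu => ⟨⟨u, 0, 0, hu, fun _ => zero_mem _⟩, fun C => by simp [pair]⟩⟩

theorem snd (i : Fin 2) : IsFieldForm fun C : CvF E => C.P i :=
  ⟨fun C => C.hP i, fun u hu => ⟨⟨0, fun j => if j = i then u else 0, 0, zero_mem _, fun j => by
    split_ifs; exacts [hu, zero_mem _]⟩, fun C => by fin_cases i <;> simp [pair]⟩⟩

theorem fib (d : Den E) : IsFieldForm fun C : CvF E => QNVP.fib (C.r • d) :=
  ⟨fun C => fib_mem _, fun u hu => ⟨⟨0, 0, u • d, zero_mem _, fun _ => zero_mem _⟩, fun C => by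
    beta_reduce
    rw [mul_comm, ← fib_smul hu, smul_comm]; simp [pair]⟩⟩

theorem fib_mul (m : Obs E) (d : Den E) : IsFieldForm fun C : CvF E => QNVP.fib ((m * C.r) • d) := by
  have := fib (m • d)
  simpa only [smul_smul, mul_comm] using this

/-- By the product rule the average of a derivative is a derivative of an average minus an average
against the differentiated density. -/
theorem fib_dq (m : Obs E) (d : Den E) (i : Fin 2) :
    IsFieldForm fun C : CvF E => QNVP.fib (QNVP.dq i (m * C.r) • d) := by
  have e : ∀ C : CvF E, QNVP.fib (QNVP.dq i (m * C.r) • d) =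
      QNVP.dq i (QNVP.fib ((m * C.r) • d)) - QNVP.fib ((m * C.r) • dqD i d) := fun C => by
    rw [← fib_dqD, dqD_smul, map_add]; abel
  simp only [e]
  exact ((fib_mul m d).dq i).sub (fib_mul m _)

/-- Integration by parts in velocity puts the derivative on the density. -/
theorem fib_dv (m : Obs E) (d : Den E) (i : Fin 2) :
    IsFieldForm fun C : CvF E => QNVP.fib (QNVP.dv i (m * C.r) • d) := by
  have e : ∀ C : CvF E, QNVP.fib (QNVP.dv i (m * C.r) • d) = -QNVP.fib ((m * C.r) • dvD i d) := fun C => by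
    have := fib_dvD i ((m * C.r) • d)
    rw [dvD_smul, map_add] at this
    exact eq_neg_of_add_eq_zero_left this
  simp only [e]
  exact (fib_mul m _).neg

end IsFieldForm

end Calculus

section Sharp

variable {E : Type} [NormedAddCommGroup E] [NormedSpace ℝ E] [FiniteDimensional ℝ E]

/-! ### Algebra of velocity averages -/

theorem av_mem (r : Den E) (F : Obs E) : av r F ∈ Fld E := fib_mem _

theorem av_add (r : Den E) (F G : Obs E) : av r (F + G) = av r F + av r G := by
  rw [av, add_smul, map_add]; rfl
theorem av_sub (r : Den E) (F G : Obs E) : av r (F - G) = av r F - av r G := by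
  rw [av, sub_smul, map_sub]; rfl
theorem av_neg (r : Den E) (F : Obs E) : av r (-F) = -av r F := by
  rw [av, neg_smul, map_neg]; rfl
theorem av_zero (r : Den E) : av r 0 = 0 := by
  rw [av, zero_smul, map_zero]
theorem av_smul (c : ℝ) (r : Den E) (F : Obs E) : av r (c • F) = c • av r F := by
  rw [av, smul_assoc, map_smul]; rfl
theorem av_mul {u : Obs E} (hu : u ∈ Fld E) (r : Den E) (F : Obs E) :
    av r (u * F) = u * av r F := by
  rw [av, mul_smul, fib_smul hu]; rfl
theorem av_mul_right {u : Obs E} (hu : u ∈ Fld E) (r : Den E) (F : Obs E) :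
    av r (F * u) = av r F * u := by
  rw [mul_comm, av_mul hu, mul_comm]
theorem av_smul_den (r : Den E) (F G : Obs E) : av (F • r) G = av r (F * G) := by
  rw [av, av, smul_smul, mul_comm]

/-! ### Representability of the bracket -/

theorem isFieldForm_av_dq (m : Obs E) (r : Den E) (i : Fin 2) :
    IsFieldForm fun C : CvF E => av r (dq i (m * C.r)) := IsFieldForm.fib_dq m r i

theorem isFieldForm_av_dv (m : Obs E) (r : Den E) (i : Fin 2) :
    IsFieldForm fun C : CvF E => av r (dv i (m * C.r)) := IsFieldForm.fib_dv m r i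

theorem isFieldForm_av (m : Obs E) (r : Den E) :
    IsFieldForm fun C : CvF E => av r (m * C.r) := IsFieldForm.fib_mul m r

theorem isFieldForm_av_dq_mul (m : Obs E) (r : Den E) (i : Fin 2) (F : Obs E) :
    IsFieldForm fun C : CvF E => av r (dq i (m * C.r) * F) := by
  simpa only [av, mul_smul] using IsFieldForm.fib_dq m (F • r) i

theorem isFieldForm_av_dv_mul (m : Obs E) (r : Den E) (i : Fin 2) (F : Obs E) :
    IsFieldForm fun C : CvF E => av r (dv i (m * C.r) * F) := by
  simpa only [av, mul_smul] using IsFieldForm.fib_dv m (F • r) i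

theorem IsFieldForm.dotO_left {T : CvF E → Fin 2 → Obs E} (h : ∀ i, IsFieldForm fun C => T C i)
    {u : Fin 2 → Obs E} (hu : ∀ i, u i ∈ Fld E) : IsFieldForm fun C => dotO (T C) u :=
  ((h 0).mul_right (hu 0)).add ((h 1).mul_right (hu 1))

theorem IsFieldForm.dotO_right {T : CvF E → Fin 2 → Obs E} (h : ∀ i, IsFieldForm fun C => T C i)
    {u : Fin 2 → Obs E} (hu : ∀ i, u i ∈ Fld E) : IsFieldForm fun C => dotO u (T C) :=
  ((h 0).mul_left (hu 0)).add ((h 1).mul_left (hu 1))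

theorem IsFieldForm.crossO_left {T : CvF E → Fin 2 → Obs E} (h : ∀ i, IsFieldForm fun C => T C i)
    {u : Fin 2 → Obs E} (hu : ∀ i, u i ∈ Fld E) : IsFieldForm fun C => crossO (T C) u :=
  ((h 1).mul_right (hu 0)).sub ((h 0).mul_right (hu 1))

theorem dotO_mem {u w : Fin 2 → Obs E} (hu : ∀ i, u i ∈ Fld E) (hw : ∀ i, w i ∈ Fld E) :
    dotO u w ∈ Fld E :=
  add_mem (mul_mem (hu _) (hw _)) (mul_mem (hu _) (hw _))

theorem crossO_mem {u w : Fin 2 → Obs E} (hu : ∀ i, u i ∈ Fld E) (hw : ∀ i, w i ∈ Fld E) :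
    crossO u w ∈ Fld E :=
  sub_mem (mul_mem (hu _) (hw _)) (mul_mem (hu _) (hw _))

theorem vortO_mem {m : Obs E} (hm : m ∈ Fld E) {P : Fin 2 → Obs E} (hP : ∀ i, P i ∈ Fld E) :
    vortO m P ∈ Fld E :=
  sub_mem (dq_mem_Fld _ (mul_mem hm (hP _))) (dq_mem_Fld _ (mul_mem hm (hP _)))

/-- For fixed `A` each summand is linear in `C` and built from components of `C` and their averages
by operations that preserve field forms. The representing family is the image of `A` under the
bundle map. -/
theorem representable_brE (ε : ℝ) {B : Obs E} (hB : B ∈ Fld E) (S : StF E) {m : Obs E}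
    (hm : m ∈ Fld E) (A : CvF E) :
    Representable fun C : CvF E =>
      brE ε B S.n m S.P S.r C.n C.P (m * C.r) A.n A.P (m * A.r) := by
  have hb : B - ε • vortO m S.P ∈ Fld E := sub_mem hB ((Fld E).smul_mem (vortO_mem hm S.hP) ε)
  have hav := fun F => av_mem S.r F
  have hten : ∀ F j, dq 0 (S.n * av S.r (dv 0 F * xi j)) + dq 1 (S.n * av S.r (dv 1 F * xi j)) ∈ Fld E :=
    fun F j => add_mem (dq_mem_Fld _ (mul_mem S.hn (hav _))) (dq_mem_Fld _ (mul_mem S.hn (hav _)))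
  unfold brE
  refine IsFieldForm.representable (.sub (.sub (.sub (.add (.add (.add (.sub (.neg (.smul ε
    (.mul_right (.sub ?_ ?_) S.hn))) (.smul ε ?_)) ?_) (.smul ε ?_)) ?_) (.smul ε (.mul_right
    (.sub ?_ ?_) S.hn))) (.mul_right (.mul_left ?_ hb) S.hn)) (.smul ε (.sub ?_ ?_)))
  · exact .dotO_left .snd fun i => add_mem (sub_mem (dq_mem_Fld _ A.hn) (dq_mem_Fld _ (hav _))) (hav _)
  · exact .dotO_right (fun i => .add (.sub (.dq .fst i) (.dq (isFieldForm_av m S.r) i))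
      (isFieldForm_av_dq m S.r i)) A.hP
  · refine .dotO_left (fun j => .sub (.dotO_left .snd fun i => dq_mem_Fld _ (A.hP _))
      (.dotO_right (fun i => .dq (.snd j) i) A.hP)) S.hP
  · exact .mul_right (.mul_left (.crossO_left .snd A.hP) hB) S.hn
  -- The derivatives of `m * A.r` are factors under the average; together with `S.r` they form
  -- densities against which `C` is tested.
  · have e : ∀ C : CvF E, fib (((dotO (fun i => dq i (m * C.r)) (fun i => dv i (m * A.r)) -
        dotO (fun i => dq i (m * A.r)) (fun i => dv i (m * C.r))) * S.n) • S.r) =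
        (av S.r (dq 0 (m * C.r) * dv 0 (m * A.r)) + av S.r (dq 1 (m * C.r) * dv 1 (m * A.r)) -
          (av S.r (dv 0 (m * C.r) * dq 0 (m * A.r)) + av S.r (dv 1 (m * C.r) * dq 1 (m * A.r)))) *
          S.n := fun C => by
      rw [← av_add, ← av_add, ← av_sub, ← av_mul_right S.hn, dotO, dotO, av]
      congr 2; ring
    simp only [e]
    exact .mul_right (.sub (.add (isFieldForm_av_dq_mul _ _ _ _) (isFieldForm_av_dq_mul _ _ _ _))
      (.add (isFieldForm_av_dv_mul _ _ _ _) (isFieldForm_av_dv_mul _ _ _ _))) S.hn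
  · have e : ∀ C : CvF E, fib (((B - ε • vortO m S.P) *
        crossO (fun i => dv i (m * C.r)) (fun i => dv i (m * A.r)) * S.n) • S.r) =
        (av S.r (dv 1 (m * C.r) * dv 0 (m * A.r)) - av S.r (dv 0 (m * C.r) * dv 1 (m * A.r))) *
          ((B - ε • vortO m S.P) * S.n) := fun C => by
      rw [← av_sub, ← av_mul_right (mul_mem hb S.hn), crossO, av]
      congr 2; ring
    simp only [e]
    exact .mul_right (.sub (isFieldForm_av_dv_mul _ _ _ _) (isFieldForm_av_dv_mul _ _ _ _))
      (mul_mem hb S.hn)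
  · exact .dotO_left (isFieldForm_av_dq m S.r) fun i => hav _
  · exact .dotO_right (isFieldForm_av_dv m S.r) fun i => hav _
  · exact .crossO_left (isFieldForm_av_dv m S.r) fun i => hav _
  · exact .dotO_left (fun i => .sub (.snd i) (isFieldForm_av_dv m S.r i)) fun j => hten _ j
  · exact .dotO_right (fun j => .add (.dq (.mul_left (isFieldForm_av_dv_mul m S.r 0 (xi j)) S.hn) 0)
      (.dq (.mul_left (isFieldForm_av_dv_mul m S.r 1 (xi j)) S.hn) 1))
      fun i => sub_mem (A.hP _) (hav _)

theorem brE_skew (ε : ℝ) (B n m : Obs E) (P : Fin 2 → Obs E) (r : Den E)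
    (Cn : Obs E) (X : Fin 2 → Obs E) (f : Obs E) (An : Obs E) (Y : Fin 2 → Obs E) (g : Obs E) :
    brE ε B n m P r Cn X f An Y g = -brE ε B n m P r An Y g Cn X f := by
  have e1 : ∀ F G : Obs E, fib (((dotO (fun i => dq i F) (fun i => dv i G) -
      dotO (fun i => dq i G) (fun i => dv i F)) * n) • r) = -fib (((dotO (fun i => dq i G)
        (fun i => dv i F) - dotO (fun i => dq i F) (fun i => dv i G)) * n) • r) := fun F G => by
    rw [← map_neg, ← neg_smul]; congr 2; ring
  have e2 : fib (((B - ε • vortO m P) * crossO (fun i => dv i f) (fun i => dv i g) * n) • r) =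
      -fib (((B - ε • vortO m P) * crossO (fun i => dv i g) (fun i => dv i f) * n) • r) := by
    rw [← map_neg, ← neg_smul]; congr 2; rw [crossO, crossO]; ring
  rw [brE, brE, e1 f g, e2]
  simp only [dotO, crossO, Algebra.smul_def]
  ring

/-- The bracket with respect to the density component of the second covector. -/
theorem brE_density (ε : ℝ) (B n m : Obs E) (P : Fin 2 → Obs E) (r : Den E)
    (Cn : Obs E) (X : Fin 2 → Obs E) (f : Obs E) (An : Obs E) (Y : Fin 2 → Obs E) (g : Obs E) :
    brE ε B n m P r Cn X f An Y g =
      brE ε B n m P r Cn X f 0 Y g - ε • (dotO X (fun i => dq i An) * n) := by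
  rw [brE, brE]
  simp only [dotO, crossO, Algebra.smul_def, map_zero]
  ring

theorem brE_zero_right (ε : ℝ) (B n m : Obs E) (P : Fin 2 → Obs E) (r : Den E)
    (Cn : Obs E) (X : Fin 2 → Obs E) (f : Obs E) : brE ε B n m P r Cn X f 0 0 0 = 0 := by
  rw [brE]
  have h1 : ∀ F : Obs E, fib ((0 * F) • r) = 0 := fun F => by rw [zero_mul, zero_smul, map_zero]
  simp [dotO, crossO, av_zero]

/-- The bracket with a covector that has only a density component in the first slot. -/
theorem brE_zero_left (ε : ℝ) (B n m : Obs E) (P : Fin 2 → Obs E) (r : Den E)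
    (Cn An : Obs E) (Y : Fin 2 → Obs E) (g : Obs E) :
    brE ε B n m P r Cn 0 0 An Y g = ε • (dotO Y (fun i => dq i Cn) * n) := by
  rw [brE_skew, brE_density, brE_zero_right]
  simp

end Sharp

section Nondegeneracy

variable {E : Type} [NormedAddCommGroup E] [NormedSpace ℝ E] [FiniteDimensional ℝ E]

/-! ### Nondegeneracy of the pairing -/

/-- The hypothesis says that the square of `d` has zero integral over phase space; positivity is
used first on the torus, then on each velocity plane. -/
theorem Den.eq_zero_of_tor_fib {d : Den E} {s : E} (h : tor (fib (d.obs • d)) s = 0) (q ξ : Vec) :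
    d.obs.fn (s, q, ξ) = 0 := by
  have h0 : ∀ q, 0 ≤ (fib (d.obs • d)).fn (s, q, 0) := fun q => by
    rw [fib_apply]; exact integral_nonneg fun ξ => mul_self_nonneg _
  have h1 := tor_eq_zero_of_nonneg (fib_mem _) h0 h q 0
  rw [fib_apply] at h1
  replace h1 := (integral_eq_zero_iff_of_nonneg (f := fun ξ => (d.obs • d).obs.fn (s, q, ξ))
    (fun ξ => mul_self_nonneg _) ((d.obs • d).integrable s q)).1 h1
  have hc : Continuous fun ξ => d.obs.fn (s, q, ξ) := d.obs.contDiff.continuous.comp (by fun_prop)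
  have h2 := Continuous.ae_eq_iff_eq volume (hc.mul hc) continuous_const |>.1 h1
  exact mul_self_eq_zero.1 (congrFun h2 ξ)

/-- A density that only depends on the velocity, with compact support. -/
def velocityBump (χ : ContDiffBump (0 : Vec)) (ξ₀ : Vec) : Den E := by
  let T : Dom E →L[ℝ] Vec := (ContinuousLinearMap.snd ℝ Vec Vec).comp
    (ContinuousLinearMap.snd ℝ E (Vec × Vec))
  let g : Vec → ℝ := fun ξ => χ (ξ - ξ₀)
  have hg : ContDiff ℝ ∞ g := χ.contDiff.comp (by fun_prop)
  have hs : HasCompactSupport g := χ.hasCompactSupport.comp_homeomorph (Homeomorph.subRight ξ₀)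
  have hb : ∀ k m : ℕ, ∃ C : ℝ, ∀ (s : E) (q ξ : Vec),
      (1 + ‖ξ‖) ^ k * ‖iteratedFDeriv ℝ m (g ∘ T) (s, q, ξ)‖ ≤ C := fun k m => by
    have hc : Continuous fun ξ => (1 + ‖ξ‖) ^ k * ‖iteratedFDeriv ℝ m g ξ‖ :=
      (by fun_prop : Continuous fun ξ : Vec => (1 + ‖ξ‖) ^ k).mul
        (hg.continuous_iteratedFDeriv (by exact_mod_cast le_top)).norm
    have hcs : HasCompactSupport fun ξ => (1 + ‖ξ‖) ^ k * ‖iteratedFDeriv ℝ m g ξ‖ :=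
      (hs.iteratedFDeriv m).norm.mul_left
    obtain ⟨C, hC⟩ := hc.bounded_above_of_compact_support hcs
    refine ⟨‖T‖ ^ m * C, fun s q ξ => ?_⟩
    calc _ ≤ (1 + ‖ξ‖) ^ k * (‖T‖ ^ m * ‖iteratedFDeriv ℝ m g (T (s, q, ξ))‖) := by
          gcongr; exact iteratedFDeriv_comp_clm_norm_le hg T m _
      _ = ‖T‖ ^ m * ((1 + ‖ξ‖) ^ k * ‖iteratedFDeriv ℝ m g ξ‖) := by
          rw [mul_left_comm]; rfl
      _ ≤ _ := by gcongr; exact (le_abs_self _).trans (hC ξ)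
  refine ⟨⟨g ∘ T, hg.comp T.contDiff, fun _ _ _ _ => rfl, fun K _ m => ?_⟩,
    mem_denIdeal.2 fun K _ k m => ?_⟩
  · obtain ⟨C, hC⟩ := hb 0 m
    exact ⟨0, C, fun s _ q ξ => by simpa using hC s q ξ⟩
  · obtain ⟨C, hC⟩ := hb k m
    exact ⟨C, fun s _ q ξ => hC s q ξ⟩

theorem velocityBump_fn (χ : ContDiffBump (0 : Vec)) (ξ₀ : Vec) (s : E) (q ξ : Vec) :
    (velocityBump χ ξ₀ : Den E).obs.fn (s, q, ξ) = χ (ξ - ξ₀) := rfl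

/-- An observable need not decay and cannot be tested against itself. It is first multiplied by a
velocity bump equal to 1 at `ξ`, which makes it a density. -/
theorem Obs.eq_zero_of_tor_fib {γ : Obs E} {s : E} (h : ∀ d : Den E, tor (fib (γ • d)) s = 0)
    (q ξ : Vec) : γ.fn (s, q, ξ) = 0 := by
  let χ : ContDiffBump (0 : Vec) := default
  have h0 := Den.eq_zero_of_tor_fib (d := γ • velocityBump χ ξ) (s := s) (by
    rw [Den.obs_smul, mul_smul]
    exact h _) q ξ
  rw [Den.obs_smul, Obs.fn_mul, Pi.mul_apply, velocityBump_fn, sub_self] at h0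
  have h1 : χ (0 : Vec) = 1 := χ.one_of_mem_closedBall (by simp [χ.rIn_pos.le])
  rwa [h1, mul_one] at h0

/-- Each component of the difference `V - V'` is itself an admissible covector component, so the
pairing yields the integral of its square. -/
theorem StF.at_eq_of_pair {V V' : StF E} {s : E} (h : ∀ C : CvF E, pair C V s = pair C V' s) :
    V.at s = V'.at s := by
  have h' : ∀ C : CvF E, tor (C.n * (V.n - V'.n) + (C.P 0 * (V.P 0 - V'.P 0) +
      C.P 1 * (V.P 1 - V'.P 1)) + fib (C.r • (V.r - V'.r))) s = 0 := fun C => by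
    have h1 := h C
    rw [pair, pair] at h1
    rw [← sub_eq_zero, ← Pi.sub_apply, ← map_sub] at h1
    rw [← h1]
    refine congrFun (congrArg tor ?_) s
    rw [smul_sub, map_sub]
    ring
  have hn := h' ⟨V.n - V'.n, 0, 0, sub_mem V.hn V'.hn, fun _ => zero_mem _⟩
  have hP0 := h' ⟨0, ![V.P 0 - V'.P 0, 0], 0, zero_mem _, fun i => by
    fin_cases i; exacts [sub_mem (V.hP 0) (V'.hP 0), zero_mem _]⟩
  have hP1 := h' ⟨0, ![0, V.P 1 - V'.P 1], 0, zero_mem _, fun i => by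
    fin_cases i; exacts [zero_mem _, sub_mem (V.hP 1) (V'.hP 1)]⟩
  have hr := h' ⟨0, 0, (V.r - V'.r).obs, zero_mem _, fun _ => zero_mem _⟩
  simp only [zero_mul, zero_add, add_zero, zero_smul, map_zero, Pi.zero_apply,
    Matrix.cons_val_zero, Matrix.cons_val_one] at hn hP0 hP1 hr
  refine State.ext (fun q => ?_) (fun q i => ?_) fun q ξ => ?_
  · exact sub_eq_zero.1 (tor_self_eq_zero (sub_mem V.hn V'.hn) hn q 0)
  · fin_cases i
    · exact sub_eq_zero.1 (tor_self_eq_zero (sub_mem (V.hP 0) (V'.hP 0)) hP0 q 0)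
    · exact sub_eq_zero.1 (tor_self_eq_zero (sub_mem (V.hP 1) (V'.hP 1)) hP1 q 0)
  · exact sub_eq_zero.1 (Den.eq_zero_of_tor_fib hr q ξ)

theorem State.eq_of_pairing {v w : State} (h : ∀ β, pairing β v = pairing β w) : v = w :=
  StF.at_eq_of_pair (V := constState (Fin 0 → ℝ) v) (V' := constState (Fin 0 → ℝ) w) (s := 0)
    fun C => by rw [← pairing_at, ← pairing_at]; exact h _

/-! ### Tangent vectors and normalized covectors -/

/-- Families of triples with constant density and divergence-free momentum. -/
def StF.Tan (V : StF E) : Prop := (∀ i, dq i V.n = 0) ∧ divO V.P = 0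

/-- Families of covectors with constant density component and divergence-free momentum component. -/
def CvF.Nrm (A : CvF E) : Prop := (∀ i, dq i A.n = 0) ∧ divO A.P = 0

/-- Triples with constant density and divergence-free momentum. -/
def IsTan (v : State) : Prop := (∀ q, grad v.n q = 0) ∧ ∀ q, divg v.P q = 0

/-- Covectors with constant density component and divergence-free momentum component. -/
def IsNrm (α : Covector) : Prop := (∀ q, grad α.n q = 0) ∧ ∀ q, divg α.P q = 0

theorem StF.tan_iff (V : StF E) : V.Tan ↔ ∀ s, IsTan (V.at s) :=
  ⟨fun h s => ⟨(dq_eq_zero_iff_grad V.hn).1 h.1 s, (divO_eq_zero_iff V.hP).1 h.2 s⟩,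
    fun h => ⟨(dq_eq_zero_iff_grad V.hn).2 fun s => (h s).1,
      (divO_eq_zero_iff V.hP).2 fun s => (h s).2⟩⟩

theorem CvF.nrm_iff (A : CvF E) : A.Nrm ↔ ∀ s, IsNrm (A.at s) :=
  ⟨fun h s => ⟨(dq_eq_zero_iff_grad A.hn).1 h.1 s, (divO_eq_zero_iff A.hP).1 h.2 s⟩,
    fun h => ⟨(dq_eq_zero_iff_grad A.hn).2 fun s => (h s).1,
      (divO_eq_zero_iff A.hP).2 fun s => (h s).2⟩⟩

theorem IsTan.const {v : State} (h : IsTan v) : (constState E v).Tan :=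
  (StF.tan_iff _).2 fun _ => h

theorem IsNrm.const {α : Covector} (h : IsNrm α) : (constCovector E α).Nrm :=
  (CvF.nrm_iff _).2 fun _ => h

/-- The density and momentum components of a normalized covector are themselves components of
tangent vectors and can be tested against themselves; the remaining component is tested by arbitrary
densities. -/
theorem CvF.Nrm.at_eq_zero {A : CvF E} (hA : A.Nrm) {s : E}
    (h : ∀ V : StF E, V.Tan → pair A V s = 0) : A.at s = 0 := by
  have hn := h ⟨A.n, 0, 0, A.hn, fun _ => zero_mem _⟩ ⟨hA.1, by simp [divO]⟩
  have hP := h ⟨0, A.P, 0, zero_mem _, A.hP⟩ ⟨by simp, hA.2⟩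
  have hr := fun d => h ⟨0, 0, d, zero_mem _, fun _ => zero_mem _⟩ ⟨by simp, by simp [divO]⟩
  simp only [pair, mul_zero, zero_add, add_zero, smul_zero, map_zero, Pi.zero_apply] at hn hP hr
  have h0 := tor_eq_zero_of_nonneg (add_mem (mul_mem (A.hP 0) (A.hP 0))
    (mul_mem (A.hP 1) (A.hP 1))) (fun q => add_nonneg (mul_self_nonneg _) (mul_self_nonneg _)) hP
  refine Covector.ext (fun q => tor_self_eq_zero A.hn hn q 0) (fun q i => ?_)
    fun q ξ => Obs.eq_zero_of_tor_fib hr q ξ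
  have h1 := (add_eq_zero_iff_of_nonneg (mul_self_nonneg _) (mul_self_nonneg _)).1 (h0 q 0)
  fin_cases i
  exacts [mul_self_eq_zero.1 h1.1, mul_self_eq_zero.1 h1.2]

/-- The difference of two families of covectors. -/
def CvF.sub (A A' : CvF E) : CvF E :=
  ⟨A.n - A'.n, fun i => A.P i - A'.P i, A.r - A'.r, sub_mem A.hn A'.hn,
    fun i => sub_mem (A.hP i) (A'.hP i)⟩

theorem pair_sub_left (A A' : CvF E) (V : StF E) : pair (A.sub A') V = pair A V - pair A' V := by
  rw [pair, pair, pair, CvF.sub, ← map_sub]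
  congr 1
  rw [sub_smul, map_sub]
  ring

theorem CvF.Nrm.sub {A A' : CvF E} (hA : A.Nrm) (hA' : A'.Nrm) : (A.sub A').Nrm := by
  refine ⟨fun i => ?_, ?_⟩
  · rw [CvF.sub, map_sub, hA.1, hA'.1, sub_zero]
  · have h1 := hA.2
    have h2 := hA'.2
    rw [divO] at h1 h2 ⊢
    simp only [CvF.sub, map_sub]
    linear_combination h1 - h2

theorem CvF.at_sub (A A' : CvF E) (s : E) : (A.sub A').at s = A.at s - A'.at s := rfl

theorem CvF.Nrm.at_eq {A A' : CvF E} (hA : A.Nrm) (hA' : A'.Nrm) {s : E}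
    (h : ∀ V : StF E, V.Tan → pair A V s = pair A' V s) : A.at s = A'.at s := by
  rw [← sub_eq_zero, ← CvF.at_sub]
  exact (hA.sub hA').at_eq_zero fun V hV => by
    rw [pair_sub_left, Pi.sub_apply, h V hV, sub_self]

theorem IsNrm.eq {α α' : Covector} (hα : IsNrm α) (hα' : IsNrm α')
    (h : ∀ v, IsTan v → pairing α v = pairing α' v) : α = α' :=
  (hα.const (E := Fin 0 → ℝ)).at_eq (s := 0) hα'.const fun V hV => by
    rw [← pairing_at, ← pairing_at]
    exact h _ ((StF.tan_iff V).1 hV 0)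

/-- Replacing the density component by its mean and the momentum component by its Leray projection
does not change the pairing with tangent vectors, whose density is constant and whose momentum is
orthogonal to gradients. This yields functional derivatives and the shape of the annihilator. -/
theorem exists_normalized (A : CvF E) : ∃ A' : CvF E, A'.Nrm ∧ A'.r = A.r ∧
    tor A'.n = tor A.n ∧ (∃ ψ ∈ Fld E, ∀ i, A.P i = A'.P i + dq i ψ) ∧
    ∀ V : StF E, V.Tan → pair A V = pair A' V := by
  obtain ⟨c, hc, hc0, hct⟩ := exists_mean A.n
  obtain ⟨X, ψ, hψ, hX, hX0, hY⟩ := exists_leray A.hP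
  refine ⟨⟨c, X, A.r, hc, hX⟩, ⟨hc0, hX0⟩, rfl, hct, ⟨ψ, hψ, hY⟩, fun V hV => ?_⟩
  have h1 : tor (A.n * V.n) = tor (c * V.n) := by
    funext s
    rw [mul_comm, tor_const V.hn hV.1, mul_comm c, tor_const V.hn hV.1, hct]
  have h2 := tor_dotO_dq_eq_zero hV.2 ψ
  rw [dotO] at h2
  simp only [pair, map_add] at h1 h2 ⊢
  rw [h1, hY, hY]
  simp only [add_mul, map_add]
  rw [mul_comm (dq 0 ψ), mul_comm (dq 1 ψ)]
  linear_combination h2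

/-! ### Families in the phase space and in the submanifold -/

theorem StF.exists_inverse {S : StF E} (h : ∀ s, S.at s ∈ phaseSpace) : ∃ m ∈ Fld E, S.n * m = 1 :=
  QNVP.exists_inverse S.hn h

theorem StF.tan_of_mem {S : StF E} (h : ∀ s, S.at s ∈ Sig) : S.Tan :=
  (StF.tan_iff S).2 fun s => (h s).2

/-- Affine families of triples. -/
def StF.line (S V : StF E) (l : E →L[ℝ] ℝ) : StF E :=
  ⟨S.n + parFld l l.contDiff * V.n, fun i => S.P i + parFld l l.contDiff * V.P i,
    S.r + parFld l l.contDiff • V.r, add_mem S.hn (mul_mem (parFld_mem _ _) V.hn),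
    fun i => add_mem (S.hP i) (mul_mem (parFld_mem _ _) (V.hP i))⟩

theorem StF.line_tan {S V : StF E} (hS : S.Tan) (hV : V.Tan) (l : E →L[ℝ] ℝ) :
    (S.line V l).Tan := by
  have h := dq_parFld l l.contDiff
  refine ⟨fun i => ?_, ?_⟩
  · simp [StF.line, hS.1, hV.1, h]
  · have h1 := hS.2
    have h2 := hV.2
    rw [divO] at h1 h2 ⊢
    simp only [StF.line, map_add, Derivation.leibniz, h, smul_eq_mul, mul_zero, add_zero]
    linear_combination h1 + parFld l l.contDiff * h2

theorem dt_const_Obs {u : Obs E} (e : E) (h : ∀ s q ξ, u.fn (s, q, ξ) = u.fn (0, q, ξ)) :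
    dt e u = 0 :=
  Obs.ext fun s q ξ => by
    rw [fn_dt]
    have : (fun s => u.fn (s, q, ξ)) = fun _ => u.fn (0, q, ξ) := funext fun s => h s q ξ
    rw [this]; simp [Obs.fn_zero]

theorem line_isVelocity (σ v : State) :
    IsVelocity (fun t : ℝ => σ + t • v) 0 v := by
  have h : ∀ a b : ℝ, HasDerivAt (fun t : ℝ => a + t * b) b 0 := fun a b => by
    simpa using ((hasDerivAt_id (0 : ℝ)).mul_const b).const_add a
  exact ⟨fun q => h _ _, fun q => hasDerivAt_pi.2 fun i => h _ _, fun q ξ => h _ _⟩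

theorem SmoothStateFamily.mono {F : Type} [NormedAddCommGroup F] [NormedSpace ℝ F] {U V : Set F}
    {σ : F → State} (h : SmoothStateFamily U σ) (hV : V ⊆ U) : SmoothStateFamily V σ :=
  ⟨h.1.mono (prod_mono hV le_rfl), h.2.1.mono (prod_mono hV le_rfl),
    h.2.2.1.mono (prod_mono hV le_rfl), fun K hK => h.2.2.2 K (hK.trans hV)⟩

/-- The defining equations are linear, so differentiating them along a curve gives one inclusion.
Conversely a vector satisfying them is the velocity of a straight line. -/
theorem tangentSpace_Sig {σ : State} (hσ : σ ∈ Sig) : tangentSpace Sig σ = {v | IsTan v} := by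
  ext v
  constructor
  · rintro ⟨U, c, hU, h0, hc, hcN, -, hv⟩
    obtain ⟨φ, hφ, hφU, hev⟩ := exists_cutoff hU h0
    set S := liftState hφ hU hφU hc
    have hS : S.Tan := StF.tan_of_mem fun s => hcN _ (hφU s)
    have hv' : (S.deriv 1).at 0 = v := by
      refine (S.isVelocity 0).unique (hv.congr ?_)
      filter_upwards [hev] with s hs
      change c (φ s) = c s
      rw [hs]
    change IsTan v
    rw [← hv']
    refine (StF.tan_iff _).1 ⟨fun i => ?_, ?_⟩ 0
    · change dq i (dt 1 S.n) = 0
      rw [← dt_dq, hS.1, map_zero]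
    · have := congrArg (dt (1 : ℝ)) hS.2
      rw [divO, map_add, dt_dq, dt_dq, map_zero] at this
      exact this
  · intro hv
    set S := (constState ℝ σ).line (constState ℝ v) (ContinuousLinearMap.id ℝ ℝ)
    have hS : S.Tan := StF.line_tan (IsTan.const hσ.2) hv.const _
    have hn : ∀ t q, (S.at t).n q = (S.at t).n 0 := fun t q => fn_eq_of_dq_eq_zero S.hn hS.1 t q 0
    -- Along the line the density stays constant in space, so it vanishes nowhere as soon as it is
    -- nonzero at the origin of the torus; this is an open condition on `t`.
    refine ⟨{t | (S.at t).n 0 ≠ 0}, S.at, ?_, ?_, S.smooth.mono (subset_univ _), ?_, ?_, ?_⟩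
    · have : Continuous fun t => (S.at t).n 0 := S.n.contDiff.continuous.comp (by fun_prop)
      exact isOpen_ne_fun this continuous_const
    · change σ.n 0 + 0 * v.n 0 ≠ 0
      rw [zero_mul, add_zero]
      exact hσ.1 0
    · exact fun t ht => ⟨fun q => by rw [hn]; exact ht, (StF.tan_iff _).1 hS t⟩
    · change σ + (0 : ℝ) • v = σ
      rw [zero_smul, add_zero]
    · exact line_isVelocity σ v

end Nondegeneracy

/-! ### The Poisson–Dirac conditions -/

section Constants

variable {E : Type} [NormedAddCommGroup E] [NormedSpace ℝ E] [FiniteDimensional ℝ E]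

theorem tor_mul_const {u : Obs E} (hu : u ∈ Fld E) (h : ∀ i, dq i u = 0) (f : Obs E) :
    tor (f * u) = fun s => u.fn (s, 0, 0) * tor f s :=
  funext fun s => by rw [mul_comm, tor_const hu h]

theorem tor_mul_const_eq_zero {u : Obs E} (hu : u ∈ Fld E) (h : ∀ i, dq i u = 0) {f : Obs E}
    (hf : tor f = 0) : tor (f * u) = 0 := by
  rw [tor_mul_const hu h, hf]; simp; rfl

theorem tor_mul_const_congr {u : Obs E} (hu : u ∈ Fld E) (h : ∀ i, dq i u = 0) {f g : Obs E}
    (hf : tor f = tor g) : tor (f * u) = tor (g * u) := by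
  rw [tor_mul_const hu h, tor_mul_const hu h, hf]

/-- The energy identity: the integral of |∇u|² is minus that of `u` times its Laplacian. -/
theorem dq_eq_zero_of_lap {u : Obs E} (hu : u ∈ Fld E) (h : lap u = 0) (i : Fin 2) :
    dq i u = 0 := by
  have h1 : tor (dq 0 u * dq 0 u + dq 1 u * dq 1 u) = 0 := by
    have h2 : tor (u * lap u) = 0 := by rw [h, mul_zero, map_zero]
    rw [lap, mul_add, map_add, tor_mul_dq 0 u (dq 0 u), tor_mul_dq 1 u (dq 1 u)] at h2
    rw [map_add]
    linear_combination -h2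
  have h0 := fun s => tor_eq_zero_of_nonneg (s := s) (add_mem (mul_mem (dq_mem_Fld 0 hu) (dq_mem_Fld 0 hu))
    (mul_mem (dq_mem_Fld 1 hu) (dq_mem_Fld 1 hu)))
    (fun q => add_nonneg (mul_self_nonneg _) (mul_self_nonneg _)) (congrFun h1 s)
  refine Obs.ext fun s q ξ => ?_
  have h3 := (add_eq_zero_iff_of_nonneg (mul_self_nonneg _) (mul_self_nonneg _)).1 (h0 s q ξ)
  fin_cases i
  exacts [mul_self_eq_zero.1 h3.1, mul_self_eq_zero.1 h3.2]

theorem dq_inverse {n m : Obs E} (h : n * m = 1) (hn : ∀ i, dq i n = 0) (i : Fin 2) :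
    dq i m = 0 := by
  have h1 : n * dq i m = 0 := by
    have := congrArg (dq i) h
    rwa [Derivation.leibniz, hn, smul_zero, add_zero, Derivation.map_one_eq_zero, smul_eq_mul] at this
  calc dq i m = m * (n * dq i m) := by rw [← mul_assoc, mul_comm m, h, one_mul]
    _ = 0 := by rw [h1, mul_zero]

theorem eq_zero_of_tor_mul {u : Obs E} (hu : u ∈ Fld E) (h : ∀ v ∈ Fld E, tor (v * u) = 0) :
    u = 0 :=
  Obs.ext fun s q ξ => tor_self_eq_zero hu (congrFun (h u hu) s) q ξ

end Constants

/-- A parameter space with one point. -/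
abbrev Pt : Type := Fin 0 → ℝ

theorem Obs.ext_pt {f g : Obs Pt} (h : ∀ q ξ, f.fn (0, q, ξ) = g.fn (0, q, ξ)) : f = g :=
  Obs.ext fun s q ξ => by rw [Subsingleton.elim s 0]; exact h q ξ

theorem CvF.eq_of_at {A A' : CvF Pt} (h : A.at 0 = A'.at 0) : A = A' :=
  CvF.ext_at fun s => by rw [Subsingleton.elim s 0]; exact h

theorem StF.eq_of_at {A A' : StF Pt} (h : A.at 0 = A'.at 0) : A = A' :=
  StF.ext_at fun s => by rw [Subsingleton.elim s 0]; exact h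

theorem pair_constCovector (α : Covector) (V : StF Pt) :
    pair (constCovector Pt α) V 0 = pairing α (V.at 0) := (pairing_at _ _ _).symm

theorem pair_constState (A : CvF Pt) (v : State) :
    pair A (constState Pt v) 0 = pairing (A.at 0) v := (pairing_at _ _ _).symm

theorem exists_inverse_const {z : State} (hz : z ∈ phaseSpace) :
    ∃ m ∈ Fld Pt, (constState Pt z).n * m = 1 :=
  StF.exists_inverse fun _ => hz

/-- Existence is representability of the bracket, uniqueness is nondegeneracy of the pairing; a
constant family over a one-point parameter space turns the ring statements into pointwise ones. -/
theorem existsUnique_sharp (ε : ℝ) (B : ScalarField) {z : State} (hz : z ∈ phaseSpace)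
    (α : Covector) : ∃! v, IsSharp (bracketE ε B) z α v := by
  obtain ⟨m, hm, hnm⟩ := exists_inverse_const hz
  obtain ⟨V, hV⟩ := representable_brE ε (constFld_mem B) (constState Pt z) hm (constCovector Pt α)
  refine ⟨V.at 0, fun β => ?_, fun w hw => State.eq_of_pairing fun β => ?_⟩
  · rw [← pair_constCovector, ← hV]
    exact (bracketE_at ε B (constState Pt z) (constCovector Pt β) (constCovector Pt α) hm hnm 0).symm
  · rw [hw, ← pair_constCovector, ← hV]
    exact bracketE_at ε B (constState Pt z) (constCovector Pt β) (constCovector Pt α) hm hnm 0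

theorem IsSharp.pair_eq {ε : ℝ} {B : ScalarField} {z : State} {α : Covector}
    {v : State} (h : IsSharp (bracketE ε B) z α v) {m : Obs Pt} (hm : m ∈ Fld Pt)
    (hnm : (constState Pt z).n * m = 1) (C : CvF Pt) :
    pair C (constState Pt v) = tor (brE ε (constFld Pt B) (constState Pt z).n m (constState Pt z).P
      (constState Pt z).r C.n C.P (m * C.r) (constCovector Pt α).n (constCovector Pt α).P
      (m * (constCovector Pt α).r)) := by
  funext s
  rw [Subsingleton.elim s 0, pair_constState, h]
  exact bracketE_at ε B (constState Pt z) C (constCovector Pt α) hm hnm 0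

/-- The annihilator consists of the covectors `(η, ∇φ, 0)` with `η` of mean zero. -/
theorem exists_potential_of_mem_annihilator {σ : State} (hσ : σ ∈ Sig) {α : Covector}
    (h : α ∈ annihilator Sig σ) : (∃ φ ∈ Fld Pt, (constCovector Pt α).P = fun i => dq i φ) ∧
      (constCovector Pt α).r = 0 := by
  obtain ⟨A', hA', hr, -, ⟨ψ, hψ, hP⟩, hp⟩ := exists_normalized (constCovector Pt α)
  have h0 : A'.at 0 = 0 := hA'.at_eq_zero fun V hV => by
    rw [← hp V hV, pair_constCovector]
    refine h _ ?_
    rw [tangentSpace_Sig hσ]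
    exact (StF.tan_iff V).1 hV 0
  have h1 : A' = ⟨0, 0, 0, zero_mem _, fun _ => zero_mem _⟩ := CvF.eq_of_at h0
  refine ⟨⟨ψ, hψ, funext fun i => ?_⟩, ?_⟩
  · rw [hP, h1]; simp
  · rw [← hr, h1]

theorem mem_annihilator {σ : State} (hσ : σ ∈ Sig) {η : Obs Pt} (hη : η ∈ Fld Pt) (h : tor η = 0) :
    (CvF.mk η 0 0 hη fun _ => zero_mem _).at 0 ∈ annihilator Sig σ := by
  intro v hv
  rw [tangentSpace_Sig hσ] at hv
  have hV : (constState Pt v).Tan := IsTan.const hv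
  have h2 := congrFun (tor_mul_const_eq_zero (constState Pt v).hn hV.1 h) 0
  rw [← pair_constState, pair]
  simpa using h2

/-- A covector (η, ∇φ, 0) whose image is tangent has ∇φ = 0 by the density component and ∇η = 0 by
the momentum component; each step is a Laplace equation on the torus, and `ε ≠ 0` is needed in both.
-/
theorem poissonDirac_dirac {ε : ℝ} (hε : ε ≠ 0) (B : ScalarField) {σ : State} (hσ : σ ∈ Sig) :
    tangentSpace Sig σ ∩ {v | ∃ α ∈ annihilator Sig σ, IsSharp (bracketE ε B) σ α v} = {0} := by
  rw [tangentSpace_Sig hσ]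
  ext v
  simp only [mem_inter_iff, mem_singleton_iff]
  constructor
  swap
  · rintro rfl
    refine ⟨⟨fun q => ?_, fun q => ?_⟩, 0, fun w _ => ?_, ?_⟩
    · change grad (fun _ => (0 : ℝ)) q = 0
      funext i; simp [grad]
    · change divg (fun _ _ => (0 : ℝ)) q = 0
      simp [divg]
    · change pairing ((CvF.mk (0 : Obs Pt) 0 0 (zero_mem _) fun _ => zero_mem _).at 0) w = 0
      rw [← pair_constState]; simp [pair]
    · intro β
      obtain ⟨m, hm, hnm⟩ := exists_inverse_const hσ.1
      have h1 := bracketE_at ε B (constState Pt σ) (constCovector Pt β)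
        (CvF.mk (0 : Obs Pt) 0 0 (zero_mem _) fun _ => zero_mem _) hm hnm 0
      rw [mul_zero, brE_zero_right, map_zero] at h1
      refine Eq.trans ?_ h1.symm
      change pairing β ((StF.mk (0 : Obs Pt) 0 0 (zero_mem _) fun _ => zero_mem _).at 0) = 0
      rw [← pair_constCovector]; simp [pair]
  rintro ⟨hv, α, hα, hs⟩
  obtain ⟨m, hm, hnm⟩ := exists_inverse_const hσ.1
  obtain ⟨⟨φ, hφ, hP⟩, hr⟩ := exists_potential_of_mem_annihilator hσ hα
  have key := hs.pair_eq hm hnm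
  have hS : (constState Pt σ).Tan := IsTan.const hσ.2
  have hV : (constState Pt v).Tan := IsTan.const hv
  set S := constState Pt σ
  set V := constState Pt v with hVdef
  set A := constCovector Pt α
  rw [hP, hr, mul_zero] at key
  -- Testing against covectors with only a density component reads off the density of the image.
  have hVn : V.n + ε • (S.n * lap φ) = 0 := by
    have hl : lap φ ∈ Fld Pt := divO_mem (X := fun i => dq i φ) fun i => dq_mem_Fld i hφ
    refine eq_zero_of_tor_mul (add_mem V.hn ((Fld Pt).smul_mem (mul_mem S.hn hl) ε)) fun u hu => ?_
    have h1 := key ⟨u, 0, 0, hu, fun _ => zero_mem _⟩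
    rw [mul_zero, brE_zero_left, map_smul] at h1
    have h2 : tor (dotO (fun i => dq i φ) (fun i => dq i u) * S.n) = -tor (u * (S.n * lap φ)) := by
      rw [tor_mul_const S.hn hS.1, tor_dotO_dq, ← mul_assoc, mul_comm u, mul_assoc]
      funext s
      rw [Pi.neg_apply, Pi.neg_apply, tor_const S.hn hS.1, mul_comm u]
      simp only [divO, lap]; ring
    rw [h2] at h1
    simp only [pair, Pi.zero_apply, zero_mul, add_zero, zero_smul, map_zero] at h1
    rw [mul_add, map_add, h1, mul_smul_comm, map_smul]
    simp
  -- `V.n` is spatially constant because `V` is tangent, and has mean zero because it is a constant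
  -- times a Laplacian.
  have hVn0 : V.n = 0 := by
    have h1 : tor V.n = 0 := by
      rw [eq_neg_of_add_eq_zero_left hVn, map_neg, map_smul, mul_comm,
        tor_mul_const_eq_zero (f := lap φ) S.hn hS.1 (tor_divO fun i => dq i φ), smul_zero, neg_zero]
    exact Obs.ext fun s q ξ =>
      tor_self_eq_zero V.hn (congrFun (tor_mul_const_eq_zero V.hn hV.1 h1) s) q ξ
  have hlap : lap φ = 0 := by
    rw [hVn0, zero_add] at hVn
    have h1 := (smul_eq_zero_iff_right hε).1 hVn
    calc lap φ = m * (S.n * lap φ) := by rw [← mul_assoc, mul_comm m, hnm, one_mul]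
      _ = 0 := by rw [h1, mul_zero]
  have hφ0 : (fun i => dq i φ) = 0 := funext fun i => dq_eq_zero_of_lap hφ hlap i
  rw [hφ0] at key
  -- With ∇φ = 0 only the density component η is left, and its image is (0, -εn∇η, 0).
  let V' : StF Pt := ⟨0, fun i => -(ε • (S.n * dq i A.n)), 0, zero_mem _,
    fun i => neg_mem ((Fld Pt).smul_mem (mul_mem S.hn (dq_mem_Fld i A.hn)) ε)⟩
  have hVV : V = V' := StF.eq_of_at (StF.at_eq_of_pair fun C => by
    rw [key C, brE_density, brE_zero_right, pair]
    refine congrFun (congrArg tor ?_) 0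
    simp only [V', dotO, smul_zero, map_zero, mul_zero, Algebra.smul_def]
    ring)
  have hA : ∀ i, dq i A.n = 0 := by
    have h1 := hV.2
    rw [hVV] at h1
    refine dq_eq_zero_of_lap A.hn ?_
    have h2 : ε • (S.n * lap A.n) = 0 := by
      simp only [V', divO, map_neg, Derivation.map_smul, Derivation.leibniz, hS.1, mul_zero, add_zero,
        smul_eq_mul] at h1
      rw [lap, mul_add, smul_add]
      linear_combination -h1
    have h3 := (smul_eq_zero_iff_right hε).1 h2
    calc lap A.n = m * (S.n * lap A.n) := by rw [← mul_assoc, mul_comm m, hnm, one_mul]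
      _ = 0 := by rw [h3, mul_zero]
  have h0 : V = ⟨0, 0, 0, zero_mem _, fun _ => zero_mem _⟩ := by
    rw [hVV]
    simp only [V', hA, mul_zero, smul_zero, neg_zero]
    rfl
  change V.at 0 = 0
  rw [h0]; rfl

/-- Vanishing on the image of the annihilator means, by skewness, that the image of the extension is
killed by all (η, ∇φ, 0) in the annihilator. The momentum and phase space components are kept
normalized, and the density component is chosen so that the momentum of the image becomes
divergence-free. -/
theorem poissonDirac_extension {ε : ℝ} (hε : ε ≠ 0) (B : ScalarField) {σ : State} (hσ : σ ∈ Sig)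
    (a : Covector) : ∃ α, IsTransverseExtension (bracketE ε B) Sig σ a α := by
  obtain ⟨m, hm, hnm⟩ := exists_inverse_const hσ.1
  have hS : (constState Pt σ).Tan := IsTan.const hσ.2
  obtain ⟨A', hA', hr, ht, -, hp⟩ := exists_normalized (constCovector Pt a)
  set S := constState Pt σ
  -- `V` is the image before a density component is added. Adding η changes its momentum by -εn∇η,
  -- whence the equation εnΔη = div V.P.
  obtain ⟨V, hV⟩ := representable_brE ε (constFld_mem B) S hm
    ⟨0, A'.P, A'.r, zero_mem _, A'.hP⟩
  have hD : tor (ε⁻¹ • (divO V.P * m)) = 0 := by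
    rw [map_smul, tor_mul_const_eq_zero hm (dq_inverse hnm hS.1) (tor_divO _), smul_zero]
  obtain ⟨η₀, hη₀, hl⟩ := exists_lap_eq ((Fld Pt).smul_mem (mul_mem (divO_mem V.hP) hm) ε⁻¹) hD
  obtain ⟨k, hk, hk0, hkt⟩ := exists_mean (A'.n - η₀)
  -- The constant `k` restores the mean of the original density component; only the mean is seen by
  -- tangent vectors.
  have hη : η₀ + k ∈ Fld Pt := add_mem hη₀ hk
  have hlap : ε • (S.n * lap (η₀ + k)) = divO V.P := by
    have : lap (η₀ + k) = lap η₀ := by simp [lap, hk0]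
    rw [this, hl, mul_smul_comm, smul_smul, mul_inv_cancel₀ hε, one_smul, mul_left_comm, hnm, mul_one]
  refine ⟨(CvF.mk (η₀ + k) A'.P A'.r hη A'.hP).at 0, fun v hv => ?_, fun γ hγ w hw => ?_⟩
  · rw [tangentSpace_Sig hσ] at hv
    have hv' : (constState Pt v).Tan := IsTan.const hv
    have h1 := congrFun (hp _ hv') 0
    rw [pair_constCovector] at h1
    rw [← pair_constState]
    refine Eq.trans ?_ h1.symm
    have h2 : tor ((η₀ + k) * (constState Pt v).n) = tor (A'.n * (constState Pt v).n) :=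
      tor_mul_const_congr (constState Pt v).hn hv'.1 (by rw [map_add, hkt, map_sub]; abel)
    simp only [pair, map_add, Pi.add_apply] at h2 ⊢
    rw [h2]
  · obtain ⟨⟨φ, hφ, hP⟩, hr'⟩ := exists_potential_of_mem_annihilator hσ hγ
    rw [← pair_constState, hw.pair_eq hm hnm, brE_skew, map_neg, brE_density, hP, hr', mul_zero]
    have h1 := hV ⟨(constCovector Pt γ).n, fun i => dq i φ, 0, (constCovector Pt γ).hn,
      fun i => dq_mem_Fld i hφ⟩
    -- The density component of the annihilating covector contributes nothing, because `A'.P` is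
    -- divergence-free; subtracting this case isolates the gradient part.
    have h2 := hV ⟨(constCovector Pt γ).n, 0, 0, (constCovector Pt γ).hn, fun i => zero_mem _⟩
    simp only [mul_zero] at h1 h2
    rw [brE_zero_left, map_smul, tor_mul_const_eq_zero S.hn hS.1 (tor_dotO_dq_eq_zero hA'.2 _),
      smul_zero] at h2
    simp only [pair, Pi.zero_apply, zero_mul, add_zero, zero_smul, map_zero] at h1 h2
    rw [map_add, ← h2, zero_add] at h1
    change (-tor (_ - _)) (0 : Pt) = 0
    rw [map_sub, h1]
    have h3 : tor (dq 0 φ * V.P 0 + dq 1 φ * V.P 1) = -tor (divO V.P * φ) := by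
      rw [← tor_dotO_dq, dotO, mul_comm, mul_comm (dq 1 φ)]
    have h4 : tor (ε • (dotO (fun i => dq i φ) (fun i => dq i (η₀ + k)) * S.n)) =
        -tor (divO V.P * φ) := by
      rw [← hlap]
      have : dotO (fun i => dq i φ) (fun i => dq i (η₀ + k)) =
        dotO (fun i => dq i (η₀ + k)) (fun i => dq i φ) := by simp only [dotO]; ring
      rw [this, smul_mul_assoc, map_smul, map_smul, tor_mul_const S.hn hS.1, tor_dotO_dq]
      funext s
      rw [Pi.neg_apply, Pi.smul_apply, Pi.smul_apply, mul_assoc, tor_const S.hn hS.1]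
      simp only [divO, lap, Pi.neg_apply, smul_eq_mul]; ring
    rw [h3, h4]
    simp

section Reduced

variable {E : Type} [NormedAddCommGroup E] [NormedSpace ℝ E] [FiniteDimensional ℝ E]

/-! ### The bracket of functions on phase space -/

theorem real_smul_eq (c : ℝ) (f : Obs E) : c • f = algebraMap ℝ (Obs E) c * f :=
  Algebra.smul_def c f

/-- The noncanonical bracket of functions on phase space with magnetic field `b`. -/
def PB (ε : ℝ) (b F G : Obs E) : Obs E :=
  ε • (dotO (fun i => dq i F) (fun i => dv i G) - dotO (fun i => dq i G) (fun i => dv i F)) +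
    b * crossO (fun i => dv i F) (fun i => dv i G)

/-- The observable that is linear in the velocity with given coefficients. -/
def lin (x : Fin 2 → Obs E) : Obs E := x 0 * xi 0 + x 1 * xi 1

/-- The derivative along the velocity direction `ρ`. -/
def vder (ρ : Fin 2 → Obs E) (F : Obs E) : Obs E := ρ 0 * dv 0 F + ρ 1 * dv 1 F

/-- The scalar curl. -/
def curlO (ρ : Fin 2 → Obs E) : Obs E := dq 0 (ρ 1) - dq 1 (ρ 0)

/-- The Lie bracket of vector fields on the torus. -/
def lieO (x y : Fin 2 → Obs E) : Fin 2 → Obs E := fun j =>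
  dotO x (fun i => dq i (y j)) - dotO y (fun i => dq i (x j))

variable (ε : ℝ)

theorem PB_skew (b F G : Obs E) : PB ε b F G = -PB ε b G F := by
  simp only [PB, dotO, crossO, real_smul_eq]; ring

theorem PB_add_left (b F F' G : Obs E) : PB ε b (F + F') G = PB ε b F G + PB ε b F' G := by
  simp only [PB, dotO, crossO, real_smul_eq, map_add]; ring

theorem PB_sub_left (b F F' G : Obs E) : PB ε b (F - F') G = PB ε b F G - PB ε b F' G := by
  simp only [PB, dotO, crossO, real_smul_eq, map_sub]; ring

theorem PB_smul_left (c : ℝ) (b F G : Obs E) : PB ε b (c • F) G = c • PB ε b F G := by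
  simp only [PB, dotO, crossO, real_smul_eq, Derivation.leibniz, Derivation.map_algebraMap,
    smul_eq_mul]; ring

theorem PB_add_right (b F G G' : Obs E) : PB ε b F (G + G') = PB ε b F G + PB ε b F G' := by
  simp only [PB, dotO, crossO, real_smul_eq, map_add]; ring

theorem dv_lin {x : Fin 2 → Obs E} (hx : ∀ i, x i ∈ Fld E) (i : Fin 2) : dv i (lin x) = x i := by
  rw [lin, map_add, Derivation.leibniz, Derivation.leibniz, dv_Fld (hx 0), dv_Fld (hx 1)]
  fin_cases i <;> simp [dv_xi_ne]

theorem dq_lin (x : Fin 2 → Obs E) (i : Fin 2) : dq i (lin x) = lin fun j => dq i (x j) := by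
  simp [lin, mul_comm]

/-- The bracket belongs to the canonical two-form plus a magnetic term. On a two-dimensional torus
that term is closed for every `b` depending on position only. -/
theorem PB_jacobi {b : Obs E} (hb : b ∈ Fld E) (F G H : Obs E) :
    PB ε b (PB ε b F G) H + PB ε b (PB ε b G H) F + PB ε b (PB ε b H F) G = 0 := by
  have h0 := dv_Fld hb
  simp only [PB, dotO, crossO, real_smul_eq, Derivation.leibniz, map_add, map_sub,
    Derivation.map_algebraMap, smul_eq_mul, h0, mul_zero, add_zero,
    dv_dq, dq_comm 1 0, dv_comm 1 0]
  ring

/-- Shifting the velocity by a covector field ρ changes the symplectic form by the magnetic form dρ,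
so `vder ρ` is a derivation up to the curl of ρ. -/
theorem vder_PB {b : Obs E} (hb : b ∈ Fld E) {ρ : Fin 2 → Obs E} (hρ : ∀ i, ρ i ∈ Fld E)
    (F G : Obs E) : vder ρ (PB ε b F G) = PB ε b (vder ρ F) G + PB ε b F (vder ρ G) -
      ε • (curlO ρ * crossO (fun i => dv i F) (fun i => dv i G)) := by
  have h0 := dv_Fld hb
  have h1 := fun i => dv_Fld (hρ i)
  simp only [PB, vder, curlO, dotO, crossO, real_smul_eq, Derivation.leibniz, map_add, map_sub,
    Derivation.map_algebraMap, smul_eq_mul, h0, h1, mul_zero, add_zero,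
    dv_dq, dq_comm 1 0, dv_comm 1 0]
  ring

theorem vder_add (ρ : Fin 2 → Obs E) (F G : Obs E) : vder ρ (F + G) = vder ρ F + vder ρ G := by
  simp only [vder, map_add]; ring

theorem vder_sub (ρ : Fin 2 → Obs E) (F G : Obs E) : vder ρ (F - G) = vder ρ F - vder ρ G := by
  simp only [vder, map_sub]; ring

/-- Both are translations in velocity with coefficients independent of velocity. -/
theorem vder_comm {ρ ρ' : Fin 2 → Obs E} (hρ : ∀ i, ρ i ∈ Fld E) (hρ' : ∀ i, ρ' i ∈ Fld E)
    (F : Obs E) : vder ρ (vder ρ' F) = vder ρ' (vder ρ F) := by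
  have h1 := fun i => dv_Fld (hρ i)
  have h2 := fun i => dv_Fld (hρ' i)
  simp only [vder, Derivation.leibniz, map_add, smul_eq_mul, h1, h2, mul_zero, add_zero,
    dv_comm 1 0]
  ring

theorem vder_lin (ρ : Fin 2 → Obs E) {x : Fin 2 → Obs E} (hx : ∀ i, x i ∈ Fld E) :
    vder ρ (lin x) = dotO ρ x := by
  rw [vder, dv_lin hx, dv_lin hx, dotO]

/-- Observables linear in velocity reproduce the Lie bracket of vector fields, with a cocycle given
by the magnetic form. -/
theorem PB_lin_lin (b : Obs E) {x y : Fin 2 → Obs E} (hx : ∀ i, x i ∈ Fld E)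
    (hy : ∀ i, y i ∈ Fld E) :
    PB ε b (lin x) (lin y) = -(ε • lin (lieO x y)) + b * crossO x y := by
  have h1 : (fun i => dv i (lin x)) = x := funext (dv_lin hx)
  have h2 : (fun i => dv i (lin y)) = y := funext (dv_lin hy)
  simp only [PB, h1, h2, dq_lin]
  simp only [lin, lieO, dotO, real_smul_eq]
  ring

theorem PB_fld_lin (b : Obs E) {φ : Obs E} (hφ : φ ∈ Fld E) {y : Fin 2 → Obs E}
    (hy : ∀ i, y i ∈ Fld E) : PB ε b φ (lin y) = ε • dotO (fun i => dq i φ) y := by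
  simp only [PB, dotO, crossO, real_smul_eq, dv_lin hy, dv_Fld hφ]
  ring

theorem PB_fld (b : Obs E) {φ : Obs E} (hφ : φ ∈ Fld E) (F : Obs E) :
    PB ε b φ F = ε • dotO (fun i => dq i φ) (fun i => dv i F) := by
  simp only [PB, dotO, crossO, real_smul_eq, dv_Fld hφ]
  ring

theorem lieO_jacobi (x y z : Fin 2 → Obs E) (j : Fin 2) :
    lieO (lieO x y) z j + lieO (lieO y z) x j + lieO (lieO z x) y j = 0 := by
  simp only [lieO, dotO, Derivation.leibniz, map_add, map_sub, smul_eq_mul, dq_comm 1 0]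
  ring

/-- An area form on the torus is closed. -/
theorem area_form_closed (b : Obs E) (x y z : Fin 2 → Obs E) :
    (b * crossO (lieO x y) z - dotO (fun i => dq i (b * crossO x y)) z) +
    (b * crossO (lieO y z) x - dotO (fun i => dq i (b * crossO y z)) x) +
    (b * crossO (lieO z x) y - dotO (fun i => dq i (b * crossO z x)) y) = 0 := by
  simp only [lieO, dotO, crossO, Derivation.leibniz, map_sub, smul_eq_mul]
  ring

/-- The exterior derivative of a covector field on the torus. -/
theorem curlO_mul_crossO (ρ x y : Fin 2 → Obs E) :
    -(curlO ρ * crossO x y) + dotO (fun i => dq i (dotO ρ x)) y - dotO (fun i => dq i (dotO ρ y)) x =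
      -dotO ρ (lieO x y) := by
  simp only [curlO, lieO, dotO, crossO, Derivation.leibniz, map_add, smul_eq_mul]
  ring

/-- The nonlinear part of the bracket of `f + lin x` and `g + lin y`. -/
def quad (b : Obs E) (x : Fin 2 → Obs E) (f : Obs E) (y : Fin 2 → Obs E) (g : Obs E) : Obs E :=
  PB ε b (lin x) g + PB ε b f (lin y) + PB ε b f g

/-- The part of `quad` that multiplies the magnetic field. -/
def quadB (x : Fin 2 → Obs E) (f : Obs E) (y : Fin 2 → Obs E) (g : Obs E) : Obs E :=
  crossO x (fun i => dv i g) + crossO (fun i => dv i f) y +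
    crossO (fun i => dv i f) (fun i => dv i g)

theorem quad_eq (b : Obs E) (x : Fin 2 → Obs E) (f : Obs E) (y : Fin 2 → Obs E) (g : Obs E) :
    quad ε b x f y g = PB ε b (f + lin x) (g + lin y) - PB ε b (lin x) (lin y) := by
  rw [quad, PB_add_left, PB_add_right, PB_add_right]; ring

theorem quadB_eq {x y : Fin 2 → Obs E} (hx : ∀ i, x i ∈ Fld E) (hy : ∀ i, y i ∈ Fld E)
    (f g : Obs E) : quadB x f y g =
      crossO (fun i => dv i (f + lin x)) (fun i => dv i (g + lin y)) -
        crossO (fun i => dv i (lin x)) (fun i => dv i (lin y)) := by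
  simp only [quadB, crossO, map_add, dv_lin hx, dv_lin hy]; ring

/-- The observable that represents the derivative of the reduced bracket in the phase space density. -/
def effective (b : Obs E) (ρ : Fin 2 → Obs E) (x : Fin 2 → Obs E) (f : Obs E)
    (σ : Fin 2 → Obs E) (y : Fin 2 → Obs E) (g : Obs E) : Obs E :=
  quad ε b x f y g - vder σ f + vder ρ g

/-- Expanded so that the cyclic sum becomes visible: iterated magnetic brackets, iterated velocity
derivatives, terms occurring twice with opposite signs, and the curl defect of `vder_PB`. -/
theorem PB_effective {b : Obs E} (hb : b ∈ Fld E) {ρ σ τ x y z : Fin 2 → Obs E}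
    (hτ : ∀ i, τ i ∈ Fld E) (hx : ∀ i, x i ∈ Fld E)
    (hy : ∀ i, y i ∈ Fld E) (f g k : Obs E) :
    PB ε b (effective ε b ρ x f σ y g) (k + lin z) - vder τ (effective ε b ρ x f σ y g) =
      PB ε b (PB ε b (f + lin x) (g + lin y)) (k + lin z)
      - PB ε b (PB ε b (lin x) (lin y)) (k + lin z)
      - PB ε b (vder σ f) (k + lin z) + PB ε b (vder ρ g) (k + lin z)
      - PB ε b (vder τ f) (g + lin y) + PB ε b (vder τ g) (f + lin x)
      - PB ε b (dotO τ x) g + PB ε b (dotO τ y) f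
      + ε • (curlO τ * quadB x f y g) + vder τ (vder σ f) - vder τ (vder ρ g) := by
  rw [effective, quad_eq, quadB_eq hx hy]
  simp only [vder_add, vder_sub, vder_PB ε hb hτ, vder_lin τ hx, vder_lin τ hy]
  rw [PB_add_left, PB_sub_left, PB_sub_left, PB_add_left _ _ (vder τ f),
    PB_add_right _ _ _ (vder τ g), PB_skew ε b (f + lin x) (vder τ g),
    PB_skew ε b (f + lin x) (dotO τ y), PB_skew ε b (lin x) (dotO τ y),
    PB_add_right ε b (dotO τ x), PB_add_right ε b (dotO τ y), mul_sub, smul_sub]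
  ring

/-- The iterated brackets of full observables cancel by the Jacobi identity, the iterated velocity
derivatives because they commute, and the brackets of `vder` with a full observable in pairs. What
remains involves the linear parts and the curls. -/
theorem effective_cyclic {b : Obs E} (hb : b ∈ Fld E) {ρ σ τ x y z : Fin 2 → Obs E}
    (hρ : ∀ i, ρ i ∈ Fld E) (hσ : ∀ i, σ i ∈ Fld E) (hτ : ∀ i, τ i ∈ Fld E)
    (hx : ∀ i, x i ∈ Fld E) (hy : ∀ i, y i ∈ Fld E) (hz : ∀ i, z i ∈ Fld E) (f g k : Obs E) :
    (PB ε b (effective ε b ρ x f σ y g) (k + lin z) - vder τ (effective ε b ρ x f σ y g)) +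
    (PB ε b (effective ε b σ y g τ z k) (f + lin x) - vder ρ (effective ε b σ y g τ z k)) +
    (PB ε b (effective ε b τ z k ρ x f) (g + lin y) - vder σ (effective ε b τ z k ρ x f)) =
    (ε • (curlO τ * quadB x f y g) - PB ε b (dotO τ x) g + PB ε b (dotO τ y) f
      - PB ε b (PB ε b (lin x) (lin y)) (k + lin z)) +
    (ε • (curlO ρ * quadB y g z k) - PB ε b (dotO ρ y) k + PB ε b (dotO ρ z) g
      - PB ε b (PB ε b (lin y) (lin z)) (f + lin x)) +
    (ε • (curlO σ * quadB z k x f) - PB ε b (dotO σ z) f + PB ε b (dotO σ x) k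
      - PB ε b (PB ε b (lin z) (lin x)) (g + lin y)) := by
  rw [PB_effective ε hb hτ hx hy, PB_effective ε hb hρ hy hz, PB_effective ε hb hσ hz hx]
  linear_combination PB_jacobi ε hb (f + lin x) (g + lin y) (k + lin z) +
    vder_comm hτ hσ f + vder_comm hρ hτ g + vder_comm hσ hρ k

/-- The inner bracket of two linear observables is again linear plus a function of position, and
each of these has an elementary bracket with `k + lin z`. -/
theorem PB_PB_lin {b : Obs E} (hb : b ∈ Fld E) {x y z : Fin 2 → Obs E} (hx : ∀ i, x i ∈ Fld E)
    (hy : ∀ i, y i ∈ Fld E) (hz : ∀ i, z i ∈ Fld E) (k : Obs E) :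
    PB ε b (PB ε b (lin x) (lin y)) (k + lin z) =
      -(ε • PB ε b (lin (lieO x y)) k) + ε • ε • lin (lieO (lieO x y) z)
      - ε • (b * crossO (lieO x y) z - dotO (fun i => dq i (b * crossO x y)) z)
      + ε • dotO (fun i => dq i (b * crossO x y)) (fun i => dv i k) := by
  have hl : ∀ i, lieO x y i ∈ Fld E := fun i => sub_mem
    (dotO_mem hx fun j => dq_mem_Fld j (hy i)) (dotO_mem hy fun j => dq_mem_Fld j (hx i))
  have hc : b * crossO x y ∈ Fld E := mul_mem hb (crossO_mem hx hy)
  rw [PB_lin_lin ε b hx hy, PB_add_left, PB_add_right _ _ (b * _), PB_fld_lin ε b hc hz,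
    PB_fld ε b hc, ← smul_neg, PB_smul_left, PB_add_right, ← neg_one_smul ℝ (lin _), PB_smul_left,
    PB_smul_left, PB_lin_lin ε b hl hz]
  simp only [smul_add, smul_sub, smul_neg, neg_one_smul]
  ring

end Reduced

section ReducedForm

variable {E : Type} [NormedAddCommGroup E] [NormedSpace ℝ E] [FiniteDimensional ℝ E]

/-! ### The reduced bracket -/

/-- The reduced bracket of `f + lin x` and `g + lin y`. -/
def redBr (ε : ℝ) (b n : Obs E) (h : Den E) (x : Fin 2 → Obs E) (f : Obs E)
    (y : Fin 2 → Obs E) (g : Obs E) : Obs E :=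
  n * b * crossO x y + av h (quad ε b x f y g)

/-- The vector field against which `redBr ε b n h Z 0 y g` integrates `Z`. -/
def momentO (ε : ℝ) (b n : Obs E) (h : Den E) (y : Fin 2 → Obs E) (g : Obs E) : Fin 2 → Obs E :=
  fun j => -(ε • (dq 0 (av h (dv 0 g * xi j)) + dq 1 (av h (dv 1 g * xi j)))) -
    ε • av h (dq j g) + b * (![-(n * y 1 + av h (dv 1 g)), n * y 0 + av h (dv 0 g)] j)

theorem momentO_mem (ε : ℝ) {b n : Obs E} (hb : b ∈ Fld E) (hn : n ∈ Fld E) (h : Den E)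
    {y : Fin 2 → Obs E} (hy : ∀ i, y i ∈ Fld E) (g : Obs E) (j : Fin 2) :
    momentO ε b n h y g j ∈ Fld E := by
  refine add_mem (sub_mem (neg_mem ((Fld E).smul_mem (add_mem (dq_mem_Fld _ (av_mem _ _))
    (dq_mem_Fld _ (av_mem _ _))) ε)) ((Fld E).smul_mem (av_mem _ _) ε)) (mul_mem hb ?_)
  fin_cases j
  · exact neg_mem (add_mem (mul_mem hn (hy 1)) (av_mem _ _))
  · exact add_mem (mul_mem hn (hy 0)) (av_mem _ _)

theorem av_PB_lin (ε : ℝ) {b : Obs E} (hb : b ∈ Fld E) (h : Den E) {z : Fin 2 → Obs E}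
    (hz : ∀ i, z i ∈ Fld E) (g : Obs E) :
    av h (PB ε b (lin z) g) =
      ε • (dq 0 (z 0) * av h (dv 0 g * xi 0) + dq 0 (z 1) * av h (dv 0 g * xi 1) +
        dq 1 (z 0) * av h (dv 1 g * xi 0) + dq 1 (z 1) * av h (dv 1 g * xi 1) -
        (z 0 * av h (dq 0 g) + z 1 * av h (dq 1 g))) +
      b * (z 1 * av h (dv 0 g) - z 0 * av h (dv 1 g)) := by
  have hd := fun i j => dq_mem_Fld i (hz j)
  rw [← av_mul (hd 0 0), ← av_mul (hd 0 1), ← av_mul (hd 1 0), ← av_mul (hd 1 1),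
    ← av_mul (hz 0), ← av_mul (hz 1), ← av_mul (hz 1), ← av_mul (hz 0), ← av_add, ← av_add,
    ← av_add, ← av_add, ← av_sub, ← av_smul, ← av_sub, ← av_mul hb, ← av_add]
  congr 1
  simp only [PB, dotO, crossO, dv_lin hz, dq_lin]
  simp only [lin, real_smul_eq]
  ring

theorem redBr_zero (ε : ℝ) (b n : Obs E) (h : Den E) (z y : Fin 2 → Obs E) (g : Obs E) :
    redBr ε b n h z 0 y g = n * b * crossO z y + av h (PB ε b (lin z) g) := by
  rw [redBr, quad]
  congr 2
  simp only [PB, dotO, crossO, real_smul_eq, map_zero]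
  ring

/-- With `f = 0` the bracket contains `z` and its first derivatives only; integration by parts frees
`z` and leaves `momentO` as coefficient. -/
theorem tor_redBr_zero (ε : ℝ) {b : Obs E} (hb : b ∈ Fld E) (n : Obs E) (h : Den E)
    {z : Fin 2 → Obs E} (hz : ∀ i, z i ∈ Fld E) (y : Fin 2 → Obs E) (g : Obs E) :
    tor (redBr ε b n h z 0 y g) = tor (dotO z (momentO ε b n h y g)) := by
  have e : redBr ε b n h z 0 y g = dotO z (momentO ε b n h y g) + ε •
      (dq 0 (z 0 * av h (dv 0 g * xi 0)) + dq 0 (z 1 * av h (dv 0 g * xi 1)) +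
        dq 1 (z 0 * av h (dv 1 g * xi 0)) + dq 1 (z 1 * av h (dv 1 g * xi 1))) := by
    rw [redBr_zero, av_PB_lin ε hb h hz]
    simp only [momentO, dotO, crossO, real_smul_eq, Derivation.leibniz, smul_eq_mul,
      Matrix.cons_val_zero, Matrix.cons_val_one]
    ring
  rw [e, map_add, map_smul, map_add, map_add, map_add]
  simp only [tor_dq, add_zero, smul_zero]

theorem av_PB_fld (ε : ℝ) (b : Obs E) (h : Den E) {φ : Obs E} (hφ : φ ∈ Fld E) (g : Obs E) :
    av h (PB ε b φ g) = ε • dotO (fun i => dq i φ) (fun i => av h (dv i g)) := by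
  rw [PB_fld ε b hφ, av_smul, dotO, av_add, av_mul (dq_mem_Fld _ hφ), av_mul (dq_mem_Fld _ hφ), dotO]

/-- Integration by parts against the velocity average of a derivative, for observables whose total
momentum is divergence-free. -/
theorem tor_dotO_dq_av {n : Obs E} (h : Den E) {x : Fin 2 → Obs E} {f : Obs E}
    (hdiv : divO (fun i => n * x i + av h (dv i f)) = 0) (φ : Obs E) :
    tor (dotO (fun i => dq i φ) (fun i => av h (dv i f))) =
      -tor (n * dotO (fun i => dq i φ) x) := by
  have h1 := tor_dotO_dq_eq_zero hdiv φ
  rw [← add_eq_zero_iff_eq_neg, ← map_add, ← h1]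
  congr 1
  simp only [dotO]; ring

theorem tor_av_PB_fld (ε : ℝ) (b : Obs E) {n : Obs E} (h : Den E) {x : Fin 2 → Obs E} {f : Obs E}
    (hdiv : divO (fun i => n * x i + av h (dv i f)) = 0) {φ : Obs E} (hφ : φ ∈ Fld E) :
    tor (av h (PB ε b φ f)) = -tor (ε • (n * dotO (fun i => dq i φ) x)) := by
  rw [av_PB_fld ε b h hφ, map_smul, map_smul, tor_dotO_dq_av h hdiv, smul_neg]

/-- One cyclic summand of the Jacobi identity for the reduced bracket. -/
theorem tor_cyclic_summand (ε : ℝ) {b n : Obs E} (hb : b ∈ Fld E) (h : Den E)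
    {τ x y z : Fin 2 → Obs E} (hτ : ∀ i, τ i ∈ Fld E)
    (hx : ∀ i, x i ∈ Fld E) (hy : ∀ i, y i ∈ Fld E) (hz : ∀ i, z i ∈ Fld E) {f g k : Obs E}
    (hf : divO (fun i => n * x i + av h (dv i f)) = 0)
    (hg : divO (fun i => n * y i + av h (dv i g)) = 0)
    (hk : divO (fun i => n * z i + av h (dv i k)) = 0)
    (hm : ∀ i, n * τ i = momentO ε b n h z k i) :
    tor (av h (ε • (curlO τ * quadB x f y g) - PB ε b (dotO τ x) g + PB ε b (dotO τ y) f
      - PB ε b (PB ε b (lin x) (lin y)) (k + lin z))) -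
      tor (ε • (curlO τ * (n * crossO x y + av h (quadB x f y g)))) =
    -tor (ε • ((n - av h 1) * (b * crossO (lieO x y) z - dotO (fun i => dq i (b * crossO x y)) z)))
      - tor (av h (ε • ε • lin (lieO (lieO x y) z))) := by
  have hl : ∀ {u v : Fin 2 → Obs E}, (∀ i, u i ∈ Fld E) → (∀ i, v i ∈ Fld E) →
      ∀ i, lieO u v i ∈ Fld E := fun hu hv i => sub_mem
    (dotO_mem hu fun j => dq_mem_Fld j (hv i)) (dotO_mem hv fun j => dq_mem_Fld j (hu i))
  have hc : b * crossO x y ∈ Fld E := mul_mem hb (crossO_mem hx hy)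
  have hcurl : curlO τ ∈ Fld E := sub_mem (dq_mem_Fld _ (hτ _)) (dq_mem_Fld _ (hτ _))
  have hD : b * crossO (lieO x y) z - dotO (fun i => dq i (b * crossO x y)) z ∈ Fld E :=
    sub_mem (mul_mem hb (crossO_mem (hl hx hy) hz)) (dotO_mem (fun i => dq_mem_Fld i hc) hz)
  -- Averaging the bracket of `lin (lieO x y)` with `k` produces n τ·[x, y] by the definition of τ.
  -- The terms in the curl of τ, in τ·x and in τ·y combine to its negative by the formula for dτ, so
  -- only the area form and the double Lie bracket survive.
  have h1 := tor_redBr_zero ε hb n h (hl hx hy) z k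
  have h2 : tor (dotO (lieO x y) (momentO ε b n h z k)) = tor (n * dotO τ (lieO x y)) := by
    congr 1
    simp only [dotO, ← hm]; ring
  have h3 := congrArg (fun u => tor (ε • (n * u))) (curlO_mul_crossO τ x y)
  rw [PB_PB_lin ε hb hx hy hz]
  simp only [av_sub, av_add, av_neg, av_smul, map_sub, map_add, map_neg, map_smul, av_mul hcurl]
  have e1 : av h (b * crossO (lieO x y) z) = av h 1 * (b * crossO (lieO x y) z) := by
    rw [← av_mul_right (mul_mem hb (crossO_mem (hl hx hy) hz)), one_mul]
  have e1' : av h (dotO (fun i => dq i (b * crossO x y)) z) =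
      av h 1 * dotO (fun i => dq i (b * crossO x y)) z := by
    rw [← av_mul_right (dotO_mem (fun i => dq_mem_Fld i hc) hz), one_mul]
  have e2 : av h (dotO (fun i => dq i (b * crossO x y)) (fun i => dv i k)) =
      dotO (fun i => dq i (b * crossO x y)) (fun i => av h (dv i k)) := by
    rw [dotO, av_add, av_mul (dq_mem_Fld _ hc), av_mul (dq_mem_Fld _ hc), dotO]
  rw [e1, e1', e2, tor_dotO_dq_av h hk, tor_av_PB_fld ε b h hg (dotO_mem hτ hx),
    tor_av_PB_fld ε b h hf (dotO_mem hτ hy)]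
  rw [redBr_zero, h2] at h1
  simp only [map_add, map_smul, mul_add, mul_sub, sub_mul, map_sub, mul_neg, map_neg,
    smul_add, smul_sub, smul_neg] at h1 h3 ⊢
  have e3 : n * b * crossO (lieO x y) z = n * (b * crossO (lieO x y) z) := mul_assoc _ _ _
  have e4 : curlO τ * (n * crossO x y) = n * (curlO τ * crossO x y) := mul_left_comm _ _ _
  rw [e4]
  rw [e3] at h1
  funext s
  have h1s := congrFun h1 s
  have h3s := congrFun h3 s
  simp only [Pi.add_apply, Pi.sub_apply, Pi.neg_apply, Pi.smul_apply, smul_eq_mul] at h1s h3s ⊢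
  linear_combination ε * h1s + h3s

end ReducedForm

/-! ### The cyclic sum, and the passage to relative velocities. -/

section ReducedBracket

variable {E : Type} [NormedAddCommGroup E] [NormedSpace ℝ E] [FiniteDimensional ℝ E]

/-- The algebraic core of the Jacobi identity for the reduced bracket. -/
theorem tor_cyclic_sum (ε : ℝ) {b n : Obs E} (hb : b ∈ Fld E) (h : Den E)
    {ρ σ τ x y z : Fin 2 → Obs E} (hρ : ∀ i, ρ i ∈ Fld E) (hσ : ∀ i, σ i ∈ Fld E)
    (hτ : ∀ i, τ i ∈ Fld E) (hx : ∀ i, x i ∈ Fld E) (hy : ∀ i, y i ∈ Fld E)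
    (hz : ∀ i, z i ∈ Fld E) {f g k : Obs E}
    (hf : divO (fun i => n * x i + av h (dv i f)) = 0)
    (hg : divO (fun i => n * y i + av h (dv i g)) = 0)
    (hk : divO (fun i => n * z i + av h (dv i k)) = 0)
    (hmρ : ∀ i, n * ρ i = momentO ε b n h x f i) (hmσ : ∀ i, n * σ i = momentO ε b n h y g i)
    (hmτ : ∀ i, n * τ i = momentO ε b n h z k i) :
    (tor (av h (PB ε b (effective ε b ρ x f σ y g) (k + lin z) -
        vder τ (effective ε b ρ x f σ y g))) -
      tor (ε • (curlO τ * (n * crossO x y + av h (quadB x f y g))))) +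
    (tor (av h (PB ε b (effective ε b σ y g τ z k) (f + lin x) -
        vder ρ (effective ε b σ y g τ z k))) -
      tor (ε • (curlO ρ * (n * crossO y z + av h (quadB y g z k))))) +
    (tor (av h (PB ε b (effective ε b τ z k ρ x f) (g + lin y) -
        vder σ (effective ε b τ z k ρ x f))) -
      tor (ε • (curlO σ * (n * crossO z x + av h (quadB z k x f))))) = 0 := by
  have h1 := congrArg (fun F => tor (av h F))
    (effective_cyclic ε hb hρ hσ hτ hx hy hz f g k)
  simp only [av_add h (_ + _) _, av_add h (_ - _) (_ - _), map_add tor (_ + _) _, map_add tor (av h _)] at h1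
  have a1 := tor_cyclic_summand ε hb h hτ hx hy hz hf hg hk hmτ
  have a2 := tor_cyclic_summand ε hb h hρ hy hz hx hg hk hf hmρ
  have a3 := tor_cyclic_summand ε hb h hσ hz hx hy hk hf hg hmσ
  -- The remainders of the three summands cancel for two reasons: an area form is closed, here with
  -- coefficient `n - av h 1`, and the Lie bracket satisfies the Jacobi identity.
  have h2 := congrArg (fun F => tor (ε • ((n - av h 1) * F))) (area_form_closed b x y z)
  have h3 : tor (av h (ε • ε • lin (lieO (lieO x y) z))) +
      tor (av h (ε • ε • lin (lieO (lieO y z) x))) +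
      tor (av h (ε • ε • lin (lieO (lieO z x) y))) = 0 := by
    rw [← map_add, ← map_add, ← av_add, ← av_add, ← smul_add, ← smul_add, ← smul_add, ← smul_add]
    have : lin (lieO (lieO x y) z) + lin (lieO (lieO y z) x) + lin (lieO (lieO z x) y) = 0 := by
      simp only [lin]
      linear_combination xi 0 * lieO_jacobi x y z 0 + xi 1 * lieO_jacobi x y z 1
    rw [this, smul_zero, smul_zero, av_zero, map_zero]
  simp only [mul_add, smul_add, map_add, mul_zero, smul_zero, map_zero] at h2
  linear_combination h1 + a1 + a2 + a3 - h2 - h3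

/-! ### The two brackets on the submanifold -/

/-- The vector field `X - ⟨∂f/∂ξ⟩`. -/
def relV (r : Den E) (X : Fin 2 → Obs E) (f : Obs E) : Fin 2 → Obs E :=
  fun i => X i - av r (dv i f)

theorem relV_mem (r : Den E) {X : Fin 2 → Obs E} (hX : ∀ i, X i ∈ Fld E) (f : Obs E) (i : Fin 2) :
    relV r X f i ∈ Fld E := sub_mem (hX i) (av_mem _ _)

/-- The modified magnetic field `B - ε Ω`. -/
def modB (ε : ℝ) (B m : Obs E) (P : Fin 2 → Obs E) : Obs E := B - ε • vortO m P

theorem modB_mem (ε : ℝ) {B m : Obs E} (hB : B ∈ Fld E) (hm : m ∈ Fld E) {P : Fin 2 → Obs E}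
    (hP : ∀ i, P i ∈ Fld E) : modB ε B m P ∈ Fld E :=
  sub_mem hB ((Fld E).smul_mem (vortO_mem hm hP) ε)

/-- Substituting X = x + ⟨∂f/∂ξ⟩ absorbs the products of averages: the bracket becomes one average
of a phase space bracket plus a magnetic term. The two integrands differ by a total divergence, and
the constancy of `n` allows it to pass through derivatives. -/
theorem tor_brS (ε : ℝ) {B n m : Obs E} (hB : B ∈ Fld E) (hn : n ∈ Fld E) (hm : m ∈ Fld E)
    (hn0 : ∀ i, dq i n = 0) {P : Fin 2 → Obs E} (hP : ∀ i, P i ∈ Fld E) (r : Den E)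
    {X Y : Fin 2 → Obs E} (hX : ∀ i, X i ∈ Fld E) (hY : ∀ i, Y i ∈ Fld E) (f g : Obs E) :
    tor (brS ε B n m P r X (n * f) f Y (n * g) g) =
      tor (redBr ε (modB ε B m P) n (n • r) (relV r X f) f (relV r Y g) g) := by
  have hb := modB_mem ε hB hm hP
  have hv := fun i => dv_Fld hn i
  have e1 : ∀ i F, av r (dq i (n * F)) = n * av r (dq i F) := fun i F => by
    rw [Derivation.leibniz, hn0, smul_zero, add_zero, smul_eq_mul, av_mul hn]
  have e2 : ∀ i j F, av r (dv i (n * F) * xi j) = n * av r (dv i F * xi j) := fun i j F => by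
    rw [Derivation.leibniz, hv, smul_zero, add_zero, smul_eq_mul, mul_assoc, av_mul hn]
  have e3 : ε • fib (((dotO (fun i => dq i f) (fun i => dv i g) -
        dotO (fun i => dq i g) (fun i => dv i f)) * n) • r)
      + fib ((modB ε B m P * crossO (fun i => dv i f) (fun i => dv i g) * n) • r) =
      n * av r (PB ε (modB ε B m P) f g) := by
    rw [← map_smul, ← smul_assoc, ← map_add, ← add_smul, ← av_mul hn, av]
    congr 2
    simp only [PB, real_smul_eq]; ring
  have e4 : redBr ε (modB ε B m P) n (n • r) (relV r X f) f (relV r Y g) g =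
      n * modB ε B m P * crossO (relV r X f) (relV r Y g) +
      n * (av r (PB ε (modB ε B m P) (lin (relV r X f)) g) -
        av r (PB ε (modB ε B m P) (lin (relV r Y g)) f) + av r (PB ε (modB ε B m P) f g)) := by
    rw [redBr, av_smul_den, quad, PB_skew _ _ f (lin _), av_mul hn, av_add, av_add, av_neg]
    ring
  have e5 : brS ε B n m P r X (n * f) f Y (n * g) g =
      redBr ε (modB ε B m P) n (n • r) (relV r X f) f (relV r Y g) g -
      ε • (dq 0 (n * (relV r X f 0 * av r (dv 0 g * xi 0) + relV r X f 1 * av r (dv 0 g * xi 1) -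
          relV r Y g 0 * av r (dv 0 f * xi 0) - relV r Y g 1 * av r (dv 0 f * xi 1))) +
        dq 1 (n * (relV r X f 0 * av r (dv 1 g * xi 0) + relV r X f 1 * av r (dv 1 g * xi 1) -
          relV r Y g 0 * av r (dv 1 f * xi 0) - relV r Y g 1 * av r (dv 1 f * xi 1)))) := by
    rw [e4, mul_add n, ← e3, brS, ← modB, av_PB_lin ε hb r (relV_mem r hX f), av_PB_lin ε hb r (relV_mem r hY g)]
    simp only [e1, e2]
    generalize fib (E := E) _ = t1
    generalize fib (E := E) _ = t2
    simp only [relV, dotO, crossO, real_smul_eq, Derivation.leibniz, map_add, map_sub, hn0,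
      smul_eq_mul, mul_zero, add_zero]
    ring
  rw [e5, map_sub, map_smul, map_add, tor_dq, tor_dq, add_zero, smul_zero, sub_zero]

/-- Gradients, in particular those of the density components, integrate to zero against
divergence-free fields. For the same reason the term with [X, Y]·P becomes a vorticity term, which
turns B into B - εΩ. -/
theorem tor_brE (ε : ℝ) {B n m : Obs E} (hn : n ∈ Fld E)
    (hnm : n * m = 1) (hn0 : ∀ i, dq i n = 0) {P : Fin 2 → Obs E} (r : Den E)
    {X Y : Fin 2 → Obs E} (hX0 : divO X = 0) (hY0 : divO Y = 0) (Cn An f g : Obs E) :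
    tor (brE ε B n m P r Cn X f An Y g) = tor (brS ε B n m P r X (n * f) f Y (n * g) g) := by
  have hv := fun i => dv_Fld hn i
  have e1 : ∀ i F, av r (dq i (n * F)) = n * av r (dq i F) := fun i F => by
    rw [Derivation.leibniz, hn0, smul_zero, add_zero, smul_eq_mul, av_mul hn]
  have e2 : ∀ i j F, av r (dv i (n * F) * xi j) = n * av r (dv i F * xi j) := fun i j F => by
    rw [Derivation.leibniz, hv, smul_zero, add_zero, smul_eq_mul, mul_assoc, av_mul hn]
  have hm0 := dq_inverse hnm hn0
  have e3 : brE ε B n m P r Cn X f An Y g = brS ε B n m P r X (n * f) f Y (n * g) g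
      - ε • (dotO X (fun i => dq i (An - av r g)) * n) + ε • (dotO Y (fun i => dq i (Cn - av r f)) * n)
      - ε • (dotO (lieO X Y) P - vortO 1 P * crossO X Y) := by
    have h1 : n * vortO m P = vortO 1 P := by
      simp only [vortO, Derivation.leibniz, hm0, smul_eq_mul, one_mul, mul_zero, add_zero]
      linear_combination (dq 0 (P 1) - dq 1 (P 0)) * hnm
    rw [brE, brS]
    simp only [e1, e2]
    generalize fib (E := E) _ = t1
    generalize fib (E := E) _ = t2
    simp only [lieO, dotO, crossO, real_smul_eq, map_sub]
    linear_combination algebraMap ℝ (Obs E) ε * (X 1 * Y 0 - X 0 * Y 1) * h1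
  -- The divergences of X and Y are the only obstruction to writing this difference as a sum of
  -- derivatives.
  have e4 : dotO (lieO X Y) P - vortO 1 P * crossO X Y =
      dq 1 (crossO X Y * P 0) - dq 0 (crossO X Y * P 1) := by
    rw [divO] at hX0 hY0
    simp only [lieO, vortO, dotO, crossO, Derivation.leibniz, map_sub, smul_eq_mul, one_mul]
    linear_combination (X 0 * P 0 + X 1 * P 1) * hY0 - (Y 0 * P 0 + Y 1 * P 1) * hX0
  rw [e3, e4]
  simp only [map_add, map_sub (tor (E := E)), map_smul, tor_dq, tor_mul_const_eq_zero hn hn0 (tor_dotO_dq_eq_zero hX0 _),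
    tor_mul_const_eq_zero hn hn0 (tor_dotO_dq_eq_zero hY0 _), smul_zero, sub_zero, add_zero]

end ReducedBracket

section Variation

variable {E : Type} [NormedAddCommGroup E] [NormedSpace ℝ E] [FiniteDimensional ℝ E]

/-! ### The reduced bracket of families of covectors -/

/-- The reduced bracket of two families of covectors along a family of triples. -/
def redS (ε : ℝ) (B : Obs E) (S : StF E) (m : Obs E) (A C : CvF E) : Obs E :=
  redBr ε (modB ε B m S.P) S.n (S.n • S.r) (relV S.r A.P (m * A.r)) (m * A.r)
    (relV S.r C.P (m * C.r)) (m * C.r)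

theorem bracketSig_eq (ε : ℝ) (B : ScalarField) {S : StF E} (hS : S.Tan) {m : Obs E} (hm : m ∈ Fld E)
    (hnm : S.n * m = 1) (A C : CvF E) (s : E) :
    bracketSig ε B (S.at s) (A.at s) (C.at s) = tor (redS ε (constFld E B) S m A C) s := by
  have e : ∀ F : Obs E, S.n * (m * F) = F := fun F => by rw [← mul_assoc, hnm, one_mul]
  rw [bracketSig_at ε B S A C hm hnm, redS,
    ← tor_brS ε (constFld_mem B) S.hn hm hS.1 S.hP S.r A.hP C.hP, e, e]

theorem bracketE_eq (ε : ℝ) (B : ScalarField) {S : StF E} (hS : S.Tan) {m : Obs E} (hm : m ∈ Fld E)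
    (hnm : S.n * m = 1) {A C : CvF E} (hA : divO A.P = 0) (hC : divO C.P = 0) (s : E) :
    bracketE ε B (S.at s) (A.at s) (C.at s) = tor (redS ε (constFld E B) S m A C) s := by
  rw [bracketE_at ε B S A C hm hnm, redS, tor_brE ε S.hn hnm hS.1 S.r hA hC,
    tor_brS ε (constFld_mem B) S.hn hm hS.1 S.hP S.r A.hP C.hP]

/-! ### The derivative of the reduced bracket -/

theorem redBr_add_left (ε : ℝ) (b n : Obs E) (h : Den E) (x x' : Fin 2 → Obs E) (f f' : Obs E)
    (y : Fin 2 → Obs E) (g : Obs E) :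
    redBr ε b n h (fun i => x i + x' i) (f + f') y g = redBr ε b n h x f y g + redBr ε b n h x' f' y g := by
  have : lin (fun i => x i + x' i) = lin x + lin x' := by simp only [lin]; ring
  simp only [redBr, quad, this, PB_add_left, av_add, crossO]
  ring

theorem redBr_skew (ε : ℝ) (b n : Obs E) (h : Den E) (x : Fin 2 → Obs E) (f : Obs E)
    (y : Fin 2 → Obs E) (g : Obs E) : redBr ε b n h x f y g = -redBr ε b n h y g x f := by
  rw [redBr, redBr, quad, quad, PB_skew _ _ (lin x), PB_skew _ _ f (lin y), PB_skew _ _ f g]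
  simp only [av_add, av_neg, crossO]
  ring

theorem redBr_add_right (ε : ℝ) (b n : Obs E) (h : Den E) (x : Fin 2 → Obs E) (f : Obs E)
    (y y' : Fin 2 → Obs E) (g g' : Obs E) :
    redBr ε b n h x f (fun i => y i + y' i) (g + g') =
      redBr ε b n h x f y g + redBr ε b n h x f y' g' := by
  rw [redBr_skew, redBr_add_left, redBr_skew _ _ _ _ y, redBr_skew _ _ _ _ y']
  ring

/-- The variation of `redBr` under variations of all its arguments. -/
def varBr (ε : ℝ) (b n : Obs E) (h : Den E) (x : Fin 2 → Obs E) (f : Obs E)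
    (y : Fin 2 → Obs E) (g : Obs E) (b' n' : Obs E) (h' : Den E) (x' : Fin 2 → Obs E) (f' : Obs E)
    (y' : Fin 2 → Obs E) (g' : Obs E) : Obs E :=
  redBr ε b n h x' f' y g + redBr ε b n h x f y' g' + (n' * b + n * b') * crossO x y +
    av h (b' * quadB x f y g) + av h' (quad ε b x f y g)

theorem dt_av (e : E) (h : Den E) (F : Obs E) : dt e (av h F) = av h (dt e F) + av (dtD e h) F := by
  rw [av, ← fib_dtD, dtD_smul, map_add]; rfl

theorem dt_PB (e : E) (ε : ℝ) (b F G : Obs E) : dt e (PB ε b F G) =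
    PB ε b (dt e F) G + PB ε b F (dt e G) +
      dt e b * crossO (fun i => dv i F) (fun i => dv i G) := by
  simp only [PB, dotO, crossO, real_smul_eq, Derivation.leibniz, map_add, map_sub,
    Derivation.map_algebraMap, smul_eq_mul, mul_zero, add_zero, dt_dq, dt_dv]
  ring

theorem dt_lin (e : E) (x : Fin 2 → Obs E) : dt e (lin x) = lin fun i => dt e (x i) := by
  simp [lin, mul_comm]

/-- The product rule: the bracket is bilinear in the two observables, while `b`, `n` and `h` enter
as coefficients and through the average. -/
theorem dt_redBr (e : E) (ε : ℝ) (b n : Obs E) (h : Den E) {x : Fin 2 → Obs E}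
    (hx : ∀ i, x i ∈ Fld E) (f : Obs E) {y : Fin 2 → Obs E} (hy : ∀ i, y i ∈ Fld E) (g : Obs E) :
    dt e (redBr ε b n h x f y g) = varBr ε b n h x f y g (dt e b) (dt e n) (dtD e h)
      (fun i => dt e (x i)) (dt e f) (fun i => dt e (y i)) (dt e g) := by
  have h1 : dt e (quad ε b x f y g) =
      quad ε b (fun i => dt e (x i)) (dt e f) y g + quad ε b x f (fun i => dt e (y i)) (dt e g) +
        dt e b * quadB x f y g := by
    simp only [quad, quadB, map_add, dt_PB, dt_lin]
    simp only [crossO, dv_lin hx, dv_lin hy]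
    ring
  rw [redBr, varBr, map_add, dt_av, h1, redBr, redBr]
  simp only [av_add, crossO, Derivation.leibniz, map_sub, smul_eq_mul]
  ring

/-- The variation of the reduced bracket in the direction `V`, with fixed covectors. -/
def varS (ε : ℝ) (B : Obs E) (S : StF E) (m : Obs E) (A C : CvF E) (V : StF E) : Obs E :=
  varBr ε (modB ε B m S.P) S.n (S.n • S.r) (relV S.r A.P (m * A.r)) (m * A.r)
    (relV S.r C.P (m * C.r)) (m * C.r)
    (-(ε • (vortO m V.P + vortO (-(m * m * V.n)) S.P))) V.n (V.n • S.r + S.n • V.r)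
    (fun i => -av S.r (dv i (-(m * V.n) * (m * A.r))) - av V.r (dv i (m * A.r)))
    (-(m * V.n) * (m * A.r))
    (fun i => -av S.r (dv i (-(m * V.n) * (m * C.r))) - av V.r (dv i (m * C.r)))
    (-(m * V.n) * (m * C.r))

theorem dt_inverse {n m : Obs E} (h : n * m = 1) (e : E) : dt e m = -(m * m * dt e n) := by
  have h1 := congrArg (dt e) h
  rw [Derivation.leibniz, Derivation.map_one_eq_zero, smul_eq_mul, smul_eq_mul] at h1
  linear_combination m * h1 - dt e m * h

/-- All dependence on the second derivatives of functionals sits in the first two terms. The third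
depends on the base point's velocity alone: it collects the variations of the vorticity, of `1/n`,
of `h` and of the averages inside the relative velocities. -/
theorem dt_redS (e : E) (ε : ℝ) {B : Obs E} (hB : dt e B = 0) (S : StF E)
    {m : Obs E} (hnm : S.n * m = 1) (A C : CvF E) :
    dt e (redS ε B S m A C) = redS ε B S m (A.deriv e) C + redS ε B S m A (C.deriv e) +
      varS ε B S m A C (S.deriv e) := by
  have hm := dt_inverse hnm e
  have hf : ∀ A : CvF E, dt e (m * A.r) = m * (A.deriv e).r + -(m * (S.deriv e).n) * (m * A.r) :=
    fun A => by
      rw [Derivation.leibniz, hm, CvF.deriv, StF.deriv, smul_eq_mul, smul_eq_mul]; ring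
  have hx : ∀ A : CvF E, (fun i => dt e (relV S.r A.P (m * A.r) i)) =
      fun i => relV S.r (A.deriv e).P (m * (A.deriv e).r) i +
        (-av S.r (dv i (-(m * (S.deriv e).n) * (m * A.r))) - av (S.deriv e).r (dv i (m * A.r))) :=
    fun A => by
      funext i
      rw [relV, relV, map_sub, dt_av, dt_dv, hf, map_add, av_add]
      change dt e (A.P i) - _ = dt e (A.P i) - _ + (_ - av (dtD e S.r) _)
      ring
  have hb : dt e (modB ε B m S.P) =
      -(ε • (vortO m (S.deriv e).P + vortO (-(m * m * (S.deriv e).n)) S.P)) := by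
    rw [modB, map_sub, hB, Derivation.map_smul, zero_sub]
    congr 2
    simp only [vortO, map_sub (dt e), dt_dq]
    change dq 0 (dt e (m * S.P 1)) - dq 1 (dt e (m * S.P 0)) =
      dq 0 (m * dt e (S.P 1)) - dq 1 (m * dt e (S.P 0)) +
        (dq 0 (-(m * m * dt e S.n) * S.P 1) - dq 1 (-(m * m * dt e S.n) * S.P 0))
    simp only [Derivation.leibniz (dt e), hm, smul_eq_mul, map_add]
    simp only [mul_comm]
    ring
  rw [redS, dt_redBr e ε _ _ _ (relV_mem _ A.hP _) _ (relV_mem _ C.hP _), hf, hf, hx, hx, hb, varBr,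
    redBr_add_left, redBr_add_right, redS, redS, varS, varBr, dtD_smul]
  change _ + _ + _ + _ + av (dt e S.n • S.r + S.n • dtD e S.r) _ =
    _ + _ + (_ + _ + _ + _ + av (dt e S.n • S.r + S.n • dtD e S.r) _)
  change _ + _ + (dt e S.n * _ + _) * _ + _ + _ = _ + _ + (_ + _ + (dt e S.n * _ + _) * _ + _ + _)
  ring

/-! ### Representability of the variation -/

/-- Linear maps from tangent vectors to functions on the torus whose product with any function on the
torus is given by a family of covectors. -/
structure IsFieldCoform (T : StF E → Obs E) : Prop where
  mem : ∀ V, V.Tan → T V ∈ Fld E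
  rep : ∀ u ∈ Fld E, ∃ K : CvF E, ∀ V, V.Tan → tor (T V * u) = pair K V

namespace IsFieldCoform

variable {T T' : StF E → Obs E}

theorem add (h : IsFieldCoform T) (h' : IsFieldCoform T') : IsFieldCoform fun V => T V + T' V :=
  ⟨fun V hV => add_mem (h.mem V hV) (h'.mem V hV), fun u hu => by
    obtain ⟨K, hK⟩ := h.rep u hu
    obtain ⟨K', hK'⟩ := h'.rep u hu
    refine ⟨⟨K.n + K'.n, fun i => K.P i + K'.P i, K.r + K'.r, add_mem K.hn K'.hn,
      fun i => add_mem (K.hP i) (K'.hP i)⟩, fun V hV => ?_⟩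
    rw [add_mul, map_add, hK V hV, hK' V hV]
    simp only [pair, add_smul, add_mul, map_add]
    abel⟩

theorem smul (c : ℝ) (h : IsFieldCoform T) : IsFieldCoform fun V => c • T V :=
  ⟨fun V hV => (Fld E).smul_mem (h.mem V hV) c, fun u hu => by
    obtain ⟨K, hK⟩ := h.rep u hu
    refine ⟨⟨c • K.n, fun i => c • K.P i, c • K.r, (Fld E).smul_mem K.hn c,
      fun i => (Fld E).smul_mem (K.hP i) c⟩, fun V hV => ?_⟩
    rw [smul_mul_assoc, map_smul, hK V hV]
    simp only [pair, smul_assoc, smul_mul_assoc, map_add, map_smul, smul_add]⟩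

theorem neg (h : IsFieldCoform T) : IsFieldCoform fun V => -T V := by
  simpa using h.smul (-1)

theorem sub (h : IsFieldCoform T) (h' : IsFieldCoform T') : IsFieldCoform fun V => T V - T' V := by
  simpa [sub_eq_add_neg] using h.add h'.neg

theorem mul_right (h : IsFieldCoform T) {w : Obs E} (hw : w ∈ Fld E) :
    IsFieldCoform fun V => T V * w :=
  ⟨fun V hV => mul_mem (h.mem V hV) hw, fun u hu => by
    simpa [mul_assoc] using h.rep (w * u) (mul_mem hw hu)⟩

theorem mul_left (h : IsFieldCoform T) {w : Obs E} (hw : w ∈ Fld E) :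
    IsFieldCoform fun V => w * T V := by
  simpa [mul_comm] using h.mul_right hw

theorem dq (h : IsFieldCoform T) (i : Fin 2) : IsFieldCoform fun V => QNVP.dq i (T V) :=
  ⟨fun V hV => dq_mem_Fld i (h.mem V hV), fun u hu => by
    obtain ⟨K, hK⟩ := h.neg.rep _ (dq_mem_Fld i hu)
    refine ⟨K, fun V hV => ?_⟩
    rw [← hK V hV, mul_comm, tor_mul_dq, neg_mul, map_neg, mul_comm]⟩

theorem fst : IsFieldCoform fun V : StF E => V.n :=
  ⟨fun V _ => V.hn, fun u hu => ⟨⟨u, 0, 0, hu, fun _ => zero_mem _⟩, fun V _ => by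
    simp [pair, mul_comm]⟩⟩

theorem snd (i : Fin 2) : IsFieldCoform fun V : StF E => V.P i :=
  ⟨fun V _ => V.hP i, fun u hu => ⟨⟨0, fun j => if j = i then u else 0, 0, zero_mem _, fun j => by
    split_ifs; exacts [hu, zero_mem _]⟩, fun V _ => by fin_cases i <;> simp [pair, mul_comm]⟩⟩

theorem av (F : Obs E) : IsFieldCoform fun V : StF E => QNVP.av V.r F :=
  ⟨fun V _ => av_mem _ _, fun u hu => ⟨⟨0, 0, u * F, zero_mem _, fun _ => zero_mem _⟩, fun V _ => by
    rw [mul_comm, ← av_mul hu]; simp [pair, QNVP.av]⟩⟩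

theorem dotO {T : StF E → Fin 2 → Obs E} (h : ∀ i, IsFieldCoform fun V => T V i)
    {u : Fin 2 → Obs E} (hu : ∀ i, u i ∈ Fld E) : IsFieldCoform fun V => QNVP.dotO (T V) u :=
  ((h 0).mul_right (hu 0)).add ((h 1).mul_right (hu 1))

end IsFieldCoform

theorem vorticity_mul (m u : Obs E) (P : Fin 2 → Obs E) :
    vortO (-(m * m * u)) P = -vortO (m * (m * u)) P := by
  simp only [vortO, neg_mul, map_neg, mul_assoc]; ring

theorem PB_mul_left (ε : ℝ) (b : Obs E) {u : Obs E} (hu : u ∈ Fld E) (hu0 : ∀ i, dq i u = 0)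
    (F G : Obs E) : PB ε b (u * F) G = u * PB ε b F G := by
  simp only [PB, dotO, crossO, real_smul_eq, Derivation.leibniz, hu0, dv_Fld hu, smul_eq_mul,
    mul_zero, add_zero]
  ring

/-- A form of the variation without derivatives of the variation of the covectors. -/
def varRed (ε : ℝ) (b n m : Obs E) (P : Fin 2 → Obs E) (r : Den E) (x : Fin 2 → Obs E)
    (f : Obs E) (y : Fin 2 → Obs E) (g : Obs E) (V : StF E) : Obs E :=
  dotO (fun i => m * V.n * av r (dv i f) - av V.r (dv i f)) (momentO ε b n (n • r) y g)
  - m * V.n * av (n • r) (PB ε b f (lin y) + PB ε b f g)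
  - dotO (fun i => m * V.n * av r (dv i g) - av V.r (dv i g)) (momentO ε b n (n • r) x f)
  + m * V.n * av (n • r) (PB ε b g (lin x) + PB ε b g f)
  + V.n * (b * crossO x y + av r (quad ε b x f y g))
  - ε • ((dq 0 (m * V.P 1) - dq 1 (m * V.P 0) -
      (dq 0 (m * (m * V.n) * P 1) - dq 1 (m * (m * V.n) * P 0))) *
        (n * crossO x y + av (n • r) (quadB x f y g)))
  + av V.r (n * quad ε b x f y g)

theorem av_add_den (h h' : Den E) (F : Obs E) : av (h + h') F = av h F + av h' F := by
  rw [av, smul_add, map_add]; rfl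

/-- The variations of the relative velocities are integrated by parts, by means of `tor_redBr_zero`,
into pairings with `momentO`; afterwards `V` appears only in operations that preserve field coforms.
-/
theorem tor_varS (ε : ℝ) {B : Obs E} (hB : B ∈ Fld E) {S : StF E} (hS : S.Tan)
    {m : Obs E} (hm : m ∈ Fld E) (hnm : S.n * m = 1) (A C : CvF E) {V : StF E} (hV : V.Tan) :
    tor (varS ε B S m A C V) = tor (varRed ε (modB ε B m S.P) S.n m S.P S.r
      (relV S.r A.P (m * A.r)) (m * A.r) (relV S.r C.P (m * C.r)) (m * C.r) V) := by
  have hb := modB_mem ε hB hm S.hP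
  have hu : m * V.n ∈ Fld E := mul_mem hm V.hn
  have hu0 : ∀ i, dq i (m * V.n) = 0 := fun i => by
    rw [Derivation.leibniz, hV.1, dq_inverse hnm hS.1, smul_zero, smul_zero, add_zero]
  -- The part of the variation proportional to `f`, which comes from `1/n`, has the coefficient `m *
  -- V.n`; this is spatially constant because `V` is tangent, so it leaves the bracket.
  have key : ∀ (f : Obs E) (y : Fin 2 → Obs E) (g : Obs E),
      tor (redBr ε (modB ε B m S.P) S.n (S.n • S.r)
        (fun i => -av S.r (dv i (-(m * V.n) * f)) - av V.r (dv i f)) (-(m * V.n) * f) y g) =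
      tor (dotO (fun i => m * V.n * av S.r (dv i f) - av V.r (dv i f))
          (momentO ε (modB ε B m S.P) S.n (S.n • S.r) y g)) -
      tor (m * V.n * av (S.n • S.r) (PB ε (modB ε B m S.P) f (lin y) + PB ε (modB ε B m S.P) f g)) := by
    intro f y g
    have e1 : (fun i => -av S.r (dv i (-(m * V.n) * f)) - av V.r (dv i f)) =
        fun i => m * V.n * av S.r (dv i f) - av V.r (dv i f) := by
      funext i
      rw [Derivation.leibniz, dv_Fld (neg_mem hu), smul_zero, add_zero, smul_eq_mul,
        av_mul (neg_mem hu)]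
      ring
    have e2 : redBr ε (modB ε B m S.P) S.n (S.n • S.r)
        (fun i => m * V.n * av S.r (dv i f) - av V.r (dv i f)) (-(m * V.n) * f) y g =
        redBr ε (modB ε B m S.P) S.n (S.n • S.r)
        (fun i => m * V.n * av S.r (dv i f) - av V.r (dv i f)) 0 y g -
        m * V.n * av (S.n • S.r) (PB ε (modB ε B m S.P) f (lin y) + PB ε (modB ε B m S.P) f g) := by
      have hn0 : ∀ i, dq i (-(m * V.n)) = 0 := fun i => by rw [map_neg, hu0, neg_zero]
      rw [redBr_zero, redBr, quad, PB_mul_left ε _ (neg_mem hu) hn0, PB_mul_left ε _ (neg_mem hu) hn0,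
        av_add, av_add, av_mul (neg_mem hu), av_mul (neg_mem hu), av_add]
      ring
    rw [e1, e2, map_sub, tor_redBr_zero ε hb]
    exact fun i => sub_mem (mul_mem hu (av_mem _ _)) (av_mem _ _)
  have hδ : -(ε • (vortO m V.P + vortO (-(m * m * V.n)) S.P)) ∈ Fld E :=
    neg_mem ((Fld E).smul_mem (add_mem (vortO_mem hm V.hP)
      (vortO_mem (neg_mem (mul_mem (mul_mem hm hm) V.hn)) S.hP)) ε)
  have f1 : ∀ Q, av (V.n • S.r) Q = V.n * av S.r Q := fun Q => by rw [av_smul_den, av_mul V.hn]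
  have f2 : ∀ Q, av (S.n • V.r) Q = av V.r (S.n * Q) := fun Q => by rw [av_smul_den]
  rw [varS, varBr, redBr_skew _ _ _ _ (relV S.r A.P (m * A.r)), map_add, map_add, map_add, map_add,
    map_neg, key, key, varRed, av_mul hδ, av_add_den, f1, f2, vorticity_mul, ← map_sub, ← map_sub,
    ← map_neg, ← map_add, ← map_add, ← map_add, ← map_add]
  congr 1
  generalize av (S.n • S.r) _ = t1
  generalize av (S.n • S.r) _ = t2
  generalize av (S.n • S.r) _ = t3
  simp only [vortO, real_smul_eq]
  ring

/-- The covector representing the explicit variation; it is what makes the bracket of two smooth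
functionals have a functional derivative. -/
theorem exists_variation (ε : ℝ) {B : Obs E} (hB : B ∈ Fld E) {S : StF E} (hS : S.Tan)
    {m : Obs E} (hm : m ∈ Fld E) (hnm : S.n * m = 1) (A C : CvF E) :
    ∃ K : CvF E, ∀ V, V.Tan → tor (varS ε B S m A C V) = pair K V := by
  have hb := modB_mem ε hB hm S.hP
  have hx := relV_mem S.r A.hP (m * A.r)
  have hy := relV_mem S.r C.hP (m * C.r)
  have hmx := momentO_mem ε hb S.hn (S.n • S.r) hx (m * A.r)
  have hmy := momentO_mem ε hb S.hn (S.n • S.r) hy (m * C.r)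
  have hu : IsFieldCoform fun V : StF E => m * V.n := .mul_left .fst hm
  have h : IsFieldCoform fun V => varRed ε (modB ε B m S.P) S.n m S.P S.r
      (relV S.r A.P (m * A.r)) (m * A.r) (relV S.r C.P (m * C.r)) (m * C.r) V := by
    unfold varRed
    refine .add (.sub (.add (.add (.sub (.sub ?_ ?_) ?_) ?_) ?_) (.smul ε ?_)) ?_
    · exact .dotO (fun i => .sub (.mul_right hu (av_mem _ _)) (.av _)) hmy
    · exact .mul_right hu (av_mem _ _)
    · exact .dotO (fun i => .sub (.mul_right hu (av_mem _ _)) (.av _)) hmx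
    · exact .mul_right hu (av_mem _ _)
    · exact .mul_right .fst (add_mem (mul_mem hb (crossO_mem hx hy)) (av_mem _ _))
    · refine .mul_right (.sub (.sub (.dq (.mul_left (.snd 1) hm) 0) (.dq (.mul_left (.snd 0) hm) 1))
        (.sub (.dq (.mul_right (.mul_left hu hm) (S.hP 1)) 0)
          (.dq (.mul_right (.mul_left hu hm) (S.hP 0)) 1)))
        (add_mem (mul_mem S.hn (crossO_mem hx hy)) (av_mem _ _))
    · exact .av _
  obtain ⟨K, hK⟩ := h.rep 1 (one_mem _)
  refine ⟨K, fun V hV => ?_⟩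
  rw [tor_varS ε hB hS hm hnm A C hV, ← hK V hV, mul_one]

end Variation

section Hamiltonian

variable {E : Type} [NormedAddCommGroup E] [NormedSpace ℝ E] [FiniteDimensional ℝ E]

/-! ### Hamiltonian fields of the reduced bracket -/

/-- On tangent families every covector may be replaced by its normalization, so normalized tests
suffice. -/
theorem StF.Tan.at_eq {W W' : StF E} (hW : W.Tan) (hW' : W'.Tan) {s : E}
    (h : ∀ A : CvF E, A.Nrm → pair A W s = pair A W' s) : W.at s = W'.at s :=
  StF.at_eq_of_pair fun C => by
    obtain ⟨C', hC', -, -, -, hp⟩ := exists_normalized C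
    rw [hp W hW, hp W' hW', h C' hC']

/-- `W` is the Hamiltonian field of the normalized family of covectors `C`. -/
structure IsHam (ε : ℝ) (B : Obs E) (S : StF E) (m : Obs E) (C : CvF E) (W : StF E) : Prop where
  tan : W.Tan
  density : W.n = 0
  pair_eq : ∀ A : CvF E, A.Nrm → pair A W = tor (redS ε B S m A C)

/-- The image of the covector under the ambient bundle map has the right pairings; its momentum is
projected to divergence-free fields, invisible to normalized covectors, and its density is set to
zero because the reduced bracket ignores density components. -/
theorem exists_isHam (ε : ℝ) {B : Obs E} (hB : B ∈ Fld E) {S : StF E} (hS : S.Tan)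
    {m : Obs E} (hm : m ∈ Fld E) (hnm : S.n * m = 1) {C : CvF E} (hC : C.Nrm) :
    ∃ W, IsHam ε B S m C W := by
  obtain ⟨V, hV⟩ := representable_brE ε hB S hm C
  obtain ⟨X, ψ, hψ, hX, hX0, hP⟩ := exists_leray V.hP
  refine ⟨⟨0, X, V.r, zero_mem _, hX⟩, ⟨by simp, hX0⟩, rfl, fun A hA => ?_⟩
  have h1 := hV ⟨0, A.P, A.r, zero_mem _, A.hP⟩
  rw [tor_brE ε S.hn hnm hS.1 S.r hA.2 hC.2, tor_brS ε hB S.hn hm hS.1 S.hP S.r A.hP C.hP] at h1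
  rw [redS]
  refine Eq.trans ?_ h1.symm
  have h2 := tor_dotO_dq_eq_zero hA.2 ψ
  rw [dotO] at h2
  simp only [pair, hP, mul_zero, zero_mul, mul_add, map_add] at h2 ⊢
  linear_combination -h2

/-- The test covector (0, 0, nF) reads off the weak form of the evolution of the phase space
density; the variation of the relative velocity produces the term with `vder τ`. -/
theorem tor_av_ham (ε : ℝ) {B : Obs E} (hB : B ∈ Fld E) {S : StF E}
    {m : Obs E} (hm : m ∈ Fld E) (hnm : S.n * m = 1) {C : CvF E} {W : StF E}
    (hW : IsHam ε B S m C W) {τ : Fin 2 → Obs E} (hτ : ∀ i, τ i ∈ Fld E)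
    (hmτ : ∀ i, S.n * τ i = momentO ε (modB ε B m S.P) S.n (S.n • S.r)
      (relV S.r C.P (m * C.r)) (m * C.r) i) (F : Obs E) :
    tor (av W.r (S.n * F)) = tor (av (S.n • S.r)
      (PB ε (modB ε B m S.P) F (m * C.r + lin (relV S.r C.P (m * C.r))) - vder τ F)) := by
  have h1 := hW.pair_eq ⟨0, 0, S.n * F, zero_mem _, fun _ => zero_mem _⟩ ⟨by simp, by simp [divO]⟩
  have e1 : m * (S.n * F) = F := by rw [← mul_assoc, mul_comm m, hnm, one_mul]
  have e2 : redBr ε (modB ε B m S.P) S.n (S.n • S.r) (relV S.r 0 F) F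
      (relV S.r C.P (m * C.r)) (m * C.r) = redBr ε (modB ε B m S.P) S.n (S.n • S.r) (relV S.r 0 F) 0
      (relV S.r C.P (m * C.r)) (m * C.r) + av (S.n • S.r)
        (PB ε (modB ε B m S.P) F (m * C.r + lin (relV S.r C.P (m * C.r)))) := by
    rw [redBr_zero, redBr, quad, PB_add_right, av_add, av_add, av_add]; ring
  rw [redS, e1, e2, map_add, tor_redBr_zero ε (modB_mem ε hB hm S.hP) _ _
    (relV_mem S.r (X := 0) (fun _ => zero_mem _) F)] at h1
  have e3 : dotO (relV S.r 0 F) (momentO ε (modB ε B m S.P) S.n (S.n • S.r)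
      (relV S.r C.P (m * C.r)) (m * C.r)) = -av (S.n • S.r) (vder τ F) := by
    rw [vder, av_add, av_mul (hτ 0), av_mul (hτ 1), av_smul_den, av_smul_den, av_mul S.hn,
      av_mul S.hn]
    simp only [dotO, relV, ← hmτ, Pi.zero_apply]
    ring
  rw [e3] at h1
  simp only [pair, hW.density, Pi.zero_apply, zero_mul, zero_add, add_zero] at h1
  rw [av_sub, map_sub, av, h1, map_neg]
  abel

/-- A rotated gradient is divergence-free, hence an admissible test covector, and detects exactly
the curl of the momentum. -/
theorem tor_curl_ham (ε : ℝ) {B : Obs E} (hB : B ∈ Fld E) {S : StF E} (hS : S.Tan)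
    {m : Obs E} (hm : m ∈ Fld E) (hnm : S.n * m = 1) {C : CvF E} {W : StF E}
    (hW : IsHam ε B S m C W) {τ : Fin 2 → Obs E}
    (hmτ : ∀ i, S.n * τ i = momentO ε (modB ε B m S.P) S.n (S.n • S.r)
      (relV S.r C.P (m * C.r)) (m * C.r) i) {G : Obs E} (hG : G ∈ Fld E) :
    tor (m * curlO W.P * G) = tor (curlO τ * G) := by
  have hm0 := dq_inverse hnm hS.1
  have hX : ∀ i, (![dq 1 (m * G), -dq 0 (m * G)] : Fin 2 → Obs E) i ∈ Fld E := fun i => by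
    fin_cases i
    exacts [dq_mem_Fld _ (mul_mem hm hG), neg_mem (dq_mem_Fld _ (mul_mem hm hG))]
  have h1 := hW.pair_eq ⟨0, ![dq 1 (m * G), -dq 0 (m * G)], 0, zero_mem _, hX⟩
    ⟨by simp, by
      simp only [divO, Matrix.cons_val_zero, Matrix.cons_val_one, map_neg]
      rw [dq_comm 0 1]; ring⟩
  have e2 : relV S.r ![dq 1 (m * G), -dq 0 (m * G)] 0 = ![dq 1 (m * G), -dq 0 (m * G)] := by
    funext i; simp [relV, av_zero]
  rw [redS, mul_zero, e2, tor_redBr_zero ε (modB_mem ε hB hm S.hP) _ _ hX] at h1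
  have e3 : dotO ![dq 1 (m * G), -dq 0 (m * G)] (momentO ε (modB ε B m S.P) S.n (S.n • S.r)
      (relV S.r C.P (m * C.r)) (m * C.r)) = dq 1 G * τ 0 - dq 0 G * τ 1 := by
    simp only [dotO, ← hmτ, Matrix.cons_val_zero, Matrix.cons_val_one, Derivation.leibniz, hm0,
      smul_eq_mul, mul_zero, add_zero]
    linear_combination (dq 1 G * τ 0 - dq 0 G * τ 1) * hnm
  have e4 : tor (dq 1 G * τ 0 - dq 0 G * τ 1) = tor (curlO τ * G) := by
    rw [map_sub, ← neg_neg (tor (dq 1 G * τ 0)), ← neg_neg (tor (dq 0 G * τ 1)), ← tor_mul_dq, ← tor_mul_dq,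
      curlO, sub_mul, map_sub, mul_comm G, mul_comm G]
    abel
  have e5 : tor (dq 1 (m * G) * W.P 0 + -dq 0 (m * G) * W.P 1) = tor (m * curlO W.P * G) := by
    have : m * curlO W.P * G = m * G * dq 0 (W.P 1) - m * G * dq 1 (W.P 0) := by
      simp only [curlO]; ring
    rw [this, map_sub, tor_mul_dq, tor_mul_dq, map_add, neg_mul, map_neg]
    abel
  rw [e3, e4] at h1
  rw [← e5, ← h1]
  simp [pair]

/-- A Hamiltonian family has zero density, so the variation sees it only through averages against
its phase space density and through the curl of its momentum; the two weak formulas evaluate both.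
-/
theorem tor_varS_ham (ε : ℝ) {B : Obs E} (hB : B ∈ Fld E) {S : StF E} (hS : S.Tan)
    {m : Obs E} (hm : m ∈ Fld E) (hnm : S.n * m = 1) (A₁ A₂ : CvF E) {C : CvF E} {W : StF E}
    (hW : IsHam ε B S m C W) {ρ σ τ : Fin 2 → Obs E} (hτ : ∀ i, τ i ∈ Fld E)
    (hmρ : ∀ i, S.n * ρ i = momentO ε (modB ε B m S.P) S.n (S.n • S.r)
      (relV S.r A₁.P (m * A₁.r)) (m * A₁.r) i)
    (hmσ : ∀ i, S.n * σ i = momentO ε (modB ε B m S.P) S.n (S.n • S.r)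
      (relV S.r A₂.P (m * A₂.r)) (m * A₂.r) i)
    (hmτ : ∀ i, S.n * τ i = momentO ε (modB ε B m S.P) S.n (S.n • S.r)
      (relV S.r C.P (m * C.r)) (m * C.r) i)
    (hρ : ∀ i, ρ i ∈ Fld E) (hσ : ∀ i, σ i ∈ Fld E) :
    tor (varS ε B S m A₁ A₂ W) =
      tor (av (S.n • S.r) (PB ε (modB ε B m S.P) (effective ε (modB ε B m S.P)
          ρ (relV S.r A₁.P (m * A₁.r)) (m * A₁.r) σ (relV S.r A₂.P (m * A₂.r)) (m * A₂.r))
          (m * C.r + lin (relV S.r C.P (m * C.r))) -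
        vder τ (effective ε (modB ε B m S.P)
          ρ (relV S.r A₁.P (m * A₁.r)) (m * A₁.r) σ (relV S.r A₂.P (m * A₂.r)) (m * A₂.r)))) -
      tor (ε • (curlO τ * (S.n * crossO (relV S.r A₁.P (m * A₁.r)) (relV S.r A₂.P (m * A₂.r)) +
        av (S.n • S.r) (quadB (relV S.r A₁.P (m * A₁.r)) (m * A₁.r)
          (relV S.r A₂.P (m * A₂.r)) (m * A₂.r))))) := by
  have hx := relV_mem S.r A₁.hP (m * A₁.r)
  have hy := relV_mem S.r A₂.hP (m * A₂.r)
  have hm0 := dq_inverse hnm hS.1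
  rw [tor_varS ε hB hS hm hnm A₁ A₂ hW.tan, ← tor_av_ham ε hB hm hnm hW hτ hmτ, map_smul,
    ← tor_curl_ham ε hB hS hm hnm hW hmτ (add_mem (mul_mem S.hn (crossO_mem hx hy)) (av_mem _ _)),
    ← map_smul, ← map_sub]
  congr 1
  have e : av W.r (S.n * effective ε (modB ε B m S.P) ρ (relV S.r A₁.P (m * A₁.r)) (m * A₁.r) σ
        (relV S.r A₂.P (m * A₂.r)) (m * A₂.r)) =
      av W.r (S.n * quad ε (modB ε B m S.P) (relV S.r A₁.P (m * A₁.r)) (m * A₁.r)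
        (relV S.r A₂.P (m * A₂.r)) (m * A₂.r)) -
      S.n * (σ 0 * av W.r (dv 0 (m * A₁.r)) + σ 1 * av W.r (dv 1 (m * A₁.r))) +
      S.n * (ρ 0 * av W.r (dv 0 (m * A₂.r)) + ρ 1 * av W.r (dv 1 (m * A₂.r))) := by
    rw [av_mul S.hn, av_mul S.hn, effective, av_add, av_sub, vder, vder, av_add, av_add,
      av_mul (hσ 0), av_mul (hσ 1), av_mul (hρ 0), av_mul (hρ 1)]
    ring
  rw [e, varRed, hW.density]
  simp only [dotO, ← hmρ, ← hmσ, curlO, Derivation.leibniz, hm0, smul_eq_mul, mul_zero, zero_mul,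
    map_zero, add_zero, sub_zero, zero_sub, real_smul_eq]
  ring

/-- The Jacobi identity for the part of the reduced bracket without second derivatives. -/
theorem varS_jacobi (ε : ℝ) {B : Obs E} (hB : B ∈ Fld E) {S : StF E} (hS : S.Tan)
    {m : Obs E} (hm : m ∈ Fld E) (hnm : S.n * m = 1) {A₁ A₂ A₃ : CvF E} (h₁ : A₁.Nrm) (h₂ : A₂.Nrm)
    (h₃ : A₃.Nrm) {W₁ W₂ W₃ : StF E} (hW₁ : IsHam ε B S m A₁ W₁) (hW₂ : IsHam ε B S m A₂ W₂)
    (hW₃ : IsHam ε B S m A₃ W₃) :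
    tor (varS ε B S m A₁ A₂ W₃) + tor (varS ε B S m A₂ A₃ W₁) + tor (varS ε B S m A₃ A₁ W₂) = 0 := by
  have hb := modB_mem ε hB hm S.hP
  have hx := fun A : CvF E => relV_mem S.r A.hP (m * A.r)
  let ρ : CvF E → Fin 2 → Obs E := fun A i => m * momentO ε (modB ε B m S.P) S.n (S.n • S.r)
      (relV S.r A.P (m * A.r)) (m * A.r) i
  have hρ : ∀ A i, ρ A i ∈ Fld E := fun A i =>
    mul_mem hm (momentO_mem ε hb S.hn _ (hx A) _ i)
  have hmρ : ∀ A i, S.n * ρ A i = momentO ε (modB ε B m S.P) S.n (S.n • S.r)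
      (relV S.r A.P (m * A.r)) (m * A.r) i := fun A i => by
    simp only [ρ]; rw [← mul_assoc, hnm, one_mul]
  -- By definition of the relative velocity this total is `n` times the original divergence-free
  -- field, and `n` is constant.
  have hdiv : ∀ A : CvF E, A.Nrm →
      divO (fun i => S.n * relV S.r A.P (m * A.r) i + av (S.n • S.r) (dv i (m * A.r))) = 0 := by
    intro A hA
    have e : (fun i => S.n * relV S.r A.P (m * A.r) i + av (S.n • S.r) (dv i (m * A.r))) =
        fun i => S.n * A.P i := by
      funext i
      rw [av_smul_den, av_mul S.hn, relV]; ring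
    have h0 := hA.2
    rw [divO] at h0
    rw [e, divO]
    simp only [Derivation.leibniz, hS.1, smul_eq_mul, mul_zero, add_zero]
    linear_combination S.n * h0
  rw [tor_varS_ham ε hB hS hm hnm A₁ A₂ hW₃ (hρ A₃) (hmρ A₁) (hmρ A₂) (hmρ A₃) (hρ A₁) (hρ A₂),
    tor_varS_ham ε hB hS hm hnm A₂ A₃ hW₁ (hρ A₁) (hmρ A₂) (hmρ A₃) (hmρ A₁) (hρ A₂) (hρ A₃),
    tor_varS_ham ε hB hS hm hnm A₃ A₁ hW₂ (hρ A₂) (hmρ A₃) (hmρ A₁) (hmρ A₂) (hρ A₃) (hρ A₁)]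
  exact tor_cyclic_sum ε hb (S.n • S.r) (hρ A₁) (hρ A₂) (hρ A₃) (hx A₁) (hx A₂) (hx A₃)
    (hdiv A₁ h₁) (hdiv A₂ h₂) (hdiv A₃ h₃) (hmρ A₁) (hmρ A₂) (hmρ A₃)

end Hamiltonian

/-! ### Naturality of the variation -/

section Naturality

variable {E : Type} [NormedAddCommGroup E] [NormedSpace ℝ E] [FiniteDimensional ℝ E]
variable {E' : Type} [NormedAddCommGroup E'] [NormedSpace ℝ E'] [FiniteDimensional ℝ E']
variable (φ : E' → E) (hφ : ContDiff ℝ ∞ φ)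

theorem compObs_av (h : Den E) (F : Obs E) :
    compObs φ hφ (av h F) = av (compDen φ hφ h) (compObs φ hφ F) := by
  rw [av, ← fib_compDen, compDen_smul, av]

theorem compObs_PB (ε : ℝ) (b F G : Obs E) : compObs φ hφ (PB ε b F G) =
    PB ε (compObs φ hφ b) (compObs φ hφ F) (compObs φ hφ G) := by
  simp only [PB, dotO, crossO, map_add, map_sub, map_mul, map_smul, dq_compObs, dv_compObs]

theorem compObs_lin (x : Fin 2 → Obs E) :
    compObs φ hφ (lin x) = lin fun i => compObs φ hφ (x i) := by
  simp only [lin, map_add, map_mul, compObs_xi]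

/-- Change of parameters is an algebra homomorphism commuting with position and velocity derivatives
and with averages, so it passes through the whole expression. It shows that the variation at a
parameter depends only on the data there. -/
theorem compObs_varS (ε : ℝ) (B : ScalarField) (S : StF E) (m : Obs E) (A C : CvF E) (V : StF E) :
    compObs φ hφ (varS ε (constFld E B) S m A C V) =
      varS ε (constFld E' B) (S.comp φ hφ) (compObs φ hφ m) (A.comp φ hφ) (C.comp φ hφ)
        (V.comp φ hφ) := by
  have hr : ∀ (r : Den E) X f, relV r X f = fun i => X i - av r (dv i f) := fun _ _ _ => rfl
  have hr' : ∀ (r : Den E') X f, relV r X f = fun i => X i - av r (dv i f) := fun _ _ _ => rfl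
  simp only [varS, varBr, redBr, quad, quadB, modB, vortO, hr, hr', crossO, map_add, map_sub, map_mul,
    map_neg, map_smul, compObs_av, compObs_PB, compObs_lin, compObs_constFld, compDen_add,
    compDen_smul, ← dq_compObs, ← dv_compObs, StF.comp_n, StF.comp_P, StF.comp_r, CvF.comp_P,
    CvF.comp_r]

theorem inverse_unique {n m m' : Obs E} (h : n * m = 1) (h' : n * m' = 1) : m = m' := by
  calc m = m * (n * m') := by rw [h', mul_one]
    _ = m' := by rw [← mul_assoc, mul_comm m, h, one_mul]

/-- The variation of the reduced bracket only depends on the slices of the families. -/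
theorem varS_slice (ε : ℝ) (B : ScalarField) {S V : StF E} {A C : CvF E} {m : Obs E}
    (hnm : S.n * m = 1) {S' V' : StF E'} {A' C' : CvF E'} {m' : Obs E'} (hnm' : S'.n * m' = 1)
    {s : E} {s' : E'} (hS : S.at s = S'.at s') (hV : V.at s = V'.at s') (hA : A.at s = A'.at s')
    (hC : C.at s = C'.at s') :
    tor (varS ε (constFld E B) S m A C V) s = tor (varS ε (constFld E' B) S' m' A' C' V') s' := by
  have h1 : S.comp (fun _ : Pt => s) contDiff_const = S'.comp (fun _ : Pt => s') contDiff_const :=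
    StF.eq_of_at hS
  have h2 : V.comp (fun _ : Pt => s) contDiff_const = V'.comp (fun _ : Pt => s') contDiff_const :=
    StF.eq_of_at hV
  have h3 : A.comp (fun _ : Pt => s) contDiff_const = A'.comp (fun _ : Pt => s') contDiff_const :=
    CvF.eq_of_at hA
  have h4 : C.comp (fun _ : Pt => s) contDiff_const = C'.comp (fun _ : Pt => s') contDiff_const :=
    CvF.eq_of_at hC
  have h5 : compObs (fun _ : Pt => s) contDiff_const m = compObs (fun _ : Pt => s') contDiff_const m' := by
    have e1 := congrArg (compObs (fun _ : Pt => s) contDiff_const) hnm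
    have e2 := congrArg (compObs (fun _ : Pt => s') contDiff_const) hnm'
    rw [map_mul, map_one, ← StF.comp_n] at e1 e2
    rw [← h1] at e2
    exact inverse_unique e1 e2
  rw [← tor_compObs (fun _ : Pt => s) contDiff_const _ 0,
    ← tor_compObs (fun _ : Pt => s') contDiff_const _ 0, compObs_varS, compObs_varS, h1, h2, h3, h4, h5]

end Naturality

section ChangeOfParameters

variable {E : Type} [NormedAddCommGroup E] [NormedSpace ℝ E] [FiniteDimensional ℝ E]
variable {E' : Type} [NormedAddCommGroup E'] [NormedSpace ℝ E'] [FiniteDimensional ℝ E']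

/-! ### Derivatives of families -/

/-- The substitutions have a constant derivative `L`; the chain rule then sends the fixed direction
`e` to the fixed direction `L e`. -/
theorem dt_compObs {φ : E' → E} (hφ : ContDiff ℝ ∞ φ) {L : E' →L[ℝ] E}
    (hL : ∀ s, HasFDerivAt φ L s) (e : E') (f : Obs E) :
    dt e (compObs φ hφ f) = compObs φ hφ (dt (L e) f) :=
  Obs.ext fun s q ξ => by
    rw [fn_dt, compObs_fn, fn_dt]
    have h := ((f.differentiable.comp (by fun_prop : Differentiable ℝ fun s : E =>
      ((s, q, ξ) : Dom E))) (φ s)).hasFDerivAt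
    have h1 := (h.comp s (hL s)).fderiv
    change fderiv ℝ ((f.fn ∘ fun s => (s, q, ξ)) ∘ φ) s e = _
    rw [h1]; rfl

theorem StF.ext_components {S T : StF E} (hn : S.n = T.n) (hP : ∀ i, S.P i = T.P i)
    (hr : S.r = T.r) : S = T := by
  obtain ⟨n, P, r, h, h'⟩ := S
  obtain ⟨n', P', r', h1, h1'⟩ := T
  obtain rfl : n = n' := hn
  obtain rfl : P = P' := funext hP
  obtain rfl : r = r' := hr
  rfl

theorem CvF.ext_components {S T : CvF E} (hn : S.n = T.n) (hP : ∀ i, S.P i = T.P i)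
    (hr : S.r = T.r) : S = T := by
  obtain ⟨n, P, r, h, h'⟩ := S
  obtain ⟨n', P', r', h1, h1'⟩ := T
  obtain rfl : n = n' := hn
  obtain rfl : P = P' := funext hP
  obtain rfl : r = r' := hr
  rfl

theorem StF.deriv_comp {φ : E' → E} (hφ : ContDiff ℝ ∞ φ) {L : E' →L[ℝ] E}
    (hL : ∀ s, HasFDerivAt φ L s) (e : E') (S : StF E) :
    (S.comp φ hφ).deriv e = (S.deriv (L e)).comp φ hφ := by
  refine StF.ext_components ?_ (fun i => ?_) (Den.ext_obs ?_)
  · rw [StF.comp_n]; simp only [StF.deriv]; rw [StF.comp_n, dt_compObs hφ hL]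
  · rw [StF.comp_P]; simp only [StF.deriv]; rw [StF.comp_P, dt_compObs hφ hL]
  · exact dt_compObs hφ hL e S.r.obs

theorem CvF.deriv_comp {φ : E' → E} (hφ : ContDiff ℝ ∞ φ) {L : E' →L[ℝ] E}
    (hL : ∀ s, HasFDerivAt φ L s) (e : E') (A : CvF E) :
    (A.comp φ hφ).deriv e = (A.deriv (L e)).comp φ hφ := by
  refine CvF.ext_components ?_ (fun i => ?_) ?_
  · rw [CvF.comp_n]; simp only [CvF.deriv]; rw [CvF.comp_n, dt_compObs hφ hL]
  · rw [CvF.comp_P]; simp only [CvF.deriv]; rw [CvF.comp_P, dt_compObs hφ hL]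
  · exact dt_compObs hφ hL e A.r

theorem StF.deriv_comm (S : StF E) (e e' : E) : (S.deriv e).deriv e' = (S.deriv e').deriv e :=
  StF.ext_components (pd_comm _ _ _) (fun _ => pd_comm _ _ _) (Den.ext_obs (pd_comm _ _ _))

theorem StF.Tan.deriv {S : StF E} (hS : S.Tan) (e : E) : (S.deriv e).Tan := by
  refine ⟨fun i => ?_, ?_⟩
  · change dq i (dt e S.n) = 0
    rw [← dt_dq, hS.1, map_zero]
  · have := congrArg (dt e) hS.2
    rw [divO, map_add, dt_dq, dt_dq, map_zero] at this
    exact this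

theorem CvF.Nrm.deriv {A : CvF E} (hA : A.Nrm) (e : E) : (A.deriv e).Nrm := by
  refine ⟨fun i => ?_, ?_⟩
  · change dq i (dt e A.n) = 0
    rw [← dt_dq, hA.1, map_zero]
  · have := congrArg (dt e) hA.2
    rw [divO, map_add, dt_dq, dt_dq, map_zero] at this
    exact this

theorem fderiv_pair (A : CvF E) (V : StF E) (s e : E) :
    fderiv ℝ (pair A V) s e = pair (A.deriv e) V s + pair A (V.deriv e) s := by
  rw [pair, fderiv_tor, pair, pair, ← Pi.add_apply, ← map_add]
  refine congrFun (congrArg tor ?_) s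
  simp only [map_add, Derivation.leibniz, ← fib_dtD, dtD_smul, smul_eq_mul, CvF.deriv, StF.deriv]
  ring

/-! ### The Hessian of a functional -/

/-- The chain rule is assumed along curves only; restricting the family to the line through `s` in
the direction `e` gives each directional derivative. -/
theorem IsDifferential.fderiv_eq {N : Set State} {F : N → ℝ} {dF : N → Covector}
    (h : IsDifferential N F dF) {S : StF E} (hS : ∀ s, S.at s ∈ N) {A : CvF E}
    (hA : ∀ s, dF ⟨S.at s, hS s⟩ = A.at s) (s e : E) :
    fderiv ℝ (fun s => F ⟨S.at s, hS s⟩) s e = pair A (S.deriv e) s := by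
  have hφ : ContDiff ℝ ∞ fun t : ℝ => s + t • e := by fun_prop
  have hL : ∀ t, HasFDerivAt (fun t : ℝ => s + t • e) (ContinuousLinearMap.toSpanSingleton ℝ e) t :=
    fun t => ((ContinuousLinearMap.toSpanSingleton ℝ e).hasFDerivAt (x := t)).const_add s
  have h1 := h.hasDerivAt (S.comp _ hφ) (fun t => ⟨S.at (s + t • e), hS _⟩) (fun _ => rfl) 0
  have h2 : HasDerivAt (fun t : ℝ => s + t • e) e 0 := by
    simpa using (hL 0).hasDerivAt
  have h3 : HasFDerivAt (fun s => F ⟨S.at s, hS s⟩) (fderiv ℝ (fun s => F ⟨S.at s, hS s⟩) s)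
      (s + (0 : ℝ) • e) := by
    rw [zero_smul, add_zero]
    exact ((h.lift S _ fun _ => rfl).1.differentiable (by simp) s).hasFDerivAt
  have h4 : HasDerivAt (fun t : ℝ => F ⟨S.at (s + t • e), hS _⟩)
      (fderiv ℝ (fun s => F ⟨S.at s, hS s⟩) s e) 0 :=
    HasFDerivAt.comp_hasDerivAt (l := fun s => F ⟨S.at s, hS s⟩) (f := fun t : ℝ => s + t • e) (0 : ℝ) h3 h2
  rw [h4.unique h1, StF.deriv_comp hφ hL, hA, StF.comp_at, pairing_at]
  simp

/-- Symmetry of the second derivative of the functional along the family. The term with the second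
derivative of the family itself is symmetric as well and cancels. -/
theorem IsDifferential.hessian_symm {N : Set State} {F : N → ℝ} {dF : N → Covector}
    (h : IsDifferential N F dF) {S : StF E} (hS : ∀ s, S.at s ∈ N) {A : CvF E}
    (hA : ∀ s, dF ⟨S.at s, hS s⟩ = A.at s) (s e e' : E) :
    pair (A.deriv e) (S.deriv e') s = pair (A.deriv e') (S.deriv e) s := by
  have hc : ContDiff ℝ ∞ fun s => F ⟨S.at s, hS s⟩ := (h.lift S _ fun _ => rfl).1
  have h2 : ∀ e e', fderiv ℝ (fderiv ℝ fun s => F ⟨S.at s, hS s⟩) s e e' =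
      pair (A.deriv e) (S.deriv e') s + pair A ((S.deriv e').deriv e) s := fun e e' => by
    rw [← fderiv_pair]
    have hd : DifferentiableAt ℝ (fderiv ℝ fun s => F ⟨S.at s, hS s⟩) s :=
      (hc.fderiv_right (m := ∞) (by simp)).differentiable (by simp) s
    have : pair A (S.deriv e') = fun s => fderiv ℝ (fun s => F ⟨S.at s, hS s⟩) s e' :=
      funext fun s => (h.fderiv_eq hS hA s e').symm
    rw [this, fderiv_clm_apply hd (by fun_prop)]
    simp
  have hs : IsSymmSndFDerivAt ℝ (fun s => F ⟨S.at s, hS s⟩) s :=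
    (contDiff_cast hc 2).contDiffAt.isSymmSndFDerivAt
      (by rw [minSmoothness_of_isRCLikeNormedField]; exact le_rfl)
  have h3 := hs e e'
  rw [h2, h2, S.deriv_comm e e'] at h3
  linarith

end ChangeOfParameters

section Pointwise

variable {E : Type} [NormedAddCommGroup E] [NormedSpace ℝ E] [FiniteDimensional ℝ E]

/-! ### Hamiltonian vectors -/

/-- `w` is the Hamiltonian vector of the covector `γ` for the reduced bracket. -/
structure IsHamVec (ε : ℝ) (B : ScalarField) (σ : State) (γ : Covector) (w : State) : Prop where
  tan : IsTan w
  density : ∀ q, w.n q = 0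
  pair_eq : ∀ α, IsNrm α → pairing α w = bracketSig ε B σ α γ

/-- Normalized covectors separate tangent vectors; this makes the Hamiltonian vector independent of
the family used to construct it. -/
theorem IsHamVec.unique {ε : ℝ} {B : ScalarField} {σ : State} {γ : Covector} {w w' : State}
    (h : IsHamVec ε B σ γ w) (h' : IsHamVec ε B σ γ w') : w = w' :=
  StF.Tan.at_eq (W := constState Pt w) (W' := constState Pt w') (s := 0) h.tan.const h'.tan.const
    fun A hA => by
      rw [pair_constState, pair_constState, h.pair_eq _ ((CvF.nrm_iff A).1 hA 0),
        h'.pair_eq _ ((CvF.nrm_iff A).1 hA 0)]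

theorem IsHam.isHamVec {ε : ℝ} {B : ScalarField} {S : StF E} (hS : S.Tan) {m : Obs E}
    (hm : m ∈ Fld E) (hnm : S.n * m = 1) {C : CvF E} {W : StF E}
    (hW : IsHam ε (constFld E B) S m C W) (s : E) : IsHamVec ε B (S.at s) (C.at s) (W.at s) where
  tan := (StF.tan_iff W).1 hW.tan s
  density q := by rw [StF.at_n, hW.density]; rfl
  pair_eq α hα := by
    have h1 := congrFun (hW.pair_eq _ (hα.const (E := E))) s
    rw [← pairing_at] at h1
    exact h1.trans (bracketSig_eq ε B hS hm hnm (constCovector E α) C s).symm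

theorem exists_isHamVec (ε : ℝ) (B : ScalarField) {σ : State} (hσ : σ ∈ Sig) {γ : Covector}
    (hγ : IsNrm γ) : ∃ w, IsHamVec ε B σ γ w := by
  obtain ⟨m, hm, hnm⟩ := exists_inverse_const hσ.1
  obtain ⟨W, hW⟩ := exists_isHam ε (constFld_mem B) (IsTan.const hσ.2) hm hnm (hγ.const (E := Pt))
  exact ⟨W.at 0, hW.isHamVec (IsTan.const hσ.2) hm hnm 0⟩

theorem bracketSig_skew (ε : ℝ) (B : ScalarField) {σ : State} (hσ : σ ∈ Sig) (α γ : Covector) :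
    bracketSig ε B σ α γ = -bracketSig ε B σ γ α := by
  obtain ⟨m, hm, hnm⟩ := exists_inverse_const hσ.1
  have h := fun α γ => bracketSig_eq ε B (IsTan.const hσ.2) hm hnm (constCovector Pt α)
    (constCovector Pt γ) 0
  refine (h α γ).trans ?_
  rw [redS, redBr_skew, map_neg]
  exact congrArg Neg.neg (h γ α).symm

/-! ### The part of the derivative of the bracket without second derivatives -/

/-- The derivative of the reduced bracket in the direction `v` for fixed covectors. -/
def bracketVar (ε : ℝ) (B : ScalarField) (σ : Sig) (α γ : Covector) (v : State) : ℝ :=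
  tor (varS ε (constFld Pt B) (constState Pt σ) (Classical.choose (exists_inverse_const σ.2.1))
    (constCovector Pt α) (constCovector Pt γ) (constState Pt v)) 0

theorem tor_varS_eq_bracketVar (ε : ℝ) (B : ScalarField) {S : StF E} (hS : ∀ s, S.at s ∈ Sig)
    {m : Obs E} (hnm : S.n * m = 1) (A C : CvF E) (V : StF E) (s : E) :
    tor (varS ε (constFld E B) S m A C V) s =
      bracketVar ε B ⟨S.at s, hS s⟩ (A.at s) (C.at s) (V.at s) :=
  varS_slice ε B hnm (Classical.choose_spec (exists_inverse_const (hS s).1)).2 rfl rfl rfl rfl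

theorem bracketVar_jacobi (ε : ℝ) (B : ScalarField) (σ : Sig) {α₁ α₂ α₃ : Covector} (h₁ : IsNrm α₁)
    (h₂ : IsNrm α₂) (h₃ : IsNrm α₃) {w₁ w₂ w₃ : State} (hw₁ : IsHamVec ε B σ α₁ w₁)
    (hw₂ : IsHamVec ε B σ α₂ w₂) (hw₃ : IsHamVec ε B σ α₃ w₃) :
    bracketVar ε B σ α₁ α₂ w₃ + bracketVar ε B σ α₂ α₃ w₁ + bracketVar ε B σ α₃ α₁ w₂ = 0 := by
  obtain ⟨m, hm, hnm⟩ := exists_inverse_const σ.2.1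
  have hS : (constState Pt σ).Tan := IsTan.const σ.2.2
  have hB := constFld_mem (E := Pt) B
  obtain ⟨W₁, hW₁⟩ := exists_isHam ε hB hS hm hnm (h₁.const (E := Pt))
  obtain ⟨W₂, hW₂⟩ := exists_isHam ε hB hS hm hnm (h₂.const (E := Pt))
  obtain ⟨W₃, hW₃⟩ := exists_isHam ε hB hS hm hnm (h₃.const (E := Pt))
  rw [hw₁.unique (hW₁.isHamVec hS hm hnm 0), hw₂.unique (hW₂.isHamVec hS hm hnm 0),
    hw₃.unique (hW₃.isHamVec hS hm hnm 0)]
  have h := congrFun (varS_jacobi ε hB hS hm hnm h₁.const h₂.const h₃.const hW₁ hW₂ hW₃) 0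
  have e := fun A C V => tor_varS_eq_bracketVar ε B (S := constState Pt σ) (fun _ => σ.2) hnm A C V 0
  simp only [Pi.add_apply, e] at h
  exact h

/-! ### Hessians -/

/-- Moving along a tangent vector with zero density never makes the density vanish, so the entire
line stays in the submanifold. -/
theorem add_smul_mem_Sig {σ w : State} (hσ : σ ∈ Sig) (hw : IsTan w) (hn : ∀ q, w.n q = 0) (x : ℝ) :
    σ + x • w ∈ Sig := by
  refine ⟨fun q => ?_, (StF.tan_iff _).1 (StF.line_tan (IsTan.const (E := ℝ) hσ.2) hw.const
    (ContinuousLinearMap.id ℝ ℝ)) x⟩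
  change σ.n q + x * w.n q ≠ 0
  rw [hn, mul_zero, add_zero]
  exact hσ.1 q

/-- `κ` is the derivative at `σ` in the direction `w` of the covector field `D`. -/
def IsHess (D : Sig → Covector) (σ w : State) (κ : Covector) : Prop :=
  ∃ A : CvF ℝ, (∀ x, ∃ h, A.at x = D ⟨σ + x • w, h⟩) ∧ κ = (A.deriv 1).at 0

theorem IsHess.unique {D : Sig → Covector} {σ w : State} {κ κ' : Covector} (h : IsHess D σ w κ)
    (h' : IsHess D σ w κ') : κ = κ' := by
  obtain ⟨A, hA, rfl⟩ := h
  obtain ⟨A', hA', rfl⟩ := h'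
  have : A = A' := CvF.ext_at fun x => by
    obtain ⟨_, e⟩ := hA x
    obtain ⟨_, e'⟩ := hA' x
    rw [e, e']
  rw [this]

/-- The covector field is lifted along the family S + xW with one more parameter x; the covector
sought is its derivative in x at 0. Symmetry of second derivatives in the enlarged family transposes
the Hessian, freeing the direction `e` from the differentiated covector. -/
theorem exists_hessian {F : Sig → ℝ} {D : Sig → Covector} (hD : IsDifferential Sig F D) {S : StF E}
    (hS : ∀ s, S.at s ∈ Sig) {A : CvF E} (hA : ∀ s, D ⟨S.at s, hS s⟩ = A.at s) {W : StF E}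
    (hW : W.Tan) (hW0 : ∀ s q, (W.at s).n q = 0) :
    ∃ K : CvF E, (∀ s, IsHess D (S.at s) (W.at s) (K.at s)) ∧
      ∀ s e, pair (A.deriv e) W s = pair K (S.deriv e) s := by
  let S' : StF (E × ℝ) := S.comp Prod.fst contDiff_fst
  let W' : StF (E × ℝ) := W.comp Prod.fst contDiff_fst
  let Γ : StF (E × ℝ) := S'.line W' (ContinuousLinearMap.snd ℝ E ℝ)
  have hΓ : ∀ p, Γ.at p ∈ Sig := fun p =>
    add_smul_mem_Sig (hS p.1) ((StF.tan_iff W).1 hW p.1) (hW0 p.1) p.2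
  obtain ⟨-, A₂, hA₂⟩ := hD.lift Γ (fun p => ⟨Γ.at p, hΓ p⟩) fun _ => rfl
  have hj : ContDiff ℝ ∞ fun s : E => (s, (0 : ℝ)) := by fun_prop
  have hjL : ∀ s, HasFDerivAt (fun s : E => (s, (0 : ℝ))) (ContinuousLinearMap.inl ℝ E ℝ) s :=
    fun s => (ContinuousLinearMap.inl ℝ E ℝ).hasFDerivAt
  have hi : ∀ s : E, ContDiff ℝ ∞ fun x : ℝ => (s, x) := fun s => by fun_prop
  have hiL : ∀ (s : E) (x : ℝ), HasFDerivAt (fun x : ℝ => (s, x)) (ContinuousLinearMap.inr ℝ E ℝ) x :=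
    fun s x => (hasFDerivAt_const s x).prodMk (hasFDerivAt_id x)
  refine ⟨(A₂.deriv (0, 1)).comp _ hj, fun s => ⟨A₂.comp _ (hi s), fun x => ⟨hΓ (s, x), ?_⟩, ?_⟩,
    fun s e => ?_⟩
  · rw [CvF.comp_at, ← hA₂]; rfl
  · rw [CvF.deriv_comp (hi s) (hiL s)]; rfl
  · have h := hD.hessian_symm hΓ hA₂ (s, 0) (e, 0) (0, 1)
    have e1 : Γ.comp _ hj = S := StF.ext_at fun s => by
      change S.at s + (0 : ℝ) • W.at s = S.at s
      rw [zero_smul, add_zero]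
    have e2 : A₂.comp _ hj = A := CvF.ext_at fun s => by
      rw [CvF.comp_at, ← hA₂, ← hA]
      congr 2
      change S.at s + (0 : ℝ) • W.at s = S.at s
      rw [zero_smul, add_zero]
    have e3 : (Γ.deriv (0, 1)).at (s, 0) = W.at s := by
      have h1 := (Γ.comp _ (hi s)).isVelocity 0
      rw [StF.deriv_comp (hi s) (hiL s)] at h1
      exact h1.unique (line_isVelocity (S.at s) (W.at s))
    have e4 : (Γ.deriv (e, 0)).at (s, 0) = (S.deriv e).at s := by
      rw [← e1, StF.deriv_comp hj hjL]; rfl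
    have e5 : (A₂.deriv (e, 0)).at (s, 0) = (A.deriv e).at s := by
      rw [← e2, CvF.deriv_comp hj hjL]; rfl
    rw [← pairing_at, ← pairing_at, e3, e4, e5] at h
    rw [← pairing_at, ← pairing_at, h]
    rfl

end Pointwise

section Gradients

variable {E : Type} [NormedAddCommGroup E] [NormedSpace ℝ E] [FiniteDimensional ℝ E]

/-! ### Functional derivatives -/

/-- The covector `α` is the functional derivative of `F` at `σ`. -/
def IsGradient (F : Sig → ℝ) (σ : Sig) (α : Covector) : Prop :=
  IsNrm α ∧ ∀ (S : StF ℝ) (hS : ∀ t, S.at t ∈ Sig) (t : ℝ), S.at t = σ →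
    HasDerivAt (fun s => F ⟨S.at s, hS s⟩) (pairing α ((S.deriv 1).at t)) t

theorem exists_curve (σ : Sig) {v : State} (hv : IsTan v) :
    ∃ S : StF ℝ, (∀ t, S.at t ∈ Sig) ∧ S.at 0 = σ ∧ (S.deriv 1).at 0 = v := by
  have h : v ∈ tangentSpace Sig σ := by rw [tangentSpace_Sig σ.2]; exact hv
  obtain ⟨U, c, hU, h0, hc, hcN, hc0, hv⟩ := h
  obtain ⟨φ, hφ, hφU, hev⟩ := exists_cutoff hU h0
  refine ⟨liftState hφ hU hφU hc, fun t => hcN _ (hφU t), ?_, ?_⟩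
  · change c (φ 0) = σ
    rw [hev.self_of_nhds, hc0]
  · refine (StF.isVelocity _ 0).unique (hv.congr ?_)
    filter_upwards [hev] with s hs
    change c (φ s) = c s
    rw [hs]

theorem IsGradient.unique {F : Sig → ℝ} {σ : Sig} {α α' : Covector} (h : IsGradient F σ α)
    (h' : IsGradient F σ α') : α = α' :=
  h.1.eq h'.1 fun v hv => by
    obtain ⟨S, hS, hσ, rfl⟩ := exists_curve σ hv
    exact (h.2 S hS 0 hσ).unique (h'.2 S hS 0 hσ)

theorem IsFunctionalDerivative.isNrm {F : Sig → ℝ} {D : Sig → Covector}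
    (h : IsFunctionalDerivative F D) (σ : Sig) : IsNrm (D σ) := h.2 σ

theorem IsFunctionalDerivative.isGradient {F : Sig → ℝ} {D : Sig → Covector}
    (h : IsFunctionalDerivative F D) (σ : Sig) : IsGradient F σ (D σ) := by
  refine ⟨h.2 σ, fun S hS t ht => ?_⟩
  have h1 := h.1.hasDerivAt S (fun s => ⟨S.at s, hS s⟩) (fun _ => rfl) t
  have e : (⟨S.at t, hS t⟩ : Sig) = σ := Subtype.ext ht
  rwa [e] at h1

theorem IsFunctionalDerivative.unique {F : Sig → ℝ} {D D' : Sig → Covector}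
    (h : IsFunctionalDerivative F D) (h' : IsFunctionalDerivative F D') : D = D' :=
  funext fun σ => (h.isGradient σ).unique (h'.isGradient σ)

/-- The gradient at a point is unique, so gradients found along separate families fit together into
one covector field, which is smooth because it is so along each family. -/
theorem exists_functionalDerivative_of_gradients {F : Sig → ℝ}
    (h : ∀ (k : ℕ) (S : StF (Fin k → ℝ)) (hS : ∀ s, S.at s ∈ Sig),
      ContDiff ℝ ∞ (fun s => F ⟨S.at s, hS s⟩) ∧
        ∃ A : CvF (Fin k → ℝ), ∀ s, IsGradient F ⟨S.at s, hS s⟩ (A.at s)) :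
    ∃ D, IsFunctionalDerivative F D := by
  have h0 : ∀ σ : Sig, ∃ α, IsGradient F σ α := fun σ => by
    obtain ⟨-, A, hA⟩ := h 0 (constState Pt σ) fun _ => σ.2
    exact ⟨_, hA 0⟩
  choose D hD using h0
  refine ⟨D, isDifferential_of_lift (fun k S σ hσ => ?_) (fun S c hc t => ?_), fun σ => (hD σ).1⟩
  · have hS : ∀ s, S.at s ∈ Sig := fun s => by rw [hσ]; exact (σ s).2
    obtain rfl : (fun s => ⟨S.at s, hS s⟩) = σ := funext fun s => Subtype.ext (hσ s)
    obtain ⟨h1, A, hA⟩ := h k S hS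
    exact ⟨h1, A, fun s => (hD _).unique (hA s)⟩
  · have hS : ∀ s, S.at s ∈ Sig := fun s => by rw [hc]; exact (c s).2
    obtain rfl : (fun s => ⟨S.at s, hS s⟩) = c := funext fun s => Subtype.ext (hc s)
    exact (hD _).2 S hS t rfl

theorem StF.tan_deriv_at {S : StF E} (hS : ∀ s, S.at s ∈ Sig) (e s : E) :
    IsTan ((S.deriv e).at s) :=
  (StF.tan_iff _).1 ((StF.tan_of_mem hS).deriv e) s

/-- Normalizing any representative of the differential along each family; velocities in the
submanifold are tangent and do not see the change. -/
theorem exists_functionalDerivative {F : Sig → ℝ} (hF : F ∈ smoothFunctionals Sig) :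
    ∃ D, IsFunctionalDerivative F D := by
  obtain ⟨dF, hdF⟩ := hF
  refine exists_functionalDerivative_of_gradients fun k S hS => ?_
  obtain ⟨h1, A, hA⟩ := hdF.lift S (fun s => ⟨S.at s, hS s⟩) fun _ => rfl
  obtain ⟨A', hA', -, -, -, hp⟩ := exists_normalized A
  refine ⟨h1, A', fun s => ⟨(CvF.nrm_iff A').1 hA' s, fun T hT t ht => ?_⟩⟩
  have h2 := hdF.hasDerivAt T (fun s => ⟨T.at s, hT s⟩) (fun _ => rfl) t
  have e : (⟨T.at t, hT t⟩ : Sig) = ⟨S.at s, hS s⟩ := Subtype.ext ht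
  have h3 := congrFun (hp _ (StF.tan_deriv_at hT 1 t).const) s
  rw [← pairing_at, ← pairing_at] at h3
  rw [e, hA] at h2
  simp only [constState_at] at h3
  rwa [h3] at h2

/-! ### Linear combinations of covectors -/

/-- Linear combinations of families of covectors with smooth coefficients. -/
def CvF.comb (f g : E → ℝ) (hf : ContDiff ℝ ∞ f) (hg : ContDiff ℝ ∞ g) (A C : CvF E) : CvF E :=
  ⟨parFld f hf * A.n + parFld g hg * C.n, fun i => parFld f hf * A.P i + parFld g hg * C.P i,
    parFld f hf * A.r + parFld g hg * C.r,
    add_mem (mul_mem (parFld_mem _ _) A.hn) (mul_mem (parFld_mem _ _) C.hn),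
    fun i => add_mem (mul_mem (parFld_mem _ _) (A.hP i)) (mul_mem (parFld_mem _ _) (C.hP i))⟩

theorem CvF.comb_at (f g : E → ℝ) (hf : ContDiff ℝ ∞ f) (hg : ContDiff ℝ ∞ g) (A C : CvF E) (s : E) :
    (A.comb f g hf hg C).at s = f s • A.at s + g s • C.at s := rfl

theorem pairing_comb (a b : ℝ) (α β : Covector) (v : State) :
    pairing (a • α + b • β) v = a * pairing α v + b * pairing β v := by
  have h := pairing_at ((constCovector Pt α).comb (fun _ => a) (fun _ => b) contDiff_const
    contDiff_const (constCovector Pt β)) (constState Pt v) 0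
  have e : pair ((constCovector Pt α).comb (fun _ => a) (fun _ => b) contDiff_const
    contDiff_const (constCovector Pt β)) (constState Pt v) =
      a • pair (constCovector Pt α) (constState Pt v) +
        b • pair (constCovector Pt β) (constState Pt v) := by
    have hp : ∀ c : ℝ, parFld (fun _ : Pt => c) contDiff_const = algebraMap ℝ (Obs Pt) c :=
      fun c => rfl
    rw [pair, pair, pair, ← map_smul, ← map_smul, ← map_add]
    congr 1
    simp only [CvF.comb, hp, ← Algebra.smul_def, add_smul, smul_assoc, map_add, map_smul, smul_add,
      smul_mul_assoc, add_mul]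
    ring
  rw [e] at h
  refine h.trans ?_
  simp only [Pi.add_apply, Pi.smul_apply, ← pairing_at, constState_at, constCovector_at, smul_eq_mul]

/-- A common form of the sum and product rules, with the coefficients of the differentials as
functionals `a` and `b`. -/
theorem isDifferential_comb {F G H : Sig → ℝ} {dF dG dH : Sig → Covector}
    (hF : IsDifferential Sig F dF) (hG : IsDifferential Sig G dG) {a b : Sig → ℝ}
    (ha : a ∈ smoothFunctionals Sig) (hb : b ∈ smoothFunctionals Sig)
    (hd : ∀ σ, dH σ = a σ • dF σ + b σ • dG σ)
    (hsm : ∀ {E : Type} [NormedAddCommGroup E] [NormedSpace ℝ E] (c : E → Sig),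
      ContDiff ℝ ∞ (fun s => F (c s)) → ContDiff ℝ ∞ (fun s => G (c s)) →
        ContDiff ℝ ∞ fun s => H (c s))
    (hder : ∀ (c : ℝ → Sig) (t f g : ℝ), HasDerivAt (fun s => F (c s)) f t →
      HasDerivAt (fun s => G (c s)) g t →
        HasDerivAt (fun s => H (c s)) (a (c t) * f + b (c t) * g) t) :
    IsDifferential Sig H dH := by
  obtain ⟨da, hda⟩ := ha
  obtain ⟨db, hdb⟩ := hb
  refine isDifferential_of_lift (fun k S σ hσ => ?_) fun S c hc t => ?_
  · obtain ⟨hF1, A, hA⟩ := hF.lift S σ hσ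
    obtain ⟨hG1, C, hC⟩ := hG.lift S σ hσ
    refine ⟨hsm σ hF1 hG1, A.comb _ _ (hda.lift S σ hσ).1 (hdb.lift S σ hσ).1 C, fun s => ?_⟩
    rw [CvF.comb_at, hd, hA, hC]
  · rw [hd, pairing_comb]
    exact hder c t _ _ (hF.hasDerivAt S c hc t) (hG.hasDerivAt S c hc t)

theorem isDifferential_const (c : ℝ) : IsDifferential Sig (fun _ => c) fun _ => 0 := by
  refine isDifferential_of_lift (fun k S σ hσ => ⟨contDiff_const, constCovector _ 0, fun _ => rfl⟩)
    fun S σ hσ t => ?_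
  have h := pairing_comb 0 0 0 0 ((S.deriv 1).at t)
  simp only [zero_smul, add_zero, zero_mul] at h
  rw [h]
  exact hasDerivAt_const _ _

theorem const_mem_smoothFunctionals (c : ℝ) : (fun _ => c) ∈ smoothFunctionals Sig :=
  ⟨_, isDifferential_const c⟩

theorem isDifferential_add {F G : Sig → ℝ} {dF dG : Sig → Covector}
    (hF : IsDifferential Sig F dF) (hG : IsDifferential Sig G dG) :
    IsDifferential Sig (F + G) (dF + dG) :=
  isDifferential_comb hF hG (const_mem_smoothFunctionals 1) (const_mem_smoothFunctionals 1)
    (fun σ => by simp) (fun c h h' => h.add h') fun c t f g hf hg => by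
      rw [one_mul, one_mul]; exact hf.add hg

theorem isDifferential_mul {F G : Sig → ℝ} {dF dG : Sig → Covector}
    (hF : IsDifferential Sig F dF) (hG : IsDifferential Sig G dG) :
    IsDifferential Sig (F * G) fun σ => G σ • dF σ + F σ • dG σ :=
  isDifferential_comb hF hG ⟨_, hG⟩ ⟨_, hF⟩ (fun σ => rfl) (fun c h h' => h.mul h')
    fun c t f g hf hg => (hf.mul hg).congr_deriv (by ring)

end Gradients

section Bracket

variable {E : Type} [NormedAddCommGroup E] [NormedSpace ℝ E] [FiniteDimensional ℝ E]

/-! ### The derivative of the bracket of two functionals -/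

theorem contDiff_bracketSig (ε : ℝ) (B : ScalarField) {S : StF E} (hS : ∀ s, S.at s ∈ Sig)
    (A C : CvF E) : ContDiff ℝ ∞ fun s => bracketSig ε B (S.at s) (A.at s) (C.at s) := by
  obtain ⟨m, hm, hnm⟩ := StF.exists_inverse fun s => (hS s).1
  simp only [bracketSig_eq ε B (StF.tan_of_mem hS) hm hnm]
  exact contDiff_tor _

theorem dt_constFld (B : ScalarField) (e : E) : dt e (constFld E B) = 0 :=
  dt_const_Obs e fun _ _ _ => rfl

/-- The second clause describes the covector `L` at a point by data at that point: Hamiltonian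
vectors, Hessians along them, and the explicit variation. Hence the derivative does not depend on
the family through the point. -/
theorem fderiv_bracketSig {ε : ℝ} {B : ScalarField} {F G : Sig → ℝ} {DF DG : Sig → Covector}
    (hF : IsFunctionalDerivative F DF) (hG : IsFunctionalDerivative G DG) {S : StF E}
    (hS : ∀ s, S.at s ∈ Sig) {A C : CvF E} (hA : ∀ s, DF ⟨S.at s, hS s⟩ = A.at s)
    (hC : ∀ s, DG ⟨S.at s, hS s⟩ = C.at s) :
    ∃ L : CvF E, ∀ s,
      (∀ e, fderiv ℝ (fun s => bracketSig ε B (S.at s) (A.at s) (C.at s)) s e =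
        pair L (S.deriv e) s) ∧
      ∀ wF wG κF κG v, IsHamVec ε B (S.at s) (A.at s) wF → IsHamVec ε B (S.at s) (C.at s) wG →
        IsHess DF (S.at s) wG κF → IsHess DG (S.at s) wF κG → IsTan v →
        pairing (L.at s) v = pairing κF v - pairing κG v +
          bracketVar ε B ⟨S.at s, hS s⟩ (A.at s) (C.at s) v := by
  have hT := StF.tan_of_mem hS
  have hB := constFld_mem (E := E) B
  obtain ⟨m, hm, hnm⟩ := StF.exists_inverse fun s => (hS s).1
  have hA' : A.Nrm := (CvF.nrm_iff A).2 fun s => by rw [← hA]; exact hF.isNrm _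
  have hC' : C.Nrm := (CvF.nrm_iff C).2 fun s => by rw [← hC]; exact hG.isNrm _
  obtain ⟨WA, hWA⟩ := exists_isHam ε hB hT hm hnm hA'
  obtain ⟨WC, hWC⟩ := exists_isHam ε hB hT hm hnm hC'
  obtain ⟨K, hK⟩ := exists_variation ε hB hT hm hnm A C
  obtain ⟨KF, hKF, hpF⟩ := exists_hessian hF.1 hS hA hWC.tan
    fun s => (hWC.isHamVec hT hm hnm s).density
  obtain ⟨KG, hKG, hpG⟩ := exists_hessian hG.1 hS hC hWA.tan
    fun s => (hWA.isHamVec hT hm hnm s).density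
  have hL : ∀ V, pair (K.sub (KG.sub KF)) V = pair K V - (pair KG V - pair KF V) := fun V => by
    rw [pair_sub_left, pair_sub_left]
  refine ⟨K.sub (KG.sub KF), fun s => ⟨fun e => ?_, fun wF wG κF κG v hwF hwG hκF hκG hv => ?_⟩⟩
  -- The derivatives of the two covector families are paired with the Hamiltonian fields of the
  -- other functional, and the transposed Hessians turn these pairings into pairings with the
  -- velocity of the family.
  · simp only [bracketSig_eq ε B hT hm hnm]
    rw [hL, fderiv_tor, dt_redS e ε (dt_constFld B e) S hnm, map_add, map_add, Pi.add_apply,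
      Pi.add_apply, ← hWC.pair_eq _ (hA'.deriv e), hK _ (hT.deriv e), redS, redBr_skew, map_neg]
    change _ + (-tor (redS ε (constFld E B) S m (C.deriv e) A)) s + _ = _
    rw [← hWA.pair_eq _ (hC'.deriv e), Pi.neg_apply, hpF, hpG]
    simp only [Pi.sub_apply]
    ring
  · rw [hwG.unique (hWC.isHamVec hT hm hnm s)] at hκF
    rw [hwF.unique (hWA.isHamVec hT hm hnm s)] at hκG
    rw [hκF.unique (hKF s), hκG.unique (hKG s)]
    have h1 := congrFun (hK _ hv.const) s
    rw [tor_varS_eq_bracketVar ε B hS hnm, constState_at] at h1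
    have h2 : ∀ A : CvF E, pairing (A.at s) v = pair A (constState E v) s := fun A => by
      rw [← pairing_at, constState_at]
    rw [h1, h2, h2, h2, hL]
    simp only [Pi.sub_apply]
    ring

/-- Hamiltonian vectors are tangent with zero density, so the line in their direction is available
at every point. -/
theorem exists_hess_of_isHamVec {ε : ℝ} {B : ScalarField} {F : Sig → ℝ} {D : Sig → Covector}
    (hD : IsDifferential Sig F D) (σ : Sig) {γ : Covector} {w : State} (hw : IsHamVec ε B σ γ w) :
    ∃ κ, IsHess D σ w κ := by
  obtain ⟨-, A, hA⟩ := hD.lift (constState Pt σ) (fun _ => σ) fun _ => rfl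
  obtain ⟨K, hK, -⟩ := exists_hessian hD (S := constState Pt σ) (fun _ => σ.2) hA
    (hw.tan.const (E := Pt)) fun _ => hw.density
  exact ⟨_, hK 0⟩

/-- The family with two directions is built on the line through `σ` along `w`, and the transposition
of Hessians is applied with `w'` as second direction. -/
theorem IsHess.symm {F : Sig → ℝ} {D : Sig → Covector} (hD : IsDifferential Sig F D) (σ : Sig)
    {w w' : State} {κ κ' : Covector} (hw : IsTan w) (hw' : IsTan w') (hn : ∀ q, w.n q = 0)
    (hn' : ∀ q, w'.n q = 0) (h : IsHess D σ w κ) (h' : IsHess D σ w' κ') :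
    pairing κ w' = pairing κ' w := by
  let S : StF ℝ := (constState ℝ σ).line (constState ℝ w) (ContinuousLinearMap.id ℝ ℝ)
  have hS : ∀ x, S.at x ∈ Sig := fun x => add_smul_mem_Sig σ.2 hw hn x
  have e0 : S.at 0 = σ := by
    change (σ : State) + (0 : ℝ) • w = σ
    rw [zero_smul, add_zero]
  obtain ⟨A, hA, rfl⟩ := h
  have hA' : ∀ x, D ⟨S.at x, hS x⟩ = A.at x := fun x => by
    obtain ⟨_, e⟩ := hA x
    exact e.symm
  obtain ⟨K, hK, hp⟩ := exists_hessian hD hS hA' (hw'.const (E := ℝ)) fun _ => hn'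
  have h0 := hK 0
  rw [e0] at h0
  have h1 := hp 0 1
  rw [← pairing_at, ← pairing_at, (S.isVelocity 0).unique (line_isVelocity σ w)] at h1
  rw [h'.unique h0]
  exact h1

/-- The gradient of the bracket of two functionals. -/
theorem isGradient_bracketSig {ε : ℝ} {B : ScalarField} {F G : Sig → ℝ} {DF DG : Sig → Covector}
    (hF : IsFunctionalDerivative F DF) (hG : IsFunctionalDerivative G DG) {S : StF E}
    (hS : ∀ s, S.at s ∈ Sig) :
    ContDiff ℝ ∞ (fun s => bracketSig ε B (S.at s) (DF ⟨S.at s, hS s⟩) (DG ⟨S.at s, hS s⟩)) ∧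
    ∃ L : CvF E, ∀ s,
      IsGradient (fun σ => bracketSig ε B σ (DF σ) (DG σ)) ⟨S.at s, hS s⟩ (L.at s) := by
  obtain ⟨-, A, hA⟩ := hF.1.lift S (fun s => ⟨S.at s, hS s⟩) fun _ => rfl
  obtain ⟨-, C, hC⟩ := hG.1.lift S (fun s => ⟨S.at s, hS s⟩) fun _ => rfl
  refine ⟨?_, ?_⟩
  · simp only [hA, hC]
    exact contDiff_bracketSig ε B hS A C
  obtain ⟨L₀, hL₀⟩ := fderiv_bracketSig (ε := ε) (B := B) hF hG hS hA hC
  obtain ⟨L, hL, -, -, -, hp⟩ := exists_normalized L₀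
  refine ⟨L, fun s => ⟨(CvF.nrm_iff L).1 hL s, fun T hT t ht => ?_⟩⟩
  have ht' : (⟨T.at t, hT t⟩ : Sig) = ⟨S.at s, hS s⟩ := Subtype.ext ht
  obtain ⟨-, A', hA'⟩ := hF.1.lift T (fun s => ⟨T.at s, hT s⟩) fun _ => rfl
  obtain ⟨-, C', hC'⟩ := hG.1.lift T (fun s => ⟨T.at s, hT s⟩) fun _ => rfl
  obtain ⟨L', hL'⟩ := fderiv_bracketSig (ε := ε) (B := B) hF hG hT hA' hC'
  have hd := ((contDiff_bracketSig ε B hT A' C').differentiable (by simp) t).hasDerivAt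
  rw [← fderiv_apply_one_eq_deriv, (hL' t).1 1, ← pairing_at] at hd
  simp only [hA', hC']
  refine hd.congr_deriv (Eq.symm ?_)
  have hv := StF.tan_deriv_at hT 1 t
  have h1 := congrFun (hp _ hv.const) s
  rw [← pairing_at, ← pairing_at, constState_at] at h1
  have eA : A'.at t = A.at s := by rw [← hA, ← hA', ht']
  have eC : C'.at t = C.at s := by rw [← hC, ← hC', ht']
  -- The curve `T` and the family `S` have different representing covectors; both are evaluated
  -- through the same Hamiltonian vectors and Hessians at the common point.
  obtain ⟨wF, hwF⟩ := exists_isHamVec ε B (hS s) (hF.isNrm ⟨S.at s, hS s⟩)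
  obtain ⟨wG, hwG⟩ := exists_isHamVec ε B (hS s) (hG.isNrm ⟨S.at s, hS s⟩)
  obtain ⟨κF, hκF⟩ := exists_hess_of_isHamVec hF.1 ⟨S.at s, hS s⟩ hwG
  obtain ⟨κG, hκG⟩ := exists_hess_of_isHamVec hG.1 ⟨S.at s, hS s⟩ hwF
  rw [hA] at hwF
  rw [hC] at hwG
  rw [← h1, (hL₀ s).2 wF wG κF κG _ hwF hwG hκF hκG hv,
    (hL' t).2 wF wG κF κG _ (by rw [ht, eA]; exact hwF) (by rw [ht, eC]; exact hwG)
      (by rw [ht]; exact hκF) (by rw [ht]; exact hκG) hv, ht', eA, eC]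

theorem exists_functionalDerivative_bracketSig (ε : ℝ) (B : ScalarField) {F G : Sig → ℝ}
    {DF DG : Sig → Covector} (hF : IsFunctionalDerivative F DF)
    (hG : IsFunctionalDerivative G DG) :
    ∃ D, IsFunctionalDerivative (fun σ => bracketSig ε B σ (DF σ) (DG σ)) D :=
  exists_functionalDerivative_of_gradients fun _ _ hS => isGradient_bracketSig hF hG hS

theorem pairing_functionalDerivative_bracketSig {ε : ℝ} {B : ScalarField} {F G : Sig → ℝ}
    {DF DG D : Sig → Covector} (hF : IsFunctionalDerivative F DF)
    (hG : IsFunctionalDerivative G DG)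
    (hD : IsFunctionalDerivative (fun σ => bracketSig ε B σ (DF σ) (DG σ)) D) (σ : Sig)
    {wF wG v : State} {κF κG : Covector} (hwF : IsHamVec ε B σ (DF σ) wF)
    (hwG : IsHamVec ε B σ (DG σ) wG) (hκF : IsHess DF σ wG κF) (hκG : IsHess DG σ wF κG)
    (hv : IsTan v) :
    pairing (D σ) v = pairing κF v - pairing κG v + bracketVar ε B σ (DF σ) (DG σ) v := by
  obtain ⟨T, hT, hσ, rfl⟩ := exists_curve σ hv
  have ht' : (⟨T.at 0, hT 0⟩ : Sig) = σ := Subtype.ext hσ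
  obtain ⟨-, A, hA⟩ := hF.1.lift T (fun s => ⟨T.at s, hT s⟩) fun _ => rfl
  obtain ⟨-, C, hC⟩ := hG.1.lift T (fun s => ⟨T.at s, hT s⟩) fun _ => rfl
  obtain ⟨L, hL⟩ := fderiv_bracketSig (ε := ε) (B := B) hF hG hT hA hC
  have hd := ((contDiff_bracketSig ε B hT A C).differentiable (by simp) 0).hasDerivAt
  rw [← fderiv_apply_one_eq_deriv, (hL 0).1 1, ← pairing_at] at hd
  have hd' := (hD.isGradient σ).2 T hT 0 hσ
  simp only [hA, hC] at hd'
  have eA : A.at 0 = DF σ := by rw [← hA, ht']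
  have eC : C.at 0 = DG σ := by rw [← hC, ht']
  rw [hd'.unique hd, (hL 0).2 wF wG κF κG _ (by rw [hσ, eA]; exact hwF)
    (by rw [hσ, eC]; exact hwG) (by rw [hσ]; exact hκF) (by rw [hσ]; exact hκG) hv, ht', eA, eC]

/-- The Jacobi identity for the reduced bracket. -/
theorem bracketSig_jacobi (ε : ℝ) (B : ScalarField) {F G H : Sig → ℝ}
    {DF DG DH DFG DGH DHF : Sig → Covector} (hF : IsFunctionalDerivative F DF)
    (hG : IsFunctionalDerivative G DG) (hH : IsFunctionalDerivative H DH)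
    (hFG : IsFunctionalDerivative (fun σ => bracketSig ε B σ (DF σ) (DG σ)) DFG)
    (hGH : IsFunctionalDerivative (fun σ => bracketSig ε B σ (DG σ) (DH σ)) DGH)
    (hHF : IsFunctionalDerivative (fun σ => bracketSig ε B σ (DH σ) (DF σ)) DHF) (σ : Sig) :
    bracketSig ε B σ (DFG σ) (DH σ) + bracketSig ε B σ (DGH σ) (DF σ) +
      bracketSig ε B σ (DHF σ) (DG σ) = 0 := by
  obtain ⟨wF, hwF⟩ := exists_isHamVec ε B σ.2 (hF.isNrm σ)
  obtain ⟨wG, hwG⟩ := exists_isHamVec ε B σ.2 (hG.isNrm σ)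
  obtain ⟨wH, hwH⟩ := exists_isHamVec ε B σ.2 (hH.isNrm σ)
  obtain ⟨κFG, hκFG⟩ := exists_hess_of_isHamVec hF.1 σ hwG
  obtain ⟨κFH, hκFH⟩ := exists_hess_of_isHamVec hF.1 σ hwH
  obtain ⟨κGF, hκGF⟩ := exists_hess_of_isHamVec hG.1 σ hwF
  obtain ⟨κGH, hκGH⟩ := exists_hess_of_isHamVec hG.1 σ hwH
  obtain ⟨κHF, hκHF⟩ := exists_hess_of_isHamVec hH.1 σ hwF
  obtain ⟨κHG, hκHG⟩ := exists_hess_of_isHamVec hH.1 σ hwG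
  rw [← hwH.pair_eq _ (hFG.isNrm σ), ← hwF.pair_eq _ (hGH.isNrm σ), ← hwG.pair_eq _ (hHF.isNrm σ),
    pairing_functionalDerivative_bracketSig hF hG hFG σ hwF hwG hκFG hκGF hwH.tan,
    pairing_functionalDerivative_bracketSig hG hH hGH σ hwG hwH hκGH hκHG hwF.tan,
    pairing_functionalDerivative_bracketSig hH hF hHF σ hwH hwF hκHF hκFH hwG.tan]
  -- Each functional contributes two Hessian terms of opposite sign that agree by symmetry; the
  -- explicit variations cancel by `bracketVar_jacobi`.
  have h1 := IsHess.symm hF.1 σ hwG.tan hwH.tan hwG.density hwH.density hκFG hκFH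
  have h2 := IsHess.symm hG.1 σ hwH.tan hwF.tan hwH.density hwF.density hκGH hκGF
  have h3 := IsHess.symm hH.1 σ hwF.tan hwG.tan hwF.density hwG.density hκHF hκHG
  have h4 := bracketVar_jacobi ε B σ (hF.isNrm σ) (hG.isNrm σ) (hH.isNrm σ) hwF hwG hwH
  linarith

/-! ### The induced bracket -/

/-- The covector (div α.P, 0, 0) lies in the annihilator since a divergence has mean zero. Testing
on its image gives ε n times the integral of (div α.P)², which must vanish. -/
theorem divO_eq_zero_of_transverse {ε : ℝ} (hε : ε ≠ 0) {B : ScalarField} {σ : State} (hσ : σ ∈ Sig)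
    {a α : Covector} (h : IsTransverseExtension (bracketE ε B) Sig σ a α) :
    divO (constCovector Pt α).P = 0 := by
  obtain ⟨m, hm, hnm⟩ := exists_inverse_const hσ.1
  have hS : (constState Pt σ).Tan := IsTan.const hσ.2
  set S := constState Pt σ with hSdef
  set A := constCovector Pt α
  have hη : divO A.P ∈ Fld Pt := divO_mem A.hP
  obtain ⟨w, hw, -⟩ := existsUnique_sharp ε B hσ.1 ((CvF.mk (divO A.P) 0 0 hη fun _ => zero_mem _).at 0)
  have h1 := h.2 _ (mem_annihilator hσ hη (tor_divO _)) w hw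
  rw [hw α] at h1
  have h2 := bracketE_at ε B S A (CvF.mk (divO A.P) 0 0 hη fun _ => zero_mem _) hm hnm 0
  rw [mul_zero, brE_density, brE_zero_right, zero_sub, map_neg, map_smul,
    tor_mul_const S.hn hS.1, tor_dotO_dq] at h2
  have h3 : tor (divO A.P * divO A.P) 0 = 0 := by
    have h4 := h2.symm.trans h1
    simp only [Pi.neg_apply, Pi.smul_apply, smul_eq_mul, mul_neg, neg_neg, mul_eq_zero, hε,
      false_or] at h4
    exact h4.resolve_left (hσ.1 0)
  exact Obs.ext_pt fun q ξ => tor_self_eq_zero hη h3 q ξ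

theorem redS_congr {ε : ℝ} {B m : Obs E} {S : StF E} {A A' C C' : CvF E} (hA : A.P = A'.P)
    (hA' : A.r = A'.r) (hC : C.P = C'.P) (hC' : C.r = C'.r) :
    redS ε B S m A C = redS ε B S m A' C' := by
  rw [redS, redS, hA, hA', hC, hC']

/-- The gradient removed by normalization is harmonic, because the momentum component is already
divergence-free, and therefore zero. Only the density component can differ, which the bracket
ignores. -/
theorem exists_isNrm_of_transverse {ε : ℝ} (hε : ε ≠ 0) {B : ScalarField} {σ : State} (hσ : σ ∈ Sig)
    {a α : Covector} (h : IsTransverseExtension (bracketE ε B) Sig σ a α) :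
    ∃ A : CvF Pt, IsNrm (A.at 0) ∧ (∀ v, IsTan v → pairing (A.at 0) v = pairing a v) ∧
      (constCovector Pt α).P = A.P ∧ (constCovector Pt α).r = A.r := by
  have hd := divO_eq_zero_of_transverse hε hσ h
  obtain ⟨A, hA, hr, -, ⟨ψ, hψ, hP⟩, hp⟩ := exists_normalized (constCovector Pt α)
  refine ⟨A, (CvF.nrm_iff A).1 hA 0, fun v hv => ?_, funext fun i => ?_, hr.symm⟩
  · rw [← h.1 v (by rw [tangentSpace_Sig hσ]; exact hv), ← pair_constState, ← hp _ hv.const]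
    rw [← pairing_at]; rfl
  · have h1 : lap ψ = 0 := by
      have h0 := hA.2
      rw [divO] at h0 hd
      rw [hP, hP, map_add, map_add] at hd
      rw [lap]
      linear_combination hd - h0
    rw [hP, dq_eq_zero_of_lap hψ h1, add_zero]

theorem bracketE_eq_bracketSig {ε : ℝ} (hε : ε ≠ 0) {B : ScalarField} {F G : Sig → ℝ}
    {dF dG DF DG : Sig → Covector} (hF : IsDifferential Sig F dF) (hG : IsDifferential Sig G dG)
    (hDF : IsFunctionalDerivative F DF) (hDG : IsFunctionalDerivative G DG) (σ : Sig)
    {α β : Covector} (hα : IsTransverseExtension (bracketE ε B) Sig σ (dF σ) α)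
    (hβ : IsTransverseExtension (bracketE ε B) Sig σ (dG σ) β) :
    bracketE ε B σ α β = bracketSig ε B σ (DF σ) (DG σ) := by
  -- The normalized form of a transverse extension and the functional derivative represent the same
  -- differential on tangent vectors, so they coincide.
  have key : ∀ {F : Sig → ℝ} {dF DF : Sig → Covector} {α : Covector}, IsDifferential Sig F dF →
      IsFunctionalDerivative F DF → IsTransverseExtension (bracketE ε B) Sig σ (dF σ) α →
      ∃ A : CvF Pt, A.at 0 = DF σ ∧ (constCovector Pt α).P = A.P ∧
        (constCovector Pt α).r = A.r := by
    intro F dF DF α hF hDF hα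
    obtain ⟨A, hA, hp, hAP, hr⟩ := exists_isNrm_of_transverse hε σ.2 hα
    refine ⟨A, hA.eq (hDF.isNrm σ) fun v hv => ?_, hAP, hr⟩
    obtain ⟨S, hS, hσ, rfl⟩ := exists_curve σ hv
    have e : (⟨S.at 0, hS 0⟩ : Sig) = σ := Subtype.ext hσ
    have h1 := hF.hasDerivAt S (fun s => ⟨S.at s, hS s⟩) (fun _ => rfl) 0
    rw [e] at h1
    rw [hp _ hv]
    exact h1.unique ((hDF.isGradient σ).2 S hS 0 hσ)
  obtain ⟨A, hA, hAP, hAr⟩ := key hF hDF hα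
  obtain ⟨C, hC, hCP, hCr⟩ := key hG hDG hβ
  obtain ⟨m, hm, hnm⟩ := exists_inverse_const σ.2.1
  have hS : (constState Pt σ).Tan := IsTan.const σ.2.2
  have h1 := bracketE_eq ε B hS hm hnm (divO_eq_zero_of_transverse hε σ.2 hα)
    (divO_eq_zero_of_transverse hε σ.2 hβ) 0
  have h2 := bracketSig_eq ε B hS hm hnm A C 0
  rw [redS_congr hAP hAr hCP hCr, ← h2, hA, hC] at h1
  exact h1

end Bracket

/-! ### The Poisson algebra of smooth functionals -/

/-- The functional derivative of a smooth functional. -/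
def funDer (F : Sig → ℝ) : Sig → Covector := Classical.epsilon (IsFunctionalDerivative F)

theorem funDer_spec {F : Sig → ℝ} (hF : F ∈ smoothFunctionals Sig) :
    IsFunctionalDerivative F (funDer F) := Classical.epsilon_spec (exists_functionalDerivative hF)

/-- The bracket of two smooth functionals. -/
def sigBr (ε : ℝ) (B : ScalarField) (F G : Sig → ℝ) (σ : Sig) : ℝ :=
  bracketSig ε B σ (funDer F σ) (funDer G σ)

theorem sigBr_mem (ε : ℝ) (B : ScalarField) {F G : Sig → ℝ} (hF : F ∈ smoothFunctionals Sig)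
    (hG : G ∈ smoothFunctionals Sig) : sigBr ε B F G ∈ smoothFunctionals Sig := by
  obtain ⟨D, hD⟩ := exists_functionalDerivative_bracketSig ε B (funDer_spec hF) (funDer_spec hG)
  exact ⟨D, hD.1⟩

theorem isInducedBracket_sigBr {ε : ℝ} (hε : ε ≠ 0) (B : ScalarField) :
    IsInducedBracket (bracketE ε B) Sig (sigBr ε B) := fun _ _ _ _ hF hG σ _ _ hα hβ =>
  (bracketE_eq_bracketSig hε hF hG (funDer_spec ⟨_, hF⟩) (funDer_spec ⟨_, hG⟩) σ hα hβ).symm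

/-- The bracket with `H` is the derivative along the Hamiltonian vector of `H`. -/
theorem exists_sigBr_eq (ε : ℝ) (B : ScalarField) {H : Sig → ℝ} (hH : H ∈ smoothFunctionals Sig)
    (σ : Sig) : ∃ c : ℝ → Sig, c 0 = σ ∧ ∀ F ∈ smoothFunctionals Sig,
      HasDerivAt (fun t => F (c t)) (sigBr ε B F H σ) 0 := by
  obtain ⟨w, hw⟩ := exists_isHamVec ε B σ.2 ((funDer_spec hH).isNrm σ)
  obtain ⟨S, hS, hσ, hv⟩ := exists_curve σ hw.tan
  refine ⟨fun t => ⟨S.at t, hS t⟩, Subtype.ext hσ, fun F hF => ?_⟩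
  rw [sigBr, ← hw.pair_eq _ ((funDer_spec hF).isNrm σ), ← hv]
  exact ((funDer_spec hF).isGradient σ).2 S hS 0 hσ

theorem add_mem_smoothFunctionals {F G : Sig → ℝ} (hF : F ∈ smoothFunctionals Sig)
    (hG : G ∈ smoothFunctionals Sig) : F + G ∈ smoothFunctionals Sig := by
  obtain ⟨dF, hF⟩ := hF
  obtain ⟨dG, hG⟩ := hG
  exact ⟨_, isDifferential_add hF hG⟩

theorem mul_mem_smoothFunctionals {F G : Sig → ℝ} (hF : F ∈ smoothFunctionals Sig)
    (hG : G ∈ smoothFunctionals Sig) : F * G ∈ smoothFunctionals Sig := by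
  obtain ⟨dF, hF⟩ := hF
  obtain ⟨dG, hG⟩ := hG
  exact ⟨_, isDifferential_mul hF hG⟩

/-- Additivity, homogeneity and the Leibniz rule are those of the ordinary derivative along a curve
with Hamiltonian velocity; for fixed `H` and `σ` one curve serves all first arguments. -/
theorem isPoissonBracket_sigBr (ε : ℝ) (B : ScalarField) :
    IsPoissonBracket (smoothFunctionals Sig) (sigBr ε B) where
  const_mem := const_mem_smoothFunctionals
  add_mem _ hF _ hG := add_mem_smoothFunctionals hF hG
  mul_mem _ hF _ hG := mul_mem_smoothFunctionals hF hG
  bracket_mem _ hF _ hG := sigBr_mem ε B hF hG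
  add_left F hF G hG H hH := funext fun σ => by
    obtain ⟨c, -, hc⟩ := exists_sigBr_eq ε B hH σ
    exact (hc _ (add_mem_smoothFunctionals hF hG)).unique ((hc F hF).add (hc G hG))
  smul_left a F hF G hG := funext fun σ => by
    obtain ⟨c, -, hc⟩ := exists_sigBr_eq ε B hG σ
    have h : a • F ∈ smoothFunctionals Sig :=
      mul_mem_smoothFunctionals (const_mem_smoothFunctionals a) hF
    exact (hc _ h).unique ((hc F hF).const_mul a)
  skew F _ G _ := funext fun σ => bracketSig_skew ε B σ.2 _ _
  leibniz F hF G hG H hH := funext fun σ => by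
    obtain ⟨c, hc0, hc⟩ := exists_sigBr_eq ε B hH σ
    rw [(hc _ (mul_mem_smoothFunctionals hF hG)).unique ((hc F hF).mul (hc G hG)), hc0]
    simp only [Pi.add_apply, Pi.mul_apply]
    ring
  jacobi F hF G hG H hH := funext fun σ =>
    bracketSig_jacobi ε B (funDer_spec hF) (funDer_spec hG) (funDer_spec hH)
      (funDer_spec (sigBr_mem ε B hF hG)) (funDer_spec (sigBr_mem ε B hG hH))
      (funDer_spec (sigBr_mem ε B hH hF)) σ

end

end QNVP

/-! ### The Poisson–Dirac property and the explicit bracket. -/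

theorem proposition1 (ε : ℝ) (hε : ε ≠ 0) (B : QNVP.ScalarField) :
    QNVP.IsPoissonDirac (QNVP.bracketE ε B) QNVP.phaseSpace QNVP.Sig ∧
    (∀ σ ∈ QNVP.Sig, QNVP.tangentSpace QNVP.Sig σ =
      {v | (∀ q, QNVP.grad v.n q = 0) ∧ (∀ q, QNVP.divg v.P q = 0)}) ∧
    (∀ F ∈ QNVP.smoothFunctionals QNVP.Sig, ∃! dF, QNVP.IsFunctionalDerivative F dF) ∧
    ∃ br : (QNVP.Sig → ℝ) → (QNVP.Sig → ℝ) → QNVP.Sig → ℝ,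
      QNVP.IsPoissonBracket (QNVP.smoothFunctionals QNVP.Sig) br ∧
      QNVP.IsInducedBracket (QNVP.bracketE ε B) QNVP.Sig br ∧
      ∀ F G dF dG, QNVP.IsFunctionalDerivative F dF → QNVP.IsFunctionalDerivative G dG →
        ∀ σ : QNVP.Sig, br F G σ = QNVP.bracketSig ε B σ (dF σ) (dG σ) := by
  refine ⟨⟨fun σ hσ => hσ.1, fun z hz α => QNVP.existsUnique_sharp ε B hz α,
    fun σ hσ => QNVP.poissonDirac_dirac hε B hσ,
    fun σ hσ a => QNVP.poissonDirac_extension hε B hσ a,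
    QNVP.sigBr ε B, QNVP.isInducedBracket_sigBr hε B, fun F hF G hG => QNVP.sigBr_mem ε B hF hG⟩,
    fun σ hσ => QNVP.tangentSpace_Sig hσ, fun F hF => ?_, QNVP.sigBr ε B,
    QNVP.isPoissonBracket_sigBr ε B, QNVP.isInducedBracket_sigBr hε B, fun F G dF dG hF hG σ => ?_⟩
  · obtain ⟨D, hD⟩ := QNVP.exists_functionalDerivative hF
    exact ⟨D, hD, fun D' hD' => hD'.unique hD⟩
  · rw [QNVP.sigBr, hF.unique (QNVP.funDer_spec ⟨_, hF.1⟩), hG.unique (QNVP.funDer_spec ⟨_, hG.1⟩)]
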